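/- **Conventions.** Let $K$ be a field. Graded means $\mathbb Z$-graded, and all signs follow the Koszul rule; in particular $\tau(x\otimes y)=(-1)^{|x||y|}y\otimes x$, $(a\otimes b)(c\otimes e)=(-1)^{|b||c|}ac\otimes be$, and $d(x\otimes y)=dx\otimes y+(-1)^{|x|}x\otimes dy$. A *differential graded Zinbiel-associative bialgebra* $(H,d)$ is a graded unital associative $K$-algebra $H=K1\oplus\bar H$ with an augmentation $\varepsilon:H\to K$, $\bar H=\ker\varepsilon$, a degree $0$ cooperation $\Delta_\prec:\bar H\to H\otimes H$ and a differential $d$ of degree $-1$ such that, with $\Delta=\Delta_\prec+\tau\Delta_\prec$ on $\bar H$ and $\Delta(1)=1\otimes1$, $$(\varepsilon\otimes\mathrm{id})\Delta_\prec=0,\quad(\mathrm{id}\otimes\varepsilon)\Delta_\prec=\mathrm{id},\quad(\Delta_\prec\otimes\mathrm{id})\Delta_\prec=(\mathrm{id}\otimes\Delta)\Delta_\prec,\quad\Delta_\prec(xy)=\Delta_\prec(x)\Delta(y)\quad(x\in\bar H,\ y\in H),$$ and $d$ is a derivation compatible with $\Delta_\prec$ and with $\varepsilon d=0$. Put $\Delta_\prec(1)=0$.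 Its *primitive part* is $\mathrm{Prim}\,H=\{x\in\bar H:\Delta_\prec(x)=x\otimes1\}$. It is *connected* if $H=\bigcup_rF_r$, where $F_0=K1$ and $F_r=\{x:\Delta_\prec(x)-x\otimes1\in F_{r-1}\otimes F_{r-1}\}$. The homology $H_*(H,d)$ carries the induced product, counit, grading and cooperation (the latter through the Künneth isomorphism). For a graded vector space $V$, the tensor module $T(V)$ carries the concatenation product, the total grading, the projection onto $K$ as counit, and the co-half shuffle $1\mapsto0$, $vw\mapsto(v\otimes1)\cdot\mathrm{sh}(w)$ ($v\in V$, $w\in T(V)$), where $\mathrm{sh}:T(V)\to T(V)\otimes T(V)$ is the morphism of algebras with $v\mapsto v\otimes1+1\otimes v$. **(A)** Let $(H,d)$ be a connected differential graded Zinbiel-associative bialgebra over $K$. Then $\mathrm{Prim}\,H$ is a graded subcomplex, and there is an isomorphism of graded Zinbiel-associative bialgebras $$T(H_*(\mathrm{Prim}\,H,d))\;\cong\;H_*(H,d)$$ which extends the map $H_*(\mathrm{Prim}\,H,d)\to H_*(H,d)$ induced by the inclusion. The primitive part of $H_*(H,d)$ is the image of $H_*(\mathrm{Prim}\,H,d)$.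 **(B)** Suppose that $K$ has characteristic $0$. A *graph* has vertices $1,\dots,m$ ($m\ge0$) and a finite multiset of edges, each joining two different vertices. Let $\mathcal G$ be the set of all graphs, and let $K[\mathcal G]$ be the vector space with basis $\mathcal G$, graded by the number of vertices, with the ordered disjoint union (the vertices of the second graph are shifted behind those of the first) as product. An oriented graph defines an element of $K[\mathcal G]$: zero if it has a loop, and otherwise the underlying graph times $(-1)^r$, with $r$ the number of edges $[i,j]$ oriented from $i$ to $j<i$. Put $$\delta(G)=\sum_{e}(-1)^{j}\,G/e,$$ the sum over all edges $e$ of $G$, joining $i<j$; here every edge of $G$ is oriented from its smaller to its larger vertex, and $G/e$ is the oriented graph obtained by deleting $e$, identifying $j$ with $i$, and decreasing by one the labels larger than $j$. Put $$\Delta_\prec(G)=\sum_{A}\pm\,G|_A\otimes G|_{A^c},$$ the sum over all unions $A$ of connected components of $G$ that contain the vertex $1$; induced subgraphs are relabelled in increasing order and the sign is $(-1)^{\#\{(u,a):\,u\notin A,\ a\in A,\ u<a\}}$ (the co-half shuffle of the connected components, with Koszul signs). Let $\mathcal G_c\subset\mathcal G$ be the set of (non-empty) connected graphs. Then $(K[\mathcal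 G],\delta)$ is a connected differential graded Zinbiel-associative bialgebra, $K[\mathcal G_c]$ is a subcomplex, and there is an isomorphism of graded Zinbiel-associative bialgebras $$T(H_*(K[\mathcal G_c],\delta))\;\cong\;H_*(K[\mathcal G],\delta)$$ which extends the map induced by the inclusion of $K[\mathcal G_c]$ in $K[\mathcal G]$. The same holds if $\mathcal G$ is replaced by the set of all graphs whose vertices all have valence at least $2$, and $\mathcal G_c$ by the set of connected ones among them. -/

import Mathlib

open scoped TensorProduct DirectSum

noncomputable section

namespace ZinbAs

/-! ### Graded vector spaces and Koszul signs -/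

section Graded

variable {K M : Type*} [Field K] [AddCommGroup M] [Module K M]

/-- The projection of a graded vector space onto its component of degree `n`. -/
def gradeProj (𝒜 : ℤ → Submodule K M) [DirectSum.Decomposition 𝒜] (n : ℤ) : M →ₗ[K] M :=
  (𝒜 n).subtype ∘ₗ DirectSum.component K ℤ (fun i => 𝒜 i) n ∘ₗ
    (DirectSum.decomposeLinearEquiv 𝒜).toLinearMap

theorem gradeProj_apply (𝒜 : ℤ → Submodule K M) [DirectSum.Decomposition 𝒜] (n : ℤ) (x : M) :
    gradeProj 𝒜 n x = (DirectSum.decompose 𝒜 x n : M) := rfl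

theorem gradeProj_same (𝒜 : ℤ → Submodule K M) [DirectSum.Decomposition 𝒜] {n : ℤ} {x : M}
    (hx : x ∈ 𝒜 n) : gradeProj 𝒜 n x = x := by
  rw [gradeProj_apply, DirectSum.decompose_of_mem_same 𝒜 hx]

theorem gradeProj_ne (𝒜 : ℤ → Submodule K M) [DirectSum.Decomposition 𝒜] {m n : ℤ} {x : M}
    (hx : x ∈ 𝒜 m) (h : m ≠ n) : gradeProj 𝒜 n x = 0 := by
  rw [gradeProj_apply, DirectSum.decompose_of_mem_ne 𝒜 hx h]

theorem gradeProj_mem (𝒜 : ℤ → Submodule K M) [DirectSum.Decomposition 𝒜] (n : ℤ) (x : M) :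
    gradeProj 𝒜 n x ∈ 𝒜 n := (DirectSum.decompose 𝒜 x n).2

/-- The linear map `x ↦ (-1)^|x| x`. -/
def signMap (𝒜 : ℤ → Submodule K M) [DirectSum.Decomposition 𝒜] : M →ₗ[K] M :=
  DirectSum.toModule K ℤ M (fun n => ((n.negOnePow : ℤ) : K) • (𝒜 n).subtype) ∘ₗ
    (DirectSum.decomposeLinearEquiv 𝒜).toLinearMap

theorem signMap_of_mem (𝒜 : ℤ → Submodule K M) [DirectSum.Decomposition 𝒜] {n : ℤ} {x : M}
    (hx : x ∈ 𝒜 n) : signMap 𝒜 x = ((n.negOnePow : ℤ) : K) • x := by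
  lift x to 𝒜 n using hx
  simp [signMap]

/-- The differential `d ⊗ id + id ⊗ d` of the tensor square of a graded complex, with the
Koszul sign: `x ⊗ y ↦ d x ⊗ y + (-1)^|x| x ⊗ d y`. -/
def tensorD (𝒜 : ℤ → Submodule K M) [DirectSum.Decomposition 𝒜] (d : M →ₗ[K] M) :
    M ⊗[K] M →ₗ[K] M ⊗[K] M :=
  TensorProduct.map d LinearMap.id + TensorProduct.map (signMap 𝒜) d

/-- The component of total degree `n` of the tensor square of a graded vector space. -/
def tensorGrade (𝒜 : ℤ → Submodule K M) (n : ℤ) : Submodule K (M ⊗[K] M) :=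
  Submodule.span K {t | ∃ p q : ℤ, p + q = n ∧ ∃ x ∈ 𝒜 p, ∃ y ∈ 𝒜 q, t = x ⊗ₜ[K] y}

end Graded

/-! ### Homology -/

section Homology

variable {K M : Type*} [Field K] [AddCommGroup M] [Module K M]

/-- The homology `ker (d|P) / d(P)` of a subspace `P` of `M` with respect to the endomorphism `d`
of `M`; it is used for subcomplexes `P` of a complex `(M, d)`. -/
abbrev Homology (d : M →ₗ[K] M) (P : Submodule K M) : Type _ :=
  ↥(LinearMap.ker d ⊓ P) ⧸ (P.map d).submoduleOf (LinearMap.ker d ⊓ P)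

/-- The homology class of a cycle. -/
def cls (d : M →ₗ[K] M) (P : Submodule K M) : ↥(LinearMap.ker d ⊓ P) →ₗ[K] Homology d P :=
  Submodule.mkQ _

theorem cls_surjective (d : M →ₗ[K] M) (P : Submodule K M) : Function.Surjective (cls d P) :=
  Submodule.mkQ_surjective _

theorem cls_eq_zero {d : M →ₗ[K] M} {P : Submodule K M} {z : ↥(LinearMap.ker d ⊓ P)} :
    cls d P z = 0 ↔ ∃ y ∈ P, d y = z := by
  rw [cls, Submodule.mkQ_apply, Submodule.Quotient.mk_eq_zero]
  rfl

/-- The map `H(P) → H(M)` induced by the inclusion of `P` in `M`. -/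
def homologyIncl (d : M →ₗ[K] M) (P : Submodule K M) : Homology d P →ₗ[K] Homology d ⊤ :=
  Submodule.mapQ _ _ (Submodule.inclusion (inf_le_inf_left _ le_top)) (by
    rintro z hz
    obtain ⟨y, -, hy⟩ := hz
    exact ⟨y, trivial, hy⟩)

/-- The component of degree `n` of the homology: the classes of the cycles of degree `n`. -/
def homologyGrade (𝒜 : ℤ → Submodule K M) (d : M →ₗ[K] M) (P : Submodule K M) (n : ℤ) :
    Submodule K (Homology d P) :=
  ((𝒜 n).submoduleOf (LinearMap.ker d ⊓ P)).map (cls d P)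

variable (𝒜 : ℤ → Submodule K M) [DirectSum.Decomposition 𝒜]

theorem gradeProj_d {d : M →ₗ[K] M} (hd : ∀ n, ∀ x ∈ 𝒜 n, d x ∈ 𝒜 (n - 1)) (n : ℤ) (x : M) :
    gradeProj 𝒜 n (d x) = d (gradeProj 𝒜 (n + 1) x) := by
  induction x using DirectSum.Decomposition.inductionOn 𝒜 with
  | zero => simp
  | add x y hx hy => simp [hx, hy]
  | @homogeneous i x =>
    by_cases h : i = n + 1
    · subst h
      rw [gradeProj_same 𝒜 x.2]
      have := hd _ _ x.2
      rw [add_sub_cancel_right] at this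
      exact gradeProj_same 𝒜 this
    · rw [gradeProj_ne 𝒜 x.2 h, map_zero]
      exact gradeProj_ne 𝒜 (hd _ _ x.2) (by omega)

/-- The projection onto the degree `n` component on homology. -/
def homologyProj {d : M →ₗ[K] M} (hd : ∀ n, ∀ x ∈ 𝒜 n, d x ∈ 𝒜 (n - 1)) {P : Submodule K M}
    (hP : DirectSum.SetLike.IsHomogeneous 𝒜 P) (n : ℤ) : Homology d P →ₗ[K] Homology d P :=
  Submodule.mapQ _ _
    ((gradeProj 𝒜 n).restrict (p := LinearMap.ker d ⊓ P) (q := LinearMap.ker d ⊓ P) (by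
      rintro x ⟨hx, hxP⟩
      refine ⟨?_, hP n hxP⟩
      have := gradeProj_d 𝒜 hd (n - 1) x
      rw [sub_add_cancel, LinearMap.mem_ker.1 hx, map_zero] at this
      exact this.symm))
    (by
      rintro z ⟨y, hy, hyz⟩
      exact ⟨gradeProj 𝒜 (n + 1) y, hP _ hy, by
        rw [← gradeProj_d 𝒜 hd, hyz]; rfl⟩)

theorem homologyProj_cls {d : M →ₗ[K] M} (hd : ∀ n, ∀ x ∈ 𝒜 n, d x ∈ 𝒜 (n - 1))
    {P : Submodule K M} (hP : DirectSum.SetLike.IsHomogeneous 𝒜 P) (n : ℤ)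
    (z : ↥(LinearMap.ker d ⊓ P)) (h : gradeProj 𝒜 n z ∈ LinearMap.ker d ⊓ P) :
    homologyProj 𝒜 hd hP n (cls d P z) = cls d P ⟨gradeProj 𝒜 n z, h⟩ := rfl

theorem homologyProj_apply_mem {d : M →ₗ[K] M} (hd : ∀ n, ∀ x ∈ 𝒜 n, d x ∈ 𝒜 (n - 1))
    {P : Submodule K M} (hP : DirectSum.SetLike.IsHomogeneous 𝒜 P) (n : ℤ) (c : Homology d P) :
    homologyProj 𝒜 hd hP n c ∈ homologyGrade 𝒜 d P n := by
  obtain ⟨z, rfl⟩ := cls_surjective d P c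
  exact ⟨_, gradeProj_mem 𝒜 n z, rfl⟩

theorem homologyProj_of_mem {d : M →ₗ[K] M} (hd : ∀ n, ∀ x ∈ 𝒜 n, d x ∈ 𝒜 (n - 1))
    {P : Submodule K M} (hP : DirectSum.SetLike.IsHomogeneous 𝒜 P) (m n : ℤ) {c : Homology d P}
    (hc : c ∈ homologyGrade 𝒜 d P m) :
    homologyProj 𝒜 hd hP n c = if m = n then c else 0 := by
  obtain ⟨z, hz, rfl⟩ := hc
  have hz' : (z : M) ∈ 𝒜 m := hz
  split_ifs with h
  · subst h
    refine congrArg (cls d P) (Subtype.ext ?_)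
    exact gradeProj_same 𝒜 hz'
  · refine (congrArg (cls d P) (Subtype.ext ?_)).trans (map_zero _)
    exact gradeProj_ne 𝒜 hz' h

/-- The homology of a homogeneous subcomplex of a graded complex is graded. -/
theorem homologyGrade_isInternal {d : M →ₗ[K] M} (hd : ∀ n, ∀ x ∈ 𝒜 n, d x ∈ 𝒜 (n - 1))
    {P : Submodule K M} (hP : DirectSum.SetLike.IsHomogeneous 𝒜 P) :
    DirectSum.IsInternal (homologyGrade 𝒜 d P) := by
  classical
  constructor
  · rw [injective_iff_map_eq_zero]
    intro x hx
    have key : ∀ (y : ⨁ n, homologyGrade 𝒜 d P n) (m : ℤ),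
        homologyProj 𝒜 hd hP m (DirectSum.coeAddMonoidHom (homologyGrade 𝒜 d P) y) = y m := by
      intro y m
      induction y using DirectSum.induction_on with
      | zero => simp
      | of i c =>
        rw [DirectSum.coeAddMonoidHom_of, homologyProj_of_mem 𝒜 hd hP i m c.2]
        split_ifs with h
        · subst h; simp
        · rw [DirectSum.of_eq_of_ne _ _ _ (Ne.symm h)]; rfl
      | add a b ha hb => simp [ha, hb]
    refine DFinsupp.ext fun m => Subtype.ext ?_
    rw [← key x m, hx, map_zero]
    rfl
  · intro c
    obtain ⟨z, rfl⟩ := cls_surjective d P c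
    refine ⟨∑ n ∈ (DirectSum.decompose 𝒜 (z : M)).support,
      DirectSum.of (fun n => homologyGrade 𝒜 d P n) n
        ⟨_, homologyProj_apply_mem 𝒜 hd hP n (cls d P z)⟩, ?_⟩
    have hmem : ∀ n, gradeProj 𝒜 n (z : M) ∈ LinearMap.ker d ⊓ P := by
      intro n
      refine ⟨?_, hP n z.2.2⟩
      have := gradeProj_d 𝒜 hd (n - 1) (z : M)
      rw [sub_add_cancel, LinearMap.mem_ker.1 z.2.1, map_zero] at this
      exact this.symm
    rw [map_sum]
    simp only [DirectSum.coeAddMonoidHom_of]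
    have : ∀ n, homologyProj 𝒜 hd hP n (cls d P z) = cls d P ⟨_, hmem n⟩ := fun n => rfl
    simp only [this]
    rw [← map_sum]
    refine congrArg (cls d P) (Subtype.ext ?_)
    rw [AddSubmonoidClass.coe_finsetSum]
    exact DirectSum.sum_support_decompose 𝒜 (z : M)

end Homology

/-! ### The Künneth isomorphism for the tensor square of a complex -/

section Kunneth

variable {K M : Type*} [Field K] [AddCommGroup M] [Module K M]
variable (𝒜 : ℤ → Submodule K M) [DirectSum.Decomposition 𝒜]

theorem signMap_d {d : M →ₗ[K] M} (hd : ∀ n, ∀ x ∈ 𝒜 n, d x ∈ 𝒜 (n - 1)) (x : M) :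
    d (signMap 𝒜 x) = - signMap 𝒜 (d x) := by
  induction x using DirectSum.Decomposition.inductionOn 𝒜 with
  | zero => simp
  | add x y hx hy => simp only [map_add, hx, hy]; abel
  | @homogeneous i x =>
    rw [signMap_of_mem 𝒜 x.2, signMap_of_mem 𝒜 (hd _ _ x.2), map_smul, Int.negOnePow_sub,
      Int.negOnePow_one]
    simp

theorem signMap_signMap (x : M) : signMap 𝒜 (signMap 𝒜 x) = x := by
  induction x using DirectSum.Decomposition.inductionOn 𝒜 with
  | zero => simp
  | add x y hx hy => simp only [map_add, hx, hy]
  | @homogeneous i x =>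
    rw [signMap_of_mem 𝒜 x.2, map_smul, signMap_of_mem 𝒜 x.2, smul_smul, ← Int.cast_mul,
      ← Units.val_mul, Int.units_mul_self]
    simp

/-- The external product `H(M) ⊗ H(M) → H(M ⊗ M)`, `[x] ⊗ [y] ↦ [x ⊗ y]`. -/
def kunnethMap {d : M →ₗ[K] M} (hd : ∀ n, ∀ x ∈ 𝒜 n, d x ∈ 𝒜 (n - 1)) :
    Homology d ⊤ ⊗[K] Homology d ⊤ →ₗ[K] Homology (tensorD 𝒜 d) ⊤ :=
  TensorProduct.lift <|
    Submodule.liftQ _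
      (LinearMap.flip <| Submodule.liftQ _
        (LinearMap.flip <| LinearMap.mk₂ K
          (fun x y : ↥(LinearMap.ker d ⊓ ⊤) => cls (tensorD 𝒜 d) ⊤ ⟨(x : M) ⊗ₜ[K] (y : M), by
            refine ⟨?_, trivial⟩
            have hx : d (x : M) = 0 := x.2.1
            have hy : d (y : M) = 0 := y.2.1
            simp [tensorD, hx, hy]⟩)
          (fun x x' y => by
            rw [← map_add]; exact congrArg _ (Subtype.ext (TensorProduct.add_tmul _ _ _)))
          (fun c x y => by
            rw [← map_smul]; exact congrArg _ (Subtype.ext (TensorProduct.smul_tmul' _ _ _)))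
          (fun x y y' => by
            rw [← map_add]; exact congrArg _ (Subtype.ext (TensorProduct.tmul_add _ _ _)))
          (fun c x y => by
            rw [← map_smul]; exact congrArg _ (Subtype.ext (TensorProduct.tmul_smul _ _ _))))
        (by
          rintro y ⟨w, -, hw⟩
          ext x
          refine cls_eq_zero.2 ⟨signMap 𝒜 (x : M) ⊗ₜ[K] w, trivial, ?_⟩
          have hx : d (x : M) = 0 := x.2.1
          simp only [tensorD, LinearMap.add_apply, TensorProduct.map_tmul, LinearMap.id_apply,
            signMap_d 𝒜 hd, hx, signMap_signMap, map_zero, neg_zero, TensorProduct.zero_tmul,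
            zero_add]
          exact congrArg _ hw))
      (by
        rintro x ⟨w, -, hw⟩
        refine LinearMap.ext fun c => ?_
        obtain ⟨y, rfl⟩ := cls_surjective d ⊤ c
        refine cls_eq_zero.2 ⟨w ⊗ₜ[K] (y : M), trivial, ?_⟩
        have hy : d (y : M) = 0 := y.2.1
        simp only [tensorD, LinearMap.add_apply, TensorProduct.map_tmul, LinearMap.id_apply,
          hy, TensorProduct.tmul_zero, add_zero]
        exact congrArg (· ⊗ₜ[K] (y : M)) hw)

theorem kunnethMap_cls {d : M →ₗ[K] M} (hd : ∀ n, ∀ x ∈ 𝒜 n, d x ∈ 𝒜 (n - 1))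
    (x y : ↥(LinearMap.ker d ⊓ ⊤))
    (h : (x : M) ⊗ₜ[K] (y : M) ∈ LinearMap.ker (tensorD 𝒜 d) ⊓ ⊤) :
    kunnethMap 𝒜 hd (cls d ⊤ x ⊗ₜ cls d ⊤ y) =
      cls (tensorD 𝒜 d) ⊤ ⟨(x : M) ⊗ₜ[K] (y : M), h⟩ := rfl

theorem kunnethMap_bijective {d : M →ₗ[K] M} (hd : ∀ n, ∀ x ∈ 𝒜 n, d x ∈ 𝒜 (n - 1))
    (hdd : d ∘ₗ d = 0) : Function.Bijective (kunnethMap 𝒜 hd) := by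
  have dd : ∀ x, d (d x) = 0 := fun x => LinearMap.congr_fun hdd x
  -- a section `h` of `d` over its image
  obtain ⟨h0, hh0⟩ := LinearMap.exists_rightInverse_of_surjective d.rangeRestrict
    (LinearMap.range_eq_top.2 d.surjective_rangeRestrict)
  obtain ⟨h, hh⟩ := LinearMap.exists_extend h0
  have dhd : ∀ x, d (h (d x)) = d x := by
    intro x
    have e1 : h (d x) = h0 ⟨d x, LinearMap.mem_range_self d x⟩ :=
      LinearMap.congr_fun hh ⟨d x, LinearMap.mem_range_self d x⟩
    rw [e1]
    exact congrArg Subtype.val (LinearMap.congr_fun hh0 ⟨d x, LinearMap.mem_range_self d x⟩)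
  obtain ⟨i0, hi0⟩ := LinearMap.exists_rightInverse_of_surjective (cls d ⊤)
    (LinearMap.range_eq_top.2 (cls_surjective d ⊤))
  let q : M →ₗ[K] ↥(LinearMap.ker d ⊓ ⊤) :=
    LinearMap.codRestrict _ (LinearMap.id - h ∘ₗ d) (fun x => ⟨by simp [dhd], trivial⟩)
  have hq : ∀ x, (q x : M) = x - h (d x) := fun x => rfl
  let p : M →ₗ[K] Homology d ⊤ := cls d ⊤ ∘ₗ q
  let i : Homology d ⊤ →ₗ[K] M := (Submodule.subtype _) ∘ₗ i0
  have di : ∀ c, d (i c) = 0 := fun c => (i0 c).2.1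
  have pd : ∀ x, p (d x) = 0 := by
    intro x
    refine cls_eq_zero.2 ⟨x, trivial, ?_⟩
    rw [hq, dd, map_zero, sub_zero]
  have pz : ∀ z : ↥(LinearMap.ker d ⊓ ⊤), p z = cls d ⊤ z := by
    intro z
    refine congrArg (cls d ⊤) (Subtype.ext ?_)
    rw [hq, LinearMap.mem_ker.1 z.2.1, map_zero, sub_zero]
  let h' : M →ₗ[K] M := h ∘ₗ ((Submodule.subtype _) ∘ₗ q - i ∘ₗ p)
  have homot1 : ∀ x, d (h' x) + h (d x) = x - i (p x) := by
    intro x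
    have hb : cls d ⊤ (q x - i0 (p x)) = 0 := by
      rw [map_sub, sub_eq_zero]
      exact (LinearMap.congr_fun hi0 (p x)).symm
    obtain ⟨b, -, hb⟩ := cls_eq_zero.1 hb
    have e : d (h' x) = (q x : M) - i (p x) := by
      change d (h ((q x : M) - i (p x))) = _
      have : (q x : M) - i (p x) = d b := hb.symm
      rw [this, dhd]
    rw [e, hq]; abel
  have h'd : ∀ x, h' (d x) = h (d x) := by
    intro x
    change h ((q (d x) : M) - i (p (d x))) = _
    rw [pd, map_zero, sub_zero, hq, dd, map_zero, sub_zero]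
  have homot : ∀ x, d (h' x) + h' (d x) = x - i (p x) := fun x => by rw [h'd, homot1]
  constructor
  · -- left inverse
    let ρ : Homology (tensorD 𝒜 d) ⊤ →ₗ[K] Homology d ⊤ ⊗[K] Homology d ⊤ :=
      Submodule.liftQ _ (TensorProduct.map p p ∘ₗ Submodule.subtype _) (by
        rintro z ⟨w, -, hw⟩
        have : ∀ w, TensorProduct.map p p (tensorD 𝒜 d w) = 0 := by
          intro w
          induction w using TensorProduct.induction_on with
          | zero => simp
          | add a b ha hb => simp [ha, hb]
          | tmul a b => simp [tensorD, pd]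
        rw [LinearMap.mem_ker]
        change TensorProduct.map p p (z : M ⊗[K] M) = 0
        have hw' : tensorD 𝒜 d w = (z : M ⊗[K] M) := hw
        rw [← hw', this])
    refine Function.LeftInverse.injective (g := ρ) fun t => ?_
    induction t using TensorProduct.induction_on with
    | zero => simp
    | add a b ha hb => rw [map_add, map_add, ha, hb]
    | tmul a b =>
      obtain ⟨x, rfl⟩ := cls_surjective d ⊤ a
      obtain ⟨y, rfl⟩ := cls_surjective d ⊤ b
      change p (x : M) ⊗ₜ[K] p (y : M) = _
      rw [pz, pz]
  · intro c
    obtain ⟨w, rfl⟩ := cls_surjective _ _ c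
    have hw : tensorD 𝒜 d (w : M ⊗[K] M) = 0 := w.2.1
    -- the homotopy `s ⊗ h'`
    let η : M ⊗[K] M →ₗ[K] M ⊗[K] M := TensorProduct.map (signMap 𝒜) h'
    have hη : ∀ w, tensorD 𝒜 d (η w) + η (tensorD 𝒜 d w) =
        w - TensorProduct.map LinearMap.id i (TensorProduct.map LinearMap.id p w) := by
      intro w
      induction w using TensorProduct.induction_on with
      | zero => simp
      | add a b ha hb =>
        simp only [map_add]
        rw [add_sub_add_comm, ← ha, ← hb]
        abel
      | tmul a b =>
        simp only [η, tensorD, LinearMap.add_apply, TensorProduct.map_tmul, LinearMap.id_apply,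
          map_add, signMap_d 𝒜 hd, signMap_signMap]
        rw [← TensorProduct.tmul_sub, ← homot b, TensorProduct.tmul_add, TensorProduct.neg_tmul]
        abel
    let qq : M ⊗[K] Homology d ⊤ →ₗ[K] ↥(LinearMap.ker d ⊓ ⊤) ⊗[K] Homology d ⊤ :=
      TensorProduct.map q LinearMap.id
    let y := TensorProduct.map (LinearMap.id (R := K) (M := M)) p (w : M ⊗[K] M)
    have hy : TensorProduct.map d LinearMap.id y = 0 := by
      have : ∀ v : M ⊗[K] M, TensorProduct.map d LinearMap.id
          (TensorProduct.map (LinearMap.id (R := K) (M := M)) p v) =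
          TensorProduct.map LinearMap.id p (tensorD 𝒜 d v) := by
        intro v
        induction v using TensorProduct.induction_on with
        | zero => simp
        | add a b ha hb => simp only [map_add, ha, hb]
        | tmul a b => simp [tensorD, pd]
      rw [this, hw, map_zero]
    have hyq : ∀ v : M ⊗[K] Homology d ⊤,
        TensorProduct.map (Submodule.subtype _) LinearMap.id (qq v) =
          v - TensorProduct.map h LinearMap.id (TensorProduct.map d LinearMap.id v) := by
      intro v
      induction v using TensorProduct.induction_on with
      | zero => simp
      | add a b ha hb => simp only [map_add, ha, hb]; abel
      | tmul a b => simp [qq, hq, TensorProduct.sub_tmul]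
    refine ⟨TensorProduct.map (cls d ⊤) LinearMap.id (qq y), ?_⟩
    -- compute the class of a tensor in `Z ⊗ H`
    have hker : ∀ v : ↥(LinearMap.ker d ⊓ ⊤) ⊗[K] Homology d ⊤,
        TensorProduct.map (Submodule.subtype _) i v ∈ LinearMap.ker (tensorD 𝒜 d) ⊓ ⊤ := by
      intro v
      refine ⟨?_, trivial⟩
      change tensorD 𝒜 d (TensorProduct.map (Submodule.subtype _) i v) = 0
      induction v using TensorProduct.induction_on with
      | zero => simp
      | add a b ha hb => simp only [map_add, ha, hb, add_zero]
      | tmul a b =>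
        have ha : d (a : M) = 0 := a.2.1
        simp [tensorD, di, ha]
    have hcl : ∀ v : ↥(LinearMap.ker d ⊓ ⊤) ⊗[K] Homology d ⊤,
        kunnethMap 𝒜 hd (TensorProduct.map (cls d ⊤) LinearMap.id v) =
          cls (tensorD 𝒜 d) ⊤ ⟨TensorProduct.map (Submodule.subtype _) i v, hker v⟩ := by
      intro v
      induction v using TensorProduct.induction_on with
      | zero =>
        rw [map_zero, map_zero]
        refine (map_zero (cls (tensorD 𝒜 d) ⊤)).symm.trans (congrArg _ (Subtype.ext ?_))
        simp
      | add a b ha hb =>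
        rw [map_add, map_add, ha, hb, ← map_add]
        exact congrArg _ (Subtype.ext (map_add _ _ _).symm)
      | tmul a b =>
        have e : b = cls d ⊤ (i0 b) := (LinearMap.congr_fun hi0 b).symm
        rw [TensorProduct.map_tmul, LinearMap.id_apply]
        conv_lhs => rw [e]
        rfl
    rw [hcl, ← sub_eq_zero, ← map_sub, cls_eq_zero]
    refine ⟨- η w, trivial, ?_⟩
    have e1 := hη (w : M ⊗[K] M)
    rw [hw, map_zero, add_zero] at e1
    have e2 := hyq y
    rw [hy, map_zero, sub_zero] at e2
    have e3 : TensorProduct.map (Submodule.subtype (LinearMap.ker d ⊓ ⊤)) i (qq y) =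
        TensorProduct.map LinearMap.id i y := by
      conv_rhs => rw [← e2, TensorProduct.map_map, LinearMap.id_comp, LinearMap.comp_id]
    rw [map_neg, e1]
    change _ = TensorProduct.map (Submodule.subtype (LinearMap.ker d ⊓ ⊤)) i (qq y) -
      (w : M ⊗[K] M)
    rw [e3]
    abel

/-- The Künneth isomorphism. -/
def kunneth {d : M →ₗ[K] M} (hd : ∀ n, ∀ x ∈ 𝒜 n, d x ∈ 𝒜 (n - 1)) (hdd : d ∘ₗ d = 0) :
    Homology d ⊤ ⊗[K] Homology d ⊤ ≃ₗ[K] Homology (tensorD 𝒜 d) ⊤ :=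
  LinearEquiv.ofBijective (kunnethMap 𝒜 hd) (kunnethMap_bijective 𝒜 hd hdd)

end Kunneth

/-! ### Differential graded Zinbiel-associative bialgebras -/

section Bialgebra

variable (K : Type*) {H : Type*} [Field K] [Ring H] [Algebra K H]

/-- The graded interchange `x ⊗ y ↦ (-1)^(|x||y|) y ⊗ x`. -/
def braid (𝒜 : ℤ → Submodule K H) [GradedAlgebra 𝒜] : H ⊗[K] H →ₗ[K] H ⊗[K] H :=
  (GradedTensorProduct.of K 𝒜 𝒜).symm.toLinearMap ∘ₗ
    (GradedTensorProduct.comm 𝒜 𝒜).toLinearMap ∘ₗ (GradedTensorProduct.of K 𝒜 𝒜).toLinearMap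

/-- A differential graded Zinbiel-associative bialgebra: a graded vector space
`H = K 1 ⊕ ker ε` with a unital associative product for which `ε` is an augmentation, a counital
Zinbiel cooperation `Δ = Δ_≺` and a differential `d` of degree `-1`, all signs being given by the
Koszul rule. The cooperation is defined on `ker ε` only; it is extended by `Δ 1 = 0`. The
cooperation `Δ + τ Δ`, completed by `1 ↦ 1 ⊗ 1`, is `full`. -/
structure DGZinbAs (𝒜 : ℤ → Submodule K H) [GradedAlgebra 𝒜] where
  /-- the counit -/
  counit : H →ₐ[K] K
  /-- the Zinbiel cooperation `Δ_≺` -/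
  coprod : H →ₗ[K] H ⊗[K] H
  /-- the coassociative cooperation `Δ = Δ_≺ + τ Δ_≺`, with `Δ 1 = 1 ⊗ 1` -/
  full : H →ₗ[K] H ⊗[K] H
  /-- the differential -/
  d : H →ₗ[K] H
  full_apply : ∀ x, full x = coprod x + braid K 𝒜 (coprod x) + counit x • (1 ⊗ₜ[K] 1)
  counit_mem : ∀ n, n ≠ 0 → ∀ x ∈ 𝒜 n, counit x = 0
  coprod_mem : ∀ n, ∀ x ∈ 𝒜 n, coprod x ∈ tensorGrade 𝒜 n
  d_mem : ∀ n, ∀ x ∈ 𝒜 n, d x ∈ 𝒜 (n - 1)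
  coprod_one : coprod 1 = 0
  /-- `(ε ⊗ id) Δ_≺ = 0` -/
  counit_left : ∀ x, TensorProduct.map counit.toLinearMap LinearMap.id (coprod x) = 0
  /-- `(id ⊗ ε) Δ_≺ = id` on `ker ε` -/
  counit_right : ∀ x, counit x = 0 →
    TensorProduct.map LinearMap.id counit.toLinearMap (coprod x) = x ⊗ₜ[K] 1
  /-- the Zinbiel relation `(Δ_≺ ⊗ id) Δ_≺ = (id ⊗ (Δ_≺ + τ Δ_≺)) Δ_≺` -/
  zinbiel : ∀ x, TensorProduct.assoc K H H H (TensorProduct.map coprod LinearMap.id (coprod x)) =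
    TensorProduct.map LinearMap.id full (coprod x)
  /-- the compatibility relation `Δ_≺ (x y) = Δ_≺ x · Δ y`; the product on the right is the one of
  the tensor square of a graded algebra, with Koszul signs -/
  compat : ∀ x y, counit x = 0 → GradedTensorProduct.of K 𝒜 𝒜 (coprod (x * y)) =
    GradedTensorProduct.of K 𝒜 𝒜 (coprod x) * GradedTensorProduct.of K 𝒜 𝒜 (full y)
  d_comp_d : d ∘ₗ d = 0
  d_mul : ∀ n, ∀ x ∈ 𝒜 n, ∀ y, d (x * y) = d x * y + ((n.negOnePow : ℤ) : K) • (x * d y)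
  coprod_d : ∀ x, coprod (d x) = tensorD 𝒜 d (coprod x)
  counit_d : ∀ x, counit (d x) = 0

variable {K}

namespace DGZinbAs

variable {𝒜 : ℤ → Submodule K H} [GradedAlgebra 𝒜] (B : DGZinbAs K 𝒜)

/-- The primitive part: the `x` in `ker ε` with `Δ_≺ x = x ⊗ 1`. -/
def prim : Submodule K H :=
  LinearMap.ker B.counit.toLinearMap ⊓
    LinearMap.eqLocus B.coprod ((TensorProduct.mk K H H).flip 1)

theorem mem_prim {x : H} : x ∈ B.prim ↔ B.counit x = 0 ∧ B.coprod x = x ⊗ₜ[K] 1 := Iff.rfl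

/-- The filtration `F 0 = K 1`, `F (r + 1) = {x | Δ_≺ x - x ⊗ 1 ∈ F r ⊗ F r}`. -/
def filt : ℕ → Submodule K H
  | 0 => Submodule.span K {1}
  | r + 1 => (LinearMap.range (TensorProduct.map (filt r).subtype (filt r).subtype)).comap
      (B.coprod - (TensorProduct.mk K H H).flip 1)

/-- Connectedness: the filtration `filt` is exhaustive. -/
def Connected : Prop := ∀ x : H, ∃ r, x ∈ B.filt r

/-- The primitive part is a graded subspace. -/
theorem prim_isHomogeneous : DirectSum.SetLike.IsHomogeneous 𝒜 B.prim := by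
  classical
  let D : H →ₗ[K] H ⊗[K] H := B.coprod - (TensorProduct.mk K H H).flip 1
  let π : ℤ → ℤ → H ⊗[K] H →ₗ[K] H ⊗[K] H := fun p q =>
    TensorProduct.map (gradeProj 𝒜 p) (gradeProj 𝒜 q)
  have hD : ∀ n, ∀ x ∈ 𝒜 n, D x ∈ tensorGrade 𝒜 n := by
    intro n x hx
    refine Submodule.sub_mem _ (B.coprod_mem n x hx) (Submodule.subset_span ?_)
    exact ⟨n, 0, add_zero n, x, hx, 1, SetLike.GradedOne.one_mem, rfl⟩
  have hπ : ∀ p q n, p + q ≠ n → ∀ t ∈ tensorGrade 𝒜 n, π p q t = 0 := by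
    intro p q n hpq t ht
    induction ht using Submodule.span_induction with
    | zero => simp
    | add a b _ _ ha hb => rw [map_add, ha, hb, add_zero]
    | smul c a _ ha => rw [map_smul, ha, smul_zero]
    | mem t ht =>
      obtain ⟨a, b, hab, x, hx, y, hy, rfl⟩ := ht
      by_cases h : a = p
      · have h2 : b ≠ q := by omega
        simp [π, gradeProj_ne 𝒜 hy h2]
      · simp [π, gradeProj_ne 𝒜 hx h]
  have hsum : ∀ x : H, ∃ S : Finset ℤ, ∀ S', S ⊆ S' → ∑ p ∈ S', gradeProj 𝒜 p x = x := by
    intro x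
    refine ⟨(DirectSum.decompose 𝒜 x).support, fun S' hS => ?_⟩
    conv_rhs => rw [← DirectSum.sum_support_decompose 𝒜 x]
    refine (Finset.sum_subset hS fun p _ hp => ?_).symm
    rw [DFinsupp.notMem_support_iff] at hp
    rw [gradeProj_apply, hp]; rfl
  have hsum2 : ∀ t : H ⊗[K] H, ∃ S : Finset ℤ, ∀ S', S ⊆ S' →
      ∑ p ∈ S', ∑ q ∈ S', π p q t = t := by
    intro t
    induction t using TensorProduct.induction_on with
    | zero => exact ⟨∅, fun _ _ => by simp⟩
    | add a b ha hb =>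
      obtain ⟨S, hS⟩ := ha
      obtain ⟨T, hT⟩ := hb
      refine ⟨S ∪ T, fun S' h => ?_⟩
      simp only [map_add, Finset.sum_add_distrib]
      rw [hS S' (Finset.union_subset_left h), hT S' (Finset.union_subset_right h)]
    | tmul x y =>
      obtain ⟨S, hS⟩ := hsum x
      obtain ⟨T, hT⟩ := hsum y
      refine ⟨S ∪ T, fun S' h => ?_⟩
      simp only [π, TensorProduct.map_tmul, ← TensorProduct.tmul_sum, ← TensorProduct.sum_tmul]
      rw [hS S' (Finset.union_subset_left h), hT S' (Finset.union_subset_right h)]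
  have hzero : ∀ t : H ⊗[K] H, (∀ p q, π p q t = 0) → t = 0 := by
    intro t ht
    obtain ⟨S, hS⟩ := hsum2 t
    rw [← hS S le_rfl]
    simp [ht]
  have hπD : ∀ p q x, π p q (D x) = π p q (D (gradeProj 𝒜 (p + q) x)) := by
    intro p q x
    induction x using DirectSum.Decomposition.inductionOn 𝒜 with
    | zero => simp
    | add x y hx hy => rw [map_add, map_add, hx, hy, map_add, map_add, map_add]
    | @homogeneous i x =>
      by_cases h : i = p + q
      · rw [gradeProj_same 𝒜 (h ▸ x.2)]
      · rw [gradeProj_ne 𝒜 x.2 h, hπ p q i (Ne.symm h) _ (hD _ _ x.2), map_zero, map_zero]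
  have hε : ∀ x, B.counit (gradeProj 𝒜 0 x) = B.counit x := by
    intro x
    induction x using DirectSum.Decomposition.inductionOn 𝒜 with
    | zero => simp
    | add x y hx hy => rw [map_add, map_add, hx, hy, map_add]
    | @homogeneous i x =>
      by_cases h : i = 0
      · rw [gradeProj_same 𝒜 (h ▸ x.2)]
      · rw [gradeProj_ne 𝒜 x.2 h, map_zero, B.counit_mem i h _ x.2]
  intro n x hx
  obtain ⟨hx0, hx1⟩ := B.mem_prim.1 hx
  refine B.mem_prim.2 ⟨?_, ?_⟩
  · by_cases h : n = 0
    · subst h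
      exact (hε x).trans hx0
    · exact B.counit_mem n h _ (gradeProj_mem 𝒜 n x)
  · have hDx : D x = 0 := sub_eq_zero.2 hx1
    refine sub_eq_zero.1 (hzero (D (gradeProj 𝒜 n x)) fun p q => ?_)
    by_cases h : p + q = n
    · subst h
      rw [← hπD, hDx, map_zero]
    · exact hπ p q n h _ (hD _ _ (gradeProj_mem 𝒜 n x))

/-! ### The bialgebra structure on homology -/

/-- The map induced on homology by a chain map. -/
def _root_.ZinbAs.homologyMap {M N : Type*} [AddCommGroup M] [Module K M] [AddCommGroup N]
    [Module K N] {d : M →ₗ[K] M} {d' : N →ₗ[K] N} (f : M →ₗ[K] N) (hf : ∀ x, f (d x) = d' (f x)) :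
    Homology d ⊤ →ₗ[K] Homology d' ⊤ :=
  Submodule.mapQ _ _
    (f.restrict (p := LinearMap.ker d ⊓ ⊤) (q := LinearMap.ker d' ⊓ ⊤) (fun x hx => by
      have h1 : d x = 0 := hx.1
      have h2 : d' (f x) = 0 := by rw [← hf, h1, map_zero]
      exact ⟨h2, trivial⟩))
    (by
      rintro z ⟨y, -, hy⟩
      exact ⟨f y, trivial, by rw [← hf, hy]; rfl⟩)

theorem d_mul' (t : H ⊗[K] H) :
    LinearMap.mul' K H (tensorD 𝒜 B.d t) = B.d (LinearMap.mul' K H t) := by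
  induction t using TensorProduct.induction_on with
  | zero => simp
  | add a b ha hb => simp only [map_add, ha, hb]
  | tmul x y =>
    induction x using DirectSum.Decomposition.inductionOn 𝒜 with
    | zero => simp
    | add x x' hx hx' => simp only [TensorProduct.add_tmul, map_add, hx, hx']
    | @homogeneous i x =>
      simp [tensorD, B.d_mul i x x.2, signMap_of_mem 𝒜 x.2]

theorem d_one : B.d 1 = 0 := by
  have h := B.d_mul 0 1 SetLike.GradedOne.one_mem 1
  simpa using h

/-- The unit of the homology: the class of `1`. -/
def homologyOne : Homology B.d ⊤ := cls B.d ⊤ ⟨1, B.d_one, trivial⟩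

/-- The product of the homology, `[x] ⊗ [y] ↦ [x y]`. -/
def homologyMul : Homology B.d ⊤ ⊗[K] Homology B.d ⊤ →ₗ[K] Homology B.d ⊤ :=
  homologyMap (LinearMap.mul' K H) B.d_mul' ∘ₗ kunnethMap 𝒜 B.d_mem

/-- The Zinbiel cooperation of the homology, `H(B) → H(B ⊗ B) ≅ H(B) ⊗ H(B)`. -/
def homologyCoprod : Homology B.d ⊤ →ₗ[K] Homology B.d ⊤ ⊗[K] Homology B.d ⊤ :=
  (kunneth 𝒜 B.d_mem B.d_comp_d).symm.toLinearMap ∘ₗ homologyMap B.coprod B.coprod_d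

/-- The counit of the homology, `[x] ↦ ε x`. -/
def homologyCounit : Homology B.d ⊤ →ₗ[K] K :=
  Submodule.liftQ _ (B.counit.toLinearMap ∘ₗ Submodule.subtype _) (by
    rintro z ⟨y, -, hy⟩
    have hy' : B.d y = (z : H) := hy
    rw [LinearMap.mem_ker]
    change B.counit (z : H) = 0
    rw [← hy', B.counit_d])

end DGZinbAs

end Bialgebra

/-! ### The tensor module -/

section TensorModule

variable {K V : Type*} [Field K] [AddCommGroup V] [Module K V] (𝒱 : ℤ → Submodule K V)

/-- The grading of the tensor module of a graded vector space: `v₁ ⋯ vₖ` has degree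
`|v₁| + ⋯ + |vₖ|`. -/
def tensorAlgGrade (n : ℤ) : Submodule K (TensorAlgebra K V) :=
  Submodule.span K {t | ∃ l : List (Σ i, 𝒱 i), (l.map Sigma.fst).sum = n ∧
    (l.map fun v => TensorAlgebra.ι K (v.2 : V)).prod = t}

theorem ι_mem_tensorAlgGrade {n : ℤ} {v : V} (hv : v ∈ 𝒱 n) :
    TensorAlgebra.ι K v ∈ tensorAlgGrade 𝒱 n :=
  Submodule.subset_span ⟨[⟨n, ⟨v, hv⟩⟩], by simp, by simp⟩

instance tensorAlgGrade.gradedMonoid : SetLike.GradedMonoid (tensorAlgGrade 𝒱) where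
  one_mem := Submodule.subset_span ⟨[], by simp, by simp⟩
  mul_mem m n x y hx hy := by
    have h : x * y ∈ tensorAlgGrade 𝒱 m * tensorAlgGrade 𝒱 n := Submodule.mul_mem_mul hx hy
    refine (?_ : tensorAlgGrade 𝒱 m * tensorAlgGrade 𝒱 n ≤ tensorAlgGrade 𝒱 (m + n)) h
    rw [tensorAlgGrade, tensorAlgGrade, Submodule.span_mul_span, Submodule.span_le]
    rintro _ ⟨_, ⟨l, rfl, rfl⟩, _, ⟨l', rfl, rfl⟩, rfl⟩
    exact Submodule.subset_span ⟨l ++ l', by simp, by simp⟩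

variable [DirectSum.Decomposition 𝒱]

/-- Auxiliary map for the decomposition of the tensor module. -/
def tensorAlgDecompose : TensorAlgebra K V →ₐ[K] ⨁ n, tensorAlgGrade 𝒱 n :=
  TensorAlgebra.lift K
    (DirectSum.toModule K ℤ _ (fun n =>
      DirectSum.lof K ℤ (fun n => tensorAlgGrade 𝒱 n) n ∘ₗ
        (TensorAlgebra.ι K).restrict (p := 𝒱 n) (q := tensorAlgGrade 𝒱 n)
          (fun _ hv => ι_mem_tensorAlgGrade 𝒱 hv)) ∘ₗ
    (DirectSum.decomposeLinearEquiv 𝒱).toLinearMap)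

theorem tensorAlgDecompose_ι {n : ℤ} (v : 𝒱 n) :
    tensorAlgDecompose 𝒱 (TensorAlgebra.ι K (v : V)) =
      DirectSum.of (fun n => tensorAlgGrade 𝒱 n) n ⟨_, ι_mem_tensorAlgGrade 𝒱 v.2⟩ := by
  rw [tensorAlgDecompose, TensorAlgebra.lift_ι_apply]
  simp only [LinearMap.comp_apply, LinearEquiv.coe_coe, DirectSum.decomposeLinearEquiv_apply_coe,
    DirectSum.toModule_lof]
  rfl

instance tensorAlgGrade.gradedAlgebra : GradedAlgebra (tensorAlgGrade 𝒱) :=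
  GradedAlgebra.ofAlgHom _ (tensorAlgDecompose 𝒱)
    (by
      refine TensorAlgebra.hom_ext (DirectSum.decompose_lhom_ext 𝒱 fun n => ?_)
      ext v
      simp [tensorAlgDecompose_ι])
    (by
      rintro n ⟨x, hx⟩
      have key : ∀ (l : List (Σ i, 𝒱 i)) (n : ℤ) (hn : (l.map Sigma.fst).sum = n)
          (h : (l.map fun v => TensorAlgebra.ι K (v.2 : V)).prod ∈ tensorAlgGrade 𝒱 n),
          tensorAlgDecompose 𝒱 (l.map fun v => TensorAlgebra.ι K (v.2 : V)).prod =
            DirectSum.of (fun n => tensorAlgGrade 𝒱 n) n ⟨_, h⟩ := by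
        intro l
        induction l with
        | nil =>
          intro n hn h
          simp only [List.map_nil, List.sum_nil] at hn
          subst hn
          simp only [List.map_nil, List.prod_nil, map_one]
          rfl
        | cons v l ih =>
          intro n hn h
          simp only [List.map_cons, List.prod_cons, List.sum_cons] at hn h ⊢
          rw [map_mul, ih _ rfl (Submodule.subset_span ⟨l, rfl, rfl⟩), tensorAlgDecompose_ι,
            DirectSum.of_mul_of]
          exact DirectSum.of_eq_of_gradedMonoid_eq (Sigma.subtype_ext hn rfl)
      change tensorAlgDecompose 𝒱 x = _
      induction hx using Submodule.span_induction with
      | zero => rw [map_zero]; exact (map_zero _).symm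
      | add a b ha hb iha ihb => rw [map_add, iha, ihb, ← map_add]; rfl
      | smul c a ha iha =>
        rw [map_smul, iha]
        exact (map_smul (DirectSum.lof K ℤ (fun n => tensorAlgGrade 𝒱 n) n) c ⟨a, ha⟩).symm
      | mem x hx =>
        obtain ⟨l, hl, rfl⟩ := hx
        exact key l n hl _)

/-- The map `v ↦ v ⊗ 1` from `V` to the graded tensor square of `T(V)`. -/
def leftι : V →ₗ[K] GradedTensorProduct K (tensorAlgGrade 𝒱) (tensorAlgGrade 𝒱) :=
  (GradedTensorProduct.of K (tensorAlgGrade 𝒱) (tensorAlgGrade 𝒱)).toLinearMap ∘ₗ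
    (TensorProduct.mk K _ _).flip 1 ∘ₗ TensorAlgebra.ι K

/-- The map `v ↦ v ⊗ 1 + 1 ⊗ v` from `V` to the graded tensor square of `T(V)`. -/
def coshuffleι : V →ₗ[K] GradedTensorProduct K (tensorAlgGrade 𝒱) (tensorAlgGrade 𝒱) :=
  (GradedTensorProduct.of K (tensorAlgGrade 𝒱) (tensorAlgGrade 𝒱)).toLinearMap ∘ₗ
    ((TensorProduct.mk K _ _).flip 1 + TensorProduct.mk K _ _ 1) ∘ₗ TensorAlgebra.ι K

/-- The co-shuffle `T(V) → T(V) ⊗ T(V)` with Koszul signs: the morphism of algebras into the graded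
tensor square with `v ↦ v ⊗ 1 + 1 ⊗ v` for `v` in `V`. -/
def coshuffle : TensorAlgebra K V →ₐ[K]
    GradedTensorProduct K (tensorAlgGrade 𝒱) (tensorAlgGrade 𝒱) :=
  TensorAlgebra.lift K (coshuffleι 𝒱)

/-- Auxiliary map for the co-half shuffle: `w` acts by
`(a, b) ↦ (coshuffle w * a, …)` and sends `(1, 0)` to `(coshuffle w, coHalfShuffle w)`. -/
def coHalfShuffleAux : TensorAlgebra K V →ₐ[K] Module.End K
    (GradedTensorProduct K (tensorAlgGrade 𝒱) (tensorAlgGrade 𝒱) ×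
      GradedTensorProduct K (tensorAlgGrade 𝒱) (tensorAlgGrade 𝒱)) :=
  TensorAlgebra.lift K
    { toFun := fun v =>
        LinearMap.prod
          (GradedTensorProduct.mulHom _ _ (coshuffleι 𝒱 v) ∘ₗ LinearMap.fst K _ _)
          (GradedTensorProduct.mulHom _ _ (leftι 𝒱 v) ∘ₗ LinearMap.fst K _ _)
      map_add' := fun v w => by
        refine LinearMap.ext fun x => Prod.ext ?_ ?_
        · simp
        · simp
      map_smul' := fun c v => by
        refine LinearMap.ext fun x => Prod.ext ?_ ?_
        · simp
        · simp }

/-- The co-half shuffle of the tensor module, with Koszul signs: `1 ↦ 0` and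
`v w ↦ (v ⊗ 1) · coshuffle w` for `v` in `V` and `w` in `T(V)`. -/
def coHalfShuffle : TensorAlgebra K V →ₗ[K] TensorAlgebra K V ⊗[K] TensorAlgebra K V :=
  (GradedTensorProduct.of K (tensorAlgGrade 𝒱) (tensorAlgGrade 𝒱)).symm.toLinearMap ∘ₗ
    LinearMap.snd K _ _ ∘ₗ LinearMap.applyₗ (1, 0) ∘ₗ (coHalfShuffleAux 𝒱).toLinearMap

theorem coHalfShuffle_one : coHalfShuffle 𝒱 (1 : TensorAlgebra K V) = 0 := by
  simp [coHalfShuffle]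

theorem coHalfShuffleAux_fst (w : TensorAlgebra K V) :
    (coHalfShuffleAux 𝒱 w (1, 0)).1 = coshuffle 𝒱 w := by
  have key : ∀ x, (coHalfShuffleAux 𝒱 w x).1 = coshuffle 𝒱 w * x.1 := by
    induction w using TensorAlgebra.induction with
    | algebraMap r =>
      intro x
      rw [AlgHom.commutes, AlgHom.commutes, Module.algebraMap_end_apply, Prod.smul_fst]
      exact Algebra.smul_def r x.1
    | ι v =>
      intro x
      simp [coHalfShuffleAux, coshuffle, GradedTensorProduct.mul_def]
    | mul a b ha hb =>
      intro x
      rw [map_mul, Module.End.mul_apply, ha, hb, map_mul, mul_assoc]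
    | add a b ha hb =>
      intro x
      rw [map_add, LinearMap.add_apply, Prod.fst_add, ha, hb, map_add, add_mul]
  rw [key, mul_one]

theorem coHalfShuffle_ι_mul (v : V) (w : TensorAlgebra K V) :
    GradedTensorProduct.of K (tensorAlgGrade 𝒱) (tensorAlgGrade 𝒱)
        (coHalfShuffle 𝒱 (TensorAlgebra.ι K v * w)) =
      GradedTensorProduct.tmul K (TensorAlgebra.ι K v) 1 * coshuffle 𝒱 w := by
  simp only [coHalfShuffle, LinearMap.comp_apply, LinearEquiv.coe_coe,
    AlgHom.toLinearMap_apply, map_mul, LinearMap.applyₗ_apply_apply, Module.End.mul_apply,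
    LinearMap.snd_apply, GradedTensorProduct.symm_of_of]
  rw [coHalfShuffleAux, TensorAlgebra.lift_ι_apply, ← coHalfShuffleAux]
  simp [coHalfShuffleAux_fst, GradedTensorProduct.mul_def, leftι]

end TensorModule

section Iso

variable {K H : Type*} [Field K] [Ring H] [Algebra K H] {𝒜 : ℤ → Submodule K H} [GradedAlgebra 𝒜]

/-- The co-half shuffle of the tensor module `T(H(P))`, for a graded subcomplex `P`. -/
def homologyCoHalfShuffle (B : DGZinbAs K 𝒜) (P : Submodule K H)
    (hP : DirectSum.SetLike.IsHomogeneous 𝒜 P) :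
    TensorAlgebra K (Homology B.d P) →ₗ[K]
      TensorAlgebra K (Homology B.d P) ⊗[K] TensorAlgebra K (Homology B.d P) :=
  letI := (homologyGrade_isInternal 𝒜 B.d_mem hP).chooseDecomposition
  coHalfShuffle (homologyGrade 𝒜 B.d P)

/-- An isomorphism of graded Zinbiel-associative bialgebras `T(H(P)) ≅ H(B)` that extends the map
`H(P) → H(B)` induced by the inclusion of the graded subcomplex `P` in `B`. Here `T(H(P))` carries
the concatenation, the co-half shuffle and the total grading. -/
structure TensorHomologyIso (B : DGZinbAs K 𝒜) (P : Submodule K H)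
    (hP : DirectSum.SetLike.IsHomogeneous 𝒜 P) where
  /-- the underlying linear isomorphism -/
  toEquiv : TensorAlgebra K (Homology B.d P) ≃ₗ[K] Homology B.d ⊤
  map_ι : ∀ c, toEquiv (TensorAlgebra.ι K c) = homologyIncl B.d P c
  map_one : toEquiv 1 = B.homologyOne
  map_mul : ∀ x y, toEquiv (x * y) = B.homologyMul (toEquiv x ⊗ₜ[K] toEquiv y)
  map_counit : ∀ x, B.homologyCounit (toEquiv x) = TensorAlgebra.algebraMapInv x
  map_coprod : ∀ x, B.homologyCoprod (toEquiv x) =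
    TensorProduct.map toEquiv.toLinearMap toEquiv.toLinearMap (homologyCoHalfShuffle B P hP x)
  map_grade : ∀ n, (tensorAlgGrade (homologyGrade 𝒜 B.d P) n).map toEquiv.toLinearMap =
    homologyGrade 𝒜 B.d ⊤ n

end Iso

/-! ### Symmetric graphs -/

section Graphs

/-- A (non-oriented) symmetric graph without loops: the vertices are `1, …, n`, and there is a
multiset of edges; the edge joining `i < j` is written `(i, j)`. -/
@[ext]
structure SymGraph where
  /-- the number of vertices -/
  n : ℕ
  /-- the edges -/
  edges : Multiset (ℕ × ℕ)
  edges_mem : ∀ e ∈ edges, 1 ≤ e.1 ∧ e.1 < e.2 ∧ e.2 ≤ n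

/-- An oriented symmetric graph: the vertices are `1, …, n`, and there is a multiset of oriented
edges; loops are allowed. -/
structure OrientedGraph where
  /-- the number of vertices -/
  n : ℕ
  /-- the edges -/
  edges : Multiset (ℕ × ℕ)
  edges_mem : ∀ e ∈ edges, (1 ≤ e.1 ∧ e.1 ≤ n) ∧ 1 ≤ e.2 ∧ e.2 ≤ n

namespace SymGraph

instance : Zero SymGraph := ⟨{ n := 0, edges := 0, edges_mem := by simp }⟩

/-- The ordered disjoint union, written additively (it is not commutative): the vertices of the
second graph are shifted behind those of the first. Its unit is the empty graph. -/
instance : Add SymGraph := ⟨fun G G' =>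
  { n := G.n + G'.n
    edges := G.edges + G'.edges.map fun e => (G.n + e.1, G.n + e.2)
    edges_mem := by
      intro e he
      rcases Multiset.mem_add.1 he with h | h
      · have := G.edges_mem e h
        omega
      · obtain ⟨e', he', rfl⟩ := Multiset.mem_map.1 h
        have := G'.edges_mem e' he'
        dsimp only
        omega }⟩

instance : AddMonoid SymGraph where
  add_assoc G G' G'' := by
    refine SymGraph.ext (Nat.add_assoc _ _ _) ?_
    change G.edges + G'.edges.map _ + G''.edges.map _ =
      G.edges + (G'.edges + G''.edges.map _).map _
    rw [Multiset.map_add, Multiset.map_map, add_assoc]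
    refine congrArg _ (congrArg _ (Multiset.map_congr rfl fun e _ => ?_))
    exact Prod.ext (Nat.add_assoc _ _ _) (Nat.add_assoc _ _ _)
  zero_add G := by
    refine SymGraph.ext (Nat.zero_add _) ?_
    change 0 + G.edges.map (fun e => (0 + e.1, 0 + e.2)) = G.edges
    simp
  add_zero G := by
    refine SymGraph.ext (Nat.add_zero _) ?_
    change G.edges + (0 : Multiset (ℕ × ℕ)).map _ = G.edges
    simp
  nsmul := nsmulRec

theorem n_add (G G' : SymGraph) : (G + G').n = G.n + G'.n := rfl

theorem edges_add (G G' : SymGraph) :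
    (G + G').edges = G.edges + G'.edges.map fun e => (G.n + e.1, G.n + e.2) := rfl

/-- The valence of a vertex: the number of edges incident to it. -/
def valence (G : SymGraph) (v : ℕ) : ℕ := (G.edges.filter fun e => e.1 = v ∨ e.2 = v).card

/-- The graphs whose vertices all have valence at least `k`. -/
def minValence (k : ℕ) : AddSubmonoid SymGraph where
  carrier := {G | ∀ v, 1 ≤ v → v ≤ G.n → k ≤ G.valence v}
  zero_mem' := by
    intro v h1 h2
    have h2' : v ≤ 0 := h2
    omega
  add_mem' := by
    intro G G' hG hG' v h1 h2
    rw [n_add] at h2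
    rw [valence, edges_add, Multiset.filter_add, Multiset.card_add]
    by_cases h : v ≤ G.n
    · exact (hG v h1 h).trans (Nat.le_add_right _ _)
    · refine (hG' (v - G.n) (by omega) (by omega)).trans (le_trans ?_ (Nat.le_add_left _ _))
      rw [Multiset.filter_map, Multiset.card_map, valence]
      refine Multiset.card_le_card (Multiset.monotone_filter_right _ fun e he => ?_)
      simp only [Function.comp]
      omega

/-- The graph on the vertices, with two vertices adjacent if an edge joins them. -/
def adjGraph (G : SymGraph) : SimpleGraph (Finset.Icc 1 G.n) :=
  SimpleGraph.fromRel fun u v => ((u : ℕ), (v : ℕ)) ∈ G.edges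

/-- A set of vertices is closed if no edge leaves it, that is, if it is a union of connected
components. -/
def Closed (G : SymGraph) (A : Finset ℕ) : Prop := ∀ e ∈ G.edges, e.1 ∈ A ↔ e.2 ∈ A

/-- The position of `v` in `A`. -/
def rank (A : Finset ℕ) (v : ℕ) : ℕ := (A.filter (· ≤ v)).card

/-- The subgraph induced on the set `A` of vertices; these are renumbered `1, …, #A`
in increasing order. -/
def induce (G : SymGraph) (A : Finset ℕ) : SymGraph where
  n := A.card
  edges := (G.edges.filter fun e => e.1 ∈ A ∧ e.2 ∈ A).map fun e => (rank A e.1, rank A e.2)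
  edges_mem := by
    intro e' he'
    obtain ⟨e, he, rfl⟩ := Multiset.mem_map.1 he'
    obtain ⟨he, h1, h2⟩ := Multiset.mem_filter.1 he
    have hlt := (G.edges_mem e he).2.1
    refine ⟨Finset.card_pos.2 ⟨e.1, by simp [h1]⟩, Finset.card_lt_card ?_,
      Finset.card_le_card (Finset.filter_subset _ _)⟩
    rw [Finset.ssubset_iff_of_subset]
    · exact ⟨e.2, by simp [h2], by simp [h2, hlt]⟩
    · intro x hx
      simp only [Finset.mem_filter] at hx ⊢
      exact ⟨hx.1, by omega⟩

/-- The standardisation map for the contraction of the edge joining `i < j`. -/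
def std (i j v : ℕ) : ℕ := if v = j then i else if j < v then v - 1 else v

/-- The contraction `G / e`; here `G` is oriented by `i → j` for an edge joining `i < j`. -/
def contract (G : SymGraph) (e : ℕ × ℕ) (he : e ∈ G.edges) : OrientedGraph where
  n := G.n - 1
  edges := (G.edges.erase e).map fun e' => (std e.1 e.2 e'.1, std e.1 e.2 e'.2)
  edges_mem := by
    intro e'' he''
    obtain ⟨e', he', rfl⟩ := Multiset.mem_map.1 he''
    have h' := G.edges_mem e' (Multiset.mem_of_mem_erase he')
    have h := G.edges_mem e he
    dsimp only [std]
    refine ⟨⟨?_, ?_⟩, ?_, ?_⟩ <;> split_ifs <;> omega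

end SymGraph

/-- The space `K[𝒢]` spanned by the graphs with all valences at least `k`; its product is the
ordered disjoint union. For `k = 0` these are all graphs. -/
abbrev GraphAlg (K : Type*) [Field K] (k : ℕ) : Type _ :=
  AddMonoidAlgebra K (SymGraph.minValence k)

/-- The number of vertices. -/
def numVertices (k : ℕ) : SymGraph.minValence k →+ ℤ where
  toFun G := (G.1.n : ℤ)
  map_zero' := rfl
  map_add' G G' := by
    change ((G.1 + G'.1).n : ℤ) = _
    rw [SymGraph.n_add, Nat.cast_add]

variable (K : Type*) [Field K] (k : ℕ)

/-- The grading of `K[𝒢]` by the number of vertices. -/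
abbrev graphGrade : ℤ → Submodule K (GraphAlg K k) :=
  AddMonoidAlgebra.gradeBy K (numVertices k)

open Classical in
/-- The basis element of `K[𝒢]` given by a graph. -/
def graphBasis (G : SymGraph) : GraphAlg K k :=
  if h : G ∈ SymGraph.minValence k then AddMonoidAlgebra.single ⟨G, h⟩ 1 else 0

/-- The class in `K[𝒢]` of an oriented graph, where changing the orientation of one edge changes
the sign, and graphs with loops are zero. -/
def orientedClass (G : OrientedGraph) : GraphAlg K k :=
  if h : ∀ e ∈ G.edges, e.1 ≠ e.2 then
    (-1 : K) ^ (G.edges.filter fun e => e.2 < e.1).card •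
      graphBasis K k
        { n := G.n
          edges := G.edges.map fun e => (min e.1 e.2, max e.1 e.2)
          edges_mem := by
            intro e' he'
            obtain ⟨e, he, rfl⟩ := Multiset.mem_map.1 he'
            have h1 := h e he
            have h2 := G.edges_mem e he
            dsimp only
            omega }
  else 0

/-- The differential `δ G = ∑ (-1)^max(i,j) ε(e) G / e`, the sum over all edges `e` of `G`. The
graph is oriented by `i → j` for an edge `e` joining `i < j`, so `max(i,j) = j` and `ε(e) = 1`. -/
def graphD : GraphAlg K k →ₗ[K] GraphAlg K k :=
  (AddMonoidAlgebra.basis (SymGraph.minValence k) K).constr K fun G =>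
    (G.1.edges.attach.map fun e =>
      (-1 : K) ^ e.1.2 • orientedClass K k (G.1.contract e.1 e.2)).sum

open Classical in
/-- The cooperation `Δ_≺ G = ∑ ± G|_A ⊗ G|_(Aᶜ)`, the sum over the unions `A` of connected
components of `G` with `1 ∈ A`; the sign is that of the unshuffle of the vertices
`1, …, n` into `A` followed by its complement (the Koszul sign). On an ordered disjoint union
`G₁ ⋯ Gₘ` of connected graphs this is the co-half shuffle. -/
def graphCoprod : GraphAlg K k →ₗ[K] GraphAlg K k ⊗[K] GraphAlg K k :=
  (AddMonoidAlgebra.basis (SymGraph.minValence k) K).constr K fun G =>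
    ∑ A ∈ (Finset.Icc 1 G.1.n).powerset with 1 ∈ A ∧ G.1.Closed A,
      (-1 : K) ^ (((Finset.Icc 1 G.1.n \ A) ×ˢ A).filter fun p => p.1 < p.2).card •
        (graphBasis K k (G.1.induce A) ⊗ₜ[K] graphBasis K k (G.1.induce (Finset.Icc 1 G.1.n \ A)))

/-- The space `K[𝒢_c]` spanned by the connected graphs. -/
def connectedGraphs : Submodule K (GraphAlg K k) :=
  Submodule.span K {x | ∃ G : SymGraph.minValence k, G.1.adjGraph.Connected ∧
    AddMonoidAlgebra.single G 1 = x}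

theorem connectedGraphs_isHomogeneous :
    DirectSum.SetLike.IsHomogeneous (graphGrade K k) (connectedGraphs K k) := by
  intro n x hx
  change gradeProj (graphGrade K k) n x ∈ connectedGraphs K k
  induction hx using Submodule.span_induction with
  | zero => rw [map_zero]; exact Submodule.zero_mem _
  | add a b _ _ ha hb => rw [map_add]; exact Submodule.add_mem _ ha hb
  | smul c a _ ha => rw [map_smul]; exact Submodule.smul_mem _ _ ha
  | mem x hx =>
    obtain ⟨G, hG, rfl⟩ := hx
    have hmem : (AddMonoidAlgebra.single G 1 : GraphAlg K k) ∈ graphGrade K k (numVertices k G) :=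
      AddMonoidAlgebra.single_mem_gradeBy _ _ _
    by_cases h : numVertices k G = n
    · subst h
      rw [gradeProj_same _ hmem]
      exact Submodule.subset_span ⟨G, hG, rfl⟩
    · rw [gradeProj_ne _ hmem h]
      exact Submodule.zero_mem _

end Graphs

end ZinbAs

end

/-!
# The homology of Zinbiel-associative bialgebras and of complexes of graphs

**The structure theorem.** Let `P` be the primitive part of a connected bialgebra `H`. The inclusion
of `P` extends to a morphism `T(P) → H` of algebras, and by the compatibility of `Δ_≺` with products
it is also a morphism for the co-half shuffle (`coprod_lift`). It is injective for any space of
primitive elements (`lift_injective`): the reduced co-half shuffle lowers the length of words, and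
the elements of the augmentation ideal of `T(P)` on which it vanishes are the words of length one.
The latter follows from the formula `mul_wordProj_coHalfShuffle`, which recovers an element from its
co-half shuffle. It is surjective if `P` is the whole primitive part (`lift_surjective`): by
induction on the filtration, the reduced cooperation of `x` comes from a tensor over `T(P)`; the
Zinbiel relation says that this tensor is a cocycle, and the same formula shows that a cocycle is a
coboundary (`coHalfShuffle_of_cocycle`), so that `x` agrees with an element of `T(P)` up to a
primitive one.

**Homology.** Over a field a graded complex `P` contracts to its homology by graded maps
(`exists_graded_homotopy`), and the contraction extends to tensor modules
(`exists_tensorAlg_homotopy`). Hence the homology of `T(P)` is `T(H(P))`, and if the subalgebra of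
`H` generated by a subcomplex `P` of primitive elements is quasi-isomorphic to `H`, then the
homology of `H` is `T(H(P))` as a bialgebra (`nonempty_tensorHomologyIso`). For a connected `H` and
its whole primitive part this subalgebra is `H` itself. The primitive part of the homology is then
that of the tensor module, which consists of the words of length one (`homology_primitive_iff`).

**Graphs.** It is convenient to label vertices by arbitrary natural numbers and to orient edges
arbitrarily (`graphElt`); the product, differential and cooperation are given by the same formulas
for such graphs (`graphElt_mul`, `graphD_graphElt`, `graphCoprod_graphElt`), and the axioms become
identities between sums over edges and over unions of components (`graphBialgebra`). Connected
graphs are primitive, but they do not span the primitive part: a signed difference of two graphs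
with the same components, one with the components in succession and one with interleaved vertices,
may be primitive. So the structure theorem for the primitive part is not enough, and it has to be
shown that the subalgebra generated by the connected graphs, spanned by the ordered disjoint unions
of connected graphs, is quasi-isomorphic to the space of all graphs.

To this end call a cut between two consecutive vertices bad if some edge crosses it although the two
vertices lie in different components. The graphs without bad cuts are the ordered disjoint unions of
connected graphs (`mem_levelSpace_zero_iff`). Filter the graphs by the maximal number of vertices
above a bad cut. At the lowest bad cut, take the mean over all edges that cross it of the graphs in
which a new vertex is inserted on this edge, just above the cut; the mean is the place where
characteristic zero is essential. The new vertex is linked to the vertex below the cut, so the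
insertion does not raise the level. Contracting the lower half of the subdivided edge recovers the
graph, contracting an edge that ends above the cut lowers the level, and contracting another edge
commutes with the insertion up to sign. So the insertion is a homotopy that contracts each step of
the filtration to the step below (`homotopy_sub_mem`), and by induction every chain whose boundary
has no bad cuts is homologous to one without bad cuts (`exists_sub_graphD_mem_levelSpace`). The new
vertex has valence two, so all this holds as well for the graphs with all valences at least two.
-/

noncomputable section

namespace ZinbAs

/-! ### Words of length one in the tensor module -/

section TensorModuleLemmas

variable {K V : Type*} [Field K] [AddCommGroup V] [Module K V]

/-- Induction on the words `v w`, with one letter `v` split off on the left; this is the shape of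
the recursion that defines the co-half shuffle. -/
theorem tensorAlgebra_induction_left {C : TensorAlgebra K V → Prop} (one : C 1)
    (add : ∀ a b, C a → C b → C (a + b)) (smul : ∀ (c : K) a, C a → C (c • a))
    (ι_mul : ∀ v w, C w → C (TensorAlgebra.ι K v * w)) (w : TensorAlgebra K V) : C w := by
  have key : ∀ a w : TensorAlgebra K V, C w → C (a * w) := by
    intro a
    induction a using TensorAlgebra.induction with
    | algebraMap r => intro w hw; rw [← Algebra.smul_def]; exact smul r w hw
    | ι v => exact ι_mul v
    | mul a b ha hb => intro w hw; rw [mul_assoc]; exact ha _ (hb _ hw)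
    | add a b ha hb => intro w hw; rw [add_mul]; exact add _ _ (ha _ hw) (hb _ hw)
  simpa using key w 1 one

theorem ιInv_ι_mul (v : V) (w : TensorAlgebra K V) :
    TensorAlgebra.ιInv (TensorAlgebra.ι K v * w) = TensorAlgebra.algebraMapInv w • v := by
  -- `TensorAlgebra.ιInv` is defined through the trivial square zero extension of `K` by `V`
  let _ : Module Kᵐᵒᵖ V := Module.compHom _ ((RingHom.id K).fromOpposite mul_comm)
  have : IsCentralScalar K V := ⟨fun r m => rfl⟩
  have hfst : ∀ w : TensorAlgebra K V,
      (TensorAlgebra.toTrivSqZeroExt w).fst = TensorAlgebra.algebraMapInv w := by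
    intro w
    have : (TrivSqZeroExt.fstHom K K V).comp (TensorAlgebra.toTrivSqZeroExt (R := K) (M := V)) =
        TensorAlgebra.algebraMapInv := by
      refine TensorAlgebra.hom_ext (LinearMap.ext fun v => ?_)
      simp [TensorAlgebra.algebraMapInv]
    exact DFunLike.congr_fun this w
  change (TensorAlgebra.toTrivSqZeroExt (TensorAlgebra.ι K v * w)).snd = _
  rw [map_mul, TensorAlgebra.toTrivSqZeroExt_ι, TrivSqZeroExt.snd_mul, hfst]
  simp

@[simp] theorem algebraMapInv_ι (v : V) :
    TensorAlgebra.algebraMapInv (TensorAlgebra.ι K v) = (0 : K) := by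
  simp [TensorAlgebra.algebraMapInv]

/-- The projection of the tensor module onto the space of words of length one. -/
def wordProj : TensorAlgebra K V →ₗ[K] TensorAlgebra K V :=
  TensorAlgebra.ι K ∘ₗ TensorAlgebra.ιInv

theorem wordProj_ι_mul (v : V) (w : TensorAlgebra K V) :
    wordProj (TensorAlgebra.ι K v * w) = TensorAlgebra.algebraMapInv w • TensorAlgebra.ι K v := by
  simp [wordProj, ιInv_ι_mul]

theorem algebraMapInv_of_mem (𝒱 : ℤ → Submodule K V) {n : ℤ} (hn : n ≠ 0) {w : TensorAlgebra K V}
    (hw : w ∈ tensorAlgGrade 𝒱 n) : TensorAlgebra.algebraMapInv w = 0 := by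
  induction hw using Submodule.span_induction with
  | zero => simp
  | add a b _ _ ha hb => rw [map_add, ha, hb, add_zero]
  | smul c a _ ha => rw [map_smul, ha, smul_zero]
  | mem x hx =>
    obtain ⟨l, hl, rfl⟩ := hx
    cases l with
    | nil => exact absurd hl.symm hn
    | cons v l => simp

end TensorModuleLemmas

/-! ### The graded tensor square of an algebra -/

section GradedSquare

variable {K A : Type*} [Field K] [Ring A] [Algebra K A] (𝒜 : ℤ → Submodule K A) [GradedAlgebra 𝒜]

/-- The product `(a ⊗ 1) t` in the graded tensor square involves no sign. -/
theorem tmul_one_mul (a : A) (t : A ⊗[K] A) :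
    GradedTensorProduct.tmul K a 1 * GradedTensorProduct.of K 𝒜 𝒜 t =
      GradedTensorProduct.of K 𝒜 𝒜 (TensorProduct.map (LinearMap.mulLeft K a) LinearMap.id t) := by
  induction t using TensorProduct.induction_on with
  | zero => simp
  | add x y hx hy => rw [map_add, mul_add, hx, hy, map_add, map_add]
  | tmul x y =>
    induction x using DirectSum.Decomposition.inductionOn 𝒜 with
    | zero => simp
    | add x x' hx hx' =>
      rw [TensorProduct.add_tmul, map_add, mul_add, hx, hx', map_add, map_add]
    | @homogeneous i x =>
      rw [GradedTensorProduct.tmul_one_mul_coe_tmul]; rfl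

theorem uzpow_smul_eq {M : Type*} [AddCommGroup M] [Module K M] (n : ℤ) (x : M) :
    ((-1 : ℤˣ) ^ n) • x = ((n.negOnePow : ℤ) : K) • x := by
  rw [Units.smul_def, ← Int.cast_smul_eq_zsmul K]
  rfl

/-- The product `(1 ⊗ b) (x ⊗ y)` of homogeneous elements in the graded tensor square. -/
theorem one_tmul_mul_tmul {i j : ℤ} {b x : A} (hb : b ∈ 𝒜 j) (hx : x ∈ 𝒜 i) (y : A) :
    GradedTensorProduct.tmul K 1 b * GradedTensorProduct.of K 𝒜 𝒜 (x ⊗ₜ y) =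
      (((j * i).negOnePow : ℤ) : K) • GradedTensorProduct.of K 𝒜 𝒜 (x ⊗ₜ (b * y)) := by
  have := GradedTensorProduct.tmul_coe_mul_coe_tmul (R := K) 𝒜 𝒜 1 (⟨b, hb⟩ : 𝒜 j)
    (⟨x, hx⟩ : 𝒜 i) y
  refine this.trans ?_
  rw [one_mul, uzpow_smul_eq (K := K)]

theorem comm_tmul_one (x : A) : GradedTensorProduct.comm 𝒜 𝒜 (GradedTensorProduct.tmul K x 1) =
    GradedTensorProduct.tmul K 1 x := by
  induction x using DirectSum.Decomposition.inductionOn 𝒜 with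
  | zero => simp [GradedTensorProduct.tmul]
  | add x y hx hy =>
    simp only [GradedTensorProduct.tmul, TensorProduct.add_tmul, TensorProduct.tmul_add,
      map_add] at hx hy ⊢
    rw [hx, hy]
  | @homogeneous i x =>
    have := GradedTensorProduct.comm_coe_tmul_coe (R := K) 𝒜 𝒜 x
      (⟨1, SetLike.GradedOne.one_mem⟩ : 𝒜 0)
    refine this.trans ?_
    simp

theorem comm_comm (t : GradedTensorProduct K 𝒜 𝒜) : GradedTensorProduct.comm 𝒜 𝒜
    (GradedTensorProduct.comm 𝒜 𝒜 t) = t := by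
  have : (GradedTensorProduct.comm 𝒜 𝒜) = (GradedTensorProduct.comm (R := K) 𝒜 𝒜).symm := rfl
  conv_lhs => enter [1]; rw [this]
  simp

variable {B : Type*} [Ring B] [Algebra K B] (ℬ : ℤ → Submodule K B) [GradedAlgebra ℬ]

/-- The morphism of graded tensor squares induced by a morphism of graded algebras. -/
def gradedSquareMap (f : A →ₐ[K] B) (hf : ∀ n, ∀ x ∈ 𝒜 n, f x ∈ ℬ n) :
    GradedTensorProduct K 𝒜 𝒜 →ₐ[K] GradedTensorProduct K ℬ ℬ :=
  GradedTensorProduct.lift 𝒜 𝒜 ((GradedTensorProduct.includeLeft ℬ ℬ).comp f)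
    ((GradedTensorProduct.includeRight ℬ ℬ).comp f) (by
      intro i j a b
      have h1 : GradedTensorProduct.tmul K (f a) 1 * GradedTensorProduct.tmul K 1 (f b) =
        (GradedTensorProduct.tmul K (f a) (f b) : GradedTensorProduct K ℬ ℬ) := by
        have := tmul_one_mul ℬ (f a) (1 ⊗ₜ (f b))
        simpa using this
      have h2 := one_tmul_mul_tmul ℬ (hf j b b.2) (hf i a a.2) 1
      change GradedTensorProduct.tmul K (f a) 1 * GradedTensorProduct.tmul K 1 (f b) =
        _ • (GradedTensorProduct.tmul K 1 (f b) * GradedTensorProduct.tmul K (f a) 1)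
      rw [h1, h2, uzpow_smul_eq (K := K), smul_smul, ← Int.cast_mul, ← Units.val_mul,
        Int.units_mul_self]
      simp)

theorem gradedSquareMap_of (f : A →ₐ[K] B) (hf : ∀ n, ∀ x ∈ 𝒜 n, f x ∈ ℬ n) (t : A ⊗[K] A) :
    gradedSquareMap 𝒜 ℬ f hf (GradedTensorProduct.of K 𝒜 𝒜 t) =
      GradedTensorProduct.of K ℬ ℬ (TensorProduct.map f.toLinearMap f.toLinearMap t) := by
  induction t using TensorProduct.induction_on with
  | zero => simp
  | add x y hx hy => simp only [map_add, hx, hy]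
  | tmul x y =>
    refine (GradedTensorProduct.lift_tmul _ _ _ _ _ _ _).trans ?_
    change GradedTensorProduct.tmul K (f x) 1 * GradedTensorProduct.tmul K 1 (f y) = _
    rw [GradedTensorProduct.tmul, tmul_one_mul]
    simp

end GradedSquare

/-! ### The co-shuffle and the co-half shuffle -/

section CoshuffleLemmas

variable {K V : Type*} [Field K] [AddCommGroup V] [Module K V] (𝒱 : ℤ → Submodule K V)
  [DirectSum.Decomposition 𝒱]

/-- The co-shuffle as a linear map to the plain tensor square. -/
def coshuffleLin : TensorAlgebra K V →ₗ[K] TensorAlgebra K V ⊗[K] TensorAlgebra K V :=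
  (GradedTensorProduct.of K (tensorAlgGrade 𝒱) (tensorAlgGrade 𝒱)).symm.toLinearMap ∘ₗ
    (coshuffle 𝒱).toLinearMap

theorem of_coshuffleLin (w : TensorAlgebra K V) :
    GradedTensorProduct.of K (tensorAlgGrade 𝒱) (tensorAlgGrade 𝒱) (coshuffleLin 𝒱 w) =
      coshuffle 𝒱 w := rfl

theorem coshuffle_ι_mul (v : V) (w : TensorAlgebra K V) :
    coshuffle 𝒱 (TensorAlgebra.ι K v * w) =
      GradedTensorProduct.tmul K (TensorAlgebra.ι K v) 1 * coshuffle 𝒱 w +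
      GradedTensorProduct.tmul K 1 (TensorAlgebra.ι K v) * coshuffle 𝒱 w := by
  rw [map_mul, ← add_mul]
  congr 1
  simp [coshuffle, coshuffleι]

theorem coHalfShuffle_ι_mul' (v : V) (w : TensorAlgebra K V) :
    coHalfShuffle 𝒱 (TensorAlgebra.ι K v * w) =
      TensorProduct.map (LinearMap.mulLeft K (TensorAlgebra.ι K v)) LinearMap.id
        (coshuffleLin 𝒱 w) := by
  apply (GradedTensorProduct.of K (tensorAlgGrade 𝒱) (tensorAlgGrade 𝒱)).injective
  rw [coHalfShuffle_ι_mul, ← tmul_one_mul, of_coshuffleLin]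

/-- The co-shuffle is counital on the left. -/
theorem counit_coshuffle (w : TensorAlgebra K V) :
    TensorProduct.map TensorAlgebra.algebraMapInv.toLinearMap LinearMap.id (coshuffleLin 𝒱 w) =
      (1 : K) ⊗ₜ[K] w := by
  -- the augmentation on the left factor is a morphism of algebras, so generators suffice
  let Λ : GradedTensorProduct K (tensorAlgGrade 𝒱) (tensorAlgGrade 𝒱) →ₐ[K] TensorAlgebra K V :=
    GradedTensorProduct.lift _ _
      ((Algebra.ofId K (TensorAlgebra K V)).comp TensorAlgebra.algebraMapInv)
      (AlgHom.id K _) (by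
        intro i j a b
        by_cases h : i = 0
        · subst h
          simp [Algebra.ofId_apply, Algebra.commutes]
        · simp [Algebra.ofId_apply, algebraMapInv_of_mem 𝒱 h a.2])
  have h1 : Λ.comp (coshuffle 𝒱) = AlgHom.id K _ := by
    refine TensorAlgebra.hom_ext (LinearMap.ext fun v => ?_)
    have e : coshuffle 𝒱 (TensorAlgebra.ι K v) = GradedTensorProduct.tmul K (TensorAlgebra.ι K v) 1
        + GradedTensorProduct.tmul K 1 (TensorAlgebra.ι K v) := by
      simp [coshuffle, coshuffleι]
    simp [e, Λ, Algebra.ofId_apply]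
  have h2 : ∀ t : TensorAlgebra K V ⊗[K] TensorAlgebra K V,
      TensorProduct.map TensorAlgebra.algebraMapInv.toLinearMap LinearMap.id t =
      (1 : K) ⊗ₜ[K] Λ (GradedTensorProduct.of K _ _ t) := by
    intro t
    induction t using TensorProduct.induction_on with
    | zero => simp
    | add x y hx hy => simp only [map_add, hx, hy, TensorProduct.tmul_add]
    | tmul x y =>
      have : Λ (GradedTensorProduct.of K _ _ (x ⊗ₜ y)) =
          algebraMap K _ (TensorAlgebra.algebraMapInv x) * y :=
        GradedTensorProduct.lift_tmul _ _ _ _ _ _ _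
      rw [this, ← Algebra.smul_def, TensorProduct.tmul_smul, TensorProduct.smul_tmul']
      simp
  rw [h2, of_coshuffleLin]
  congr 1
  exact DFunLike.congr_fun h1 w

theorem wordProj_coshuffle_aux (v : V) (t : TensorAlgebra K V ⊗[K] TensorAlgebra K V) :
    LinearMap.mul' K _ (TensorProduct.map wordProj LinearMap.id
      (TensorProduct.map (LinearMap.mulLeft K (TensorAlgebra.ι K v)) LinearMap.id t)) =
    TensorAlgebra.ι K v * TensorProduct.lid K _ (TensorProduct.map
      TensorAlgebra.algebraMapInv.toLinearMap LinearMap.id t) := by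
  induction t using TensorProduct.induction_on with
  | zero => simp
  | add x y hx hy => simp only [map_add, hx, hy, mul_add]
  | tmul x y => simp [wordProj_ι_mul]

/-- The projection `wordProj` onto the words of length one, applied to the left factor of the
co-half shuffle, splits off the first letter of a word, and the product puts it back. Hence every
`w` in the augmentation ideal is recovered from its co-half shuffle; in particular `w` is a word of
length one as soon as its co-half shuffle is `w ⊗ 1`. -/
theorem mul_wordProj_coHalfShuffle (w : TensorAlgebra K V) :
    LinearMap.mul' K _ (TensorProduct.map wordProj LinearMap.id (coHalfShuffle 𝒱 w)) =
      w - algebraMap K _ (TensorAlgebra.algebraMapInv w) := by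
  induction w using tensorAlgebra_induction_left with
  | one => simp [coHalfShuffle_one]
  | add a b ha hb => simp only [map_add, ha, hb]; abel
  | smul c a ha =>
    rw [map_smul, map_smul, map_smul, ha, smul_sub, map_smul, smul_eq_mul, map_mul,
      ← Algebra.smul_def]
  | ι_mul v w ih =>
    rw [coHalfShuffle_ι_mul', wordProj_coshuffle_aux, counit_coshuffle]
    simp

end CoshuffleLemmas

/-! ### The filtration of the tensor module by the length of words -/

section Words

variable {K V : Type*} [Field K] [AddCommGroup V] [Module K V] (𝒱 : ℤ → Submodule K V)

/-- The word `v₁ ⋯ vₖ` of homogeneous vectors. -/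
def word (l : List (Σ i, 𝒱 i)) : TensorAlgebra K V :=
  (l.map fun v => TensorAlgebra.ι K (v.2 : V)).prod

/-- The span of the words of length at most `n` in homogeneous vectors. -/
def wordFilt (n : ℕ) : Submodule K (TensorAlgebra K V) :=
  Submodule.span K {t | ∃ l : List (Σ i, 𝒱 i), l.length ≤ n ∧ word 𝒱 l = t}

theorem word_cons (v : Σ i, 𝒱 i) (l : List (Σ i, 𝒱 i)) :
    word 𝒱 (v :: l) = TensorAlgebra.ι K (v.2 : V) * word 𝒱 l := by simp [word]

theorem word_mem_wordFilt {l : List (Σ i, 𝒱 i)} {n : ℕ} (h : l.length ≤ n) :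
    word 𝒱 l ∈ wordFilt 𝒱 n := Submodule.subset_span ⟨l, h, rfl⟩

theorem wordFilt_mono {m n : ℕ} (h : m ≤ n) : wordFilt 𝒱 m ≤ wordFilt 𝒱 n :=
  Submodule.span_mono fun _ ⟨l, hl, e⟩ => ⟨l, hl.trans h, e⟩

theorem word_mem_tensorAlgGrade (l : List (Σ i, 𝒱 i)) :
    word 𝒱 l ∈ tensorAlgGrade 𝒱 (l.map Sigma.fst).sum := Submodule.subset_span ⟨l, rfl, rfl⟩

theorem tmul_mem_range_map {M : Type*} [AddCommGroup M] [Module K M] {S : Submodule K M} {x y : M}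
    (hx : x ∈ S) (hy : y ∈ S) :
    x ⊗ₜ[K] y ∈ LinearMap.range (TensorProduct.map S.subtype S.subtype) :=
  ⟨⟨x, hx⟩ ⊗ₜ ⟨y, hy⟩, rfl⟩

variable [DirectSum.Decomposition 𝒱]

theorem exists_mem_wordFilt (w : TensorAlgebra K V) : ∃ n, w ∈ wordFilt 𝒱 n := by
  induction w using tensorAlgebra_induction_left with
  | one => exact ⟨0, word_mem_wordFilt 𝒱 (l := []) le_rfl⟩
  | add a b ha hb =>
    obtain ⟨m, hm⟩ := ha
    obtain ⟨n, hn⟩ := hb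
    exact ⟨max m n, Submodule.add_mem _ (wordFilt_mono 𝒱 (le_max_left _ _) hm)
      (wordFilt_mono 𝒱 (le_max_right _ _) hn)⟩
  | smul c a ha => obtain ⟨m, hm⟩ := ha; exact ⟨m, Submodule.smul_mem _ _ hm⟩
  | ι_mul v w hw =>
    obtain ⟨n, hn⟩ := hw
    refine ⟨n + 1, ?_⟩
    induction hn using Submodule.span_induction with
    | zero => simp
    | add a b _ _ ha hb => rw [mul_add]; exact Submodule.add_mem _ ha hb
    | smul c a _ ha => rw [mul_smul_comm]; exact Submodule.smul_mem _ _ ha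
    | mem x hx =>
      obtain ⟨l, hl, rfl⟩ := hx
      induction v using DirectSum.Decomposition.inductionOn 𝒱 with
      | zero => simp
      | add v v' hv hv' => rw [map_add, add_mul]; exact Submodule.add_mem _ hv hv'
      | @homogeneous i v =>
        rw [← word_cons 𝒱 ⟨i, v⟩]
        exact word_mem_wordFilt 𝒱 (by simpa using hl)

/-- The co-shuffle of a word `w` is `w ⊗ 1` up to tensors whose left factors are shorter. -/
theorem coshuffle_word_sub (l : List (Σ i, 𝒱 i)) :
    coshuffleLin 𝒱 (word 𝒱 l) - word 𝒱 l ⊗ₜ[K] 1 ∈ Submodule.span K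
      {t | ∃ l₁ l₂ : List (Σ i, 𝒱 i), l₁.length < l.length ∧ l₂.length ≤ l.length ∧
        t = word 𝒱 l₁ ⊗ₜ[K] word 𝒱 l₂} := by
  induction l with
  | nil =>
    have : coshuffleLin 𝒱 (word 𝒱 []) - word 𝒱 [] ⊗ₜ[K] 1 = 0 := by
      rw [sub_eq_zero]
      change _ = (1 : TensorAlgebra K V) ⊗ₜ[K] 1
      simp only [word, List.map_nil, List.prod_nil, coshuffleLin, LinearMap.comp_apply,
        AlgHom.toLinearMap_apply, map_one]
      rfl
    rw [this]; exact Submodule.zero_mem _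
  | cons v l ih =>
    -- the letter `v` goes to the left or to the right factor; `hR` treats the right one
    have hR : ∀ l₁ l₂ : List (Σ i, 𝒱 i),
        (GradedTensorProduct.of K (tensorAlgGrade 𝒱) (tensorAlgGrade 𝒱)).symm
          (GradedTensorProduct.tmul K 1 (TensorAlgebra.ι K (v.2 : V)) *
          GradedTensorProduct.of K (tensorAlgGrade 𝒱) (tensorAlgGrade 𝒱)
            (word 𝒱 l₁ ⊗ₜ word 𝒱 l₂)) ∈ Submodule.span K {word 𝒱 l₁ ⊗ₜ[K] word 𝒱 (v :: l₂)} := by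
      intro l₁ l₂
      rw [one_tmul_mul_tmul _ (ι_mem_tensorAlgGrade 𝒱 v.2.2) (word_mem_tensorAlgGrade 𝒱 l₁),
        map_smul, ← word_cons]
      exact Submodule.smul_mem _ _ (Submodule.mem_span_singleton_self _)
    generalize hu : coshuffleLin 𝒱 (word 𝒱 l) - word 𝒱 l ⊗ₜ[K] 1 = u at ih
    have hu' : coshuffleLin 𝒱 (word 𝒱 l) = u + word 𝒱 l ⊗ₜ[K] 1 := by rw [← hu]; abel
    have e : coshuffleLin 𝒱 (word 𝒱 (v :: l)) - word 𝒱 (v :: l) ⊗ₜ[K] 1 =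
        TensorProduct.map (LinearMap.mulLeft K (TensorAlgebra.ι K (v.2 : V))) LinearMap.id u +
        ((GradedTensorProduct.of K (tensorAlgGrade 𝒱) (tensorAlgGrade 𝒱)).symm
          (GradedTensorProduct.tmul K 1 (TensorAlgebra.ι K (v.2 : V)) *
          GradedTensorProduct.of K (tensorAlgGrade 𝒱) (tensorAlgGrade 𝒱) u) +
        (GradedTensorProduct.of K (tensorAlgGrade 𝒱) (tensorAlgGrade 𝒱)).symm
          (GradedTensorProduct.tmul K 1 (TensorAlgebra.ι K (v.2 : V)) *
          GradedTensorProduct.of K (tensorAlgGrade 𝒱) (tensorAlgGrade 𝒱)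
            (word 𝒱 l ⊗ₜ word 𝒱 []))) := by
      have e1 : coshuffleLin 𝒱 (word 𝒱 (v :: l)) =
          (GradedTensorProduct.of K (tensorAlgGrade 𝒱) (tensorAlgGrade 𝒱)).symm
            (coshuffle 𝒱 (word 𝒱 (v :: l))) := rfl
      rw [e1, word_cons, coshuffle_ι_mul, ← of_coshuffleLin, hu', tmul_one_mul]
      simp only [map_add, mul_add, GradedTensorProduct.of_symm_of, TensorProduct.map_tmul,
        LinearMap.mulLeft_apply, LinearMap.id_apply, word, List.map_nil, List.prod_nil]
      abel
    rw [e]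
    refine Submodule.add_mem _ ?_ (Submodule.add_mem _ ?_ ?_)
    · clear hu hu' e
      induction ih using Submodule.span_induction with
      | zero => simp
      | add a b _ _ ha hb => rw [map_add]; exact Submodule.add_mem _ ha hb
      | smul c a _ ha => rw [map_smul]; exact Submodule.smul_mem _ _ ha
      | mem x hx =>
        obtain ⟨l₁, l₂, h1, h2, rfl⟩ := hx
        refine Submodule.subset_span ⟨v :: l₁, l₂, by simpa using h1, by simp; omega, ?_⟩
        simp [word_cons]
    · clear hu hu' e
      induction ih using Submodule.span_induction with
      | zero => simp
      | add a b _ _ ha hb => rw [map_add, mul_add, map_add]; exact Submodule.add_mem _ ha hb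
      | smul c a _ ha => rw [map_smul, mul_smul_comm, map_smul]; exact Submodule.smul_mem _ _ ha
      | mem x hx =>
        obtain ⟨l₁, l₂, h1, h2, rfl⟩ := hx
        refine Submodule.span_mono ?_ (hR l₁ l₂)
        rintro _ rfl
        exact ⟨l₁, v :: l₂, by simp; omega, by simpa using h2, rfl⟩
    · refine Submodule.span_mono ?_ (hR l [])
      rintro _ rfl
      exact ⟨l, [v], by simp, by simp, rfl⟩

/-- The reduced co-half shuffle lowers the length of words. -/
theorem coHalfShuffle_sub_mem {n : ℕ} {w : TensorAlgebra K V} (hw : w ∈ wordFilt 𝒱 (n + 1)) :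
    coHalfShuffle 𝒱 w - w ⊗ₜ[K] 1 ∈
      LinearMap.range (TensorProduct.map (wordFilt 𝒱 n).subtype (wordFilt 𝒱 n).subtype) := by
  induction hw using Submodule.span_induction with
  | zero => simp
  | add a b _ _ ha hb =>
    rw [map_add, TensorProduct.add_tmul, add_sub_add_comm]; exact Submodule.add_mem _ ha hb
  | smul c a _ ha =>
    have e : coHalfShuffle 𝒱 (c • a) - (c • a) ⊗ₜ[K] (1 : TensorAlgebra K V) =
        c • (coHalfShuffle 𝒱 a - a ⊗ₜ[K] 1) := by
      rw [map_smul, smul_sub, TensorProduct.smul_tmul']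
    rw [e]; exact Submodule.smul_mem _ _ ha
  | mem x hx =>
    obtain ⟨l, hl, rfl⟩ := hx
    cases l with
    | nil =>
      have : word 𝒱 [] = 1 := rfl
      rw [this, coHalfShuffle_one, zero_sub]
      have h1 : (1 : TensorAlgebra K V) ∈ wordFilt 𝒱 n :=
        word_mem_wordFilt 𝒱 (l := []) (Nat.zero_le _)
      exact Submodule.neg_mem _ (tmul_mem_range_map h1 h1)
    | cons v l =>
      have hl' : l.length ≤ n := by simpa using hl
      have ih := coshuffle_word_sub 𝒱 l
      generalize hu : coshuffleLin 𝒱 (word 𝒱 l) - word 𝒱 l ⊗ₜ[K] 1 = u at ih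
      have hu' : coshuffleLin 𝒱 (word 𝒱 l) = u + word 𝒱 l ⊗ₜ[K] 1 := by rw [← hu]; abel
      have e : coHalfShuffle 𝒱 (word 𝒱 (v :: l)) - word 𝒱 (v :: l) ⊗ₜ[K] 1 =
          TensorProduct.map (LinearMap.mulLeft K (TensorAlgebra.ι K (v.2 : V))) LinearMap.id u := by
        rw [word_cons, coHalfShuffle_ι_mul', hu', map_add]
        simp
      rw [e]
      clear hu hu' e
      induction ih using Submodule.span_induction with
      | zero => simp
      | add a b _ _ ha hb => rw [map_add]; exact Submodule.add_mem _ ha hb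
      | smul c a _ ha => rw [map_smul]; exact Submodule.smul_mem _ _ ha
      | mem x hx =>
        obtain ⟨l₁, l₂, h1, h2, rfl⟩ := hx
        rw [TensorProduct.map_tmul, LinearMap.mulLeft_apply, LinearMap.id_apply, ← word_cons]
        exact tmul_mem_range_map (word_mem_wordFilt 𝒱 (by simp; omega))
          (word_mem_wordFilt 𝒱 (by omega))

end Words

/-! ### The extension of a map into the primitive part -/

section Extension

variable {K H V : Type*} [Field K] [Ring H] [Algebra K H] {𝒜 : ℤ → Submodule K H}
  [GradedAlgebra 𝒜] [AddCommGroup V] [Module K V] {𝒱 : ℤ → Submodule K V}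

theorem DGZinbAs.full_one (B : DGZinbAs K 𝒜) : B.full 1 = 1 ⊗ₜ[K] 1 := by
  simp [B.full_apply, B.coprod_one]

theorem of_braid (t : H ⊗[K] H) : GradedTensorProduct.of K 𝒜 𝒜 (braid K 𝒜 t) =
    GradedTensorProduct.comm 𝒜 𝒜 (GradedTensorProduct.of K 𝒜 𝒜 t) := rfl

/-- The cooperation `Δ = Δ_≺ + τ Δ_≺` is cocommutative. -/
theorem DGZinbAs.comm_full (B : DGZinbAs K 𝒜) (x : H) :
    GradedTensorProduct.comm 𝒜 𝒜 (GradedTensorProduct.of K 𝒜 𝒜 (B.full x)) =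
      GradedTensorProduct.of K 𝒜 𝒜 (B.full x) := by
  simp only [B.full_apply, map_add, of_braid, comm_comm, map_smul]
  have : GradedTensorProduct.comm 𝒜 𝒜 (GradedTensorProduct.of K 𝒜 𝒜 ((1 : H) ⊗ₜ[K] (1 : H))) =
    GradedTensorProduct.of K 𝒜 𝒜 ((1 : H) ⊗ₜ[K] (1 : H)) := comm_tmul_one 𝒜 1
  rw [this]
  abel

theorem DGZinbAs.coprod_prim_mul (B : DGZinbAs K 𝒜) {x : H} (hx : x ∈ B.prim) (y : H) :
    GradedTensorProduct.of K 𝒜 𝒜 (B.coprod (x * y)) =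
      GradedTensorProduct.tmul K x 1 * GradedTensorProduct.of K 𝒜 𝒜 (B.full y) := by
  rw [B.compat x y hx.1, (B.mem_prim.1 hx).2]

theorem DGZinbAs.full_prim_mul (B : DGZinbAs K 𝒜) {x : H} (hx : x ∈ B.prim) (y : H) :
    GradedTensorProduct.of K 𝒜 𝒜 (B.full (x * y)) =
      GradedTensorProduct.tmul K x 1 * GradedTensorProduct.of K 𝒜 𝒜 (B.full y) +
      GradedTensorProduct.tmul K 1 x * GradedTensorProduct.of K 𝒜 𝒜 (B.full y) := by
  rw [B.full_apply, map_add, map_add, of_braid, B.coprod_prim_mul hx, map_mul, B.comm_full,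
    comm_tmul_one, map_mul, (B.mem_prim.1 hx).1, zero_mul, zero_smul, map_zero, add_zero]

/-- The extension of a graded linear map to the tensor module is graded. -/
theorem lift_mem_grade {i : V →ₗ[K] H} (hi : ∀ n, ∀ v ∈ 𝒱 n, i v ∈ 𝒜 n) (n : ℤ)
    (w : TensorAlgebra K V) (hw : w ∈ tensorAlgGrade 𝒱 n) : TensorAlgebra.lift K i w ∈ 𝒜 n := by
  induction hw using Submodule.span_induction with
  | zero => simp
  | add a b _ _ ha hb => rw [map_add]; exact Submodule.add_mem _ ha hb
  | smul c a _ ha => rw [map_smul]; exact Submodule.smul_mem _ _ ha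
  | mem x hx =>
    obtain ⟨l, rfl, rfl⟩ := hx
    rw [map_list_prod, List.map_map]
    exact SetLike.list_prod_map_mem_graded l _ _ fun v _ => by
      simpa using hi _ _ v.2.2

theorem counit_lift (B : DGZinbAs K 𝒜) {i : V →ₗ[K] H} (hprim : ∀ v, i v ∈ B.prim)
    (w : TensorAlgebra K V) :
    B.counit (TensorAlgebra.lift K i w) = TensorAlgebra.algebraMapInv w := by
  have : B.counit.comp (TensorAlgebra.lift K i) = TensorAlgebra.algebraMapInv :=
    TensorAlgebra.hom_ext (LinearMap.ext fun v => by simpa using (B.mem_prim.1 (hprim v)).1)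
  exact DFunLike.congr_fun this w

variable [DirectSum.Decomposition 𝒱]

/-- The extension to the tensor module is compatible with `Δ = Δ_≺ + τ Δ_≺`. -/
theorem full_lift (B : DGZinbAs K 𝒜) {i : V →ₗ[K] H} (hi : ∀ n, ∀ v ∈ 𝒱 n, i v ∈ 𝒜 n)
    (hprim : ∀ v, i v ∈ B.prim) (w : TensorAlgebra K V) :
    B.full (TensorAlgebra.lift K i w) = TensorProduct.map (TensorAlgebra.lift K i).toLinearMap
      (TensorAlgebra.lift K i).toLinearMap (coshuffleLin 𝒱 w) := by
  apply (GradedTensorProduct.of K 𝒜 𝒜).injective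
  rw [← gradedSquareMap_of (tensorAlgGrade 𝒱) 𝒜 (TensorAlgebra.lift K i) (lift_mem_grade hi),
    of_coshuffleLin]
  induction w using tensorAlgebra_induction_left with
  | one => rw [map_one, B.full_one, map_one, map_one]; rfl
  | add a b ha hb => simp only [map_add, ha, hb]
  | smul c a ha => simp only [map_smul, ha]
  | ι_mul v w ih =>
    rw [map_mul, TensorAlgebra.lift_ι_apply, B.full_prim_mul (hprim v), ih, coshuffle_ι_mul,
      map_add, map_mul, map_mul]
    simp only [GradedTensorProduct.tmul, gradedSquareMap_of]
    simp

/-- A graded linear map from `V` to the primitive part extends to a morphism of coalgebras from the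
tensor module. -/
theorem coprod_lift (B : DGZinbAs K 𝒜) {i : V →ₗ[K] H} (hi : ∀ n, ∀ v ∈ 𝒱 n, i v ∈ 𝒜 n)
    (hprim : ∀ v, i v ∈ B.prim) (w : TensorAlgebra K V) :
    B.coprod (TensorAlgebra.lift K i w) = TensorProduct.map (TensorAlgebra.lift K i).toLinearMap
      (TensorAlgebra.lift K i).toLinearMap (coHalfShuffle 𝒱 w) := by
  apply (GradedTensorProduct.of K 𝒜 𝒜).injective
  induction w using tensorAlgebra_induction_left with
  | one => rw [map_one, B.coprod_one, coHalfShuffle_one, map_zero, map_zero, map_zero]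
  | add a b ha hb => simp only [map_add, ha, hb]
  | smul c a ha => simp only [map_smul, ha]
  | ι_mul v w ih =>
    rw [map_mul, TensorAlgebra.lift_ι_apply, B.coprod_prim_mul (hprim v), full_lift B hi hprim,
      tmul_one_mul, coHalfShuffle_ι_mul']
    congr 1
    rw [TensorProduct.map_map, TensorProduct.map_map]
    congr 2
    ext x
    simp

/-- The extension to the tensor module of an injective graded map into the primitive part is
injective: the reduced co-half shuffle lowers the length of words, and the elements on which it
vanishes are linear. -/
theorem lift_injective (B : DGZinbAs K 𝒜) {i : V →ₗ[K] H} (hi : ∀ n, ∀ v ∈ 𝒱 n, i v ∈ 𝒜 n)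
    (hprim : ∀ v, i v ∈ B.prim) (hinj : Function.Injective i) :
    Function.Injective (TensorAlgebra.lift K i) := by
  have key : ∀ n, ∀ w ∈ wordFilt 𝒱 n, TensorAlgebra.lift K i w = 0 → w = 0 := by
    intro n
    induction n with
    | zero =>
      intro w hw h
      have : w ∈ Submodule.span K {(1 : TensorAlgebra K V)} := by
        refine Submodule.span_mono ?_ hw
        rintro _ ⟨l, hl, rfl⟩
        obtain rfl : l = [] := List.length_eq_zero_iff.1 (by omega)
        rfl
      obtain ⟨c, rfl⟩ := Submodule.mem_span_singleton.1 this
      have h' := counit_lift B hprim (c • 1)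
      rw [h, map_zero, map_smul, map_one] at h'
      simp at h'
      simp [← h']
    | succ n ih =>
      intro w hw h
      -- the reduced co-half shuffle of `w` is `t`, with factors of smaller length; it is mapped to
      -- zero, so it vanishes by induction, and `w` is a word of length one
      obtain ⟨t, ht⟩ := coHalfShuffle_sub_mem 𝒱 hw
      have h1 := coprod_lift B hi hprim w
      rw [h, map_zero, eq_comm] at h1
      have h2 : coHalfShuffle 𝒱 w = TensorProduct.map (wordFilt 𝒱 n).subtype
          (wordFilt 𝒱 n).subtype t + w ⊗ₜ[K] 1 := by rw [ht]; abel
      rw [h2, map_add, TensorProduct.map_tmul, AlgHom.toLinearMap_apply, h,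
        TensorProduct.zero_tmul, add_zero, TensorProduct.map_map] at h1
      have hinj' : Function.Injective
          ((TensorAlgebra.lift K i).toLinearMap ∘ₗ (wordFilt 𝒱 n).subtype) := by
        rw [injective_iff_map_eq_zero]
        intro x hx
        exact Subtype.ext (ih x x.2 hx)
      have ht0 : t = 0 := (injective_iff_map_eq_zero _).1
        (TensorProduct.map_injective_of_flat_flat _ _ hinj' hinj') t h1
      rw [ht0, map_zero, zero_add] at h2
      have h3 := mul_wordProj_coHalfShuffle 𝒱 w
      have hc := counit_lift B hprim w
      rw [h, map_zero] at hc
      rw [h2, ← hc, TensorProduct.map_tmul, LinearMap.id_apply, LinearMap.mul'_apply, mul_one,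
        map_zero, sub_zero] at h3
      rw [← h3] at h ⊢
      rw [wordProj, LinearMap.comp_apply, TensorAlgebra.lift_ι_apply] at h
      rw [wordProj, LinearMap.comp_apply, hinj (h.trans (map_zero i).symm), map_zero]
  rw [injective_iff_map_eq_zero]
  intro w hw
  obtain ⟨n, hn⟩ := exists_mem_wordFilt 𝒱 w
  exact key n w hn hw

end Extension

/-! ### Connected bialgebras are generated by their primitive part -/

section Surjectivity

variable {K H V : Type*} [Field K] [Ring H] [Algebra K H] {𝒜 : ℤ → Submodule K H}
  [GradedAlgebra 𝒜] [AddCommGroup V] [Module K V] {𝒱 : ℤ → Submodule K V}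

theorem DGZinbAs.one_mem_filt (B : DGZinbAs K 𝒜) (r : ℕ) : (1 : H) ∈ B.filt r := by
  induction r with
  | zero => exact Submodule.mem_span_singleton_self _
  | succ r ih =>
    change B.coprod 1 - 1 ⊗ₜ[K] 1 ∈
      LinearMap.range (TensorProduct.map (B.filt r).subtype (B.filt r).subtype)
    rw [B.coprod_one, zero_sub]
    exact Submodule.neg_mem _ (tmul_mem_range_map ih ih)

theorem range_map_le_range_map {M N : Type*} [AddCommGroup M] [Module K M] [AddCommGroup N]
    [Module K N] {S : Submodule K M} {f : N →ₗ[K] M} (h : S ≤ LinearMap.range f) :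
    LinearMap.range (TensorProduct.map S.subtype S.subtype) ≤
      LinearMap.range (TensorProduct.map f f) := by
  rintro _ ⟨t, rfl⟩
  induction t using TensorProduct.induction_on with
  | zero => simp
  | add a b ha hb => rw [map_add]; exact Submodule.add_mem _ ha hb
  | tmul x y =>
    obtain ⟨a, ha⟩ := h x.2
    obtain ⟨b, hb⟩ := h y.2
    exact ⟨a ⊗ₜ b, by simp [ha, hb]⟩

variable [DirectSum.Decomposition 𝒱]

/-- In the tensor module, a tensor satisfying the cocycle condition imposed by the Zinbiel relation
is a reduced co-half shuffle. -/
theorem coHalfShuffle_of_cocycle {t : TensorAlgebra K V ⊗[K] TensorAlgebra K V}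
    (h0 : TensorProduct.map TensorAlgebra.algebraMapInv.toLinearMap LinearMap.id t =
      (0 : K ⊗[K] TensorAlgebra K V))
    (h : TensorProduct.assoc K _ _ _ (t ⊗ₜ[K] (1 : TensorAlgebra K V)) +
      TensorProduct.assoc K _ _ _ (TensorProduct.map (coHalfShuffle 𝒱) LinearMap.id t) =
      TensorProduct.map LinearMap.id (coshuffleLin 𝒱) t) :
    coHalfShuffle 𝒱 (LinearMap.mul' K _ (TensorProduct.map wordProj LinearMap.id t)) =
      LinearMap.mul' K _ (TensorProduct.map wordProj LinearMap.id t) ⊗ₜ[K] 1 + t := by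
  -- project the first of three factors to the words of length one and multiply it with the second
  let Θ : TensorAlgebra K V ⊗[K] (TensorAlgebra K V ⊗[K] TensorAlgebra K V) →ₗ[K]
      TensorAlgebra K V ⊗[K] TensorAlgebra K V :=
    TensorProduct.map (LinearMap.mul' K _ ∘ₗ TensorProduct.map wordProj LinearMap.id)
      LinearMap.id ∘ₗ (TensorProduct.assoc K _ _ _).symm.toLinearMap
  have hΘ := congrArg Θ h
  rw [map_add] at hΘ
  have e1 : Θ (TensorProduct.assoc K _ _ _ (t ⊗ₜ[K] (1 : TensorAlgebra K V))) =
      LinearMap.mul' K _ (TensorProduct.map wordProj LinearMap.id t) ⊗ₜ[K] 1 := by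
    simp [Θ]
  have e2 : ∀ t : TensorAlgebra K V ⊗[K] TensorAlgebra K V,
      Θ (TensorProduct.assoc K _ _ _ (TensorProduct.map (coHalfShuffle 𝒱) LinearMap.id t)) =
      t - TensorProduct.map (Algebra.linearMap K (TensorAlgebra K V)) LinearMap.id
        (TensorProduct.map TensorAlgebra.algebraMapInv.toLinearMap LinearMap.id t) := by
    intro t
    induction t using TensorProduct.induction_on with
    | zero => simp
    | add a b ha hb => simp only [map_add, ha, hb]; abel
    | tmul a b => simp [Θ, mul_wordProj_coHalfShuffle, TensorProduct.sub_tmul]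
  have e3 : ∀ t : TensorAlgebra K V ⊗[K] TensorAlgebra K V,
      Θ (TensorProduct.map LinearMap.id (coshuffleLin 𝒱) t) =
      coHalfShuffle 𝒱 (LinearMap.mul' K _ (TensorProduct.map wordProj LinearMap.id t)) := by
    intro t
    induction t using TensorProduct.induction_on with
    | zero => simp
    | add a b ha hb => simp only [map_add, ha, hb]
    | tmul a b =>
      have : ∀ u : TensorAlgebra K V ⊗[K] TensorAlgebra K V, Θ (a ⊗ₜ[K] u) =
          TensorProduct.map (LinearMap.mulLeft K (wordProj a)) LinearMap.id u := by
        intro u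
        induction u using TensorProduct.induction_on with
        | zero => simp
        | add a b ha hb => simp only [TensorProduct.tmul_add, map_add, ha, hb]
        | tmul a b => simp [Θ]
      rw [TensorProduct.map_tmul, LinearMap.id_apply, this, TensorProduct.map_tmul,
        LinearMap.mul'_apply]
      exact (coHalfShuffle_ι_mul' 𝒱 (TensorAlgebra.ιInv a) b).symm
  rw [e1, e2, e3, h0, map_zero, sub_zero] at hΘ
  exact hΘ.symm

theorem map_map_assoc_tmul {M N : Type*} [AddCommGroup M] [Module K M] [AddCommGroup N]
    [Module K N] (f : M →ₗ[K] N) (u : M ⊗[K] M) (b : M) :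
    TensorProduct.assoc K _ _ _ (TensorProduct.map f f u ⊗ₜ[K] f b) =
      TensorProduct.map f (TensorProduct.map f f) (TensorProduct.assoc K _ _ _ (u ⊗ₜ[K] b)) := by
  induction u using TensorProduct.induction_on with
  | zero => simp
  | add x y hx hy => simp only [TensorProduct.add_tmul, map_add, hx, hy]
  | tmul x y => simp

/-- A connected bialgebra is generated by its primitive part. By induction on the filtration, the
reduced cooperation of `x` comes from a tensor `t` over `T(V)`. By the Zinbiel relation for `x` and
the injectivity of `T(V) → H` this tensor satisfies the cocycle condition of
`coHalfShuffle_of_cocycle`, so it is the reduced co-half shuffle of some `y`, and the difference of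
`x` and the image of `y` is primitive. -/
theorem lift_surjective (B : DGZinbAs K 𝒜) (hB : B.Connected) {i : V →ₗ[K] H}
    (hi : ∀ n, ∀ v ∈ 𝒱 n, i v ∈ 𝒜 n) (hprim : ∀ v, i v ∈ B.prim) (hinj : Function.Injective i)
    (hsurj : ∀ x ∈ B.prim, ∃ v, i v = x) :
    Function.Surjective (TensorAlgebra.lift K i) := by
  have hI := lift_injective B hi hprim hinj
  let I : TensorAlgebra K V →ₗ[K] H := (TensorAlgebra.lift K i).toLinearMap
  have hI' : Function.Injective I := hI
  have hIa : ∀ w, TensorAlgebra.lift K i w = I w := fun _ => rfl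
  have key : ∀ r, B.filt r ≤ LinearMap.range I := by
    intro r
    induction r with
    | zero =>
      refine Submodule.span_le.2 ?_
      rintro _ rfl
      exact ⟨1, map_one (TensorAlgebra.lift K i)⟩
    | succ r ih =>
      -- it suffices to treat the elements of the augmentation ideal
      suffices h : ∀ x ∈ B.filt (r + 1), B.counit x = 0 → x ∈ LinearMap.range I by
        intro x hx
        have h1 := h (x - B.counit x • 1)
          (Submodule.sub_mem _ hx (Submodule.smul_mem _ _ (B.one_mem_filt _))) (by simp)
        have h2 : B.counit x • (1 : H) ∈ LinearMap.range I :=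
          Submodule.smul_mem _ _ ⟨1, map_one (TensorAlgebra.lift K i)⟩
        simpa using Submodule.add_mem _ h1 h2
      intro x hx hε
      obtain ⟨t, ht⟩ := range_map_le_range_map ih (show B.coprod x - x ⊗ₜ[K] 1 ∈ _ from hx)
      have hc : B.coprod x = x ⊗ₜ[K] 1 + TensorProduct.map I I t := by rw [ht]; abel
      have h0 : TensorProduct.map TensorAlgebra.algebraMapInv.toLinearMap LinearMap.id t =
          (0 : K ⊗[K] TensorAlgebra K V) := by
        have h1 := B.counit_left x
        rw [hc, map_add, TensorProduct.map_tmul, AlgHom.toLinearMap_apply, hε,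
          TensorProduct.zero_tmul, zero_add] at h1
        have h2 : ∀ t, TensorProduct.map B.counit.toLinearMap LinearMap.id
            (TensorProduct.map I I t) = TensorProduct.map LinearMap.id I
            (TensorProduct.map TensorAlgebra.algebraMapInv.toLinearMap LinearMap.id t) := by
          intro t
          induction t using TensorProduct.induction_on with
          | zero => simp
          | add a b ha hb => simp only [map_add, ha, hb]
          | tmul a b => simp [← counit_lift B hprim, hIa]
        rw [h2] at h1
        exact (injective_iff_map_eq_zero _).1
          (TensorProduct.map_injective_of_flat_flat _ _ Function.injective_id hI') _ h1
      -- the Zinbiel relation for `x`, without its terms in `x ⊗ 1 ⊗ 1`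
      have hz : TensorProduct.assoc K _ _ _ (t ⊗ₜ[K] (1 : TensorAlgebra K V)) +
          TensorProduct.assoc K _ _ _ (TensorProduct.map (coHalfShuffle 𝒱) LinearMap.id t) =
          TensorProduct.map LinearMap.id (coshuffleLin 𝒱) t := by
        apply TensorProduct.map_injective_of_flat_flat I (TensorProduct.map I I) hI'
          (TensorProduct.map_injective_of_flat_flat I I hI' hI')
        have h1 := B.zinbiel x
        rw [hc, map_add, map_add, map_add, TensorProduct.map_tmul, TensorProduct.map_tmul,
          LinearMap.id_apply, LinearMap.id_apply, B.full_one, hc, TensorProduct.add_tmul, map_add,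
          TensorProduct.assoc_tmul, add_assoc, add_right_inj] at h1
        have e1 : TensorProduct.assoc K _ _ _ (TensorProduct.map I I t ⊗ₜ[K] (1 : H)) =
            TensorProduct.map I (TensorProduct.map I I)
              (TensorProduct.assoc K _ _ _ (t ⊗ₜ[K] (1 : TensorAlgebra K V))) := by
          rw [← map_map_assoc_tmul, ← hIa, map_one]
        have e2 : ∀ t, TensorProduct.assoc K _ _ _
            (TensorProduct.map B.coprod LinearMap.id (TensorProduct.map I I t)) =
            TensorProduct.map I (TensorProduct.map I I) (TensorProduct.assoc K _ _ _
              (TensorProduct.map (coHalfShuffle 𝒱) LinearMap.id t)) := by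
          intro t
          induction t using TensorProduct.induction_on with
          | zero => simp
          | add a b ha hb => simp only [map_add, ha, hb]
          | tmul a b =>
            simp only [TensorProduct.map_tmul, LinearMap.id_apply]
            rw [← map_map_assoc_tmul, ← hIa, coprod_lift B hi hprim]
        have e3 : ∀ t, TensorProduct.map LinearMap.id B.full (TensorProduct.map I I t) =
            TensorProduct.map I (TensorProduct.map I I)
              (TensorProduct.map LinearMap.id (coshuffleLin 𝒱) t) := by
          intro t
          induction t using TensorProduct.induction_on with
          | zero => simp
          | add a b ha hb => simp only [map_add, ha, hb]
          | tmul a b =>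
            simp only [TensorProduct.map_tmul, LinearMap.id_apply]
            rw [← hIa b, full_lift B hi hprim]
        rw [e1, e2, e3] at h1
        rw [map_add]
        exact h1
      have hy := coHalfShuffle_of_cocycle h0 hz
      generalize hyd : LinearMap.mul' K _ (TensorProduct.map wordProj LinearMap.id t) = y at hy
      have hyε : TensorAlgebra.algebraMapInv y = 0 := by
        rw [← hyd]
        clear * -
        induction t using TensorProduct.induction_on with
        | zero => simp
        | add a b ha hb => simp only [map_add, ha, hb, add_zero]
        | tmul a b => simp [wordProj]
      have hp : x - I y ∈ B.prim := by
        refine B.mem_prim.2 ⟨?_, ?_⟩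
        · rw [map_sub, hε, ← hIa, counit_lift B hprim, hyε, sub_zero]
        · rw [map_sub, hc, ← hIa, coprod_lift B hi hprim, hy, map_add, TensorProduct.map_tmul,
            TensorProduct.sub_tmul]
          simp only [AlgHom.toLinearMap_apply, map_one]
          abel
      obtain ⟨v, hv⟩ := hsurj _ hp
      refine ⟨y + TensorAlgebra.ι K v, ?_⟩
      rw [map_add, ← hIa (TensorAlgebra.ι K v), TensorAlgebra.lift_ι_apply, hv]
      abel
  intro x
  obtain ⟨r, hr⟩ := hB x
  exact key r hr

end Surjectivity

/-! ### Homogeneous subspaces -/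

section GradedSubspace

variable {K M : Type*} [Field K] [AddCommGroup M] [Module K M] (𝒜 : ℤ → Submodule K M)
  [DirectSum.Decomposition 𝒜]

/-- The grading of a homogeneous subspace. -/
def subGrade (P : Submodule K M) (n : ℤ) : Submodule K P := (𝒜 n).submoduleOf P

theorem subGrade_isInternal {P : Submodule K M} (hP : DirectSum.SetLike.IsHomogeneous 𝒜 P) :
    DirectSum.IsInternal (subGrade 𝒜 P) := by
  classical
  constructor
  · rw [injective_iff_map_eq_zero]
    intro x hx
    have key : ∀ (y : ⨁ n, subGrade 𝒜 P n) (m : ℤ),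
        gradeProj 𝒜 m (DirectSum.coeAddMonoidHom (subGrade 𝒜 P) y : P) = (y m : P) := by
      intro y m
      induction y using DirectSum.induction_on with
      | zero => simp
      | of i c =>
        rw [DirectSum.coeAddMonoidHom_of]
        have hc : ((c : P) : M) ∈ 𝒜 i := c.2
        by_cases h : i = m
        · subst h
          rw [gradeProj_same 𝒜 hc]; simp
        · rw [DirectSum.of_eq_of_ne _ _ _ (Ne.symm h), gradeProj_ne 𝒜 hc h]; rfl
      | add a b ha hb => simp [ha, hb]
    refine DFinsupp.ext fun m => Subtype.ext (Subtype.ext ?_)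
    rw [← key x m, hx]
    simp
  · intro x
    refine ⟨∑ n ∈ (DirectSum.decompose 𝒜 (x : M)).support,
      DirectSum.of (fun n => subGrade 𝒜 P n) n
        ⟨⟨gradeProj 𝒜 n x, hP n x.2⟩, gradeProj_mem 𝒜 n (x : M)⟩, ?_⟩
    rw [map_sum]
    simp only [DirectSum.coeAddMonoidHom_of]
    apply Subtype.ext
    rw [AddSubmonoidClass.coe_finsetSum]
    exact DirectSum.sum_support_decompose 𝒜 (x : M)

end GradedSubspace

/-! ### The contraction of a complex to its homology -/

section GradedMaps

variable {K V W : Type*} [Field K] [AddCommGroup V] [Module K V] [AddCommGroup W] [Module K W]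
  (𝒱 : ℤ → Submodule K V) [DirectSum.Decomposition 𝒱] (𝒲 : ℤ → Submodule K W)
  [DirectSum.Decomposition 𝒲]

/-- The component of degree `k` of a linear map between graded vector spaces. -/
def degPart (k : ℤ) (f : V →ₗ[K] W) : V →ₗ[K] W :=
  DirectSum.toModule K ℤ W (fun n => gradeProj 𝒲 (n + k) ∘ₗ f ∘ₗ (𝒱 n).subtype) ∘ₗ
    (DirectSum.decomposeLinearEquiv 𝒱).toLinearMap

theorem degPart_of_mem (k : ℤ) (f : V →ₗ[K] W) {n : ℤ} {x : V} (hx : x ∈ 𝒱 n) :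
    degPart 𝒱 𝒲 k f x = gradeProj 𝒲 (n + k) (f x) := by
  lift x to 𝒱 n using hx
  simp [degPart]

theorem degPart_mem (k : ℤ) (f : V →ₗ[K] W) {n : ℤ} {x : V} (hx : x ∈ 𝒱 n) :
    degPart 𝒱 𝒲 k f x ∈ 𝒲 (n + k) := by
  rw [degPart_of_mem 𝒱 𝒲 k f hx]; exact gradeProj_mem _ _ _

/-- Over a field, a graded complex `V` is homotopy equivalent to its homology `W`, by maps that
respect the gradings. -/
theorem exists_graded_homotopy {d : V →ₗ[K] V} (hd : ∀ n, ∀ x ∈ 𝒱 n, d x ∈ 𝒱 (n - 1))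
    (hdd : ∀ x, d (d x) = 0) (c : LinearMap.ker d →ₗ[K] W) (hc : Function.Surjective c)
    (hker : ∀ z, c z = 0 ↔ ∃ y, d y = z) (hcg : ∀ n, ∀ z : LinearMap.ker d, (z : V) ∈ 𝒱 n →
      c z ∈ 𝒲 n) :
    ∃ (i : W →ₗ[K] LinearMap.ker d) (p : V →ₗ[K] W) (h : V →ₗ[K] V), (∀ w, c (i w) = w) ∧
      (∀ n, ∀ w ∈ 𝒲 n, (i w : V) ∈ 𝒱 n) ∧ (∀ n, ∀ v ∈ 𝒱 n, p v ∈ 𝒲 n) ∧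
      (∀ n, ∀ v ∈ 𝒱 n, h v ∈ 𝒱 (n + 1)) ∧ (∀ v, p (d v) = 0) ∧ (∀ w, p (i w) = w) ∧
      ∀ v, d (h v) + h (d v) = v - i (p v) := by
  classical
  -- the projection to the homology commutes with the projections to the components
  have hcproj : ∀ n (z : LinearMap.ker d) (hz : gradeProj 𝒱 n (z : V) ∈ LinearMap.ker d),
      c ⟨_, hz⟩ = gradeProj 𝒲 n (c z) := by
    have hzk : ∀ n (z : LinearMap.ker d), gradeProj 𝒱 n (z : V) ∈ LinearMap.ker d := by
      intro n z
      have := gradeProj_d 𝒱 hd (n - 1) (z : V)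
      rw [sub_add_cancel, LinearMap.mem_ker.1 z.2, map_zero] at this
      exact this.symm
    intro n z hz
    have hsum : z = ∑ m ∈ (DirectSum.decompose 𝒱 (z : V)).support,
        (⟨gradeProj 𝒱 m (z : V), hzk m z⟩ : LinearMap.ker d) := by
      apply Subtype.ext
      rw [AddSubmonoidClass.coe_finsetSum]
      exact (DirectSum.sum_support_decompose 𝒱 (z : V)).symm
    conv_rhs => rw [hsum]
    rw [map_sum, map_sum]
    have hm : ∀ m, gradeProj 𝒲 n (c ⟨gradeProj 𝒱 m (z : V), hzk m z⟩) =
        if m = n then c ⟨gradeProj 𝒱 n (z : V), hz⟩ else 0 := by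
      intro m
      have := hcg m ⟨gradeProj 𝒱 m (z : V), hzk m z⟩ (gradeProj_mem _ _ _)
      split_ifs with h
      · subst h; exact gradeProj_same 𝒲 this
      · exact gradeProj_ne 𝒲 this h
    simp only [hm]
    rw [Finset.sum_ite_eq']
    split_ifs with h
    · rfl
    · rw [DFinsupp.notMem_support_iff] at h
      have : (⟨gradeProj 𝒱 n (z : V), hz⟩ : LinearMap.ker d) = 0 :=
        Subtype.ext (by change gradeProj 𝒱 n (z : V) = 0; rw [gradeProj_apply, h]; rfl)
      rw [this, map_zero]
  -- a section of `d` over its image, of degree one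
  obtain ⟨k0, hk0⟩ := LinearMap.exists_rightInverse_of_surjective d.rangeRestrict
    (LinearMap.range_eq_top.2 d.surjective_rangeRestrict)
  obtain ⟨k1, hk1⟩ := LinearMap.exists_extend k0
  have dk1 : ∀ x, d (k1 (d x)) = d x := by
    intro x
    have e1 : k1 (d x) = k0 ⟨d x, LinearMap.mem_range_self d x⟩ :=
      LinearMap.congr_fun hk1 ⟨d x, LinearMap.mem_range_self d x⟩
    rw [e1]
    exact congrArg Subtype.val (LinearMap.congr_fun hk0 ⟨d x, LinearMap.mem_range_self d x⟩)
  let k := degPart 𝒱 𝒱 1 k1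
  have dk : ∀ x, d (k (d x)) = d x := by
    intro x
    induction x using DirectSum.Decomposition.inductionOn 𝒱 with
    | zero => simp
    | add x y hx hy => simp only [map_add, hx, hy]
    | @homogeneous n x =>
      have hx := hd n x x.2
      have e := degPart_of_mem 𝒱 𝒱 1 k1 hx
      change d (degPart 𝒱 𝒱 1 k1 (d x)) = _
      rw [e, ← gradeProj_d 𝒱 hd, dk1, gradeProj_same 𝒱 hx]
  -- a section of the projection to the homology, of degree zero
  obtain ⟨i0, hi0⟩ := LinearMap.exists_rightInverse_of_surjective c (LinearMap.range_eq_top.2 hc)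
  let i1 : W →ₗ[K] V := degPart 𝒲 𝒱 0 ((LinearMap.ker d).subtype ∘ₗ i0)
  have hi1 : ∀ n, ∀ w ∈ 𝒲 n, i1 w ∈ 𝒱 n := fun n w hw => by
    simpa using degPart_mem 𝒲 𝒱 0 ((LinearMap.ker d).subtype ∘ₗ i0) hw
  have di1 : ∀ w, d (i1 w) = 0 := by
    intro w
    induction w using DirectSum.Decomposition.inductionOn 𝒲 with
    | zero => simp
    | add x y hx hy => simp only [map_add, hx, hy, add_zero]
    | @homogeneous n w =>
      change d (degPart 𝒲 𝒱 0 ((LinearMap.ker d).subtype ∘ₗ i0) w) = 0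
      rw [degPart_of_mem 𝒲 𝒱 0 _ w.2]
      have := gradeProj_d 𝒱 hd (n + 0 - 1) (i0 w : V)
      rw [sub_add_cancel, LinearMap.mem_ker.1 (i0 w).2, map_zero] at this
      exact this.symm
  let i : W →ₗ[K] LinearMap.ker d := LinearMap.codRestrict _ i1 di1
  have ci : ∀ w, c (i w) = w := by
    intro w
    induction w using DirectSum.Decomposition.inductionOn 𝒲 with
    | zero => simp
    | add x y hx hy => simp only [map_add, hx, hy]
    | @homogeneous n w =>
      have e : i1 w = gradeProj 𝒱 (n + 0) (i0 w : V) := degPart_of_mem 𝒲 𝒱 0 _ w.2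
      have e' : i w = ⟨gradeProj 𝒱 (n + 0) (i0 w : V), by rw [← e]; exact di1 w⟩ :=
        Subtype.ext e
      rw [e', hcproj, add_zero]
      have : c (i0 w) = w := LinearMap.congr_fun hi0 w
      rw [this, gradeProj_same 𝒲 w.2]
  -- the projection to the cycles
  let q : V →ₗ[K] LinearMap.ker d :=
    LinearMap.codRestrict _ (LinearMap.id - k ∘ₗ d) (fun x => by simp [dk])
  have hq : ∀ x, (q x : V) = x - k (d x) := fun x => rfl
  let p : V →ₗ[K] W := c ∘ₗ q
  have pd : ∀ x, p (d x) = 0 := by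
    intro x
    refine (hker _).2 ⟨x, ?_⟩
    rw [hq, hdd, map_zero, sub_zero]
  have pz : ∀ z : LinearMap.ker d, p z = c z := by
    intro z
    refine congrArg c (Subtype.ext ?_)
    rw [hq, LinearMap.mem_ker.1 z.2, map_zero, sub_zero]
  have hkg : ∀ n, ∀ v ∈ 𝒱 n, k v ∈ 𝒱 (n + 1) := fun n v hv => degPart_mem 𝒱 𝒱 1 k1 hv
  have hqg : ∀ n, ∀ v ∈ 𝒱 n, (q v : V) ∈ 𝒱 n := by
    intro n v hv
    rw [hq]
    refine Submodule.sub_mem _ hv ?_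
    simpa using hkg _ _ (hd n v hv)
  have hpg : ∀ n, ∀ v ∈ 𝒱 n, p v ∈ 𝒲 n := fun n v hv => hcg n _ (hqg n v hv)
  let h : V →ₗ[K] V := k ∘ₗ (LinearMap.ker d).subtype ∘ₗ (q - i ∘ₗ p)
  have hh : ∀ x, h x = k ((q x : V) - (i (p x) : V)) := fun x => rfl
  refine ⟨i, p, h, ci, hi1, hpg, ?_, pd, fun w => by rw [pz, ci], ?_⟩
  · intro n v hv
    rw [hh]
    exact hkg n _ (Submodule.sub_mem _ (hqg n v hv) (hi1 n _ (hpg n v hv)))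
  · intro x
    obtain ⟨b, hb⟩ := (hker (q x - i (p x))).1 (by rw [map_sub, ci]; exact sub_self _)
    have hb' : d b = (q x : V) - (i (p x) : V) := hb
    have e : d (h x) = (q x : V) - i (p x) := by rw [hh, ← hb', dk]
    have e' : h (d x) = k (d x) := by rw [hh, pd, map_zero, hq, hdd]; simp
    rw [e, e', hq]
    abel

end GradedMaps

/-! ### The homotopy on the tensor module -/

section TwistedDerivation

variable {K V : Type*} [Field K] [AddCommGroup V] [Module K V]

/-- Auxiliary map for `twistedDer`: `w` sends `(1, 0)` to `(w, twistedDer f g w)`. -/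
def twistedDerAux (f g : V →ₗ[K] TensorAlgebra K V) :
    TensorAlgebra K V →ₐ[K] Module.End K (TensorAlgebra K V × TensorAlgebra K V) :=
  TensorAlgebra.lift K
    { toFun := fun v => LinearMap.prod
        (LinearMap.mulLeft K (TensorAlgebra.ι K v) ∘ₗ LinearMap.fst K _ _)
        (LinearMap.mulLeft K (f v) ∘ₗ LinearMap.fst K _ _ +
          LinearMap.mulLeft K (g v) ∘ₗ LinearMap.snd K _ _)
      map_add' := fun v w => LinearMap.ext fun x => Prod.ext (by simp [add_mul]) (by
        simp [add_mul]; abel)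
      map_smul' := fun c v => LinearMap.ext fun x => Prod.ext (by simp) (by simp) }

/-- The endomorphism `θ` of the tensor module with `θ(1) = 0` and `θ(v w) = f(v) w + g(v) θ(w)` for
`v` in `V`. -/
def twistedDer (f g : V →ₗ[K] TensorAlgebra K V) : TensorAlgebra K V →ₗ[K] TensorAlgebra K V :=
  LinearMap.snd K _ _ ∘ₗ LinearMap.applyₗ (1, 0) ∘ₗ (twistedDerAux f g).toLinearMap

theorem twistedDer_one (f g : V →ₗ[K] TensorAlgebra K V) : twistedDer f g 1 = 0 := by
  simp [twistedDer]

theorem twistedDer_ι_mul (f g : V →ₗ[K] TensorAlgebra K V) (v : V) (w : TensorAlgebra K V) :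
    twistedDer f g (TensorAlgebra.ι K v * w) = f v * w + g v * twistedDer f g w := by
  have hι : ∀ v x, twistedDerAux f g (TensorAlgebra.ι K v) x =
      (TensorAlgebra.ι K v * x.1, f v * x.1 + g v * x.2) := by
    intro v x
    rw [twistedDerAux, TensorAlgebra.lift_ι_apply]
    rfl
  have hfst : ∀ w, (twistedDerAux f g w (1, 0)).1 = w := by
    intro w
    induction w using tensorAlgebra_induction_left with
    | one => simp
    | add a b ha hb => rw [map_add, LinearMap.add_apply, Prod.fst_add, ha, hb]
    | smul c a ha => rw [map_smul, LinearMap.smul_apply, Prod.smul_fst, ha]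
    | ι_mul v w hw => rw [map_mul, Module.End.mul_apply, hι, hw]
  simp only [twistedDer, LinearMap.comp_apply, AlgHom.toLinearMap_apply,
    LinearMap.applyₗ_apply_apply, LinearMap.snd_apply]
  rw [map_mul, Module.End.mul_apply, hι, hfst]

variable {W : Type*} [AddCommGroup W] [Module K W] (𝒱 : ℤ → Submodule K V)
  [DirectSum.Decomposition 𝒱] (𝒲 : ℤ → Submodule K W) [DirectSum.Decomposition 𝒲]

/-- The differential of the tensor module of a complex: the graded derivation that extends `d`. -/
def tensorAlgD (d : V →ₗ[K] V) : TensorAlgebra K V →ₗ[K] TensorAlgebra K V :=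
  twistedDer (TensorAlgebra.ι K ∘ₗ d) (TensorAlgebra.ι K ∘ₗ signMap 𝒱)

theorem tensorAlgD_ι_mul (d : V →ₗ[K] V) (v : V) (w : TensorAlgebra K V) :
    tensorAlgD 𝒱 d (TensorAlgebra.ι K v * w) =
      TensorAlgebra.ι K (d v) * w + TensorAlgebra.ι K (signMap 𝒱 v) * tensorAlgD 𝒱 d w :=
  twistedDer_ι_mul _ _ _ _

/-- A map of degree one anticommutes with the sign map. -/
theorem signMap_homotopy {h : V →ₗ[K] V} (hh : ∀ n, ∀ x ∈ 𝒱 n, h x ∈ 𝒱 (n + 1)) (x : V) :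
    signMap 𝒱 (h x) = - h (signMap 𝒱 x) := by
  induction x using DirectSum.Decomposition.inductionOn 𝒱 with
  | zero => simp
  | add x y hx hy => simp only [map_add, hx, hy]; abel
  | @homogeneous i x =>
    rw [signMap_of_mem 𝒱 x.2, signMap_of_mem 𝒱 (hh _ _ x.2), map_smul, Int.negOnePow_add,
      Int.negOnePow_one]
    simp

/-- A map of degree zero commutes with the sign maps. -/
theorem signMap_graded {f : V →ₗ[K] W} (hf : ∀ n, ∀ x ∈ 𝒱 n, f x ∈ 𝒲 n) (x : V) :
    signMap 𝒲 (f x) = f (signMap 𝒱 x) := by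
  induction x using DirectSum.Decomposition.inductionOn 𝒱 with
  | zero => simp
  | add x y hx hy => simp only [map_add, hx, hy]
  | @homogeneous i x =>
    rw [signMap_of_mem 𝒱 x.2, signMap_of_mem 𝒲 (hf _ _ x.2), map_smul]

variable {𝒱 𝒲}

/-- The tensor module of a complex `V` is homotopy equivalent to the tensor module of its
homology `W`. The homotopy is determined by `v w ↦ h(v) w ± i(p(v)) hT(w)`; on words of length `n`
this is the sum over the positions of `h`, with `i ∘ p` on the letters before it and the identity on
those behind it. -/
theorem exists_tensorAlg_homotopy {d h : V →ₗ[K] V} {i : W →ₗ[K] V} {p : V →ₗ[K] W}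
    (hd : ∀ n, ∀ x ∈ 𝒱 n, d x ∈ 𝒱 (n - 1)) (hi : ∀ n, ∀ w ∈ 𝒲 n, i w ∈ 𝒱 n)
    (hp : ∀ n, ∀ v ∈ 𝒱 n, p v ∈ 𝒲 n) (hh : ∀ n, ∀ v ∈ 𝒱 n, h v ∈ 𝒱 (n + 1))
    (di : ∀ w, d (i w) = 0) (pd : ∀ v, p (d v) = 0)
    (hom : ∀ v, d (h v) + h (d v) = v - i (p v)) :
    ∃ hT : TensorAlgebra K V →ₗ[K] TensorAlgebra K V, ∀ w,
      tensorAlgD 𝒱 d (hT w) + hT (tensorAlgD 𝒱 d w) =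
        w - TensorAlgebra.lift K (TensorAlgebra.ι K ∘ₗ i)
          (TensorAlgebra.lift K (TensorAlgebra.ι K ∘ₗ p) w) := by
  let hT := twistedDer (TensorAlgebra.ι K ∘ₗ h) (TensorAlgebra.ι K ∘ₗ signMap 𝒱 ∘ₗ i ∘ₗ p)
  have hT_mul : ∀ v w, hT (TensorAlgebra.ι K v * w) = TensorAlgebra.ι K (h v) * w +
      TensorAlgebra.ι K (signMap 𝒱 (i (p v))) * hT w := fun v w => twistedDer_ι_mul _ _ v w
  refine ⟨hT, fun w => ?_⟩
  induction w using tensorAlgebra_induction_left with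
  | one =>
    have h1 : tensorAlgD 𝒱 d 1 = 0 := twistedDer_one _ _
    have h2 : hT 1 = 0 := twistedDer_one _ _
    simp [h1, h2]
  | add a b ha hb =>
    simp only [map_add]
    rw [add_sub_add_comm, ← ha, ← hb]; abel
  | smul c a ha => simp only [map_smul]; rw [← smul_sub, ← ha, smul_add]
  | ι_mul v w ih =>
    have hip : ∀ x, signMap 𝒱 (i (p (signMap 𝒱 x))) = i (p x) := by
      intro x
      rw [← signMap_graded 𝒱 𝒲 hp, ← signMap_graded 𝒲 𝒱 hi, signMap_signMap]
    have e1 : tensorAlgD 𝒱 d (hT (TensorAlgebra.ι K v * w)) =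
        TensorAlgebra.ι K (d (h v)) * w + TensorAlgebra.ι K (signMap 𝒱 (h v)) * tensorAlgD 𝒱 d w +
        TensorAlgebra.ι K (i (p v)) * tensorAlgD 𝒱 d (hT w) := by
      rw [hT_mul, map_add, tensorAlgD_ι_mul, tensorAlgD_ι_mul, signMap_d 𝒱 hd, di, signMap_signMap]
      simp
    have e2 : hT (tensorAlgD 𝒱 d (TensorAlgebra.ι K v * w)) =
        TensorAlgebra.ι K (h (d v)) * w - TensorAlgebra.ι K (signMap 𝒱 (h v)) * tensorAlgD 𝒱 d w +
        TensorAlgebra.ι K (i (p v)) * hT (tensorAlgD 𝒱 d w) := by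
      rw [tensorAlgD_ι_mul, map_add, hT_mul, hT_mul, pd, hip, signMap_homotopy 𝒱 hh]
      simp [add_assoc]
    have e3 : TensorAlgebra.ι K (d (h v)) = TensorAlgebra.ι K v - TensorAlgebra.ι K (i (p v)) -
        TensorAlgebra.ι K (h (d v)) := by
      rw [← map_sub, ← map_sub, ← hom v, add_sub_cancel_right]
    have e4 : tensorAlgD 𝒱 d (hT w) = w - TensorAlgebra.lift K (TensorAlgebra.ι K ∘ₗ i)
          (TensorAlgebra.lift K (TensorAlgebra.ι K ∘ₗ p) w) - hT (tensorAlgD 𝒱 d w) := by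
      rw [← ih, add_sub_cancel_right]
    rw [e1, e2, e3, e4, map_mul, map_mul, TensorAlgebra.lift_ι_apply, LinearMap.comp_apply,
      TensorAlgebra.lift_ι_apply, LinearMap.comp_apply]
    noncomm_ring

theorem lift_tensorAlgD {d : V →ₗ[K] V} {p : V →ₗ[K] W} (pd : ∀ v, p (d v) = 0)
    (w : TensorAlgebra K V) :
    TensorAlgebra.lift K (TensorAlgebra.ι K ∘ₗ p) (tensorAlgD 𝒱 d w) = 0 := by
  induction w using tensorAlgebra_induction_left with
  | one => rw [tensorAlgD, twistedDer_one, map_zero]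
  | add a b ha hb => rw [map_add, map_add, ha, hb, add_zero]
  | smul c a ha => rw [map_smul, map_smul, ha, smul_zero]
  | ι_mul v w ih => simp [tensorAlgD_ι_mul, ih, pd]

end TwistedDerivation

/-! ### Classes of cycles in the tensor square -/

section CycleClass

variable {K M N : Type*} [Field K] [AddCommGroup M] [Module K M] [AddCommGroup N] [Module K N]
  (𝒜 : ℤ → Submodule K M) [DirectSum.Decomposition 𝒜]

/-- The map to the homology induced by a linear map into the cycles. -/
def cycleClass {d : M →ₗ[K] M} (J : N →ₗ[K] M) (hJ : ∀ w, d (J w) = 0) : N →ₗ[K] Homology d ⊤ :=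
  cls d ⊤ ∘ₗ LinearMap.codRestrict _ J (fun w => ⟨hJ w, trivial⟩)

theorem tensorD_map_cycles {d : M →ₗ[K] M} (J : N →ₗ[K] M) (hJ : ∀ w, d (J w) = 0)
    (t : N ⊗[K] N) : tensorD 𝒜 d (TensorProduct.map J J t) = 0 := by
  induction t using TensorProduct.induction_on with
  | zero => simp
  | add a b ha hb => rw [map_add, map_add, ha, hb, add_zero]
  | tmul a b => simp [tensorD, hJ]

/-- The Künneth isomorphism on tensors of classes of cycles. -/
theorem kunnethMap_cycleClass {d : M →ₗ[K] M} (hd : ∀ n, ∀ x ∈ 𝒜 n, d x ∈ 𝒜 (n - 1))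
    (J : N →ₗ[K] M) (hJ : ∀ w, d (J w) = 0) (t : N ⊗[K] N) :
    kunnethMap 𝒜 hd (TensorProduct.map (cycleClass J hJ) (cycleClass J hJ) t) =
      cycleClass (TensorProduct.map J J) (tensorD_map_cycles 𝒜 J hJ) t := by
  induction t using TensorProduct.induction_on with
  | zero => simp
  | add a b ha hb => simp only [map_add, ha, hb]
  | tmul a b => rfl

end CycleClass

/-! ### The homology of a bialgebra -/

section Structure

variable {K H : Type*} [Field K] [Ring H] [Algebra K H] {𝒜 : ℤ → Submodule K H}
  [GradedAlgebra 𝒜] (B : DGZinbAs K 𝒜)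

theorem DGZinbAs.d_prim {x : H} (hx : x ∈ B.prim) : B.d x ∈ B.prim := by
  refine B.mem_prim.2 ⟨B.counit_d x, ?_⟩
  rw [B.coprod_d, (B.mem_prim.1 hx).2]
  simp [tensorD, B.d_one]

/-- The Leibniz rule, without homogeneity assumptions. -/
theorem DGZinbAs.d_mul_signMap (x y : H) :
    B.d (x * y) = B.d x * y + signMap 𝒜 x * B.d y := by
  have := B.d_mul' (x ⊗ₜ y)
  simpa [tensorD] using this.symm

theorem homologyCoprod_eq_iff (c : Homology B.d ⊤) (t : Homology B.d ⊤ ⊗[K] Homology B.d ⊤) :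
    B.homologyCoprod c = t ↔
      homologyMap B.coprod B.coprod_d c = kunnethMap 𝒜 B.d_mem t := by
  rw [DGZinbAs.homologyCoprod, LinearMap.comp_apply]
  exact LinearEquiv.symm_apply_eq _

/-- Let `P` be a graded subcomplex of the primitive part of `B`. Suppose that every relative cycle
of `B` modulo the subalgebra generated by `P` is homologous to an element of this subalgebra; that
is, the inclusion of the subalgebra in `B` is a quasi-isomorphism. By `lift_injective` the
subalgebra is the tensor module `T(P)`, hence the homology of `B` is `T(H(P))`. -/
theorem nonempty_tensorHomologyIso {P : Submodule K H} (hP : DirectSum.SetLike.IsHomogeneous 𝒜 P)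
    (hPp : P ≤ B.prim) (hdP : ∀ x ∈ P, B.d x ∈ P)
    (hq : ∀ z, B.d z ∈ Algebra.adjoin K (P : Set H) →
      ∃ y, z - B.d y ∈ Algebra.adjoin K (P : Set H)) :
    Nonempty (TensorHomologyIso B P hP) := by
  classical
  let i𝒱 : DirectSum.Decomposition (subGrade 𝒜 P) := (subGrade_isInternal 𝒜 hP).chooseDecomposition
  let i𝒲 : DirectSum.Decomposition (homologyGrade 𝒜 B.d P) :=
    (homologyGrade_isInternal 𝒜 B.d_mem hP).chooseDecomposition
  let dP : P →ₗ[K] P := B.d.restrict hdP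
  have hdPc : ∀ x, (dP x : H) = B.d x := fun _ => rfl
  have hdPg : ∀ n, ∀ x ∈ subGrade 𝒜 P n, dP x ∈ subGrade 𝒜 P (n - 1) :=
    fun n x hx => B.d_mem n x hx
  have hdd : ∀ x, B.d (B.d x) = 0 := fun x => LinearMap.congr_fun B.d_comp_d x
  have hker : ∀ x : LinearMap.ker dP, ((x : P) : H) ∈ LinearMap.ker B.d ⊓ P := fun x =>
    ⟨congrArg Subtype.val (LinearMap.mem_ker.1 x.2), (x : P).2⟩
  let c : LinearMap.ker dP →ₗ[K] Homology B.d P := cls B.d P ∘ₗ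
    LinearMap.codRestrict _ (P.subtype ∘ₗ (LinearMap.ker dP).subtype) hker
  have hcdef : ∀ x, c x = cls B.d P ⟨((x : P) : H), hker x⟩ := fun _ => rfl
  have hcs : Function.Surjective c := by
    intro y
    obtain ⟨z, rfl⟩ := cls_surjective B.d P y
    exact ⟨⟨⟨z, z.2.2⟩, LinearMap.mem_ker.2 (Subtype.ext z.2.1)⟩, rfl⟩
  have hck : ∀ z, c z = 0 ↔ ∃ y, dP y = z := by
    intro z
    rw [hcdef, cls_eq_zero]
    constructor
    · rintro ⟨y, hy, e⟩; exact ⟨⟨y, hy⟩, Subtype.ext e⟩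
    · rintro ⟨y, e⟩; exact ⟨y, y.2, congrArg Subtype.val e⟩
  obtain ⟨i, p, h, ci, hig, hpg, hhg, pd, pi, hom⟩ := exists_graded_homotopy (subGrade 𝒜 P)
    (homologyGrade 𝒜 B.d P) hdPg (fun x => Subtype.ext (hdd x)) c hcs hck
    (fun n z hz => ⟨_, hz, rfl⟩)
  let i' : Homology B.d P →ₗ[K] P := (LinearMap.ker dP).subtype ∘ₗ i
  have di' : ∀ w, dP (i' w) = 0 := fun w => (i w).2
  obtain ⟨hT, hhT⟩ := exists_tensorAlg_homotopy (i := i') hdPg hig hpg hhg di' pd hom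
  -- the inclusion of `T(P)` in `B`
  let I := TensorAlgebra.lift K P.subtype
  have hIinj : Function.Injective I := lift_injective (𝒱 := subGrade 𝒜 P) B (fun n v hv => hv)
    (fun v => hPp v.2) Subtype.val_injective
  have hIrange : ∀ x, x ∈ Algebra.adjoin K (P : Set H) ↔ ∃ w, I w = x := by
    intro x
    have := TensorAlgebra.range_lift (R := K) P.subtype
    rw [Submodule.coe_subtype, Subtype.range_coe_subtype] at this
    change x ∈ Algebra.adjoin K {x | x ∈ P} ↔ _
    rw [← this]; rfl
  have hsign : ∀ v : P, (signMap (subGrade 𝒜 P) v : H) = signMap 𝒜 (v : H) := by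
    intro v
    exact (signMap_graded (subGrade 𝒜 P) 𝒜 (f := P.subtype) (fun n x hx => hx) v).symm
  have hId : ∀ w, I (tensorAlgD (subGrade 𝒜 P) dP w) = B.d (I w) := by
    intro w
    induction w using tensorAlgebra_induction_left with
    | one => rw [tensorAlgD, twistedDer_one, map_one, map_zero, B.d_one]
    | add a b ha hb => simp only [map_add, ha, hb]
    | smul c a ha => simp only [map_smul, ha]
    | ι_mul v w ih =>
      rw [tensorAlgD_ι_mul, map_add, map_mul, map_mul, map_mul, ih, B.d_mul_signMap]
      simp [I, hsign, hdPc]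
  -- the map `J` from `T(H(P))` to the cycles of `B`
  let ιi := TensorAlgebra.lift K (TensorAlgebra.ι K ∘ₗ i')
  let J := TensorAlgebra.lift K (P.subtype ∘ₗ i')
  let Q := TensorAlgebra.lift K (TensorAlgebra.ι K ∘ₗ p)
  have hJ : ∀ w, J w = I (ιi w) := by
    intro w
    have : J = I.comp ιi := TensorAlgebra.hom_ext (LinearMap.ext fun v => by simp [J, I, ιi])
    rw [this]; rfl
  have hQι : ∀ w, Q (ιi w) = w := by
    intro w
    have : Q.comp ιi = AlgHom.id K _ :=
      TensorAlgebra.hom_ext (LinearMap.ext fun v => by simp [Q, ιi, i', pi])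
    exact DFunLike.congr_fun this w
  have hQd : ∀ w, Q (tensorAlgD (subGrade 𝒜 P) dP w) = 0 := lift_tensorAlgD pd
  have hdJ : ∀ w, B.d (J w) = 0 := by
    intro w
    induction w using tensorAlgebra_induction_left with
    | one => rw [map_one, B.d_one]
    | add a b ha hb => rw [map_add, map_add, ha, hb, add_zero]
    | smul c a ha => rw [map_smul, map_smul, ha, smul_zero]
    | ι_mul v w ih =>
      have e : B.d (i' v : H) = 0 := congrArg Subtype.val (di' v)
      rw [map_mul, B.d_mul_signMap, ih, TensorAlgebra.lift_ι_apply, LinearMap.comp_apply,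
        Submodule.subtype_apply, e]
      simp
  have hJg : ∀ n, ∀ w ∈ homologyGrade 𝒜 B.d P n, (P.subtype ∘ₗ i') w ∈ 𝒜 n :=
    fun n w hw => hig n w hw
  let Φ : TensorAlgebra K (Homology B.d P) →ₗ[K] Homology B.d ⊤ :=
    cycleClass J.toLinearMap hdJ
  have hΦ : ∀ w, Φ w = cls B.d ⊤ ⟨J w, hdJ w, trivial⟩ := fun _ => rfl
  -- if `J w` is the boundary of `y`, then `y` can be moved into `T(P)`, and `Q` kills boundaries
  have hΦinj : Function.Injective Φ := by
    rw [injective_iff_map_eq_zero]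
    intro w hw
    obtain ⟨y, -, hy⟩ := cls_eq_zero.1 hw
    have hy' : B.d y = I (ιi w) := hy.trans (hJ w)
    obtain ⟨y', hyy⟩ := hq y ((hIrange _).2 ⟨_, hy'.symm⟩)
    obtain ⟨u, hu⟩ := (hIrange _).1 hyy
    have e : ιi w = tensorAlgD (subGrade 𝒜 P) dP u := by
      apply hIinj
      rw [hId, hu, map_sub, hdd, sub_zero, hy']
    rw [← hQι w, e, hQd]
  -- a cycle can be moved to a cycle `u` of `T(P)`, which is homologous to the image of `Q u`
  have hΦsurj : Function.Surjective Φ := by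
    intro x
    obtain ⟨z, rfl⟩ := cls_surjective B.d ⊤ x
    have hz : B.d (z : H) = 0 := z.2.1
    obtain ⟨y, hy⟩ := hq z (by rw [hz]; exact Subalgebra.zero_mem _)
    obtain ⟨u, hu⟩ := (hIrange _).1 hy
    have hdu : tensorAlgD (subGrade 𝒜 P) dP u = 0 := by
      apply hIinj
      rw [hId, hu, map_sub, hdd, hz, sub_zero, map_zero]
    have e := hhT u
    rw [hdu, map_zero, add_zero] at e
    refine ⟨Q u, ?_⟩
    rw [hΦ, ← sub_eq_zero, ← map_sub, cls_eq_zero]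
    refine ⟨- (y + I (hT u)), trivial, ?_⟩
    rw [map_neg, map_add, ← hId, e, map_sub, hu]
    change _ = J (Q u) - (z : H)
    rw [hJ]
    abel
  let E := LinearEquiv.ofBijective Φ ⟨hΦinj, hΦsurj⟩
  have hE : ∀ w, E w = cls B.d ⊤ ⟨J w, hdJ w, trivial⟩ := fun _ => rfl
  have hEgrade : ∀ n, ∀ w ∈ tensorAlgGrade (homologyGrade 𝒜 B.d P) n,
      E w ∈ homologyGrade 𝒜 B.d ⊤ n := by
    intro n w hw
    exact ⟨_, lift_mem_grade hJg n w hw, rfl⟩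
  refine ⟨{
    toEquiv := E
    map_ι := fun x => ?_
    map_one := ?_
    map_mul := fun x y => ?_
    map_counit := fun x => ?_
    map_coprod := fun x => ?_
    map_grade := fun n => ?_ }⟩
  · conv_rhs => rw [← ci x]
    rw [hE]
    refine congrArg (cls B.d ⊤) (Subtype.ext ?_)
    change J _ = (i' x : H)
    simp [J]
  · rw [hE]
    exact congrArg (cls B.d ⊤) (Subtype.ext (map_one J))
  · rw [hE]
    exact congrArg (cls B.d ⊤) (Subtype.ext (map_mul J x y))
  · rw [hE]
    exact counit_lift B (i := P.subtype ∘ₗ i') (fun v => hPp (i' v).2) x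
  · rw [homologyCoprod_eq_iff]
    refine Eq.trans ?_ (kunnethMap_cycleClass 𝒜 B.d_mem J.toLinearMap hdJ
      (coHalfShuffle (homologyGrade 𝒜 B.d P) x)).symm
    refine congrArg (cls _ ⊤) (Subtype.ext ?_)
    exact coprod_lift B hJg (fun v => hPp (i' v).2) x
  · have htop : DirectSum.SetLike.IsHomogeneous 𝒜 (⊤ : Submodule K H) := fun _ _ _ => trivial
    refine le_antisymm ?_ ?_
    · rintro _ ⟨w, hw, rfl⟩
      exact hEgrade n w hw
    · intro x hx
      obtain ⟨w, rfl⟩ := E.surjective x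
      have hproj : ∀ w, homologyProj 𝒜 B.d_mem htop n (E w) =
          E (gradeProj (tensorAlgGrade (homologyGrade 𝒜 B.d P)) n w) := by
        intro w
        induction w using DirectSum.Decomposition.inductionOn
            (tensorAlgGrade (homologyGrade 𝒜 B.d P)) with
        | zero => simp
        | add a b ha hb => simp only [map_add, ha, hb]
        | @homogeneous m w =>
          rw [homologyProj_of_mem 𝒜 B.d_mem htop m n (hEgrade m w w.2)]
          split_ifs with hmn
          · subst hmn; rw [gradeProj_same _ w.2]
          · rw [gradeProj_ne _ w.2 hmn, map_zero]
      have e := hproj w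
      rw [homologyProj_of_mem 𝒜 B.d_mem htop n n hx, if_pos rfl] at e
      exact ⟨_, gradeProj_mem _ n w, e.symm⟩

/-- The primitive elements of the homology are those of the tensor module, that is, its words of
length one. -/
theorem homology_primitive_iff {P : Submodule K H} {hP : DirectSum.SetLike.IsHomogeneous 𝒜 P}
    (Φ : TensorHomologyIso B P hP) (c : Homology B.d ⊤) :
    (B.homologyCounit c = 0 ∧ B.homologyCoprod c = c ⊗ₜ[K] B.homologyOne) ↔
      c ∈ LinearMap.range (homologyIncl B.d P) := by
  let i𝒲 : DirectSum.Decomposition (homologyGrade 𝒜 B.d P) :=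
    (homologyGrade_isInternal 𝒜 B.d_mem hP).chooseDecomposition
  have hΦ : ∀ w, B.homologyCoprod (Φ.toEquiv w) = TensorProduct.map Φ.toEquiv.toLinearMap
    Φ.toEquiv.toLinearMap (coHalfShuffle (homologyGrade 𝒜 B.d P) w) := Φ.map_coprod
  constructor
  · rintro ⟨h1, h2⟩
    obtain ⟨w, rfl⟩ := Φ.toEquiv.surjective c
    rw [Φ.map_counit] at h1
    rw [hΦ, ← Φ.map_one] at h2
    have h3 : coHalfShuffle (homologyGrade 𝒜 B.d P) w = w ⊗ₜ[K] 1 :=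
      (TensorProduct.congr Φ.toEquiv Φ.toEquiv).injective h2
    have h4 := mul_wordProj_coHalfShuffle (homologyGrade 𝒜 B.d P) w
    rw [h3, h1, TensorProduct.map_tmul, LinearMap.id_apply, LinearMap.mul'_apply, mul_one,
      map_zero, sub_zero] at h4
    refine ⟨TensorAlgebra.ιInv w, ?_⟩
    rw [← Φ.map_ι]
    exact congrArg _ h4
  · rintro ⟨v, rfl⟩
    rw [← Φ.map_ι]
    refine ⟨by rw [Φ.map_counit, algebraMapInv_ι], ?_⟩
    have h := coHalfShuffle_ι_mul' (homologyGrade 𝒜 B.d P) v 1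
    have h1 : coshuffleLin (homologyGrade 𝒜 B.d P) 1 = 1 ⊗ₜ[K] 1 := by
      change (GradedTensorProduct.of K _ _).symm (coshuffle (homologyGrade 𝒜 B.d P) 1) = _
      rw [map_one]; rfl
    rw [mul_one, h1, TensorProduct.map_tmul, LinearMap.mulLeft_apply, mul_one,
      LinearMap.id_apply] at h
    rw [hΦ, h, ← Φ.map_one]
    rfl

theorem adjoin_prim_eq_top (hB : B.Connected) : Algebra.adjoin K (B.prim : Set H) = ⊤ := by
  let i𝒱 : DirectSum.Decomposition (subGrade 𝒜 B.prim) :=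
    (subGrade_isInternal 𝒜 B.prim_isHomogeneous).chooseDecomposition
  have h := lift_surjective (𝒱 := subGrade 𝒜 B.prim) B hB (i := B.prim.subtype)
    (fun n v hv => hv) (fun v => v.2) Subtype.val_injective (fun x hx => ⟨⟨x, hx⟩, rfl⟩)
  have := TensorAlgebra.range_lift (R := K) B.prim.subtype
  rw [(AlgHom.range_eq_top _).2 h, Submodule.coe_subtype, Subtype.range_coe_subtype] at this
  exact this.symm

end Structure

section LabelledGraphs

/-! ### Graphs with labelled vertices -/

/-- The edge `e`, reoriented from its smaller to its larger end. -/
def enorm (e : ℕ × ℕ) : ℕ × ℕ := (min e.1 e.2, max e.1 e.2)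

/-- The number of ends at the vertex `v` of the edges in `E`; a loop has two ends at its vertex. -/
def ends (E : Multiset (ℕ × ℕ)) (v : ℕ) : ℕ :=
  (E.map fun e => (if e.1 = v then 1 else 0) + (if e.2 = v then 1 else 0)).sum

/-- A multiset `E` of oriented edges between vertices in `A`, all of whose valences are at
least `k`. -/
structure IsGraphOn (k : ℕ) (A : Finset ℕ) (E : Multiset (ℕ × ℕ)) : Prop where
  mem : ∀ e ∈ E, e.1 ∈ A ∧ e.2 ∈ A
  le_ends : ∀ v ∈ A, k ≤ ends E v

/-- The graph with vertex set `A` and edges `E`, renumbered in increasing order. -/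
def stdGraph (A : Finset ℕ) (E : Multiset (ℕ × ℕ)) : SymGraph where
  n := A.card
  edges := (E.filter fun e => e.1 ∈ A ∧ e.2 ∈ A ∧ e.1 < e.2).map
    (Prod.map (SymGraph.rank A) (SymGraph.rank A))
  edges_mem := by
    intro e' he'
    obtain ⟨e, he, rfl⟩ := Multiset.mem_map.1 he'
    obtain ⟨-, h1, h2, hlt⟩ := Multiset.mem_filter.1 he
    refine ⟨Finset.card_pos.2 ⟨e.1, by simp [h1]⟩, Finset.card_lt_card ?_,
      Finset.card_le_card (Finset.filter_subset _ _)⟩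
    rw [Finset.ssubset_iff_of_subset]
    · exact ⟨e.2, by simp [h2], by simp [h2, hlt]⟩
    · intro x hx
      simp only [Finset.mem_filter] at hx ⊢
      exact ⟨hx.1, by omega⟩

theorem rank_lt {A : Finset ℕ} {u v : ℕ} (hv : v ∈ A) (h : u < v) :
    SymGraph.rank A u < SymGraph.rank A v := by
  refine Finset.card_lt_card ((Finset.ssubset_iff_of_subset ?_).2
    ⟨v, by simp [hv], by simp [h]⟩)
  intro x hx
  simp only [Finset.mem_filter] at hx ⊢
  exact ⟨hx.1, by omega⟩

theorem rank_strictMonoOn (A : Finset ℕ) : StrictMonoOn (SymGraph.rank A) A :=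
  fun _ _ _ hv h => rank_lt hv h

theorem rank_mem_Icc {A : Finset ℕ} {v : ℕ} (hv : v ∈ A) :
    SymGraph.rank A v ∈ Finset.Icc 1 A.card :=
  Finset.mem_Icc.2 ⟨Finset.card_pos.2 ⟨v, by simp [hv]⟩,
    Finset.card_le_card (Finset.filter_subset _ _)⟩

theorem image_rank (A : Finset ℕ) : A.image (SymGraph.rank A) = Finset.Icc 1 A.card := by
  refine Finset.eq_of_subset_of_card_le (fun x hx => ?_) ?_
  · obtain ⟨v, hv, rfl⟩ := Finset.mem_image.1 hx
    exact rank_mem_Icc hv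
  · rw [Finset.card_image_of_injOn (rank_strictMonoOn A).injOn]; simp

theorem rank_Icc {n v : ℕ} (hv : v ∈ Finset.Icc 1 n) : SymGraph.rank (Finset.Icc 1 n) v = v := by
  have : (Finset.Icc 1 n).filter (· ≤ v) = Finset.Icc 1 v := by
    ext x; simp only [Finset.mem_filter, Finset.mem_Icc] at *; omega
  rw [SymGraph.rank, this]; simp

theorem rank_image {A : Finset ℕ} {f : ℕ → ℕ} (hf : StrictMonoOn f A) {v : ℕ} (hv : v ∈ A) :
    SymGraph.rank (A.image f) (f v) = SymGraph.rank A v := by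
  have : (A.image f).filter (· ≤ f v) = (A.filter (· ≤ v)).image f := by
    ext x
    simp only [Finset.mem_filter, Finset.mem_image]
    constructor
    · rintro ⟨⟨a, ha, rfl⟩, h⟩
      exact ⟨a, ⟨ha, (hf.le_iff_le ha hv).1 h⟩, rfl⟩
    · rintro ⟨a, ⟨ha, h⟩, rfl⟩
      exact ⟨⟨a, ha, rfl⟩, (hf.le_iff_le ha hv).2 h⟩
  rw [SymGraph.rank, this, Finset.card_image_of_injOn]
  · rfl
  · exact hf.injOn.mono (by intro x; simp; tauto)

theorem stdGraph_image {A : Finset ℕ} {f : ℕ → ℕ} (hf : StrictMonoOn f A)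
    {E : Multiset (ℕ × ℕ)} (hE : ∀ e ∈ E, e.1 ∈ A ∧ e.2 ∈ A) :
    stdGraph (A.image f) (E.map (Prod.map f f)) = stdGraph A E := by
  refine SymGraph.ext (Finset.card_image_of_injOn hf.injOn) ?_
  change Multiset.map _ (Multiset.filter _ (E.map (Prod.map f f))) = Multiset.map _ _
  rw [Multiset.filter_map, Multiset.map_map]
  have h1 : E.filter ((fun e : ℕ × ℕ => e.1 ∈ A.image f ∧ e.2 ∈ A.image f ∧ e.1 < e.2) ∘
      Prod.map f f) = E.filter fun e => e.1 ∈ A ∧ e.2 ∈ A ∧ e.1 < e.2 := by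
    refine Multiset.filter_congr fun e he => ?_
    obtain ⟨ha, hb⟩ := hE e he
    simp only [Function.comp, Prod.map_fst, Prod.map_snd, ha, hb, true_and,
      Finset.mem_image_of_mem f ha, Finset.mem_image_of_mem f hb]
    exact hf.lt_iff_lt ha hb
  rw [h1]
  refine Multiset.map_congr rfl fun e he => ?_
  obtain ⟨ha, hb⟩ := hE e (Multiset.mem_of_mem_filter he)
  exact Prod.ext (rank_image hf ha) (rank_image hf hb)

theorem stdGraph_Icc {n : ℕ} {E : Multiset (ℕ × ℕ)}
    (hE : ∀ e ∈ E, 1 ≤ e.1 ∧ e.1 < e.2 ∧ e.2 ≤ n) :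
    stdGraph (Finset.Icc 1 n) E = ⟨n, E, hE⟩ := by
  refine SymGraph.ext (by simp [stdGraph]) ?_
  change Multiset.map _ (Multiset.filter _ E) = E
  rw [Multiset.filter_eq_self.2]
  · conv_rhs => rw [← Multiset.map_id E]
    refine Multiset.map_congr rfl fun e he => ?_
    have := hE e he
    exact Prod.ext (rank_Icc (Finset.mem_Icc.2 ⟨by omega, by omega⟩))
      (rank_Icc (Finset.mem_Icc.2 ⟨by omega, by omega⟩))
  · intro e he
    have := hE e he
    simp only [Finset.mem_Icc]; omega

theorem multiset_card_filter {α : Type*} (s : Multiset α) (p : α → Prop) [DecidablePred p] :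
    (s.filter p).card = (s.map fun a => if p a then 1 else 0).sum := by
  induction s using Multiset.induction with
  | empty => simp
  | cons a s ih => by_cases h : p a <;> simp [h, ih]; omega

theorem ends_map_enorm (E : Multiset (ℕ × ℕ)) (v : ℕ) : ends (E.map enorm) v = ends E v := by
  rw [ends, Multiset.map_map, ends]
  congr 1
  refine Multiset.map_congr rfl fun e _ => ?_
  rcases le_total e.1 e.2 with h | h
  · simp [enorm, h]
  · simp [enorm, h, add_comm]

theorem ends_add (E F : Multiset (ℕ × ℕ)) (v : ℕ) : ends (E + F) v = ends E v + ends F v := by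
  simp [ends]

theorem ends_map {A : Finset ℕ} {f : ℕ → ℕ} (hf : Set.InjOn f A) {E : Multiset (ℕ × ℕ)}
    (hE : ∀ e ∈ E, e.1 ∈ A ∧ e.2 ∈ A) {v : ℕ} (hv : v ∈ A) :
    ends (E.map (Prod.map f f)) (f v) = ends E v := by
  rw [ends, Multiset.map_map, ends]
  congr 1
  refine Multiset.map_congr rfl fun e he => ?_
  obtain ⟨ha, hb⟩ := hE e he
  simp only [Function.comp, Prod.map_fst, Prod.map_snd, hf.eq_iff ha hv, hf.eq_iff hb hv]

theorem valence_eq_ends (G : SymGraph) (v : ℕ) : G.valence v = ends G.edges v := by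
  rw [SymGraph.valence, multiset_card_filter, ends]
  congr 1
  refine Multiset.map_congr rfl fun e he => ?_
  have := G.edges_mem e he
  split_ifs <;> omega

theorem isGraphOn_of_mem {k : ℕ} {G : SymGraph} (hG : G ∈ SymGraph.minValence k) :
    IsGraphOn k (Finset.Icc 1 G.n) G.edges where
  mem e he := by
    have := G.edges_mem e he
    simp only [Finset.mem_Icc]; omega
  le_ends v hv := by
    rw [← valence_eq_ends]
    rw [Finset.mem_Icc] at hv
    exact hG v hv.1 hv.2

theorem IsGraphOn.map {k : ℕ} {A : Finset ℕ} {E : Multiset (ℕ × ℕ)} (h : IsGraphOn k A E)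
    {f : ℕ → ℕ} (hf : Set.InjOn f A) : IsGraphOn k (A.image f) (E.map (Prod.map f f)) where
  mem e he := by
    obtain ⟨e', he', rfl⟩ := Multiset.mem_map.1 he
    exact ⟨Finset.mem_image_of_mem f (h.mem e' he').1, Finset.mem_image_of_mem f (h.mem e' he').2⟩
  le_ends v hv := by
    obtain ⟨u, hu, rfl⟩ := Finset.mem_image.1 hv
    rw [ends_map hf h.mem hu]
    exact h.le_ends u hu

theorem enorm_mem {A : Finset ℕ} {e : ℕ × ℕ} (h : e.1 ∈ A ∧ e.2 ∈ A) :
    (enorm e).1 ∈ A ∧ (enorm e).2 ∈ A := by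
  rcases le_total e.1 e.2 with h' | h' <;> simp [enorm, h', h]

theorem enorm_lt {e : ℕ × ℕ} (h : e.1 ≠ e.2) : (enorm e).1 < (enorm e).2 := by
  simp only [enorm]; omega

theorem enorm_of_lt {e : ℕ × ℕ} (h : e.1 < e.2) : enorm e = e := by
  simp only [enorm]; exact Prod.ext (by simp; omega) (by simp; omega)

theorem IsGraphOn.map_enorm {k : ℕ} {A : Finset ℕ} {E : Multiset (ℕ × ℕ)} (h : IsGraphOn k A E) :
    IsGraphOn k A (E.map enorm) where
  mem e he := by
    obtain ⟨e', he', rfl⟩ := Multiset.mem_map.1 he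
    exact enorm_mem (h.mem e' he')
  le_ends v hv := by rw [ends_map_enorm]; exact h.le_ends v hv

theorem stdGraph_edges {A : Finset ℕ} {E : Multiset (ℕ × ℕ)}
    (hE : ∀ e ∈ E, e.1 ∈ A ∧ e.2 ∈ A) (hlt : ∀ e ∈ E, e.1 < e.2) :
    (stdGraph A E).edges = E.map (Prod.map (SymGraph.rank A) (SymGraph.rank A)) := by
  change Multiset.map _ (Multiset.filter _ E) = _
  rw [Multiset.filter_eq_self.2]
  exact fun e he => ⟨(hE e he).1, (hE e he).2, hlt e he⟩

theorem IsGraphOn.stdGraph_mem {k : ℕ} {A : Finset ℕ} {E : Multiset (ℕ × ℕ)}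
    (h : IsGraphOn k A E) (hlt : ∀ e ∈ E, e.1 < e.2) : stdGraph A E ∈ SymGraph.minValence k := by
  intro v h1 h2
  have hv : v ∈ A.image (SymGraph.rank A) := by rw [image_rank]; exact Finset.mem_Icc.2 ⟨h1, h2⟩
  obtain ⟨a, ha, rfl⟩ := Finset.mem_image.1 hv
  rw [valence_eq_ends, stdGraph_edges h.mem hlt, ends_map (rank_strictMonoOn A).injOn h.mem ha]
  exact h.le_ends a ha

end LabelledGraphs

section GraphElements

variable (K : Type*) [Field K] (k : ℕ)

/-- The sign of an oriented edge with respect to the order of the vertices; loops have sign `0`. -/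
def edgeSign (e : ℕ × ℕ) : K := if e.1 < e.2 then 1 else if e.2 < e.1 then -1 else 0

/-- The element of `K[𝒢]` given by a graph with oriented edges `E` whose vertices are labelled by
the finite set `A` of natural numbers; the labels are replaced by their positions in `A`. It is zero
if there are loops, or if some valence is less than `k`. -/
def graphElt (A : Finset ℕ) (E : Multiset (ℕ × ℕ)) : GraphAlg K k :=
  (E.map (edgeSign K)).prod • graphBasis K k (stdGraph A (E.map enorm))

variable {K k}

theorem edgeSign_of_lt {e : ℕ × ℕ} (h : e.1 < e.2) : edgeSign K e = 1 := if_pos h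

theorem graphElt_of_loop (A : Finset ℕ) {E : Multiset (ℕ × ℕ)} {e : ℕ × ℕ} (he : e ∈ E)
    (h : e.1 = e.2) : graphElt K k A E = 0 := by
  have : (E.map (edgeSign K)).prod = 0 :=
    Multiset.prod_eq_zero (Multiset.mem_map.2 ⟨e, he, by simp [edgeSign, h]⟩)
  rw [graphElt, this, zero_smul]

theorem graphElt_of_lt (A : Finset ℕ) {E : Multiset (ℕ × ℕ)} (h : ∀ e ∈ E, e.1 < e.2) :
    graphElt K k A E = graphBasis K k (stdGraph A E) := by
  have h1 : (E.map (edgeSign K)).prod = 1 := by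
    refine Multiset.prod_eq_one fun x hx => ?_
    obtain ⟨e, he, rfl⟩ := Multiset.mem_map.1 hx
    exact edgeSign_of_lt (h e he)
  have h2 : E.map enorm = E := by
    conv_rhs => rw [← Multiset.map_id E]
    exact Multiset.map_congr rfl fun e he => enorm_of_lt (h e he)
  rw [graphElt, h1, h2, one_smul]

/-- Reorienting all edges of a graph without loops from the smaller to the larger end. -/
theorem graphElt_eq_smul (A : Finset ℕ) {E : Multiset (ℕ × ℕ)} (h : ∀ e ∈ E, e.1 ≠ e.2) :
    graphElt K k A E = (E.map (edgeSign K)).prod • graphElt K k A (E.map enorm) := by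
  rw [graphElt_of_lt A (E := E.map enorm), graphElt]
  intro e he
  obtain ⟨e', he', rfl⟩ := Multiset.mem_map.1 he
  exact enorm_lt (h e' he')

theorem edgeSign_map {f : ℕ → ℕ} {A : Finset ℕ} (hf : StrictMonoOn f A) {e : ℕ × ℕ}
    (he : e.1 ∈ A ∧ e.2 ∈ A) : edgeSign K (Prod.map f f e) = edgeSign K e := by
  simp only [edgeSign, Prod.map_fst, Prod.map_snd, hf.lt_iff_lt he.1 he.2, hf.lt_iff_lt he.2 he.1]

theorem enorm_map {f : ℕ → ℕ} {A : Finset ℕ} (hf : StrictMonoOn f A) {e : ℕ × ℕ}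
    (he : e.1 ∈ A ∧ e.2 ∈ A) : enorm (Prod.map f f e) = Prod.map f f (enorm e) := by
  rcases le_total e.1 e.2 with h | h
  · have := (hf.le_iff_le he.1 he.2).2 h
    exact Prod.ext (by simp [enorm, h, this]) (by simp [enorm, h, this])
  · have := (hf.le_iff_le he.2 he.1).2 h
    exact Prod.ext (by simp [enorm, h, this]) (by simp [enorm, h, this])

/-- Order preserving changes of the labels of the vertices do not matter. -/
theorem graphElt_image {A : Finset ℕ} {f : ℕ → ℕ} (hf : StrictMonoOn f A)
    {E : Multiset (ℕ × ℕ)} (hE : ∀ e ∈ E, e.1 ∈ A ∧ e.2 ∈ A) :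
    graphElt K k (A.image f) (E.map (Prod.map f f)) = graphElt K k A E := by
  rw [graphElt, graphElt, Multiset.map_map, Multiset.map_map]
  congr 1
  · congr 1
    exact Multiset.map_congr rfl fun e he => edgeSign_map hf (hE e he)
  · congr 1
    rw [← stdGraph_image hf, Multiset.map_map]
    · congr 1
      exact Multiset.map_congr rfl fun e he => enorm_map hf (hE e he)
    · intro e he
      obtain ⟨e', he', rfl⟩ := Multiset.mem_map.1 he
      exact enorm_mem (hE e' he')

theorem graphBasis_eq_graphElt (G : SymGraph) :
    graphBasis K k G = graphElt K k (Finset.Icc 1 G.n) G.edges := by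
  rw [graphElt_of_lt _ fun e he => (G.edges_mem e he).2.1, stdGraph_Icc G.edges_mem]

theorem single_eq_graphElt (G : SymGraph.minValence k) :
    (AddMonoidAlgebra.single G 1 : GraphAlg K k) =
      graphElt K k (Finset.Icc 1 G.1.n) G.1.edges := by
  rw [← graphBasis_eq_graphElt, graphBasis, dif_pos G.2]

theorem graphBasis_induce (G : SymGraph) (A : Finset ℕ) : graphBasis K k (G.induce A) =
    graphElt K k A (G.edges.filter fun e => e.1 ∈ A ∧ e.2 ∈ A) := by
  have h : ∀ e ∈ G.edges.filter fun e => e.1 ∈ A ∧ e.2 ∈ A, e.1 < e.2 := fun e he =>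
    (G.edges_mem e (Multiset.mem_of_mem_filter he)).2.1
  rw [graphElt_of_lt _ h]
  congr 1
  refine SymGraph.ext rfl ?_
  rw [stdGraph_edges (fun e he => (Multiset.mem_filter.1 he).2) h]
  rfl

theorem prod_edgeSign {E : Multiset (ℕ × ℕ)} (h : ∀ e ∈ E, e.1 ≠ e.2) :
    (E.map (edgeSign K)).prod = (-1 : K) ^ (E.filter fun e => e.2 < e.1).card := by
  induction E using Multiset.induction with
  | empty => simp
  | cons e E ih =>
    have h1 := h e (Multiset.mem_cons_self e E)
    rw [Multiset.map_cons, Multiset.prod_cons, ih fun e' he' => h e' (Multiset.mem_cons_of_mem he')]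
    rcases lt_or_gt_of_ne h1 with h2 | h2
    · rw [Multiset.filter_cons_of_neg _ (by omega), edgeSign_of_lt h2, one_mul]
    · rw [Multiset.filter_cons_of_pos (p := fun e : ℕ × ℕ => e.2 < e.1) _ h2,
        Multiset.card_cons, pow_succ, edgeSign,
        if_neg (by omega), if_pos h2, mul_comm]

theorem orientedClass_eq_graphElt (G : OrientedGraph) :
    orientedClass K k G = graphElt K k (Finset.Icc 1 G.n) G.edges := by
  unfold orientedClass
  split_ifs with h
  · rw [graphElt, prod_edgeSign h]
    congr 2
    refine (stdGraph_Icc _).symm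
  · push Not at h
    obtain ⟨e, he, h⟩ := h
    rw [graphElt_of_loop _ he h]

/-- The graphs with vertices `1, …, n`, with all edges oriented from the smaller to the larger
vertex, span `K[𝒢]`. -/
theorem graphAlg_induction {p : GraphAlg K k → Prop} (x : GraphAlg K k) (zero : p 0)
    (add : ∀ x y, p x → p y → p (x + y)) (smul : ∀ (c : K) x, p x → p (c • x))
    (elt : ∀ (n : ℕ) (E : Multiset (ℕ × ℕ)), IsGraphOn k (Finset.Icc 1 n) E →
      (∀ e ∈ E, e.1 < e.2) → p (graphElt K k (Finset.Icc 1 n) E)) : p x := by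
  induction x using AddMonoidAlgebra.induction_linear with
  | zero => exact zero
  | add f g hf hg => exact add f g hf hg
  | single G c =>
    have : (AddMonoidAlgebra.single G c : GraphAlg K k) = c • AddMonoidAlgebra.single G 1 := by
      simp
    rw [this, single_eq_graphElt]
    exact smul _ _ (elt _ _ (isGraphOn_of_mem G.2) fun e he => (G.1.edges_mem e he).2.1)

end GraphElements

/-! ### The contraction of an edge -/

section Contraction

/-- The map identifying the vertex `e.2` with the vertex `e.1`. -/
def merge (e : ℕ × ℕ) (v : ℕ) : ℕ := if v = e.2 then e.1 else v

theorem merge_snd (e : ℕ × ℕ) : merge e e.2 = e.1 := if_pos rfl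

theorem merge_of_ne {e : ℕ × ℕ} {v : ℕ} (h : v ≠ e.2) : merge e v = v := if_neg h

theorem merge_mem {A : Finset ℕ} {e : ℕ × ℕ} (h1 : e.1 ∈ A) (hne : e.1 ≠ e.2) {v : ℕ}
    (hv : v ∈ A) : merge e v ∈ A.erase e.2 := by
  unfold merge
  split_ifs with h
  · exact Finset.mem_erase.2 ⟨hne, h1⟩
  · exact Finset.mem_erase.2 ⟨h, hv⟩

theorem ends_erase {E : Multiset (ℕ × ℕ)} {e : ℕ × ℕ} (he : e ∈ E) (v : ℕ) :
    ends E v = ((if e.1 = v then 1 else 0) + (if e.2 = v then 1 else 0)) + ends (E.erase e) v := by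
  conv_lhs => rw [← Multiset.cons_erase he]
  simp [ends]

theorem ends_map_merge_self {e : ℕ × ℕ} (hne : e.1 ≠ e.2) (E : Multiset (ℕ × ℕ)) :
    ends (E.map (Prod.map (merge e) (merge e))) e.1 = ends E e.1 + ends E e.2 := by
  induction E using Multiset.induction with
  | empty => simp [ends]
  | cons a E ih =>
    have h : ∀ v, (if merge e v = e.1 then 1 else 0) =
        (if v = e.1 then 1 else 0) + (if v = e.2 then 1 else 0) := by
      intro v; unfold merge; split_ifs <;> omega
    simp only [ends, Multiset.map_cons, Multiset.sum_cons, Prod.map_fst, Prod.map_snd, h] at ih ⊢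
    omega

theorem ends_map_merge_of_ne {e : ℕ × ℕ} {v : ℕ} (h1 : v ≠ e.1) (h2 : v ≠ e.2)
    (E : Multiset (ℕ × ℕ)) :
    ends (E.map (Prod.map (merge e) (merge e))) v = ends E v := by
  induction E using Multiset.induction with
  | empty => simp [ends]
  | cons a E ih =>
    have h : ∀ u, (if merge e u = v then 1 else 0) = (if u = v then 1 else 0) := by
      intro u; unfold merge; split_ifs <;> omega
    simp only [ends, Multiset.map_cons, Multiset.sum_cons, Prod.map_fst, Prod.map_snd, h] at ih ⊢
    omega

/-- Contracting an edge that is not a loop produces a vertex of valence `a + b - 2` from vertices of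
valences `a` and `b`, so it preserves the condition that all valences are at least `2`. -/
theorem IsGraphOn.contract {k : ℕ} (hk : k = 0 ∨ k = 2) {A : Finset ℕ} {E : Multiset (ℕ × ℕ)}
    (h : IsGraphOn k A E) {e : ℕ × ℕ} (he : e ∈ E) (hne : e.1 ≠ e.2) :
    IsGraphOn k (A.erase (enorm e).2)
      ((E.erase e).map (Prod.map (merge (enorm e)) (merge (enorm e)))) := by
  have hne' := (enorm_lt hne).ne
  have hm := enorm_mem (h.mem e he)
  constructor
  · intro a ha
    obtain ⟨a', ha', rfl⟩ := Multiset.mem_map.1 ha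
    have := h.mem a' (Multiset.mem_of_mem_erase ha')
    exact ⟨merge_mem hm.1 hne' this.1, merge_mem hm.1 hne' this.2⟩
  · intro v hv
    obtain ⟨hv2, hvA⟩ := Finset.mem_erase.1 hv
    have e1 : ∀ v, (if e.1 = v then 1 else 0) + (if e.2 = v then 1 else 0) =
        (if (enorm e).1 = v then 1 else 0) + (if (enorm e).2 = v then 1 else 0) := by
      intro v
      rcases le_total e.1 e.2 with h' | h' <;> simp [ZinbAs.enorm, h', add_comm]
    by_cases hv1 : v = (enorm e).1
    · subst hv1
      rw [ends_map_merge_self hne']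
      have h1 := ends_erase he (enorm e).1
      have h2 := ends_erase he (enorm e).2
      rw [e1, if_pos rfl, if_neg (Ne.symm hne')] at h1
      rw [e1, if_pos rfl, if_neg hne'] at h2
      have h3 := h.le_ends _ hm.1
      have h4 := h.le_ends _ hm.2
      omega
    · rw [ends_map_merge_of_ne hv1 hv2]
      have h1 := ends_erase he v
      rw [e1, if_neg (Ne.symm hv1), if_neg (Ne.symm hv2)] at h1
      have h3 := h.le_ends _ hvA
      omega

end Contraction

/-! ### The differential of graphs -/

section Differential

variable (K : Type*) [Field K] (k : ℕ)

/-- The summand of the differential of `graphElt A E` given by the contraction of the edge `e`; the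
removed vertex is the larger end of `e`. The factor `edgeSign e` makes this compatible with changes
of the orientation of `e`, and it is zero for loops. -/
def dTerm (A : Finset ℕ) (E : Multiset (ℕ × ℕ)) (e : ℕ × ℕ) : GraphAlg K k :=
  edgeSign K e • (-1 : K) ^ SymGraph.rank A (enorm e).2 • graphElt K k (A.erase (enorm e).2)
    ((E.erase e).map (Prod.map (merge (enorm e)) (merge (enorm e))))

variable {K k}

theorem graphD_single (G : SymGraph.minValence k) :
    graphD K k (AddMonoidAlgebra.single G 1) = (G.1.edges.map fun e => (-1 : K) ^ e.2 •
      graphElt K k (Finset.Icc 1 (G.1.n - 1))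
        ((G.1.edges.erase e).map
          (Prod.map (SymGraph.std e.1 e.2) (SymGraph.std e.1 e.2)))).sum := by
  have h : (AddMonoidAlgebra.single G 1 : GraphAlg K k) =
    AddMonoidAlgebra.basis (SymGraph.minValence k) K G := by simp
  rw [h, graphD, Module.Basis.constr_basis, ← Multiset.attach_map_val' G.1.edges]
  simp only [orientedClass_eq_graphElt]
  rfl

theorem graphD_graphElt_of_lt {A : Finset ℕ} {E : Multiset (ℕ × ℕ)} (h : IsGraphOn k A E)
    (hlt : ∀ e ∈ E, e.1 < e.2) :
    graphD K k (graphElt K k A E) = (E.map (dTerm K k A E)).sum := by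
  have hmem := h.stdGraph_mem hlt
  rw [graphElt_of_lt A hlt, graphBasis, dif_pos hmem, graphD_single]
  simp only [stdGraph_edges h.mem hlt]
  rw [Multiset.map_map]
  congr 1
  refine Multiset.map_congr rfl fun e he => ?_
  have hlt' := hlt e he
  obtain ⟨h1, h2⟩ := h.mem e he
  rw [Function.comp_apply, dTerm, enorm_of_lt hlt', edgeSign_of_lt hlt', one_smul,
    ← Multiset.map_erase_of_mem _ _ he, Multiset.map_map]
  congr 1
  -- renumbering `A ∖ {e.2}`
  let f : ℕ → ℕ := fun v => if SymGraph.rank A e.2 < SymGraph.rank A v then SymGraph.rank A v - 1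
    else SymGraph.rank A v
  have hr := rank_strictMonoOn A
  have hf : StrictMonoOn f (A.erase e.2) := by
    intro u hu v hv huv
    obtain ⟨hu2, hu⟩ := Finset.mem_erase.1 hu
    obtain ⟨hv2, hv⟩ := Finset.mem_erase.1 hv
    have h3 := hr hu hv huv
    have h4 : SymGraph.rank A u ≠ SymGraph.rank A e.2 := fun h => hu2 (hr.injOn hu h2 h)
    have h5 : SymGraph.rank A v ≠ SymGraph.rank A e.2 := fun h => hv2 (hr.injOn hv h2 h)
    simp only [f]
    split_ifs <;> omega
  have himg : (A.erase e.2).image f = Finset.Icc 1 (A.card - 1) := by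
    refine Finset.eq_of_subset_of_card_le (fun x hx => ?_) ?_
    · obtain ⟨v, hv, rfl⟩ := Finset.mem_image.1 hx
      obtain ⟨hv2, hv⟩ := Finset.mem_erase.1 hv
      have h3 := Finset.mem_Icc.1 (rank_mem_Icc hv)
      have h4 := Finset.mem_Icc.1 (rank_mem_Icc h2)
      have h5 : SymGraph.rank A v ≠ SymGraph.rank A e.2 := fun h => hv2 (hr.injOn hv h2 h)
      simp only [f, Finset.mem_Icc]
      split_ifs <;> omega
    · rw [Finset.card_image_of_injOn hf.injOn, Finset.card_erase_of_mem h2]; simp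
  have hE' : ∀ a ∈ (E.erase e).map (Prod.map (merge e) (merge e)),
      a.1 ∈ A.erase e.2 ∧ a.2 ∈ A.erase e.2 := by
    intro a ha
    obtain ⟨a', ha', rfl⟩ := Multiset.mem_map.1 ha
    have := h.mem a' (Multiset.mem_of_mem_erase ha')
    exact ⟨merge_mem h1 hlt'.ne this.1, merge_mem h1 hlt'.ne this.2⟩
  rw [← graphElt_image hf hE', himg, Multiset.map_map]
  congr 1
  refine Multiset.map_congr rfl fun a ha => ?_
  have key : ∀ v ∈ A, SymGraph.std (SymGraph.rank A e.1) (SymGraph.rank A e.2)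
      (SymGraph.rank A v) = f (merge e v) := by
    intro v hv
    have h6 := hr h1 h2 hlt'
    by_cases hv2 : v = e.2
    · subst hv2
      rw [merge_snd]
      simp only [SymGraph.std, f, if_true]
      rw [if_neg (by omega)]
    · have h5 : SymGraph.rank A v ≠ SymGraph.rank A e.2 := fun h => hv2 (hr.injOn hv h2 h)
      rw [merge_of_ne hv2, SymGraph.std, if_neg h5]
  have := h.mem a (Multiset.mem_of_mem_erase ha)
  exact Prod.ext (key _ this.1) (key _ this.2)

/-- Reorienting an edge before the ends are relabelled changes the sign of the edge consistently,
even if the relabelling is not monotone or makes the edge a loop. -/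
theorem edgeSign_mul_edgeSign_map {φ : ℕ → ℕ} {e : ℕ × ℕ} (h : e.1 ≠ e.2) :
    edgeSign K e * edgeSign K (Prod.map φ φ (enorm e)) = edgeSign K (Prod.map φ φ e) := by
  rcases lt_or_gt_of_ne h with h | h
  · rw [edgeSign_of_lt h, enorm_of_lt h, one_mul]
  · have : enorm e = (e.2, e.1) := Prod.ext (by simp [enorm]; omega) (by simp [enorm]; omega)
    rw [this]
    simp only [edgeSign, if_neg (not_lt.2 h.le), if_pos h, Prod.map_fst, Prod.map_snd]
    rcases lt_trichotomy (φ e.1) (φ e.2) with h' | h' | h'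
    · simp [h', not_lt.2 h'.le]
    · simp [h']
    · simp [h', not_lt.2 h'.le]

theorem prod_edgeSign_smul_graphElt_map (A : Finset ℕ) {F : Multiset (ℕ × ℕ)} (φ : ℕ → ℕ)
    (h : ∀ e ∈ F, e.1 ≠ e.2) :
    (F.map (edgeSign K)).prod • graphElt K k A ((F.map enorm).map (Prod.map φ φ)) =
      graphElt K k A (F.map (Prod.map φ φ)) := by
  rw [graphElt, graphElt, smul_smul]
  simp only [Multiset.map_map]
  congr 1
  · rw [← Multiset.prod_map_mul]
    congr 1
    exact Multiset.map_congr rfl fun e he => edgeSign_mul_edgeSign_map (h e he)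
  · congr 2
    refine Multiset.map_congr rfl fun e _ => ?_
    rcases le_total e.1 e.2 with h | h
    · simp [enorm, h]
    · simp [enorm, h, min_comm, max_comm]

/-- The differential of a graph with arbitrary vertex labels and orientations. -/
theorem graphD_graphElt {A : Finset ℕ} {E : Multiset (ℕ × ℕ)} (h : IsGraphOn k A E) :
    graphD K k (graphElt K k A E) = (E.map (dTerm K k A E)).sum := by
  by_cases hl : ∀ e ∈ E, e.1 ≠ e.2
  · rw [graphElt_eq_smul A hl, map_smul, graphD_graphElt_of_lt h.map_enorm, Multiset.map_map,
      Multiset.smul_sum, Multiset.map_map]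
    · congr 1
      refine Multiset.map_congr rfl fun e he => ?_
      have hlt := enorm_lt (hl e he)
      simp only [Function.comp_apply, dTerm, enorm_of_lt hlt, edgeSign_of_lt hlt, one_smul]
      rw [← Multiset.map_erase_of_mem _ _ he]
      have : (E.map (edgeSign K)).prod = edgeSign K e * ((E.erase e).map (edgeSign K)).prod := by
        conv_lhs => rw [← Multiset.cons_erase he]
        rw [Multiset.map_cons, Multiset.prod_cons]
      rw [this, ← prod_edgeSign_smul_graphElt_map (F := E.erase e) _ _ fun a ha =>
        hl a (Multiset.mem_of_mem_erase ha)]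
      simp only [smul_smul]
      congr 1
      ring
    · intro a ha
      obtain ⟨a', ha', rfl⟩ := Multiset.mem_map.1 ha
      exact enorm_lt (hl a' ha')
  · push Not at hl
    obtain ⟨l, hl, hl'⟩ := hl
    rw [graphElt_of_loop A hl hl', map_zero]
    refine (Multiset.sum_eq_zero fun x hx => ?_).symm
    obtain ⟨e, he, rfl⟩ := Multiset.mem_map.1 hx
    rw [dTerm]
    by_cases hel : e.1 = e.2
    · simp [edgeSign, hel]
    · have hne : l ≠ e := by rintro rfl; exact hel hl'
      rw [graphElt_of_loop _ (Multiset.mem_map.2 ⟨l, (Multiset.mem_erase_of_ne hne).2 hl, rfl⟩)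
        (by simp [hl']), smul_zero, smul_zero]

theorem multiset_sum_erase_swap {α M : Type*} [DecidableEq α] [AddCommGroup M] (E : Multiset α)
    (F : α → α → M) : (E.map fun a => ((E.erase a).map (F a)).sum).sum =
      (E.map fun a => ((E.erase a).map fun b => F b a).sum).sum := by
  have h : ∀ (g : α → M), ∀ a ∈ E, ((E.erase a).map g).sum = (E.map g).sum - g a := by
    intro g a ha
    rw [← Multiset.sum_map_erase ha, add_sub_cancel_left]
  rw [Multiset.map_congr rfl fun a ha => h (F a) a ha,
    Multiset.map_congr rfl fun a ha => h (fun b => F b a) a ha, Multiset.sum_map_sub,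
    Multiset.sum_map_sub, Multiset.sum_map_sum_map]

theorem rank_erase_of_le {A : Finset ℕ} {u v : ℕ} (hu : u ∈ A) (h : u ≤ v) :
    SymGraph.rank A v = SymGraph.rank (A.erase u) v + 1 := by
  have : (A.erase u).filter (· ≤ v) = (A.filter (· ≤ v)).erase u := by
    ext x; simp only [Finset.mem_filter, Finset.mem_erase]; tauto
  have hu' : u ∈ A.filter (· ≤ v) := by simp [hu, h]
  rw [SymGraph.rank, SymGraph.rank, this, Finset.card_erase_of_mem hu']
  have := Finset.card_pos.2 ⟨u, hu'⟩
  omega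

theorem rank_erase_of_gt {A : Finset ℕ} {u v : ℕ} (h : v < u) :
    SymGraph.rank (A.erase u) v = SymGraph.rank A v := by
  have : (A.erase u).filter (· ≤ v) = A.filter (· ≤ v) := by
    ext x; simp only [Finset.mem_filter, Finset.mem_erase]; constructor
    · tauto
    · rintro ⟨h1, h2⟩; exact ⟨⟨by omega, h1⟩, h2⟩
  rw [SymGraph.rank, SymGraph.rank, this]

/-- The contraction of the edge `e` followed by that of the edge `e'`, with the signs of the
differential; both edges are assumed to be oriented from the smaller to the larger end. -/
def dTerm₂ (K : Type*) [Field K] (k : ℕ) (A : Finset ℕ) (E : Multiset (ℕ × ℕ)) (e e' : ℕ × ℕ) :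
    GraphAlg K k :=
  (-1 : K) ^ SymGraph.rank A e.2 • dTerm K k (A.erase e.2)
    ((Prod.map (merge e) (merge e) e') ::ₘ
      ((E.erase e).erase e').map (Prod.map (merge e) (merge e)))
    (Prod.map (merge e) (merge e) e')

/-- If the removed vertices differ, contracting in the other order changes the sign because one
vertex shifts the position of the other. -/
theorem dTerm₂_swap_of_lt {A : Finset ℕ} {E : Multiset (ℕ × ℕ)} {e e' : ℕ × ℕ} (h : e.1 < e.2)
    (h' : e'.1 < e'.2) (hA : e.2 ∈ A) (hlt : e.2 < e'.2) :
    dTerm₂ K k A E e e' = - dTerm₂ K k A E e' e := by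
  have e1 : Prod.map (merge e) (merge e) e' = (merge e e'.1, e'.2) :=
    Prod.ext rfl (merge_of_ne (by omega))
  have e2 : Prod.map (merge e') (merge e') e = e :=
    Prod.ext (merge_of_ne (by omega)) (merge_of_ne (by omega))
  have hm : merge e e'.1 < e'.2 := by unfold merge; split_ifs <;> omega
  have hr := rank_erase_of_le hA hlt.le
  rw [dTerm₂, dTerm₂, dTerm, dTerm, e1, e2, enorm_of_lt h,
    enorm_of_lt (e := (merge e e'.1, e'.2)) hm,
    edgeSign_of_lt h, edgeSign_of_lt (e := (merge e e'.1, e'.2)) hm, one_smul, one_smul,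
    Multiset.erase_cons_head, Multiset.erase_cons_head, Multiset.map_map, Multiset.map_map,
    Finset.erase_right_comm,
    Multiset.erase_comm, rank_erase_of_gt hlt, hr, smul_smul, smul_smul, ← neg_smul]
  congr 1
  · ring
  · congr 1
    refine Multiset.map_congr rfl fun a _ => ?_
    have key : ∀ v, merge (merge e e'.1, e'.2) (merge e v) = merge e (merge e' v) := by
      intro v; simp only [merge]; split_ifs <;> omega
    exact Prod.ext (key _) (key _)

/-- If the two edges have the same larger end, one order of contraction reverses the second edge. -/
theorem dTerm₂_swap_of_eq {A : Finset ℕ} {E : Multiset (ℕ × ℕ)} {e e' : ℕ × ℕ} (h : e.1 < e.2)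
    (h' : e'.1 < e'.2) (heq : e.2 = e'.2) (hlt : e.1 < e'.1) :
    dTerm₂ K k A E e e' = - dTerm₂ K k A E e' e := by
  have e1 : Prod.map (merge e) (merge e) e' = (e'.1, e.1) :=
    Prod.ext (merge_of_ne (by omega)) (by simp [← heq, merge_snd])
  have e2 : Prod.map (merge e') (merge e') e = (e.1, e'.1) :=
    Prod.ext (merge_of_ne (by omega)) (by simp [heq, merge_snd])
  have hn : enorm (e'.1, e.1) = (e.1, e'.1) :=
    Prod.ext (by simp [enorm]; omega) (by simp [enorm]; omega)
  have hs : edgeSign K (e'.1, e.1) = -1 := by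
    rw [edgeSign, if_neg (by simp; omega), if_pos (by simpa using hlt)]
  rw [dTerm₂, dTerm₂, dTerm, dTerm, e1, e2, hn, hs, enorm_of_lt (e := (e.1, e'.1)) hlt,
    edgeSign_of_lt (e := (e.1, e'.1)) hlt, Multiset.erase_cons_head,
    Multiset.erase_cons_head, Multiset.map_map, Multiset.map_map, heq,
    Multiset.erase_comm, one_smul, neg_smul, one_smul, smul_neg]
  congr 4
  refine Multiset.map_congr rfl fun a _ => ?_
  have key : ∀ v, merge (e.1, e'.1) (merge e v) = merge (e.1, e'.1) (merge e' v) := by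
    intro v; simp only [merge]; split_ifs <;> omega
  exact Prod.ext (key _) (key _)

theorem dTerm₂_swap {A : Finset ℕ} {E : Multiset (ℕ × ℕ)} {e e' : ℕ × ℕ} (h : e.1 < e.2)
    (h' : e'.1 < e'.2) (hA : e.2 ∈ A) (hA' : e'.2 ∈ A) :
    dTerm₂ K k A E e e' = - dTerm₂ K k A E e' e := by
  rcases lt_trichotomy e.2 e'.2 with h2 | h2 | h2
  · exact dTerm₂_swap_of_lt h h' hA h2
  · rcases lt_trichotomy e.1 e'.1 with h1 | h1 | h1
    · exact dTerm₂_swap_of_eq h h' h2 h1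
    · -- parallel edges: the contraction of one makes the other a loop
      obtain rfl : e = e' := Prod.ext h1 h2
      have : edgeSign K (Prod.map (merge e) (merge e) e) = 0 := by
        have hm : merge e e.1 = merge e e.2 := by simp only [merge]; split_ifs <;> omega
        simp [edgeSign, hm]
      simp [dTerm₂, dTerm, this]
    · rw [dTerm₂_swap_of_eq h' h h2.symm h1, neg_neg]
  · rw [dTerm₂_swap_of_lt h' h hA' h2, neg_neg]

/-- The differential squares to zero: `δ² G` is the sum over the ordered pairs of different edges of
the contraction of both of them, and the two orders have opposite signs. -/
theorem graphD_graphD [CharZero K] (hk : k = 0 ∨ k = 2) (x : GraphAlg K k) :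
    graphD K k (graphD K k x) = 0 := by
  induction x using graphAlg_induction with
  | zero => simp
  | add x y hx hy => rw [map_add, map_add, hx, hy, add_zero]
  | smul c x hx => rw [map_smul, map_smul, hx, smul_zero]
  | elt n E hE hlt =>
    have e1 : graphD K k (graphD K k (graphElt K k (Finset.Icc 1 n) E)) =
        (E.map fun e => ((E.erase e).map (dTerm₂ K k (Finset.Icc 1 n) E e)).sum).sum := by
      rw [graphD_graphElt hE, map_multiset_sum, Multiset.map_map]
      congr 1
      refine Multiset.map_congr rfl fun e he => ?_
      have hc := hE.contract hk he (hlt e he).ne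
      rw [enorm_of_lt (hlt e he)] at hc
      rw [Function.comp_apply, dTerm, map_smul, map_smul, enorm_of_lt (hlt e he),
        edgeSign_of_lt (hlt e he), one_smul, graphD_graphElt hc, Multiset.smul_sum,
        Multiset.map_map, Multiset.map_map]
      congr 1
      refine Multiset.map_congr rfl fun e' he' => ?_
      rw [Function.comp_apply, Function.comp_apply, dTerm₂]
      congr 2
      rw [← Multiset.map_cons, Multiset.cons_erase he']
    have e2 := multiset_sum_erase_swap E (dTerm₂ K k (Finset.Icc 1 n) E)
    have e3 : (E.map fun a => ((E.erase a).map fun b => dTerm₂ K k (Finset.Icc 1 n) E b a).sum).sum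
        = - (E.map fun e => ((E.erase e).map (dTerm₂ K k (Finset.Icc 1 n) E e)).sum).sum := by
      rw [← Multiset.sum_map_neg', Multiset.map_map]
      congr 1
      refine Multiset.map_congr rfl fun a ha => ?_
      rw [Function.comp_apply, ← Multiset.sum_map_neg', Multiset.map_map]
      congr 1
      refine Multiset.map_congr rfl fun b hb => ?_
      have hb' := Multiset.mem_of_mem_erase hb
      exact dTerm₂_swap (hlt b hb') (hlt a ha) (hE.mem b hb').2 (hE.mem a ha).2
    rw [e1]
    rw [e3] at e2
    have e4 : (2 : K) • (E.map fun e =>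
        ((E.erase e).map (dTerm₂ K k (Finset.Icc 1 n) E e)).sum).sum = 0 := by
      rw [two_smul]
      nth_rewrite 1 [e2]
      exact neg_add_cancel _
    -- an element that equals its negative is zero, as `2 ≠ 0`
    exact (smul_eq_zero.1 e4).resolve_left two_ne_zero

end Differential

section ClosedSets

/-! ### Unions of connected components -/

/-- The number of pairs `u < v` with `u` in `U` and `v` in `V`. For the unshuffle of the vertices
into `V` followed by `U` this is the number of inversions. -/
def invCount (U V : Finset ℕ) : ℕ := ((U ×ˢ V).filter fun p => p.1 < p.2).card

theorem invCount_union_left {U U' V : Finset ℕ} (h : Disjoint U U') :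
    invCount (U ∪ U') V = invCount U V + invCount U' V := by
  rw [invCount, Finset.union_product, Finset.filter_union, Finset.card_union_of_disjoint]
  · rfl
  · refine Finset.disjoint_filter_filter ?_
    rw [Finset.disjoint_product]
    exact Or.inl h

theorem invCount_union_right {U V V' : Finset ℕ} (h : Disjoint V V') :
    invCount U (V ∪ V') = invCount U V + invCount U V' := by
  rw [invCount, Finset.product_union, Finset.filter_union, Finset.card_union_of_disjoint]
  · rfl
  · refine Finset.disjoint_filter_filter ?_
    rw [Finset.disjoint_product]
    exact Or.inr h

theorem invCount_empty_left (V : Finset ℕ) : invCount ∅ V = 0 := by simp [invCount]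

theorem invCount_of_lt {U V : Finset ℕ} (h : ∀ u ∈ U, ∀ v ∈ V, u < v) :
    invCount U V = U.card * V.card := by
  rw [invCount, Finset.filter_true_of_mem, Finset.card_product]
  intro p hp
  rw [Finset.mem_product] at hp
  exact h _ hp.1 _ hp.2

theorem invCount_of_gt {U V : Finset ℕ} (h : ∀ u ∈ U, ∀ v ∈ V, v < u) : invCount U V = 0 := by
  rw [invCount, Finset.filter_false_of_mem, Finset.card_empty]
  intro p hp
  rw [Finset.mem_product] at hp
  exact (h _ hp.1 _ hp.2).le.not_gt

theorem invCount_add_swap {U V : Finset ℕ} (h : Disjoint U V) :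
    invCount U V + invCount V U = U.card * V.card := by
  have h1 : invCount V U = ((U ×ˢ V).filter fun p => ¬ p.1 < p.2).card := by
    refine Finset.card_bij (fun p _ => p.swap) ?_ ?_ ?_
    · intro p hp
      simp only [Finset.mem_filter, Finset.mem_product, Prod.fst_swap, Prod.snd_swap] at hp ⊢
      exact ⟨⟨hp.1.2, hp.1.1⟩, by omega⟩
    · intro p _ q _ hpq
      exact Prod.swap_injective hpq
    · intro p hp
      simp only [Finset.mem_filter, Finset.mem_product] at hp
      have hne : p.1 ≠ p.2 := fun he => Finset.disjoint_left.1 h hp.1.1 (he ▸ hp.1.2)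
      exact ⟨p.swap, by
        simp only [Finset.mem_filter, Finset.mem_product, Prod.fst_swap, Prod.snd_swap]
        exact ⟨⟨hp.1.2, hp.1.1⟩, by omega⟩, p.swap_swap⟩
  rw [h1, invCount, Finset.card_filter_add_card_filter_not, Finset.card_product]

theorem invCount_image {U V A : Finset ℕ} {f : ℕ → ℕ} (hf : StrictMonoOn f A) (hU : U ⊆ A)
    (hV : V ⊆ A) : invCount (U.image f) (V.image f) = invCount U V := by
  refine (Finset.card_bij (fun p _ => Prod.map f f p) ?_ ?_ ?_).symm
  · intro p hp
    simp only [Finset.mem_filter, Finset.mem_product, Prod.map_fst, Prod.map_snd] at hp ⊢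
    exact ⟨⟨Finset.mem_image_of_mem f hp.1.1, Finset.mem_image_of_mem f hp.1.2⟩,
      hf (hU hp.1.1) (hV hp.1.2) hp.2⟩
  · intro p hp q hq hpq
    simp only [Finset.mem_filter, Finset.mem_product] at hp hq
    have h1 := congrArg Prod.fst hpq
    have h2 := congrArg Prod.snd hpq
    exact Prod.ext (hf.injOn (hU hp.1.1) (hU hq.1.1) h1) (hf.injOn (hV hp.1.2) (hV hq.1.2) h2)
  · rintro ⟨x, y⟩ hp
    simp only [Finset.mem_filter, Finset.mem_product, Finset.mem_image] at hp
    obtain ⟨⟨⟨u, hu, rfl⟩, ⟨v, hv, rfl⟩⟩, h⟩ := hp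
    exact ⟨(u, v), by
      simp only [Finset.mem_filter, Finset.mem_product]
      exact ⟨⟨hu, hv⟩, (hf.lt_iff_lt (hU hu) (hV hv)).1 h⟩, rfl⟩

/-- No edge leaves the set `C`. -/
def ClosedIn (E : Multiset (ℕ × ℕ)) (C : Finset ℕ) : Prop := ∀ e ∈ E, e.1 ∈ C ↔ e.2 ∈ C

/-- The edges between vertices in `C`. -/
def edgesIn (E : Multiset (ℕ × ℕ)) (C : Finset ℕ) : Multiset (ℕ × ℕ) :=
  E.filter fun e => e.1 ∈ C ∧ e.2 ∈ C

/-- The set `C` contains the smallest element of `A`. -/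
def HasMin (A C : Finset ℕ) : Prop := ∃ a ∈ C, ∀ b ∈ A, a ≤ b

open Classical in
/-- The closed sets of vertices. -/
def closedSets (A : Finset ℕ) (E : Multiset (ℕ × ℕ)) : Finset (Finset ℕ) :=
  A.powerset.filter (ClosedIn E)

open Classical in
/-- The closed sets of vertices that contain the smallest vertex. -/
def closedSetsMin (A : Finset ℕ) (E : Multiset (ℕ × ℕ)) : Finset (Finset ℕ) :=
  (closedSets A E).filter (HasMin A)

theorem mem_closedSets {A C : Finset ℕ} {E : Multiset (ℕ × ℕ)} :
    C ∈ closedSets A E ↔ C ⊆ A ∧ ClosedIn E C := by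
  simp [closedSets]

theorem mem_closedSetsMin {A C : Finset ℕ} {E : Multiset (ℕ × ℕ)} :
    C ∈ closedSetsMin A E ↔ (C ⊆ A ∧ ClosedIn E C) ∧ HasMin A C := by
  simp [closedSetsMin, mem_closedSets]

theorem mem_edgesIn {E : Multiset (ℕ × ℕ)} {C : Finset ℕ} {e : ℕ × ℕ} :
    e ∈ edgesIn E C ↔ e ∈ E ∧ e.1 ∈ C ∧ e.2 ∈ C := Multiset.mem_filter

theorem ClosedIn.sdiff {k : ℕ} {A C : Finset ℕ} {E : Multiset (ℕ × ℕ)} (hE : IsGraphOn k A E)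
    (h : ClosedIn E C) : ClosedIn E (A \ C) := by
  intro e he
  have h1 := hE.mem e he
  simp only [Finset.mem_sdiff, h1, h e he]

/-- A closed subset of a union of components is a union of components. -/
theorem closedIn_edgesIn {C D : Finset ℕ} {E : Multiset (ℕ × ℕ)} (hC : ClosedIn E C)
    (hD : D ⊆ C) : ClosedIn (edgesIn E C) D ↔ ClosedIn E D := by
  constructor
  · intro h e he
    by_cases h1 : e.1 ∈ C
    · exact h e (mem_edgesIn.2 ⟨he, h1, (hC e he).1 h1⟩)
    · have h2 : e.2 ∉ C := fun h2 => h1 ((hC e he).2 h2)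
      exact ⟨fun h3 => absurd (hD h3) h1, fun h3 => absurd (hD h3) h2⟩
  · exact fun h e he => h e (mem_edgesIn.1 he).1

theorem edgesIn_edgesIn {C D : Finset ℕ} (E : Multiset (ℕ × ℕ)) (hD : D ⊆ C) :
    edgesIn (edgesIn E C) D = edgesIn E D := by
  rw [edgesIn, edgesIn, Multiset.filter_filter]
  refine Multiset.filter_congr fun e _ => ?_
  exact ⟨fun h => h.1, fun h => ⟨h, hD h.1, hD h.2⟩⟩

theorem edgesIn_add_edgesIn_sdiff {k : ℕ} {A C : Finset ℕ} {E : Multiset (ℕ × ℕ)}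
    (hE : IsGraphOn k A E) (h : ClosedIn E C) : edgesIn E C + edgesIn E (A \ C) = E := by
  have : edgesIn E (A \ C) = E.filter fun e => ¬ (e.1 ∈ C ∧ e.2 ∈ C) := by
    refine Multiset.filter_congr fun e he => ?_
    have h1 := hE.mem e he
    have h2 := h e he
    simp only [Finset.mem_sdiff, h1, h2]
    tauto
  rw [this, edgesIn, Multiset.filter_add_not]

theorem edgesIn_self {k : ℕ} {A : Finset ℕ} {E : Multiset (ℕ × ℕ)} (hE : IsGraphOn k A E) :
    edgesIn E A = E := Multiset.filter_eq_self.2 hE.mem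

theorem ends_edgesIn {C : Finset ℕ} {E : Multiset (ℕ × ℕ)} (h : ClosedIn E C) {v : ℕ}
    (hv : v ∈ C) : ends (edgesIn E C) v = ends E v := by
  induction E using Multiset.induction with
  | empty => rfl
  | cons e E ih =>
    have ih' := ih fun e' he' => h e' (Multiset.mem_cons_of_mem he')
    have h1 := h e (Multiset.mem_cons_self e E)
    by_cases h2 : e.1 ∈ C
    · rw [edgesIn, Multiset.filter_cons_of_pos (p := fun e : ℕ × ℕ => e.1 ∈ C ∧ e.2 ∈ C) _
        ⟨h2, h1.1 h2⟩]
      simp only [ends, Multiset.map_cons, Multiset.sum_cons] at ih' ⊢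
      rw [← ih']; rfl
    · have h3 : e.2 ∉ C := fun h3 => h2 (h1.2 h3)
      rw [edgesIn, Multiset.filter_cons_of_neg (p := fun e : ℕ × ℕ => e.1 ∈ C ∧ e.2 ∈ C) _
        (fun h => h2 h.1)]
      have h4 : e.1 ≠ v := fun h => h2 (h ▸ hv)
      have h5 : e.2 ≠ v := fun h => h3 (h ▸ hv)
      simp only [ends, Multiset.map_cons, Multiset.sum_cons, if_neg h4, if_neg h5] at ih' ⊢
      rw [zero_add, zero_add, ← ih']; rfl

theorem IsGraphOn.edgesIn {k : ℕ} {A C : Finset ℕ} {E : Multiset (ℕ × ℕ)} (hE : IsGraphOn k A E)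
    (hC : C ⊆ A) (h : ClosedIn E C) : IsGraphOn k C (edgesIn E C) where
  mem e he := (mem_edgesIn.1 he).2
  le_ends v hv := by rw [ends_edgesIn h hv]; exact hE.le_ends v (hC hv)

theorem IsGraphOn.edges_empty {k : ℕ} {E : Multiset (ℕ × ℕ)} (hE : IsGraphOn k ∅ E) : E = 0 :=
  Multiset.eq_zero_of_forall_notMem fun e he => by simpa using (hE.mem e he).1

theorem closedIn_map {A C : Finset ℕ} {E : Multiset (ℕ × ℕ)} {f : ℕ → ℕ} (hf : Set.InjOn f A)
    (hE : ∀ e ∈ E, e.1 ∈ A ∧ e.2 ∈ A) (hC : C ⊆ A) :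
    ClosedIn (E.map (Prod.map f f)) (C.image f) ↔ ClosedIn E C := by
  have key : ∀ v ∈ A, f v ∈ C.image f ↔ v ∈ C := by
    intro v hv
    refine ⟨fun h => ?_, Finset.mem_image_of_mem f⟩
    obtain ⟨u, hu, h⟩ := Finset.mem_image.1 h
    exact hf (hC hu) hv h ▸ hu
  constructor
  · intro h e he
    have := h _ (Multiset.mem_map_of_mem _ he)
    rwa [Prod.map_fst, Prod.map_snd, key _ (hE e he).1, key _ (hE e he).2] at this
  · intro h e' he'
    obtain ⟨e, he, rfl⟩ := Multiset.mem_map.1 he'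
    rw [Prod.map_fst, Prod.map_snd, key _ (hE e he).1, key _ (hE e he).2]
    exact h e he

theorem edgesIn_map {A C : Finset ℕ} {E : Multiset (ℕ × ℕ)} {f : ℕ → ℕ} (hf : Set.InjOn f A)
    (hE : ∀ e ∈ E, e.1 ∈ A ∧ e.2 ∈ A) (hC : C ⊆ A) :
    edgesIn (E.map (Prod.map f f)) (C.image f) = (edgesIn E C).map (Prod.map f f) := by
  have key : ∀ v ∈ A, f v ∈ C.image f ↔ v ∈ C := by
    intro v hv
    refine ⟨fun h => ?_, Finset.mem_image_of_mem f⟩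
    obtain ⟨u, hu, h⟩ := Finset.mem_image.1 h
    exact hf (hC hu) hv h ▸ hu
  rw [edgesIn, Multiset.filter_map, edgesIn]
  congr 1
  refine Multiset.filter_congr fun e he => ?_
  rw [Function.comp_apply, Prod.map_fst, Prod.map_snd, key _ (hE e he).1, key _ (hE e he).2]

theorem hasMin_image {A C : Finset ℕ} {f : ℕ → ℕ} (hf : StrictMonoOn f A) (hC : C ⊆ A) :
    HasMin (A.image f) (C.image f) ↔ HasMin A C := by
  constructor
  · rintro ⟨a, ha, h⟩
    obtain ⟨a', ha', rfl⟩ := Finset.mem_image.1 ha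
    exact ⟨a', ha', fun b hb => (hf.le_iff_le (hC ha') hb).1 (h _ (Finset.mem_image_of_mem f hb))⟩
  · rintro ⟨a, ha, h⟩
    refine ⟨f a, Finset.mem_image_of_mem f ha, fun b hb => ?_⟩
    obtain ⟨b', hb', rfl⟩ := Finset.mem_image.1 hb
    exact (hf.le_iff_le (hC ha) hb').2 (h b' hb')

theorem hasMin_or_sdiff {A C : Finset ℕ} (hA : A.Nonempty) (h : ¬ HasMin A C) :
    HasMin A (A \ C) := by
  refine ⟨A.min' hA, Finset.mem_sdiff.2 ⟨Finset.min'_mem A hA, fun hm => h ?_⟩,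
    fun b hb => Finset.min'_le A b hb⟩
  exact ⟨_, hm, fun b hb => Finset.min'_le A b hb⟩

theorem HasMin.not_sdiff {A C : Finset ℕ} (hC : C ⊆ A) (h : HasMin A C) : ¬ HasMin A (A \ C) := by
  rintro ⟨b, hb, hb'⟩
  obtain ⟨a, ha, ha'⟩ := h
  rw [Finset.mem_sdiff] at hb
  exact hb.2 (le_antisymm (hb' a (hC ha)) (ha' b hb.1) ▸ ha)

end ClosedSets

section Cooperation

variable (K : Type*) [Field K] (k : ℕ)

/-- The summand of the cooperation of `graphElt A E` given by the set `C` of vertices. -/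
def coprodTerm (A : Finset ℕ) (E : Multiset (ℕ × ℕ)) (C : Finset ℕ) :
    GraphAlg K k ⊗[K] GraphAlg K k :=
  (-1 : K) ^ invCount (A \ C) C •
    (graphElt K k C (edgesIn E C) ⊗ₜ[K] graphElt K k (A \ C) (edgesIn E (A \ C)))

variable {K k}

theorem edgesIn_map_enorm (E : Multiset (ℕ × ℕ)) (C : Finset ℕ) :
    edgesIn (E.map enorm) C = (edgesIn E C).map enorm := by
  rw [edgesIn, Multiset.filter_map, edgesIn]
  congr 1
  refine Multiset.filter_congr fun e _ => ?_
  rcases le_total e.1 e.2 with h | h <;> simp [enorm, h, and_comm]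

theorem closedIn_map_enorm {E : Multiset (ℕ × ℕ)} {C : Finset ℕ} :
    ClosedIn (E.map enorm) C ↔ ClosedIn E C := by
  simp only [ClosedIn, Multiset.mem_map, forall_exists_index, and_imp, forall_apply_eq_imp_iff₂]
  refine forall₂_congr fun e _ => ?_
  rcases le_total e.1 e.2 with h | h <;> simp [enorm, h, iff_comm]

theorem closedSetsMin_map_enorm (A : Finset ℕ) (E : Multiset (ℕ × ℕ)) :
    closedSetsMin A (E.map enorm) = closedSetsMin A E := by
  ext C
  simp only [mem_closedSetsMin, closedIn_map_enorm]

theorem graphCoprod_single (G : SymGraph.minValence k) :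
    graphCoprod K k (AddMonoidAlgebra.single G 1) =
      ∑ C ∈ closedSetsMin (Finset.Icc 1 G.1.n) G.1.edges,
        coprodTerm K k (Finset.Icc 1 G.1.n) G.1.edges C := by
  have h : (AddMonoidAlgebra.single G 1 : GraphAlg K k) =
    AddMonoidAlgebra.basis (SymGraph.minValence k) K G := by simp
  rw [h, graphCoprod, Module.Basis.constr_basis]
  refine Finset.sum_congr ?_ fun C _ => ?_
  · ext C
    simp only [Finset.mem_filter, Finset.mem_powerset, mem_closedSetsMin]
    constructor
    · rintro ⟨h1, h2, h3⟩
      exact ⟨⟨h1, h3⟩, 1, h2, fun b hb => (Finset.mem_Icc.1 hb).1⟩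
    · rintro ⟨⟨h1, h3⟩, a, ha, h⟩
      have h4 := Finset.mem_Icc.1 (h1 ha)
      have h5 := h 1 (Finset.mem_Icc.2 ⟨le_rfl, by omega⟩)
      have : a = 1 := by omega
      exact ⟨h1, this ▸ ha, h3⟩
  · rw [graphBasis_induce, graphBasis_induce]; rfl

theorem graphCoprod_graphElt_of_lt {A : Finset ℕ} {E : Multiset (ℕ × ℕ)} (h : IsGraphOn k A E)
    (hlt : ∀ e ∈ E, e.1 < e.2) :
    graphCoprod K k (graphElt K k A E) = ∑ C ∈ closedSetsMin A E, coprodTerm K k A E C := by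
  have hmem := h.stdGraph_mem hlt
  have hr := rank_strictMonoOn A
  rw [graphElt_of_lt A hlt, graphBasis, dif_pos hmem, graphCoprod_single]
  simp only [stdGraph_edges h.mem hlt]
  change ∑ C ∈ closedSetsMin (Finset.Icc 1 A.card) _, coprodTerm K k (Finset.Icc 1 A.card) _ C = _
  rw [← image_rank]
  symm
  refine Finset.sum_nbij (fun C => C.image (SymGraph.rank A)) ?_ ?_ ?_ ?_
  · intro C hC
    obtain ⟨⟨h1, h2⟩, h3⟩ := mem_closedSetsMin.1 hC
    exact mem_closedSetsMin.2 ⟨⟨Finset.image_subset_image h1,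
      (closedIn_map hr.injOn h.mem h1).2 h2⟩,
      (hasMin_image hr h1).2 h3⟩
  · intro C hC D hD hCD
    have h1 := (mem_closedSetsMin.1 hC).1.1
    have h2 := (mem_closedSetsMin.1 hD).1.1
    have key : ∀ {C : Finset ℕ}, C ⊆ A → ∀ v ∈ A, SymGraph.rank A v ∈ C.image (SymGraph.rank A) ↔
        v ∈ C := by
      intro C hC v hv
      refine ⟨fun h => ?_, Finset.mem_image_of_mem _⟩
      obtain ⟨u, hu, h⟩ := Finset.mem_image.1 h
      exact hr.injOn (hC hu) hv h ▸ hu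
    have hCD' : C.image (SymGraph.rank A) = D.image (SymGraph.rank A) := hCD
    ext v
    constructor
    · intro hv; rw [← key h2 v (h1 hv), ← hCD', key h1 v (h1 hv)]; exact hv
    · intro hv; rw [← key h1 v (h2 hv), hCD', key h2 v (h2 hv)]; exact hv
  · intro C' hC'
    obtain ⟨⟨h1, h2⟩, h3⟩ := mem_closedSetsMin.1 hC'
    obtain ⟨C, h4, rfl⟩ := Finset.subset_image_iff.1 h1
    have h4 : C ⊆ A := by exact_mod_cast h4
    exact ⟨C, mem_closedSetsMin.2 ⟨⟨h4, (closedIn_map hr.injOn h.mem h4).1 h2⟩,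
      (hasMin_image hr h4).1 h3⟩, rfl⟩
  · intro C hC
    have h1 := (mem_closedSetsMin.1 hC).1.1
    have hrC : StrictMonoOn (SymGraph.rank A) C := hr.mono (by exact_mod_cast h1)
    have hrC' : StrictMonoOn (SymGraph.rank A) (A \ C : Finset ℕ) :=
      hr.mono (by exact_mod_cast Finset.sdiff_subset)
    rw [coprodTerm, coprodTerm, ← Finset.image_sdiff_of_injOn hr.injOn h1,
      invCount_image hr Finset.sdiff_subset h1, edgesIn_map hr.injOn h.mem h1,
      edgesIn_map hr.injOn h.mem Finset.sdiff_subset,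
      graphElt_image hrC fun e he => (mem_edgesIn.1 he).2,
      graphElt_image hrC' fun e he => (mem_edgesIn.1 he).2]

/-- The cooperation of a graph with arbitrary vertex labels and orientations. -/
theorem graphCoprod_graphElt {A : Finset ℕ} {E : Multiset (ℕ × ℕ)} (h : IsGraphOn k A E) :
    graphCoprod K k (graphElt K k A E) = ∑ C ∈ closedSetsMin A E, coprodTerm K k A E C := by
  by_cases hl : ∀ e ∈ E, e.1 ≠ e.2
  · rw [graphElt_eq_smul A hl, map_smul, graphCoprod_graphElt_of_lt h.map_enorm,
      closedSetsMin_map_enorm, Finset.smul_sum]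
    · refine Finset.sum_congr rfl fun C hC => ?_
      have h2 := (mem_closedSetsMin.1 hC).1.2
      have hs : ∀ D, ∀ e ∈ edgesIn E D, e.1 ≠ e.2 := fun D e he => hl e (mem_edgesIn.1 he).1
      rw [coprodTerm, coprodTerm, graphElt_eq_smul C (hs C), graphElt_eq_smul (A \ C) (hs _),
        edgesIn_map_enorm, edgesIn_map_enorm, TensorProduct.smul_tmul_smul, smul_smul, smul_smul]
      congr 1
      conv_lhs => rw [← edgesIn_add_edgesIn_sdiff h h2, Multiset.map_add, Multiset.prod_add]
      ring
    · intro a ha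
      obtain ⟨a', ha', rfl⟩ := Multiset.mem_map.1 ha
      exact enorm_lt (hl a' ha')
  · push Not at hl
    obtain ⟨l, hl, hl'⟩ := hl
    rw [graphElt_of_loop A hl hl', map_zero]
    refine (Finset.sum_eq_zero fun C hC => ?_).symm
    have h2 := (mem_closedSetsMin.1 hC).1.2
    have h3 := hl
    rw [← edgesIn_add_edgesIn_sdiff h h2, Multiset.mem_add] at h3
    rcases h3 with h3 | h3
    · rw [coprodTerm, graphElt_of_loop C h3 hl', TensorProduct.zero_tmul, smul_zero]
    · rw [coprodTerm, graphElt_of_loop (A \ C) h3 hl', TensorProduct.tmul_zero, smul_zero]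

theorem single_mem_graphGrade (G : SymGraph.minValence k) (c : K) :
    AddMonoidAlgebra.single G c ∈ graphGrade K k (G.1.n : ℤ) :=
  AddMonoidAlgebra.single_mem_gradeBy _ _ _

theorem graphElt_mem_graphGrade (A : Finset ℕ) (E : Multiset (ℕ × ℕ)) :
    graphElt K k A E ∈ graphGrade K k (A.card : ℤ) := by
  refine Submodule.smul_mem _ _ ?_
  unfold graphBasis
  split_ifs with h
  · exact single_mem_graphGrade ⟨_, h⟩ 1
  · exact Submodule.zero_mem _

theorem graphElt_empty : graphElt K k ∅ 0 = 1 := by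
  have h : (0 : Multiset (ℕ × ℕ)) = (0 : SymGraph.minValence k).1.edges := rfl
  have h' : (∅ : Finset ℕ) = Finset.Icc 1 (0 : SymGraph.minValence k).1.n := rfl
  rw [h, h', ← single_eq_graphElt]
  rfl

variable (K k)

/-- The coefficient of the empty graph. -/
def graphCounit : GraphAlg K k →ₐ[K] K :=
  AddMonoidAlgebra.lift K K (SymGraph.minValence k)
    { toFun := fun G => if (Multiplicative.toAdd G).1.n = 0 then 1 else 0
      map_one' := if_pos rfl
      map_mul' := fun G G' => by
        change (if (Multiplicative.toAdd G).1.n + (Multiplicative.toAdd G').1.n = 0 then (1 : K)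
          else 0) = _
        split_ifs <;> first | omega | simp }

variable {K k}

theorem graphCounit_single (G : SymGraph.minValence k) (c : K) :
    graphCounit K k (AddMonoidAlgebra.single G c) = if G.1.n = 0 then c else 0 := by
  rw [graphCounit, AddMonoidAlgebra.lift_single]
  simp

theorem graphCounit_graphElt {A : Finset ℕ} (hA : A.Nonempty) (E : Multiset (ℕ × ℕ)) :
    graphCounit K k (graphElt K k A E) = 0 := by
  rw [graphElt, map_smul]
  unfold graphBasis
  split_ifs with h
  · have : (stdGraph A (E.map enorm)).n ≠ 0 := (Finset.card_pos.2 hA).ne'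
    rw [graphCounit_single, if_neg this, smul_zero]
  · rw [map_zero, smul_zero]

theorem braid_tmul {H : Type*} [Ring H] [Algebra K H] {𝒜 : ℤ → Submodule K H} [GradedAlgebra 𝒜]
    {m n : ℕ} {x y : H} (hx : x ∈ 𝒜 m) (hy : y ∈ 𝒜 n) :
    braid K 𝒜 (x ⊗ₜ[K] y) = (-1 : K) ^ (m * n) • (y ⊗ₜ[K] x) := by
  have h := GradedTensorProduct.comm_coe_tmul_coe (R := K) 𝒜 𝒜 (⟨x, hx⟩ : 𝒜 m) (⟨y, hy⟩ : 𝒜 n)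
  rw [uzpow_smul_eq (K := K)] at h
  refine (congrArg (GradedTensorProduct.of K 𝒜 𝒜).symm h).trans ?_
  rw [map_smul, mul_comm (n : ℤ), ← Nat.cast_mul, Int.coe_negOnePow_natCast]
  push_cast
  rfl

variable (K k)

/-- The coassociative cooperation of `K[𝒢]`. -/
def graphFull : GraphAlg K k →ₗ[K] GraphAlg K k ⊗[K] GraphAlg K k :=
  graphCoprod K k + braid K (graphGrade K k) ∘ₗ graphCoprod K k +
    (graphCounit K k).toLinearMap.smulRight (1 ⊗ₜ[K] 1)

variable {K k}

/-- The coassociative cooperation is the sum over all unions of connected components. -/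
theorem graphFull_graphElt {A : Finset ℕ} {E : Multiset (ℕ × ℕ)} (h : IsGraphOn k A E) :
    graphFull K k (graphElt K k A E) = ∑ C ∈ closedSets A E, coprodTerm K k A E C := by
  classical
  have e0 : graphFull K k (graphElt K k A E) = graphCoprod K k (graphElt K k A E) +
      braid K (graphGrade K k) (graphCoprod K k (graphElt K k A E)) +
      graphCounit K k (graphElt K k A E) • (1 ⊗ₜ[K] 1) := rfl
  rw [e0, graphCoprod_graphElt h]
  rcases A.eq_empty_or_nonempty with rfl | hA
  · obtain rfl := h.edges_empty
    have h1 : closedSetsMin ∅ 0 = ∅ := by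
      refine Finset.eq_empty_of_forall_notMem fun C hC => ?_
      obtain ⟨⟨h1, -⟩, a, ha, -⟩ := mem_closedSetsMin.1 hC
      simpa using h1 ha
    have h2 : closedSets ∅ 0 = {∅} := by
      ext C
      rw [mem_closedSets, Finset.subset_empty, Finset.mem_singleton]
      exact ⟨fun h => h.1, fun h => ⟨h, by simp [ClosedIn]⟩⟩
    rw [h1, h2, Finset.sum_empty, map_zero, Finset.sum_singleton, graphElt_empty, map_one,
      coprodTerm]
    simp [edgesIn, graphElt_empty, invCount]
  · rw [graphCounit_graphElt hA, zero_smul, add_zero, map_sum,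
      ← Finset.sum_filter_add_sum_filter_not (closedSets A E) (HasMin A)]
    congr 1
    refine Finset.sum_nbij' (fun C => A \ C) (fun C => A \ C) ?_ ?_ ?_ ?_ ?_
    · intro C hC
      obtain ⟨⟨h1, h2⟩, h3⟩ := mem_closedSetsMin.1 hC
      exact Finset.mem_filter.2 ⟨mem_closedSets.2 ⟨Finset.sdiff_subset, h2.sdiff h⟩,
        h3.not_sdiff h1⟩
    · intro C hC
      obtain ⟨h1, h3⟩ := Finset.mem_filter.1 hC
      obtain ⟨h1, h2⟩ := mem_closedSets.1 h1
      exact mem_closedSetsMin.2 ⟨⟨Finset.sdiff_subset, h2.sdiff h⟩, hasMin_or_sdiff hA h3⟩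
    · intro C hC
      exact Finset.sdiff_sdiff_eq_self (mem_closedSetsMin.1 hC).1.1
    · intro C hC
      exact Finset.sdiff_sdiff_eq_self (mem_closedSets.1 (Finset.mem_filter.1 hC).1).1
    · intro C hC
      have h1 := (mem_closedSetsMin.1 hC).1.1
      rw [coprodTerm, coprodTerm, map_smul, braid_tmul (graphElt_mem_graphGrade _ _)
        (graphElt_mem_graphGrade _ _), Finset.sdiff_sdiff_eq_self h1, smul_smul]
      congr 1
      rw [← invCount_add_swap Finset.disjoint_sdiff, ← pow_add,
        show invCount (A \ C) C + (invCount C (A \ C) + invCount (A \ C) C) =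
          invCount C (A \ C) + 2 * invCount (A \ C) C by ring, pow_add, pow_mul]
      simp

end Cooperation

section Axioms

variable {K : Type*} [Field K] {k : ℕ}

/-! ### The axioms for the cooperation of graphs -/

theorem graphCoprod_mem (n : ℤ) (x : GraphAlg K k) (hx : x ∈ graphGrade K k n) :
    graphCoprod K k x ∈ tensorGrade (graphGrade K k) n := by
  have h : ∀ (m : ℕ) (E : Multiset (ℕ × ℕ)), IsGraphOn k (Finset.Icc 1 m) E →
      graphCoprod K k (graphElt K k (Finset.Icc 1 m) E) ∈ tensorGrade (graphGrade K k) m := by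
    intro m E hE
    rw [graphCoprod_graphElt hE]
    refine Submodule.sum_mem _ fun C hC => Submodule.smul_mem _ _ (Submodule.subset_span
      ⟨C.card, (Finset.Icc 1 m \ C).card, ?_, _, graphElt_mem_graphGrade _ _, _,
        graphElt_mem_graphGrade _ _, rfl⟩)
    have h1 := Finset.card_sdiff_add_card_eq_card (mem_closedSetsMin.1 hC).1.1
    rw [Nat.card_Icc] at h1
    omega
  have key : ∀ (x : GraphAlg K k) (n : ℤ), graphCoprod K k (gradeProj (graphGrade K k) n x) ∈
      tensorGrade (graphGrade K k) n := by
    intro x n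
    induction x using graphAlg_induction with
    | zero => rw [map_zero, map_zero]; exact Submodule.zero_mem _
    | add x y hx hy => rw [map_add, map_add]; exact Submodule.add_mem _ hx hy
    | smul c x hx => rw [map_smul, map_smul]; exact Submodule.smul_mem _ _ hx
    | elt m E hE _ =>
      have hm := graphElt_mem_graphGrade (K := K) (k := k) (Finset.Icc 1 m) E
      rw [Nat.card_Icc, Nat.add_sub_cancel] at hm
      by_cases hmn : (m : ℤ) = n
      · subst hmn
        rw [gradeProj_same _ hm]
        exact h m E hE
      · rw [gradeProj_ne _ hm hmn, map_zero]
        exact Submodule.zero_mem _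
  have := key x n
  rwa [gradeProj_same _ hx] at this

theorem graphCounit_of_mem (n : ℤ) (hn : n ≠ 0) (x : GraphAlg K k) (hx : x ∈ graphGrade K k n) :
    graphCounit K k x = 0 := by
  have key : ∀ x : GraphAlg K k, graphCounit K k (gradeProj (graphGrade K k) n x) = 0 := by
    intro x
    induction x using graphAlg_induction with
    | zero => simp
    | add x y hx hy => rw [map_add, map_add, hx, hy, add_zero]
    | smul c x hx => rw [map_smul, map_smul, hx, smul_zero]
    | elt m E hE _ =>
      have hm := graphElt_mem_graphGrade (K := K) (k := k) (Finset.Icc 1 m) E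
      rw [Nat.card_Icc, Nat.add_sub_cancel] at hm
      by_cases hmn : (m : ℤ) = n
      · rw [gradeProj_same _ (hmn ▸ hm), graphCounit_graphElt]
        rw [Finset.nonempty_Icc]
        omega
      · rw [gradeProj_ne _ hm hmn, map_zero]
  have := key x
  rwa [gradeProj_same _ hx] at this

theorem graphD_mem (n : ℤ) (x : GraphAlg K k) (hx : x ∈ graphGrade K k n) :
    graphD K k x ∈ graphGrade K k (n - 1) := by
  have key : ∀ x : GraphAlg K k, graphD K k (gradeProj (graphGrade K k) n x) ∈
      graphGrade K k (n - 1) := by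
    intro x
    induction x using graphAlg_induction with
    | zero => rw [map_zero, map_zero]; exact Submodule.zero_mem _
    | add x y hx hy => rw [map_add, map_add]; exact Submodule.add_mem _ hx hy
    | smul c x hx => rw [map_smul, map_smul]; exact Submodule.smul_mem _ _ hx
    | elt m E hE hlt =>
      have hm := graphElt_mem_graphGrade (K := K) (k := k) (Finset.Icc 1 m) E
      rw [Nat.card_Icc, Nat.add_sub_cancel] at hm
      by_cases hmn : (m : ℤ) = n
      · rw [gradeProj_same _ (hmn ▸ hm), graphD_graphElt hE]
        refine multiset_sum_mem _ fun y hy => ?_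
        obtain ⟨e, he, rfl⟩ := Multiset.mem_map.1 hy
        refine Submodule.smul_mem _ _ (Submodule.smul_mem _ _ ?_)
        have h2 := (hE.mem e he).2
        rw [enorm_of_lt (hlt e he)]
        have := graphElt_mem_graphGrade (K := K) (k := k) ((Finset.Icc 1 m).erase e.2)
          ((E.erase e).map (Prod.map (merge e) (merge e)))
        rw [Finset.card_erase_of_mem h2, Nat.card_Icc, Nat.add_sub_cancel] at this
        rw [Finset.mem_Icc] at h2
        have h3 : ((m - 1 : ℕ) : ℤ) = n - 1 := by omega
        rwa [h3] at this
      · rw [gradeProj_ne _ hm hmn, map_zero]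
        exact Submodule.zero_mem _
  have := key x
  rwa [gradeProj_same _ hx] at this

theorem graphCounit_graphD (x : GraphAlg K k) : graphCounit K k (graphD K k x) = 0 := by
  induction x using graphAlg_induction with
  | zero => simp
  | add x y hx hy => rw [map_add, map_add, hx, hy, add_zero]
  | smul c x hx => rw [map_smul, map_smul, hx, smul_zero]
  | elt m E hE hlt =>
    rw [graphD_graphElt hE, map_multiset_sum, Multiset.map_map]
    refine Multiset.sum_eq_zero fun y hy => ?_
    obtain ⟨e, he, rfl⟩ := Multiset.mem_map.1 hy
    have h1 := hE.mem e he
    have h2 := hlt e he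
    rw [Function.comp_apply, dTerm, map_smul, map_smul, enorm_of_lt h2, graphCounit_graphElt,
      smul_zero, smul_zero]
    exact ⟨e.1, Finset.mem_erase.2 ⟨h2.ne, h1.1⟩⟩

theorem graphCoprod_one : graphCoprod K k 1 = 0 := by
  have h : IsGraphOn k ∅ 0 := ⟨by simp, by simp⟩
  rw [← graphElt_empty, graphCoprod_graphElt h]
  refine Finset.sum_eq_zero fun C hC => ?_
  obtain ⟨⟨h1, -⟩, a, ha, -⟩ := mem_closedSetsMin.1 hC
  simpa using h1 ha

theorem graphCounit_left (x : GraphAlg K k) :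
    TensorProduct.map (graphCounit K k).toLinearMap LinearMap.id (graphCoprod K k x) = 0 := by
  induction x using graphAlg_induction with
  | zero => simp
  | add x y hx hy => rw [map_add, map_add, hx, hy, add_zero]
  | smul c x hx => rw [map_smul, map_smul, hx, smul_zero]
  | elt m E hE _ =>
    rw [graphCoprod_graphElt hE, map_sum]
    refine Finset.sum_eq_zero fun C hC => ?_
    obtain ⟨-, a, ha, -⟩ := mem_closedSetsMin.1 hC
    rw [coprodTerm, map_smul, TensorProduct.map_tmul, AlgHom.toLinearMap_apply,
      graphCounit_graphElt ⟨a, ha⟩, TensorProduct.zero_tmul, smul_zero]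

theorem coprodTerm_self {A : Finset ℕ} {E : Multiset (ℕ × ℕ)} (hE : IsGraphOn k A E) :
    coprodTerm K k A E A = graphElt K k A E ⊗ₜ[K] 1 := by
  have h : edgesIn E ∅ = 0 := Multiset.filter_eq_nil.2 (by simp)
  rw [coprodTerm, Finset.sdiff_self, invCount_empty_left, pow_zero, one_smul, edgesIn_self hE, h,
    graphElt_empty]

theorem self_mem_closedSetsMin {A : Finset ℕ} (hA : A.Nonempty) {E : Multiset (ℕ × ℕ)}
    (hE : IsGraphOn k A E) : A ∈ closedSetsMin A E :=
  mem_closedSetsMin.2 ⟨⟨le_rfl, fun e he => by simp [hE.mem e he]⟩, A.min' hA, A.min'_mem hA,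
    fun b hb => A.min'_le b hb⟩

theorem graphCounit_right (x : GraphAlg K k) (hx : graphCounit K k x = 0) :
    TensorProduct.map LinearMap.id (graphCounit K k).toLinearMap (graphCoprod K k x) =
      x ⊗ₜ[K] 1 := by
  have key : ∀ x : GraphAlg K k,
      TensorProduct.map LinearMap.id (graphCounit K k).toLinearMap (graphCoprod K k x) =
        (x - graphCounit K k x • 1) ⊗ₜ[K] 1 := by
    intro x
    induction x using graphAlg_induction with
    | zero => simp
    | add x y hx hy =>
      simp only [map_add, hx, hy, add_smul, ← TensorProduct.add_tmul]
      congr 1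
      abel
    | smul c x hx =>
      rw [map_smul, map_smul, hx, map_smul, TensorProduct.smul_tmul', smul_sub, smul_eq_mul,
        mul_smul]
    | elt m E hE _ =>
      rw [graphCoprod_graphElt hE, map_sum]
      rcases (Finset.Icc 1 m).eq_empty_or_nonempty with h0 | hne
      · rw [h0] at hE ⊢
        obtain rfl := hE.edges_empty
        rw [graphElt_empty, map_one, one_smul, sub_self, TensorProduct.zero_tmul]
        refine Finset.sum_eq_zero fun C hC => ?_
        obtain ⟨⟨h1, -⟩, a, ha, -⟩ := mem_closedSetsMin.1 hC
        simpa using h1 ha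
      · rw [Finset.sum_eq_single_of_mem _ (self_mem_closedSetsMin hne hE), coprodTerm_self hE,
          graphCounit_graphElt hne, zero_smul, sub_zero, TensorProduct.map_tmul]
        · simp
        · intro C hC hCA
          have h1 := (mem_closedSetsMin.1 hC).1.1
          have h2 : (Finset.Icc 1 m \ C).Nonempty := by
            rw [Finset.sdiff_nonempty]
            exact fun h => hCA (h1.antisymm h)
          rw [coprodTerm, map_smul, TensorProduct.map_tmul, AlgHom.toLinearMap_apply,
            graphCounit_graphElt h2, TensorProduct.tmul_zero, smul_zero]
  rw [key, hx, zero_smul, sub_zero]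

/-- Both sides are sums over the pairs of a union `D` of components that contains the first one
and a union `F` of components in the complement of `D`. -/
theorem graph_zinbiel (x : GraphAlg K k) :
    TensorProduct.assoc K _ _ _
        (TensorProduct.map (graphCoprod K k) LinearMap.id (graphCoprod K k x)) =
      TensorProduct.map LinearMap.id (graphFull K k) (graphCoprod K k x) := by
  induction x using graphAlg_induction with
  | zero => simp
  | add x y hx hy => simp only [map_add, hx, hy]
  | smul c x hx => simp only [map_smul, hx]
  | elt m E hE _ =>
    generalize Finset.Icc 1 m = A at hE
    rw [graphCoprod_graphElt hE]
    simp only [map_sum]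
    have hl : ∀ C ∈ closedSetsMin A E, TensorProduct.assoc K _ _ _
        (TensorProduct.map (graphCoprod K k) LinearMap.id (coprodTerm K k A E C)) =
        ∑ D ∈ closedSetsMin C (edgesIn E C), (-1 : K) ^ (invCount (A \ C) C + invCount (C \ D) D) •
          (graphElt K k D (edgesIn E D) ⊗ₜ[K] (graphElt K k (C \ D) (edgesIn E (C \ D)) ⊗ₜ[K]
            graphElt K k (A \ C) (edgesIn E (A \ C)))) := by
      intro C hC
      obtain ⟨⟨h1, h2⟩, -⟩ := mem_closedSetsMin.1 hC
      rw [coprodTerm, map_smul, map_smul, TensorProduct.map_tmul,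
        graphCoprod_graphElt (hE.edgesIn h1 h2), TensorProduct.sum_tmul, map_sum, Finset.smul_sum]
      refine Finset.sum_congr rfl fun D hD => ?_
      have h3 := (mem_closedSetsMin.1 hD).1.1
      rw [coprodTerm, ← TensorProduct.smul_tmul', map_smul, smul_smul, pow_add, LinearMap.id_apply,
        TensorProduct.assoc_tmul, edgesIn_edgesIn E h3, edgesIn_edgesIn E Finset.sdiff_subset]
    have hr : ∀ D ∈ closedSetsMin A E,
        TensorProduct.map LinearMap.id (graphFull K k) (coprodTerm K k A E D) =
        ∑ F ∈ closedSets (A \ D) (edgesIn E (A \ D)),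
          (-1 : K) ^ (invCount (A \ D) D + invCount ((A \ D) \ F) F) •
          (graphElt K k D (edgesIn E D) ⊗ₜ[K] (graphElt K k F (edgesIn E F) ⊗ₜ[K]
            graphElt K k ((A \ D) \ F) (edgesIn E ((A \ D) \ F)))) := by
      intro D hD
      obtain ⟨⟨h1, h2⟩, -⟩ := mem_closedSetsMin.1 hD
      rw [coprodTerm, map_smul, TensorProduct.map_tmul,
        graphFull_graphElt (hE.edgesIn Finset.sdiff_subset (h2.sdiff hE)), TensorProduct.tmul_sum,
        Finset.smul_sum]
      refine Finset.sum_congr rfl fun F hF => ?_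
      have h3 := (mem_closedSets.1 hF).1
      rw [coprodTerm, TensorProduct.tmul_smul, smul_smul, pow_add, LinearMap.id_apply,
        edgesIn_edgesIn E h3, edgesIn_edgesIn E Finset.sdiff_subset]
    rw [Finset.sum_congr rfl hl, Finset.sum_congr rfl hr, Finset.sum_sigma', Finset.sum_sigma']
    refine Finset.sum_nbij' (fun p => ⟨p.2, p.1 \ p.2⟩) (fun p => ⟨p.1 ∪ p.2, p.1⟩) ?_ ?_ ?_ ?_ ?_
    · rintro ⟨C, D⟩ h
      simp only [Finset.mem_sigma, mem_closedSetsMin, mem_closedSets] at h ⊢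
      obtain ⟨⟨⟨h1, h2⟩, a, ha, h3⟩, ⟨h4, h5⟩, b, hb, h6⟩ := h
      have h5' := (closedIn_edgesIn h2 h4).1 h5
      refine ⟨⟨⟨h4.trans h1, h5'⟩, b, hb, fun c hc => (h6 a ha).trans (h3 c hc)⟩,
        Finset.sdiff_subset_sdiff h1 le_rfl, ?_⟩
      rw [closedIn_edgesIn (h5'.sdiff hE) (Finset.sdiff_subset_sdiff h1 le_rfl)]
      intro e he
      simp only [Finset.mem_sdiff, h2 e he, h5' e he]
    · rintro ⟨D, F⟩ h
      simp only [Finset.mem_sigma, mem_closedSetsMin, mem_closedSets] at h ⊢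
      obtain ⟨⟨⟨h1, h2⟩, a, ha, h3⟩, h4, h5⟩ := h
      rw [closedIn_edgesIn (h2.sdiff hE) h4] at h5
      have h6 : ClosedIn E (D ∪ F) := by
        intro e he
        simp only [Finset.mem_union, h2 e he, h5 e he]
      have h7 : D ∪ F ⊆ A := Finset.union_subset h1 (h4.trans Finset.sdiff_subset)
      refine ⟨⟨⟨h7, h6⟩, a, Finset.mem_union_left _ ha, h3⟩,
        ⟨Finset.subset_union_left, ?_⟩, a, ha, fun b hb => h3 b (h7 hb)⟩
      rwa [closedIn_edgesIn h6 Finset.subset_union_left]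
    · rintro ⟨C, D⟩ h
      simp only [Finset.mem_sigma, mem_closedSetsMin] at h
      simp only [Finset.union_sdiff_of_subset h.2.1.1]
    · rintro ⟨D, F⟩ h
      simp only [Finset.mem_sigma, mem_closedSets] at h
      have h1 : Disjoint F D := by
        rw [Finset.disjoint_left]
        exact fun x hx => (Finset.mem_sdiff.1 (h.2.1 hx)).2
      simp only [Finset.union_sdiff_cancel_left h1.symm]
    · rintro ⟨C, D⟩ h
      simp only [Finset.mem_sigma, mem_closedSetsMin] at h
      have h1 := h.1.1.1
      have h2 := h.2.1.1
      have e1 : (A \ D) \ (C \ D) = A \ C := by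
        ext x; simp only [Finset.mem_sdiff]
        have := @h2 x
        tauto
      have e2 : A \ D = (A \ C) ∪ (C \ D) := by
        ext x; simp only [Finset.mem_sdiff, Finset.mem_union]
        have := @h2 x
        have := @h1 x
        tauto
      have e3 : C = D ∪ (C \ D) := (Finset.union_sdiff_of_subset h2).symm
      have e4 : Disjoint (A \ C) (C \ D) := by
        rw [Finset.disjoint_left]
        exact fun x hx hx' => (Finset.mem_sdiff.1 hx).2 (Finset.mem_sdiff.1 hx').1
      simp only [e1]
      congr 2
      rw [e2, invCount_union_left e4]
      have e5 : invCount (A \ C) C = invCount (A \ C) D + invCount (A \ C) (C \ D) := by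
        conv_lhs => enter [2]; rw [e3]
        exact invCount_union_right Finset.disjoint_sdiff
      omega

/-! ### The product of graphs -/

theorem isGraphOn_union {A B : Finset ℕ} {E F : Multiset (ℕ × ℕ)} (hE : IsGraphOn k A E)
    (hF : IsGraphOn k B F) : IsGraphOn k (A ∪ B) (E + F) where
  mem e he := by
    rcases Multiset.mem_add.1 he with h | h
    · exact ⟨Finset.mem_union_left _ (hE.mem e h).1, Finset.mem_union_left _ (hE.mem e h).2⟩
    · exact ⟨Finset.mem_union_right _ (hF.mem e h).1, Finset.mem_union_right _ (hF.mem e h).2⟩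
  le_ends v hv := by
    rw [ends_add]
    rcases Finset.mem_union.1 hv with h | h
    · exact (hE.le_ends v h).trans (Nat.le_add_right _ _)
    · exact (hF.le_ends v h).trans (Nat.le_add_left _ _)

theorem rank_union_left {A B : Finset ℕ} (hAB : ∀ a ∈ A, ∀ b ∈ B, a < b) {v : ℕ} (hv : v ∈ A) :
    SymGraph.rank (A ∪ B) v = SymGraph.rank A v := by
  rw [SymGraph.rank, Finset.filter_union, Finset.filter_false_of_mem (s := B), Finset.union_empty]
  · rfl
  · exact fun b hb => (hAB v hv b hb).not_ge

theorem rank_union_right {A B : Finset ℕ} (hAB : ∀ a ∈ A, ∀ b ∈ B, a < b) {v : ℕ} (hv : v ∈ B) :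
    SymGraph.rank (A ∪ B) v = A.card + SymGraph.rank B v := by
  rw [SymGraph.rank, Finset.filter_union, Finset.filter_true_of_mem (s := A),
    Finset.card_union_of_disjoint]
  · rfl
  · rw [Finset.disjoint_left]
    exact fun x hx hx' => (hAB x hx x (Finset.mem_filter.1 hx').1).ne rfl
  · exact fun a ha => (hAB a ha v hv).le

/-- The ordered disjoint union of two graphs. -/
theorem graphElt_mul {A B : Finset ℕ} {E F : Multiset (ℕ × ℕ)} (hE : IsGraphOn k A E)
    (hF : IsGraphOn k B F) (hAB : ∀ a ∈ A, ∀ b ∈ B, a < b) :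
    graphElt K k A E * graphElt K k B F = graphElt K k (A ∪ B) (E + F) := by
  by_cases hl : ∀ e ∈ E + F, e.1 ≠ e.2
  · have hE' : ∀ e ∈ E.map enorm, e.1 < e.2 := by
      intro e he
      obtain ⟨a, ha, rfl⟩ := Multiset.mem_map.1 he
      exact enorm_lt (hl a (Multiset.mem_add.2 (Or.inl ha)))
    have hF' : ∀ e ∈ F.map enorm, e.1 < e.2 := by
      intro e he
      obtain ⟨a, ha, rfl⟩ := Multiset.mem_map.1 he
      exact enorm_lt (hl a (Multiset.mem_add.2 (Or.inr ha)))
    have hEF' : ∀ e ∈ E.map enorm + F.map enorm, e.1 < e.2 := by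
      intro e he
      exact (Multiset.mem_add.1 he).elim (hE' e) (hF' e)
    have m1 := hE.map_enorm.stdGraph_mem hE'
    have m2 := hF.map_enorm.stdGraph_mem hF'
    have m3 := (isGraphOn_union hE.map_enorm hF.map_enorm).stdGraph_mem hEF'
    rw [graphElt, graphElt, graphElt, Multiset.map_add, Multiset.map_add, Multiset.prod_add,
      smul_mul_smul_comm]
    congr 1
    rw [graphBasis, graphBasis, graphBasis, dif_pos m1, dif_pos m2, dif_pos m3,
      AddMonoidAlgebra.single_mul_single, mul_one]
    congr 1
    refine Subtype.ext (SymGraph.ext ?_ ?_)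
    · refine (Finset.card_union_of_disjoint ?_).symm
      rw [Finset.disjoint_left]
      exact fun x hx hx' => (hAB x hx x hx').ne rfl
    · change (stdGraph A (E.map enorm) + stdGraph B (F.map enorm)).edges = _
      rw [SymGraph.edges_add, stdGraph_edges hE.map_enorm.mem hE',
        stdGraph_edges hF.map_enorm.mem hF',
        stdGraph_edges (isGraphOn_union hE.map_enorm hF.map_enorm).mem hEF', Multiset.map_add]
      congr 1
      · refine Multiset.map_congr rfl fun e he => ?_
        have := hE.map_enorm.mem e he
        exact Prod.ext (rank_union_left hAB this.1).symm (rank_union_left hAB this.2).symm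
      · rw [Multiset.map_map]
        refine Multiset.map_congr rfl fun e he => ?_
        have := hF.map_enorm.mem e he
        exact Prod.ext (rank_union_right hAB this.1).symm (rank_union_right hAB this.2).symm
  · push Not at hl
    obtain ⟨l, hl, hl'⟩ := hl
    rw [graphElt_of_loop (A ∪ B) hl hl']
    rcases Multiset.mem_add.1 hl with h | h
    · rw [graphElt_of_loop A h hl', zero_mul]
    · rw [graphElt_of_loop B h hl', mul_zero]

/-- Any graph is isomorphic to one whose vertices lie behind a given set of vertices. -/
theorem exists_graphElt_shift {n : ℕ} {F : Multiset (ℕ × ℕ)} (m : ℕ)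
    (hF : IsGraphOn k (Finset.Icc 1 m) F) (hlt : ∀ e ∈ F, e.1 < e.2) :
    ∃ B F', IsGraphOn k B F' ∧ (∀ e ∈ F', e.1 < e.2) ∧ (∀ a ∈ Finset.Icc 1 n, ∀ b ∈ B, a < b) ∧
      graphElt K k (Finset.Icc 1 m) F = graphElt K k B F' := by
  have hmono : StrictMono (n + ·) := fun a b h => by dsimp only; omega
  refine ⟨_, _, hF.map hmono.injective.injOn, ?_, ?_,
    (graphElt_image (hmono.strictMonoOn _) hF.mem).symm⟩
  · intro e he
    obtain ⟨e', he', rfl⟩ := Multiset.mem_map.1 he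
    exact hmono (hlt e' he')
  · intro a ha b hb
    obtain ⟨b', hb', rfl⟩ := Finset.mem_image.1 hb
    rw [Finset.mem_Icc] at ha hb'
    omega

theorem edgesIn_add_union {A B C C' : Finset ℕ} {E F : Multiset (ℕ × ℕ)} (hE : IsGraphOn k A E)
    (hF : IsGraphOn k B F) (hAB : Disjoint A B) (hC : C ⊆ A) (hC' : C' ⊆ B) :
    edgesIn (E + F) (C ∪ C') = edgesIn E C + edgesIn F C' := by
  rw [edgesIn, Multiset.filter_add]
  congr 1
  · refine Multiset.filter_congr fun e he => ?_
    have h1 : ∀ v ∈ A, v ∉ C' := fun v hv hv' => Finset.disjoint_left.1 hAB hv (hC' hv')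
    simp only [Finset.mem_union, h1 _ (hE.mem e he).1, h1 _ (hE.mem e he).2, or_false]
  · refine Multiset.filter_congr fun e he => ?_
    have h1 : ∀ v ∈ B, v ∉ C := fun v hv hv' => Finset.disjoint_left.1 hAB (hC hv') hv
    simp only [Finset.mem_union, h1 _ (hF.mem e he).1, h1 _ (hF.mem e he).2, false_or]

theorem closedIn_add_union {A B C C' : Finset ℕ} {E F : Multiset (ℕ × ℕ)} (hE : IsGraphOn k A E)
    (hF : IsGraphOn k B F) (hAB : Disjoint A B) (hC : C ⊆ A) (hC' : C' ⊆ B) :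
    ClosedIn (E + F) (C ∪ C') ↔ ClosedIn E C ∧ ClosedIn F C' := by
  have h1 : ∀ v ∈ A, v ∉ C' := fun v hv hv' => Finset.disjoint_left.1 hAB hv (hC' hv')
  have h2 : ∀ v ∈ B, v ∉ C := fun v hv hv' => Finset.disjoint_left.1 hAB (hC hv') hv
  have e1 : ∀ e ∈ E, ((e.1 ∈ C ∪ C' ↔ e.2 ∈ C ∪ C') ↔ (e.1 ∈ C ↔ e.2 ∈ C)) := by
    intro e he
    simp only [Finset.mem_union, h1 _ (hE.mem e he).1, h1 _ (hE.mem e he).2, or_false]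
  have e2 : ∀ e ∈ F, ((e.1 ∈ C ∪ C' ↔ e.2 ∈ C ∪ C') ↔ (e.1 ∈ C' ↔ e.2 ∈ C')) := by
    intro e he
    simp only [Finset.mem_union, h2 _ (hF.mem e he).1, h2 _ (hF.mem e he).2, false_or]
  constructor
  · intro h
    exact ⟨fun e he => (e1 e he).1 (h e (Multiset.mem_add.2 (Or.inl he))),
      fun e he => (e2 e he).1 (h e (Multiset.mem_add.2 (Or.inr he)))⟩
  · rintro ⟨h, h'⟩ e he
    rcases Multiset.mem_add.1 he with he | he
    · exact (e1 e he).2 (h e he)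
    · exact (e2 e he).2 (h' e he)

theorem coprodTerm_mul {A B C C' : Finset ℕ} {E F : Multiset (ℕ × ℕ)} (hE : IsGraphOn k A E)
    (hF : IsGraphOn k B F) (hAB : ∀ a ∈ A, ∀ b ∈ B, a < b) (hC : C ⊆ A) (hC' : C' ⊆ B)
    (hEC : ClosedIn E C) (hFC : ClosedIn F C') :
    GradedTensorProduct.of K (graphGrade K k) (graphGrade K k) (coprodTerm K k A E C) *
        GradedTensorProduct.of K (graphGrade K k) (graphGrade K k) (coprodTerm K k B F C') =
      GradedTensorProduct.of K (graphGrade K k) (graphGrade K k)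
        (coprodTerm K k (A ∪ B) (E + F) (C ∪ C')) := by
  have hd : Disjoint A B := by
    rw [Finset.disjoint_left]
    exact fun x hx hx' => (hAB x hx x hx').ne rfl
  have hd1 : ∀ v ∈ A, v ∉ B := fun v hv hv' => Finset.disjoint_left.1 hd hv hv'
  have hs : (A ∪ B) \ (C ∪ C') = (A \ C) ∪ (B \ C') := by
    ext x
    have h1 := @hC x
    have h2 := @hC' x
    have h3 := hd1 x
    simp only [Finset.mem_sdiff, Finset.mem_union]
    tauto
  have m1 := graphElt_mem_graphGrade (K := K) (k := k) (A \ C) (edgesIn E (A \ C))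
  have m2 := graphElt_mem_graphGrade (K := K) (k := k) C' (edgesIn F C')
  have h := GradedTensorProduct.tmul_coe_mul_coe_tmul (R := K) (graphGrade K k) (graphGrade K k)
    (graphElt K k C (edgesIn E C)) (⟨_, m1⟩ : graphGrade K k _) (⟨_, m2⟩ : graphGrade K k _)
    (graphElt K k (B \ C') (edgesIn F (B \ C')))
  rw [uzpow_smul_eq (K := K)] at h
  have h' : GradedTensorProduct.of K (graphGrade K k) (graphGrade K k)
      (graphElt K k C (edgesIn E C) ⊗ₜ[K] graphElt K k (A \ C) (edgesIn E (A \ C))) *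
      GradedTensorProduct.of K (graphGrade K k) (graphGrade K k)
        (graphElt K k C' (edgesIn F C') ⊗ₜ[K] graphElt K k (B \ C') (edgesIn F (B \ C'))) =
      ((-1 : K) ^ ((A \ C).card * C'.card)) •
      GradedTensorProduct.of K (graphGrade K k) (graphGrade K k)
        ((graphElt K k C (edgesIn E C) * graphElt K k C' (edgesIn F C')) ⊗ₜ[K]
        (graphElt K k (A \ C) (edgesIn E (A \ C)) *
          graphElt K k (B \ C') (edgesIn F (B \ C')))) := by
    refine h.trans ?_
    rw [← Nat.cast_mul, Int.coe_negOnePow_natCast]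
    push_cast
    rfl
  have sub1 : A \ C ⊆ A := Finset.sdiff_subset
  have sub2 : B \ C' ⊆ B := Finset.sdiff_subset
  rw [coprodTerm, coprodTerm, coprodTerm, map_smul, map_smul, map_smul, smul_mul_smul_comm, h',
    smul_smul, hs, edgesIn_add_union hE hF hd hC hC', edgesIn_add_union hE hF hd sub1 sub2,
    graphElt_mul (hE.edgesIn hC hEC) (hF.edgesIn hC' hFC) fun a ha b hb => hAB a (hC ha) b (hC' hb),
    graphElt_mul (hE.edgesIn sub1 (hEC.sdiff hE)) (hF.edgesIn sub2 (hFC.sdiff hF))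
      fun a ha b hb => hAB a (sub1 ha) b (sub2 hb)]
  congr 1
  rw [invCount_union_left (hd.mono sub1 sub2), invCount_union_right (hd.mono hC hC'),
    invCount_union_right (hd.mono hC hC'),
    invCount_of_lt (U := A \ C) fun a ha b hb => hAB a (sub1 ha) b (hC' hb),
    invCount_of_gt (U := B \ C') (V := C) fun b hb a ha => hAB a (hC ha) b (sub2 hb)]
  ring

theorem graph_compat (x y : GraphAlg K k) :
    GradedTensorProduct.of K (graphGrade K k) (graphGrade K k) (graphCoprod K k (x * y)) =
      GradedTensorProduct.of K (graphGrade K k) (graphGrade K k) (graphCoprod K k x) *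
        GradedTensorProduct.of K (graphGrade K k) (graphGrade K k) (graphFull K k y) +
      graphCounit K k x •
        GradedTensorProduct.of K (graphGrade K k) (graphGrade K k) (graphCoprod K k y) := by
  induction x using graphAlg_induction with
  | zero => simp
  | add x x' hx hx' => simp only [add_mul, map_add, hx, hx', add_smul]; abel
  | smul c x hx =>
    simp only [smul_mul_assoc, map_smul, hx, smul_add, smul_smul, smul_eq_mul]
  | elt n E hE hEl =>
    induction y using graphAlg_induction with
    | zero => simp
    | add y y' hy hy' => simp only [mul_add, map_add, hy, hy', smul_add]; abel
    | smul c y hy =>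
      simp only [mul_smul_comm, map_smul, hy, smul_add]
      rw [smul_comm c]
    | elt m F hF hFl =>
      obtain ⟨B, F', hF', -, hAB, h⟩ := exists_graphElt_shift (K := K) (n := n) m hF hFl
      rw [h]
      rcases (Finset.Icc 1 n).eq_empty_or_nonempty with h0 | hne
      · rw [h0] at hE ⊢
        obtain rfl := hE.edges_empty
        rw [graphElt_empty, graphCoprod_one, map_one, one_mul, map_zero, zero_mul, one_smul,
          zero_add]
      · generalize Finset.Icc 1 n = A at *
        have hd : Disjoint A B := by
          rw [Finset.disjoint_left]
          exact fun x hx hx' => (hAB x hx x hx').ne rfl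
        rw [graphCounit_graphElt hne, zero_smul, add_zero, graphElt_mul hE hF' hAB,
          graphCoprod_graphElt (isGraphOn_union hE hF'), graphCoprod_graphElt hE,
          graphFull_graphElt hF', map_sum, map_sum, map_sum, Finset.sum_mul_sum,
          ← Finset.sum_product']
        symm
        refine Finset.sum_nbij' (fun p => p.1 ∪ p.2) (fun C => (C ∩ A, C ∩ B)) ?_ ?_ ?_ ?_ ?_
        · rintro ⟨C, C'⟩ h
          simp only [Finset.mem_product, mem_closedSetsMin, mem_closedSets] at h ⊢
          obtain ⟨⟨⟨h1, h2⟩, a, ha, h3⟩, h4, h5⟩ := h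
          refine ⟨⟨Finset.union_subset_union h1 h4,
            (closedIn_add_union hE hF' hd h1 h4).2 ⟨h2, h5⟩⟩, a, Finset.mem_union_left _ ha, ?_⟩
          intro b hb
          rcases Finset.mem_union.1 hb with hb | hb
          · exact h3 b hb
          · exact (hAB a (h1 ha) b hb).le
        · intro C h
          simp only [Finset.mem_product, mem_closedSetsMin, mem_closedSets] at h ⊢
          obtain ⟨⟨h1, h2⟩, a, ha, h3⟩ := h
          have hC : C ∩ A ∪ C ∩ B = C := by
            rw [← Finset.inter_union_distrib_left, Finset.inter_eq_left.2 h1]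
          rw [← hC, closedIn_add_union hE hF' hd Finset.inter_subset_right
            Finset.inter_subset_right] at h2
          refine ⟨⟨⟨Finset.inter_subset_right, h2.1⟩, a, ?_, fun b hb =>
            h3 b (Finset.mem_union_left _ hb)⟩, Finset.inter_subset_right, h2.2⟩
          refine Finset.mem_inter.2 ⟨ha, ?_⟩
          rcases Finset.mem_union.1 (h1 ha) with h | h
          · exact h
          · obtain ⟨b, hb⟩ := hne
            have := hAB b hb a h
            have := h3 b (Finset.mem_union_left _ hb)
            omega
        · rintro ⟨C, C'⟩ h
          simp only [Finset.mem_product, mem_closedSetsMin, mem_closedSets] at h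
          have h1 := h.1.1.1
          have h2 := h.2.1
          have h3 : ∀ x ∈ A, x ∉ B := fun v hv hv' => Finset.disjoint_left.1 hd hv hv'
          refine Prod.ext ?_ ?_
          · ext x
            have := @h1 x; have := @h2 x; have := h3 x
            simp only [Finset.mem_inter, Finset.mem_union]
            tauto
          · ext x
            have := @h1 x; have := @h2 x; have := h3 x
            simp only [Finset.mem_inter, Finset.mem_union]
            tauto
        · intro C h
          have h1 := (mem_closedSetsMin.1 h).1.1
          change C ∩ A ∪ C ∩ B = C
          rw [← Finset.inter_union_distrib_left, Finset.inter_eq_left.2 h1]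
        · rintro ⟨C, C'⟩ h
          simp only [Finset.mem_product, mem_closedSetsMin, mem_closedSets] at h
          obtain ⟨⟨⟨h1, h2⟩, -⟩, h4, h5⟩ := h
          exact coprodTerm_mul hE hF' hAB h1 h4 h2 h5

end Axioms

section DifferentialAxioms

variable {K : Type*} [Field K] {k : ℕ}

/-! ### Compatibility of the differential of graphs with products and cooperations -/

theorem dTerm_of_lt {A : Finset ℕ} {E : Multiset (ℕ × ℕ)} {e : ℕ × ℕ} (h : e.1 < e.2) :
    dTerm K k A E e = (-1 : K) ^ SymGraph.rank A e.2 •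
      graphElt K k (A.erase e.2) ((E.erase e).map (Prod.map (merge e) (merge e))) := by
  rw [dTerm, enorm_of_lt h, edgeSign_of_lt h, one_smul]

theorem map_merge_of_notMem {A : Finset ℕ} {E : Multiset (ℕ × ℕ)}
    (hE : ∀ e ∈ E, e.1 ∈ A ∧ e.2 ∈ A) {e : ℕ × ℕ} (h : e.2 ∉ A) :
    E.map (Prod.map (merge e) (merge e)) = E := by
  conv_rhs => rw [← Multiset.map_id E]
  refine Multiset.map_congr rfl fun a ha => ?_
  have := hE a ha
  exact Prod.ext (merge_of_ne fun h' => h (h' ▸ this.1)) (merge_of_ne fun h' => h (h' ▸ this.2))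

theorem graphD_graphElt_mul (hk : k = 0 ∨ k = 2) {A B : Finset ℕ} {E F : Multiset (ℕ × ℕ)}
    (hE : IsGraphOn k A E) (hF : IsGraphOn k B F) (hEl : ∀ e ∈ E, e.1 < e.2)
    (hFl : ∀ e ∈ F, e.1 < e.2) (hAB : ∀ a ∈ A, ∀ b ∈ B, a < b) :
    graphD K k (graphElt K k A E * graphElt K k B F) =
      graphD K k (graphElt K k A E) * graphElt K k B F +
        (-1 : K) ^ A.card • (graphElt K k A E * graphD K k (graphElt K k B F)) := by
  rw [graphElt_mul hE hF hAB, graphD_graphElt (isGraphOn_union hE hF), graphD_graphElt hE,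
    graphD_graphElt hF, Multiset.map_add, Multiset.sum_add, ← Multiset.sum_map_mul_right,
    ← Multiset.sum_map_mul_left, Multiset.smul_sum, Multiset.map_map]
  have hd1 : ∀ v ∈ A, v ∉ B := fun v hv hv' => (hAB v hv v hv').ne rfl
  have hd2 : ∀ v ∈ B, v ∉ A := fun v hv hv' => (hAB v hv' v hv).ne rfl
  congr 2
  · refine Multiset.map_congr rfl fun e he => ?_
    have h1 := hE.mem e he
    have hc := hE.contract hk he (hEl e he).ne
    rw [enorm_of_lt (hEl e he)] at hc
    rw [dTerm_of_lt (hEl e he), dTerm_of_lt (hEl e he), smul_mul_assoc, graphElt_mul hc hF,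
      rank_union_left hAB h1.2, Finset.erase_union_distrib,
      Finset.erase_eq_of_notMem (hd1 _ h1.2), Multiset.erase_add_left_pos _ he, Multiset.map_add,
      map_merge_of_notMem hF.mem (hd1 _ h1.2)]
    exact fun a ha b hb => hAB a (Finset.mem_of_mem_erase ha) b hb
  · refine Multiset.map_congr rfl fun e he => ?_
    have h1 := hF.mem e he
    have hc := hF.contract hk he (hFl e he).ne
    rw [enorm_of_lt (hFl e he)] at hc
    rw [Function.comp_apply, dTerm_of_lt (hFl e he), dTerm_of_lt (hFl e he), mul_smul_comm,
      graphElt_mul hE hc, smul_smul, ← pow_add,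
      rank_union_right hAB h1.2, Finset.erase_union_distrib,
      Finset.erase_eq_of_notMem (hd2 _ h1.2), Multiset.erase_add_right_pos _ he, Multiset.map_add,
      map_merge_of_notMem hE.mem (hd2 _ h1.2)]
    exact fun a ha b hb => hAB a ha b (Finset.mem_of_mem_erase hb)

theorem signMap_graphElt (A : Finset ℕ) (E : Multiset (ℕ × ℕ)) :
    signMap (graphGrade K k) (graphElt K k A E) = (-1 : K) ^ A.card • graphElt K k A E := by
  rw [signMap_of_mem _ (graphElt_mem_graphGrade A E), Int.coe_negOnePow_natCast]
  push_cast
  rfl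

/-- The Leibniz rule. The sign of the second term comes from the positions of the vertices of the
second graph, which are shifted by the number of vertices of the first one. -/
theorem graphD_mul (hk : k = 0 ∨ k = 2) (x y : GraphAlg K k) :
    graphD K k (x * y) = graphD K k x * y + signMap (graphGrade K k) x * graphD K k y := by
  induction x using graphAlg_induction with
  | zero => simp
  | add x x' hx hx' => simp only [add_mul, map_add, hx, hx']; abel
  | smul c x hx => simp only [smul_mul_assoc, map_smul, hx, smul_add]
  | elt n E hE hEl =>
    induction y using graphAlg_induction with
    | zero => simp
    | add y y' hy hy' => simp only [mul_add, map_add, hy, hy']; abel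
    | smul c y hy => simp only [mul_smul_comm, map_smul, hy, smul_add]
    | elt m F hF hFl =>
      obtain ⟨B, F', hF', hFl', hAB, h⟩ := exists_graphElt_shift (K := K) (n := n) m hF hFl
      rw [h, graphD_graphElt_mul hk hE hF' hEl hFl' hAB, signMap_graphElt, smul_mul_assoc]

theorem merge_mem_erase_iff {e : ℕ × ℕ} (h : e.1 ≠ e.2) {C : Finset ℕ} (hC : e.1 ∈ C ↔ e.2 ∈ C)
    (v : ℕ) : merge e v ∈ C.erase e.2 ↔ v ∈ C := by
  by_cases hv : v = e.2
  · subst hv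
    rw [merge_snd, Finset.mem_erase, hC]
    exact ⟨fun h => h.2, fun h' => ⟨h, h'⟩⟩
  · rw [merge_of_ne hv, Finset.mem_erase]
    exact ⟨fun h => h.2, fun h' => ⟨hv, h'⟩⟩

/-- The unions of connected components correspond to each other under the contraction of an edge. -/
theorem closedIn_contract {E : Multiset (ℕ × ℕ)} {e : ℕ × ℕ} (h : e.1 ≠ e.2)
    {C : Finset ℕ} (hC : e.1 ∈ C ↔ e.2 ∈ C) :
    ClosedIn ((E.erase e).map (Prod.map (merge e) (merge e))) (C.erase e.2) ↔ ClosedIn E C := by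
  constructor
  · intro hcl a ha
    by_cases hae : a = e
    · rw [hae]; exact hC
    · have := hcl _ (Multiset.mem_map_of_mem _ ((Multiset.mem_erase_of_ne hae).2 ha))
      rwa [Prod.map_fst, Prod.map_snd, merge_mem_erase_iff h hC, merge_mem_erase_iff h hC] at this
  · intro hcl a' ha'
    obtain ⟨a, ha, rfl⟩ := Multiset.mem_map.1 ha'
    rw [Prod.map_fst, Prod.map_snd, merge_mem_erase_iff h hC, merge_mem_erase_iff h hC]
    exact hcl a (Multiset.mem_of_mem_erase ha)

theorem edgesIn_contract {E : Multiset (ℕ × ℕ)} {e : ℕ × ℕ} (h : e.1 ≠ e.2)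
    {C : Finset ℕ} (hC : e.1 ∈ C ↔ e.2 ∈ C) :
    edgesIn ((E.erase e).map (Prod.map (merge e) (merge e))) (C.erase e.2) =
      (edgesIn (E.erase e) C).map (Prod.map (merge e) (merge e)) := by
  rw [edgesIn, Multiset.filter_map, edgesIn]
  congr 1
  refine Multiset.filter_congr fun a _ => ?_
  rw [Function.comp_apply, Prod.map_fst, Prod.map_snd, merge_mem_erase_iff h hC,
    merge_mem_erase_iff h hC]

theorem edgesIn_erase_of_mem {E : Multiset (ℕ × ℕ)} {e : ℕ × ℕ} {C : Finset ℕ} (h1 : e.1 ∈ C)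
    (h2 : e.2 ∈ C) : edgesIn (E.erase e) C = (edgesIn E C).erase e := by
  by_cases he : e ∈ E
  · conv_rhs => rw [← Multiset.cons_erase he]
    rw [edgesIn, edgesIn, Multiset.filter_cons_of_pos (p := fun e : ℕ × ℕ => e.1 ∈ C ∧ e.2 ∈ C) _
      ⟨h1, h2⟩, Multiset.erase_cons_head]
  · rw [Multiset.erase_of_notMem he, Multiset.erase_of_notMem fun h => he (mem_edgesIn.1 h).1]

theorem edgesIn_erase_of_notMem {E : Multiset (ℕ × ℕ)} {e : ℕ × ℕ} {C : Finset ℕ}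
    (h2 : e.2 ∉ C) : edgesIn (E.erase e) C = edgesIn E C := by
  by_cases he : e ∈ E
  · conv_rhs => rw [← Multiset.cons_erase he]
    rw [edgesIn, edgesIn, Multiset.filter_cons_of_neg (p := fun e : ℕ × ℕ => e.1 ∈ C ∧ e.2 ∈ C) _
      (fun h => h2 h.2)]
  · rw [Multiset.erase_of_notMem he]

/-- The part in `C` of the contraction of an edge in `C` is a term of the differential. -/
theorem graphElt_contract_of_mem {E : Multiset (ℕ × ℕ)} {e : ℕ × ℕ} (h : e.1 < e.2)
    {C : Finset ℕ} (h1 : e.1 ∈ C) (h2 : e.2 ∈ C) :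
    (-1 : K) ^ SymGraph.rank C e.2 • graphElt K k (C.erase e.2)
      (edgesIn ((E.erase e).map (Prod.map (merge e) (merge e))) (C.erase e.2)) =
        dTerm K k C (edgesIn E C) e := by
  rw [dTerm_of_lt h, edgesIn_contract h.ne (iff_of_true h1 h2), edgesIn_erase_of_mem h1 h2]

/-- The part in `C` of a graph does not change by the contraction of an edge outside of `C`. -/
theorem edgesIn_contract_of_notMem {E : Multiset (ℕ × ℕ)} {e : ℕ × ℕ} (h : e.1 < e.2)
    {C : Finset ℕ} (h1 : e.1 ∉ C) (h2 : e.2 ∉ C) :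
    edgesIn ((E.erase e).map (Prod.map (merge e) (merge e))) (C.erase e.2) = edgesIn E C := by
  rw [edgesIn_contract h.ne (iff_of_false h1 h2), edgesIn_erase_of_notMem h2,
    map_merge_of_notMem (fun a ha => (mem_edgesIn.1 ha).2) h2]

theorem invCount_singleton_right (U : Finset ℕ) (j : ℕ) (hj : j ∉ U) :
    invCount U {j} = SymGraph.rank U j := by
  refine Finset.card_bij (fun p _ => p.1) ?_ ?_ ?_
  · intro p hp
    simp only [Finset.mem_filter, Finset.mem_product, Finset.mem_singleton] at hp ⊢
    exact ⟨hp.1.1, hp.1.2 ▸ hp.2.le⟩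
  · intro p hp q hq hpq
    simp only [Finset.mem_filter, Finset.mem_product, Finset.mem_singleton] at hp hq
    exact Prod.ext hpq (hp.1.2.trans hq.1.2.symm)
  · intro u hu
    rw [Finset.mem_filter] at hu
    have hne : u ≠ j := fun h => hj (h ▸ hu.1)
    refine ⟨(u, j), ?_, rfl⟩
    simp only [Finset.mem_filter, Finset.mem_product, Finset.mem_singleton]
    exact ⟨⟨hu.1, trivial⟩, by omega⟩

theorem rank_sdiff_add_rank {A C : Finset ℕ} (hC : C ⊆ A) (j : ℕ) :
    SymGraph.rank (A \ C) j + SymGraph.rank C j = SymGraph.rank A j := by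
  rw [SymGraph.rank, SymGraph.rank, SymGraph.rank, ← Finset.card_union_of_disjoint
    (Finset.disjoint_filter_filter Finset.sdiff_disjoint), ← Finset.filter_union,
    Finset.sdiff_union_of_subset hC]

theorem erase_sdiff_erase {A C : Finset ℕ} (j : ℕ) :
    A.erase j \ C.erase j = (A \ C).erase j := by
  ext x; simp only [Finset.mem_sdiff, Finset.mem_erase]; tauto

theorem invCount_erase_right {U C : Finset ℕ} {j : ℕ} (hj : j ∈ C) (hjU : j ∉ U) :
    invCount U C = invCount U (C.erase j) + SymGraph.rank U j := by
  have h : Disjoint (C.erase j) {j} := by simp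
  rw [← invCount_singleton_right U j hjU, ← invCount_union_right h]
  congr 1
  ext x; simp only [Finset.mem_union, Finset.mem_erase, Finset.mem_singleton]
  by_cases hx : x = j
  · simp [hx, hj]
  · simp [hx]

theorem invCount_erase_left {D C : Finset ℕ} {j : ℕ} (hj : j ∈ D) (hjC : j ∉ C) :
    invCount D C + SymGraph.rank C j = invCount (D.erase j) C + C.card := by
  have h : Disjoint (D.erase j) {j} := by simp
  have h1 : invCount D C = invCount (D.erase j) C + invCount {j} C := by
    rw [← invCount_union_left h]
    congr 1
    ext x; simp only [Finset.mem_union, Finset.mem_erase, Finset.mem_singleton]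
    by_cases hx : x = j
    · simp [hx, hj]
    · simp [hx]
  have h2 := invCount_add_swap (U := {j}) (V := C) (by simpa using hjC)
  rw [invCount_singleton_right C j hjC, Finset.card_singleton, one_mul] at h2
  omega

/-- The differential of the tensor square on a summand of the cooperation: the edges in `C` and
those in its complement are contracted. -/
theorem tensorD_coprodTerm {A C : Finset ℕ} {E : Multiset (ℕ × ℕ)} (hE : IsGraphOn k A E)
    (hlt : ∀ e ∈ E, e.1 < e.2) (hCA : C ⊆ A) (hC : ClosedIn E C) :
    tensorD (graphGrade K k) (graphD K k) (coprodTerm K k A E C) =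
      (E.map fun e => (-1 : K) ^ SymGraph.rank A e.2 • coprodTerm K k (A.erase e.2)
        ((E.erase e).map (Prod.map (merge e) (merge e))) (C.erase e.2)).sum := by
  have hs : A \ C ⊆ A := Finset.sdiff_subset
  have hC' := hC.sdiff hE
  conv_rhs => enter [1, 2]; rw [← edgesIn_add_edgesIn_sdiff hE hC]
  rw [coprodTerm, map_smul, tensorD, LinearMap.add_apply, TensorProduct.map_tmul,
    TensorProduct.map_tmul, LinearMap.id_apply, signMap_graphElt,
    graphD_graphElt (hE.edgesIn hCA hC), graphD_graphElt (hE.edgesIn hs hC'), Multiset.map_add,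
    Multiset.sum_add, smul_add]
  have hl : ∀ (s : Multiset (GraphAlg K k)) (y : GraphAlg K k), s.sum ⊗ₜ[K] y =
      (s.map fun x => x ⊗ₜ[K] y).sum := by
    intro s y
    exact map_multiset_sum ((TensorProduct.mk K (GraphAlg K k) (GraphAlg K k)).flip y) s
  have hr : ∀ (s : Multiset (GraphAlg K k)) (y : GraphAlg K k), y ⊗ₜ[K] s.sum =
      (s.map fun x => y ⊗ₜ[K] x).sum := by
    intro s y
    exact map_multiset_sum (TensorProduct.mk K (GraphAlg K k) (GraphAlg K k) y) s
  rw [hl, hr, Multiset.smul_sum, Multiset.smul_sum, Multiset.map_map, Multiset.map_map,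
    Multiset.map_map, Multiset.map_map]
  congr 2
  · refine Multiset.map_congr rfl fun e he => ?_
    obtain ⟨heE, h1, h2⟩ := mem_edgesIn.1 he
    have h := hlt e heE
    have h1' : e.1 ∉ A \ C := fun h => (Finset.mem_sdiff.1 h).2 h1
    have h2' : e.2 ∉ A \ C := fun h => (Finset.mem_sdiff.1 h).2 h2
    simp only [Function.comp_apply]
    rw [← graphElt_contract_of_mem h h1 h2, coprodTerm, erase_sdiff_erase,
      edgesIn_contract_of_notMem h h1' h2', Finset.erase_eq_of_notMem h2',
      ← TensorProduct.smul_tmul', smul_smul, smul_smul, invCount_erase_right h2 h2',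
      ← rank_sdiff_add_rank hCA]
    congr 1
    ring
  · refine Multiset.map_congr rfl fun e he => ?_
    obtain ⟨heE, h1, h2⟩ := mem_edgesIn.1 he
    have h := hlt e heE
    have h1' : e.1 ∉ C := (Finset.mem_sdiff.1 h1).2
    have h2' : e.2 ∉ C := (Finset.mem_sdiff.1 h2).2
    simp only [Function.comp_apply]
    rw [← graphElt_contract_of_mem h h1 h2, coprodTerm, erase_sdiff_erase,
      edgesIn_contract_of_notMem h h1' h2', Finset.erase_eq_of_notMem h2',
      TensorProduct.smul_tmul_smul, smul_smul, smul_smul, ← rank_sdiff_add_rank hCA]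
    congr 1
    have := invCount_erase_left h2 h2'
    rw [← pow_add, ← pow_add, ← pow_add]
    have e1 : SymGraph.rank (A \ C) e.2 + SymGraph.rank C e.2 + invCount ((A \ C).erase e.2) C +
        2 * (C.card) = invCount (A \ C) C + (C.card + SymGraph.rank (A \ C) e.2) +
          2 * SymGraph.rank C e.2 := by omega
    have e2 := congrArg (fun n => (-1 : K) ^ n) e1
    simpa [pow_add, pow_mul] using e2.symm

theorem finset_sum_multiset_sum {α β M : Type*} [AddCommMonoid M] (s : Finset α) (E : Multiset β)
    (f : α → β → M) : ∑ a ∈ s, (E.map (f a)).sum = (E.map fun b => ∑ a ∈ s, f a b).sum := by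
  induction E using Multiset.induction with
  | empty => simp
  | cons b E ih => simp [Finset.sum_add_distrib, ih]

/-- The differential is compatible with the cooperation: an edge of `G` joins two vertices of `C` or
two vertices of its complement if `C` is closed, and the closed sets of `G / e` correspond to those
of `G`. -/
theorem graphCoprod_graphD (hk : k = 0 ∨ k = 2) (x : GraphAlg K k) :
    graphCoprod K k (graphD K k x) = tensorD (graphGrade K k) (graphD K k) (graphCoprod K k x) := by
  induction x using graphAlg_induction with
  | zero => simp
  | add x y hx hy => simp only [map_add, hx, hy]
  | smul c x hx => simp only [map_smul, hx]
  | elt m E hE hlt =>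
    generalize Finset.Icc 1 m = A at hE
    rw [graphD_graphElt hE, graphCoprod_graphElt hE, map_sum, map_multiset_sum, Multiset.map_map]
    rw [Finset.sum_congr rfl fun C hC => tensorD_coprodTerm hE hlt (mem_closedSetsMin.1 hC).1.1
      (mem_closedSetsMin.1 hC).1.2, finset_sum_multiset_sum]
    congr 1
    refine Multiset.map_congr rfl fun e he => ?_
    have h := hlt e he
    have hm := hE.mem e he
    have hc := hE.contract hk he h.ne
    rw [enorm_of_lt h] at hc
    rw [Function.comp_apply, dTerm_of_lt h, map_smul, graphCoprod_graphElt hc, Finset.smul_sum]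
    symm
    refine Finset.sum_nbij' (fun C => C.erase e.2)
      (fun C => if e.1 ∈ C then insert e.2 C else C) ?_ ?_ ?_ ?_ ?_
    · intro C hC
      obtain ⟨⟨h1, h2⟩, a, ha, h3⟩ := mem_closedSetsMin.1 hC
      refine mem_closedSetsMin.2 ⟨⟨Finset.erase_subset_erase _ h1,
        (closedIn_contract h.ne (h2 e he)).2 h2⟩, a, Finset.mem_erase.2 ⟨?_, ha⟩,
        fun b hb => h3 b (Finset.mem_of_mem_erase hb)⟩
      have := h3 e.1 hm.1
      omega
    · intro C hC
      obtain ⟨⟨h1, h2⟩, a, ha, h3⟩ := mem_closedSetsMin.1 hC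
      have h4 : e.2 ∉ C := fun h => Finset.notMem_erase _ _ (h1 h)
      have h5 := h3 e.1 (Finset.mem_erase.2 ⟨h.ne, hm.1⟩)
      have h6 : ∀ b ∈ A, a ≤ b := by
        intro b hb
        by_cases hb2 : b = e.2
        · omega
        · exact h3 b (Finset.mem_erase.2 ⟨hb2, hb⟩)
      have h7 : C ⊆ A := h1.trans (Finset.erase_subset _ _)
      by_cases h8 : e.1 ∈ C
      · rw [if_pos h8]
        refine mem_closedSetsMin.2 ⟨⟨Finset.insert_subset hm.2 h7, ?_⟩, a,
          Finset.mem_insert_of_mem ha, h6⟩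
        rw [← closedIn_contract h.ne (C := insert e.2 C) (by simp [h8]),
          Finset.erase_insert h4]
        exact h2
      · rw [if_neg h8]
        refine mem_closedSetsMin.2 ⟨⟨h7, ?_⟩, a, ha, h6⟩
        rw [← closedIn_contract h.ne (C := C) (iff_of_false h8 h4), Finset.erase_eq_of_notMem h4]
        exact h2
    · intro C hC
      have h2 := (mem_closedSetsMin.1 hC).1.2 e he
      by_cases h8 : e.1 ∈ C
      · rw [if_pos (Finset.mem_erase.2 ⟨h.ne, h8⟩), Finset.insert_erase (h2.1 h8)]
      · rw [if_neg fun h => h8 (Finset.mem_of_mem_erase h),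
          Finset.erase_eq_of_notMem fun h => h8 (h2.2 h)]
    · intro C hC
      have h4 : e.2 ∉ C := fun h => Finset.notMem_erase _ _ ((mem_closedSetsMin.1 hC).1.1 h)
      split_ifs with h8
      · exact Finset.erase_insert h4
      · exact Finset.erase_eq_of_notMem h4
    · intro C _
      rfl

variable (K) in
/-- The differential graded Zinbiel-associative bialgebra of graphs. -/
def graphBialgebra [CharZero K] (hk : k = 0 ∨ k = 2) : DGZinbAs K (graphGrade K k) where
  counit := graphCounit K k
  coprod := graphCoprod K k
  full := graphFull K k
  d := graphD K k
  full_apply _ := rfl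
  counit_mem := graphCounit_of_mem
  coprod_mem := graphCoprod_mem
  d_mem := graphD_mem
  coprod_one := graphCoprod_one
  counit_left := graphCounit_left
  counit_right := graphCounit_right
  zinbiel := graph_zinbiel
  compat x y hx := by rw [graph_compat, hx, zero_smul, add_zero]
  d_comp_d := LinearMap.ext fun x => graphD_graphD hk x
  d_mul n x hx y := by rw [graphD_mul hk, signMap_of_mem _ hx, smul_mul_assoc]
  coprod_d := graphCoprod_graphD hk
  counit_d := graphCounit_graphD

/-- A graph with at most `r` vertices lies in the step `r` of the filtration. -/
theorem graphElt_mem_filt [CharZero K] (hk : k = 0 ∨ k = 2) (r : ℕ) {A : Finset ℕ}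
    {E : Multiset (ℕ × ℕ)} (hE : IsGraphOn k A E) (hA : A.card ≤ r) :
    graphElt K k A E ∈ (graphBialgebra K hk).filt r := by
  induction r generalizing A E with
  | zero =>
    obtain rfl := Finset.card_eq_zero.1 (Nat.le_zero.1 hA)
    obtain rfl := hE.edges_empty
    rw [graphElt_empty]
    exact (graphBialgebra K hk).one_mem_filt 0
  | succ r ih =>
    rcases A.eq_empty_or_nonempty with rfl | hne
    · obtain rfl := hE.edges_empty
      rw [graphElt_empty]
      exact (graphBialgebra K hk).one_mem_filt _
    · change graphCoprod K k (graphElt K k A E) - graphElt K k A E ⊗ₜ[K] 1 ∈ LinearMap.range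
        (TensorProduct.map ((graphBialgebra K hk).filt r).subtype
          ((graphBialgebra K hk).filt r).subtype)
      classical
      rw [graphCoprod_graphElt hE, ← Finset.add_sum_erase _ _ (self_mem_closedSetsMin hne hE),
        coprodTerm_self hE, add_sub_cancel_left]
      refine Submodule.sum_mem _ fun C hC => Submodule.smul_mem _ _ ?_
      obtain ⟨hCA, hC⟩ := Finset.mem_erase.1 hC
      obtain ⟨⟨h1, h2⟩, a, ha, -⟩ := mem_closedSetsMin.1 hC
      have h3 := Finset.card_lt_card (h1.ssubset_of_ne hCA)
      have h4 := Finset.card_sdiff_add_card_eq_card h1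
      have h5 := Finset.card_pos.2 ⟨a, ha⟩
      exact tmul_mem_range_map (ih (hE.edgesIn h1 h2) (by omega))
        (ih (hE.edgesIn Finset.sdiff_subset (h2.sdiff hE)) (by omega))

theorem DGZinbAs.filt_le_succ {H : Type*} [Ring H] [Algebra K H]
    {𝒜 : ℤ → Submodule K H} [GradedAlgebra 𝒜] (B : DGZinbAs K 𝒜) (r : ℕ) :
    B.filt r ≤ B.filt (r + 1) := by
  induction r with
  | zero =>
    intro x hx
    obtain ⟨c, rfl⟩ := Submodule.mem_span_singleton.1 hx
    exact Submodule.smul_mem _ _ (B.one_mem_filt 1)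
  | succ r ih =>
    intro x hx
    have h := range_map_le_range_map (S := B.filt r) (f := (B.filt (r + 1)).subtype)
      (by rwa [Submodule.range_subtype])
    exact h hx

theorem graphBialgebra_connected [CharZero K] (hk : k = 0 ∨ k = 2) :
    (graphBialgebra K hk).Connected := by
  have hmono : Monotone (graphBialgebra K hk).filt :=
    monotone_nat_of_le_succ (DGZinbAs.filt_le_succ _)
  intro x
  induction x using graphAlg_induction with
  | zero => exact ⟨0, Submodule.zero_mem _⟩
  | add x y hx hy =>
    obtain ⟨r, hr⟩ := hx
    obtain ⟨s, hs⟩ := hy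
    exact ⟨max r s, Submodule.add_mem _ (hmono (le_max_left r s) hr) (hmono (le_max_right r s) hs)⟩
  | smul c x hx =>
    obtain ⟨r, hr⟩ := hx
    exact ⟨r, Submodule.smul_mem _ _ hr⟩
  | elt m E hE _ => exact ⟨_, graphElt_mem_filt hk _ hE le_rfl⟩

end DifferentialAxioms

section ConnectedGraphs

variable {K : Type*} [Field K] {k : ℕ}

/-! ### Connected graphs -/

/-- The graph with vertex set `A` and edges `E` is connected: it is not empty, and it is the only
nonempty union of components. -/
structure IsConn (A : Finset ℕ) (E : Multiset (ℕ × ℕ)) : Prop where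
  nonempty : A.Nonempty
  eq_of_closed : ∀ C ⊆ A, C.Nonempty → ClosedIn E C → C = A

theorem isConn_of_connected {G : SymGraph} (h : G.adjGraph.Connected) :
    IsConn (Finset.Icc 1 G.n) G.edges where
  nonempty := by
    obtain ⟨⟨v, hv⟩⟩ := h.nonempty
    exact ⟨v, hv⟩
  eq_of_closed C hC hne hcl := by
    obtain ⟨u, hu⟩ := hne
    refine hC.antisymm fun v hv => ?_
    obtain ⟨p⟩ := h.preconnected ⟨u, hC hu⟩ ⟨v, hv⟩
    have key : ∀ {a b : Finset.Icc 1 G.n}, G.adjGraph.Walk a b → (a : ℕ) ∈ C → (b : ℕ) ∈ C := by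
      intro a b p
      induction p with
      | nil => exact id
      | cons hab _ ih =>
        intro ha
        apply ih
        obtain ⟨-, h | h⟩ := (SimpleGraph.fromRel_adj _ _ _).1 hab
        · exact (hcl _ h).1 ha
        · exact (hcl _ h).2 ha
    exact key p hu

theorem IsConn.connected {G : SymGraph} (h : IsConn (Finset.Icc 1 G.n) G.edges) :
    G.adjGraph.Connected := by
  classical
  obtain ⟨u, hu⟩ := h.nonempty
  refine SimpleGraph.connected_iff_exists_forall_reachable _ |>.2 ⟨⟨u, hu⟩, ?_⟩
  let C : Finset ℕ := ((Finset.Icc 1 G.n).attach.filter fun v => G.adjGraph.Reachable ⟨u, hu⟩ v).map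
    (Function.Embedding.subtype _)
  have hC : ∀ v, v ∈ C ↔ ∃ hv : v ∈ Finset.Icc 1 G.n, G.adjGraph.Reachable ⟨u, hu⟩ ⟨v, hv⟩ := by
    intro v
    simp [C]
  have hCA : C = Finset.Icc 1 G.n := by
    refine h.eq_of_closed C (fun v hv => ((hC v).1 hv).1)
      ⟨u, (hC u).2 ⟨hu, SimpleGraph.Reachable.refl _⟩⟩ ?_
    intro e he
    have h1 := G.edges_mem e he
    have m1 : e.1 ∈ Finset.Icc 1 G.n := Finset.mem_Icc.2 (by omega)
    have m2 : e.2 ∈ Finset.Icc 1 G.n := Finset.mem_Icc.2 (by omega)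
    have hadj : G.adjGraph.Adj ⟨e.1, m1⟩ ⟨e.2, m2⟩ :=
      (SimpleGraph.fromRel_adj _ _ _).2 ⟨fun h => h1.2.1.ne (congrArg Subtype.val h), Or.inl he⟩
    rw [hC, hC]
    exact ⟨fun ⟨_, h⟩ => ⟨m2, h.trans hadj.reachable⟩,
      fun ⟨_, h⟩ => ⟨m1, h.trans hadj.symm.reachable⟩⟩
  rintro ⟨v, hv⟩
  rw [← hCA] at hv
  exact ((hC v).1 hv).2

theorem IsConn.image {A : Finset ℕ} {E : Multiset (ℕ × ℕ)} (h : IsConn A E)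
    (hE : ∀ e ∈ E, e.1 ∈ A ∧ e.2 ∈ A) {f : ℕ → ℕ} (hf : Set.InjOn f A) :
    IsConn (A.image f) (E.map (Prod.map f f)) where
  nonempty := h.nonempty.image f
  eq_of_closed C' hC' hne hcl := by
    obtain ⟨C, h4, rfl⟩ := Finset.subset_image_iff.1 hC'
    have h4 : C ⊆ A := by exact_mod_cast h4
    rw [h.eq_of_closed C h4 (Finset.image_nonempty.1 hne) ((closedIn_map hf hE h4).1 hcl)]

theorem isConn_map_enorm {A : Finset ℕ} {E : Multiset (ℕ × ℕ)} (h : IsConn A E) :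
    IsConn A (E.map enorm) :=
  ⟨h.nonempty, fun C hC hne hcl => h.eq_of_closed C hC hne (closedIn_map_enorm.1 hcl)⟩

theorem graphElt_mem_connectedGraphs {A : Finset ℕ} {E : Multiset (ℕ × ℕ)}
    (hE : IsGraphOn k A E) (h : IsConn A E) : graphElt K k A E ∈ connectedGraphs K k := by
  by_cases hl : ∀ e ∈ E, e.1 ≠ e.2
  · have hlt : ∀ e ∈ E.map enorm, e.1 < e.2 := by
      intro e he
      obtain ⟨a, ha, rfl⟩ := Multiset.mem_map.1 he
      exact enorm_lt (hl a ha)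
    have hm := hE.map_enorm.stdGraph_mem hlt
    rw [graphElt, graphBasis, dif_pos hm]
    refine Submodule.smul_mem _ _ (Submodule.subset_span ⟨⟨_, hm⟩, IsConn.connected ?_, rfl⟩)
    rw [stdGraph_edges hE.map_enorm.mem hlt]
    change IsConn (Finset.Icc 1 A.card) _
    rw [← image_rank]
    exact (isConn_map_enorm h).image hE.map_enorm.mem (rank_strictMonoOn A).injOn
  · push Not at hl
    obtain ⟨l, hl, hl'⟩ := hl
    rw [graphElt_of_loop A hl hl']
    exact Submodule.zero_mem _

theorem IsConn.contract {A : Finset ℕ} {E : Multiset (ℕ × ℕ)} (h : IsConn A E) {e : ℕ × ℕ}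
    (hm : e.1 ∈ A ∧ e.2 ∈ A) (hne : e.1 ≠ e.2) :
    IsConn (A.erase e.2) ((E.erase e).map (Prod.map (merge e) (merge e))) where
  nonempty := ⟨e.1, Finset.mem_erase.2 ⟨hne, hm.1⟩⟩
  eq_of_closed C hC hCne hcl := by
    have h4 : e.2 ∉ C := fun h => Finset.notMem_erase _ _ (hC h)
    have h7 : C ⊆ A := hC.trans (Finset.erase_subset _ _)
    by_cases h8 : e.1 ∈ C
    · have h9 : insert e.2 C = A := by
        refine h.eq_of_closed _ (Finset.insert_subset hm.2 h7) (Finset.insert_nonempty _ _) ?_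
        rw [← closedIn_contract hne (C := insert e.2 C) (by simp [h8]), Finset.erase_insert h4]
        exact hcl
      rw [← h9, Finset.erase_insert h4]
    · have h9 : C = A := by
        refine h.eq_of_closed _ h7 hCne ?_
        rw [← closedIn_contract hne (C := C) (iff_of_false h8 h4), Finset.erase_eq_of_notMem h4]
        exact hcl
      rw [h9] at h4
      exact absurd hm.2 h4

theorem graphD_mem_connectedGraphs (hk : k = 0 ∨ k = 2) {x : GraphAlg K k}
    (hx : x ∈ connectedGraphs K k) : graphD K k x ∈ connectedGraphs K k := by
  induction hx using Submodule.span_induction with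
  | zero => rw [map_zero]; exact Submodule.zero_mem _
  | add a b _ _ ha hb => rw [map_add]; exact Submodule.add_mem _ ha hb
  | smul c a _ ha => rw [map_smul]; exact Submodule.smul_mem _ _ ha
  | mem x hx =>
    obtain ⟨G, hG, rfl⟩ := hx
    have hE := isGraphOn_of_mem G.2
    rw [single_eq_graphElt, graphD_graphElt hE]
    refine multiset_sum_mem _ fun y hy => ?_
    obtain ⟨e, he, rfl⟩ := Multiset.mem_map.1 hy
    have hlt := (G.1.edges_mem e he).2.1
    have hc := hE.contract hk he hlt.ne
    rw [enorm_of_lt hlt] at hc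
    rw [dTerm_of_lt hlt]
    exact Submodule.smul_mem _ _ (graphElt_mem_connectedGraphs hc
      ((isConn_of_connected hG).contract (hE.mem e he) hlt.ne))

theorem connectedGraphs_le_prim [CharZero K] (hk : k = 0 ∨ k = 2) :
    connectedGraphs K k ≤ (graphBialgebra K hk).prim := by
  refine Submodule.span_le.2 ?_
  rintro _ ⟨G, hG, rfl⟩
  have hE := isGraphOn_of_mem G.2
  have hc := isConn_of_connected hG
  rw [single_eq_graphElt]
  refine (DGZinbAs.mem_prim _).2 ⟨graphCounit_graphElt hc.nonempty _, ?_⟩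
  change graphCoprod K k _ = _
  rw [graphCoprod_graphElt hE,
    Finset.sum_eq_single_of_mem _ (self_mem_closedSetsMin hc.nonempty hE),
    coprodTerm_self hE]
  intro C hC hCA
  obtain ⟨⟨h1, h2⟩, a, ha, -⟩ := mem_closedSetsMin.1 hC
  exact absurd (hc.eq_of_closed C h1 ⟨a, ha⟩ h2) hCA

end ConnectedGraphs

section Cuts

/-! ### Cuts of the ordered set of vertices -/

/-- The edge `e` joins a vertex `≤ t` and a vertex `> t`. -/
def Crosses (t : ℕ) (e : ℕ × ℕ) : Prop := (e.1 ≤ t ∧ t < e.2) ∨ (e.2 ≤ t ∧ t < e.1)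

instance (t : ℕ) : DecidablePred (Crosses t) := fun e => by unfold Crosses; infer_instance

/-- The vertices `u` and `v` lie in the same component: the same unions of components contain
them. -/
def Linked (E : Multiset (ℕ × ℕ)) (u v : ℕ) : Prop := ∀ C, ClosedIn E C → (u ∈ C ↔ v ∈ C)

theorem Linked.symm {E : Multiset (ℕ × ℕ)} {u v : ℕ} (h : Linked E u v) : Linked E v u :=
  fun C hC => (h C hC).symm

theorem Linked.trans {E : Multiset (ℕ × ℕ)} {u v w : ℕ} (h : Linked E u v) (h' : Linked E v w) :
    Linked E u w := fun C hC => (h C hC).trans (h' C hC)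

theorem linked_of_mem {E : Multiset (ℕ × ℕ)} {e : ℕ × ℕ} (he : e ∈ E) : Linked E e.1 e.2 :=
  fun _ hC => hC e he

/-- The vertices `u < v` of `A` have no vertex of `A` between them. -/
structure Consecutive (A : Finset ℕ) (u v : ℕ) : Prop where
  left_mem : u ∈ A
  right_mem : v ∈ A
  lt : u < v
  le_or_le : ∀ x ∈ A, x ≤ u ∨ v ≤ x

/-- The cut at `t`, into the vertices `≤ t` and those `> t`, is bad if some edge crosses it but
the two vertices next to it lie in different components. A graph without bad cuts is an ordered
disjoint union of connected graphs. -/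
def BadCut (A : Finset ℕ) (E : Multiset (ℕ × ℕ)) (t : ℕ) : Prop :=
  (∃ e ∈ E, Crosses t e) ∧ ∃ u v, Consecutive A u v ∧ u ≤ t ∧ t < v ∧ ¬ Linked E u v

/-- The number of vertices `> t`. -/
def above (A : Finset ℕ) (t : ℕ) : ℕ := (A.filter (t < ·)).card

/-- All bad cuts have at most `q` vertices above them. -/
def LevelLE (q : ℕ) (A : Finset ℕ) (E : Multiset (ℕ × ℕ)) : Prop :=
  ∀ t, BadCut A E t → above A t ≤ q

theorem LevelLE.mono {q r : ℕ} (h : q ≤ r) {A : Finset ℕ} {E : Multiset (ℕ × ℕ)}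
    (hE : LevelLE q A E) : LevelLE r A E := fun t ht => (hE t ht).trans h

theorem levelLE_card (A : Finset ℕ) (E : Multiset (ℕ × ℕ)) : LevelLE A.card A E :=
  fun _ _ => Finset.card_le_card (Finset.filter_subset _ _)

theorem above_anti (A : Finset ℕ) {s t : ℕ} (h : s ≤ t) : above A t ≤ above A s :=
  Finset.card_le_card fun x hx => by
    simp only [Finset.mem_filter] at hx ⊢
    exact ⟨hx.1, by omega⟩

theorem above_lt_above {A : Finset ℕ} {s t v : ℕ} (hv : v ∈ A) (h : s < v) (h' : v ≤ t) :
    above A t < above A s := by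
  refine Finset.card_lt_card ((Finset.ssubset_iff_of_subset ?_).2
    ⟨v, by simp [hv, h], by simp [h']⟩)
  intro x hx
  simp only [Finset.mem_filter] at hx ⊢
  exact ⟨hx.1, by omega⟩

theorem above_erase_of_lt {A : Finset ℕ} {t j : ℕ} (hj : j ∈ A) (h : t < j) :
    above (A.erase j) t + 1 = above A t := by
  have h1 : (A.erase j).filter (t < ·) = (A.filter (t < ·)).erase j := by
    rw [Finset.filter_erase]
  have h2 : j ∈ A.filter (t < ·) := by simp [hj, h]
  have h3 := Finset.card_pos.2 ⟨j, h2⟩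
  rw [above, h1, Finset.card_erase_of_mem h2, above]
  omega

theorem above_erase_of_ge (A : Finset ℕ) {t j : ℕ} (h : j ≤ t) :
    above (A.erase j) t = above A t := by
  rw [above, above, Finset.filter_erase, Finset.erase_eq_of_notMem]
  simp [h]

theorem crosses_enorm {t : ℕ} {e : ℕ × ℕ} : Crosses t (enorm e) ↔ Crosses t e := by
  simp only [Crosses, enorm]; omega

theorem linked_map_enorm {E : Multiset (ℕ × ℕ)} {u v : ℕ} :
    Linked (E.map enorm) u v ↔ Linked E u v := by
  simp only [Linked, closedIn_map_enorm]

theorem badCut_map_enorm {A : Finset ℕ} {E : Multiset (ℕ × ℕ)} {t : ℕ} :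
    BadCut A (E.map enorm) t ↔ BadCut A E t := by
  simp only [BadCut, linked_map_enorm, Multiset.mem_map, exists_exists_and_eq_and, crosses_enorm]

theorem levelLE_map_enorm {q : ℕ} {A : Finset ℕ} {E : Multiset (ℕ × ℕ)} :
    LevelLE q A (E.map enorm) ↔ LevelLE q A E := by
  simp only [LevelLE, badCut_map_enorm]

/-- A property that differs at two vertices differs at two consecutive vertices between them. -/
theorem exists_consecutive {A : Finset ℕ} (P : ℕ → Prop) {a b : ℕ} (ha : a ∈ A) (hb : b ∈ A)
    (hab : a < b) (h : ¬ (P a ↔ P b)) :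
    ∃ u v, Consecutive A u v ∧ a ≤ u ∧ v ≤ b ∧ ¬ (P u ↔ P v) := by
  obtain ⟨d, hd⟩ : ∃ d, b - a = d := ⟨_, rfl⟩
  induction d using Nat.strong_induction_on generalizing a b with
  | _ d ih =>
    by_cases hx : ∃ x ∈ A, a < x ∧ x < b
    · obtain ⟨x, hx, h1, h2⟩ := hx
      by_cases h3 : P a ↔ P x
      · obtain ⟨u, v, h4, h5, h6, h7⟩ := ih (b - x) (by omega) hx hb h2
          (fun h' => h (h3.trans h')) rfl
        exact ⟨u, v, h4, by omega, h6, h7⟩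
      · obtain ⟨u, v, h4, h5, h6, h7⟩ := ih (x - a) (by omega) ha hx h1 h3 rfl
        exact ⟨u, v, h4, h5, by omega, h7⟩
    · push Not at hx
      refine ⟨a, b, ⟨ha, hb, hab, fun x hxA => ?_⟩, le_rfl, le_rfl, h⟩
      by_contra! hc
      exact absurd (hx x hxA hc.1) (by omega)

/-- The lower end of an edge is linked to the vertices between its ends that lie at or below `t`, if
there are at least `q` vertices above `t` and all bad cuts have at most `q` vertices above them: the
cuts in between are crossed by the edge, and they are not bad. -/
theorem linked_of_crosses {q : ℕ} {A : Finset ℕ} {E : Multiset (ℕ × ℕ)} (hq : LevelLE q A E)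
    {t : ℕ} (ht : q ≤ above A t) {e : ℕ × ℕ} (he : e ∈ E) {x : ℕ} (h1 : e.1 ∈ A) (hx : x ∈ A)
    (h1x : e.1 ≤ x) (hxt : x ≤ t) (hx2 : x ≤ e.2) : Linked E e.1 x := by
  rcases h1x.eq_or_lt with h | h
  · rw [h]; exact fun _ _ => Iff.rfl
  · by_contra hl
    simp only [Linked, not_forall] at hl
    obtain ⟨C, hC, hl⟩ := hl
    obtain ⟨u, v, huv, h2, h3, h4⟩ := exists_consecutive (· ∈ C) h1 hx h hl
    have hlt := huv.lt
    have hb : BadCut A E u := ⟨⟨e, he, Or.inl ⟨h2, by omega⟩⟩, u, v, huv, le_rfl, hlt,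
      fun hL => h4 (hL C hC)⟩
    have h5 := hq u hb
    have h6 := above_lt_above huv.right_mem hlt (h3.trans hxt)
    omega

theorem linked_map {A : Finset ℕ} {E : Multiset (ℕ × ℕ)} (hE : ∀ e ∈ E, e.1 ∈ A ∧ e.2 ∈ A)
    (φ : ℕ → ℕ) {E' : Multiset (ℕ × ℕ)}
    (hE' : ∀ e ∈ E, Linked E' (φ e.1) (φ e.2)) {u v : ℕ} (hu : u ∈ A) (hv : v ∈ A)
    (h : Linked E u v) : Linked E' (φ u) (φ v) := by
  classical
  intro C hC
  have := h (A.filter fun x => φ x ∈ C) (fun e he => by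
    simp only [Finset.mem_filter, hE e he, true_and]
    exact hE' e he C hC)
  simpa only [Finset.mem_filter, hu, hv, true_and] using this

/-! ### Cuts and order preserving relabellings -/

theorem linked_of_linked_map {A : Finset ℕ} {E : Multiset (ℕ × ℕ)}
    (hE : ∀ e ∈ E, e.1 ∈ A ∧ e.2 ∈ A) {f : ℕ → ℕ} (hf : Set.InjOn f A) {u v : ℕ} (hu : u ∈ A)
    (hv : v ∈ A) (h : Linked (E.map (Prod.map f f)) (f u) (f v)) : Linked E u v := by
  intro C hC
  have hCA : C ∩ A ⊆ A := Finset.inter_subset_right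
  have hC' : ClosedIn E (C ∩ A) := fun e he => by
    simp only [Finset.mem_inter, hE e he, and_true]
    exact hC e he
  have key : ∀ x ∈ A, f x ∈ (C ∩ A).image f ↔ x ∈ C := by
    intro x hx
    constructor
    · intro h
      obtain ⟨y, hy, h⟩ := Finset.mem_image.1 h
      exact hf (hCA hy) hx h ▸ (Finset.mem_inter.1 hy).1
    · exact fun h => Finset.mem_image_of_mem f (Finset.mem_inter.2 ⟨h, hx⟩)
  rw [← key u hu, ← key v hv]
  exact h _ ((closedIn_map hf hE hCA).2 hC')

theorem above_image {A : Finset ℕ} {f : ℕ → ℕ} (hf : Set.InjOn f A) {s t : ℕ}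
    (h : ∀ a ∈ A, f a ≤ s ↔ a ≤ t) : above (A.image f) s = above A t := by
  have : (A.image f).filter (s < ·) = (A.filter (t < ·)).image f := by
    ext x
    simp only [Finset.mem_filter, Finset.mem_image]
    constructor
    · rintro ⟨⟨a, ha, rfl⟩, h'⟩
      have := h a ha
      exact ⟨a, ⟨ha, by omega⟩, rfl⟩
    · rintro ⟨a, ⟨ha, h'⟩, rfl⟩
      have := h a ha
      exact ⟨⟨a, ha, rfl⟩, by omega⟩
  rw [above, this, Finset.card_image_of_injOn]
  · rfl
  · exact hf.mono (by intro x; simp; tauto)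

theorem badCut_of_image {A : Finset ℕ} {E : Multiset (ℕ × ℕ)}
    (hE : ∀ e ∈ E, e.1 ∈ A ∧ e.2 ∈ A) {f : ℕ → ℕ} (hf : StrictMonoOn f A) {s : ℕ}
    (h : BadCut (A.image f) (E.map (Prod.map f f)) s) :
    ∃ t, BadCut A E t ∧ ∀ a ∈ A, f a ≤ s ↔ a ≤ t := by
  obtain ⟨⟨e', he', hc⟩, u', v', huv, hus, hsv, hL⟩ := h
  obtain ⟨e, he, rfl⟩ := Multiset.mem_map.1 he'
  obtain ⟨u, hu, rfl⟩ := Finset.mem_image.1 huv.left_mem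
  obtain ⟨v, hv, rfl⟩ := Finset.mem_image.1 huv.right_mem
  have hlt := (hf.lt_iff_lt hu hv).1 huv.lt
  have hor : ∀ x ∈ A, x ≤ u ∨ v ≤ x := by
    intro x hx
    rcases huv.le_or_le _ (Finset.mem_image_of_mem f hx) with h | h
    · exact Or.inl ((hf.le_iff_le hx hu).1 h)
    · exact Or.inr ((hf.le_iff_le hv hx).1 h)
  have key : ∀ a ∈ A, f a ≤ s ↔ a ≤ u := by
    intro a ha
    constructor
    · intro h
      rcases hor a ha with h' | h'
      · exact h'
      · have := (hf.le_iff_le hv ha).2 h'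
        omega
    · intro h
      exact ((hf.le_iff_le ha hu).2 h).trans hus
  refine ⟨u, ⟨⟨e, he, ?_⟩, u, v, ⟨hu, hv, hlt, hor⟩, le_rfl, hlt, fun hl => hL ?_⟩, key⟩
  · have h1 := key _ (hE e he).1
    have h2 := key _ (hE e he).2
    simp only [Crosses, Prod.map_fst, Prod.map_snd] at hc ⊢
    omega
  · exact linked_map hE f
      (fun e he => linked_of_mem (Multiset.mem_map_of_mem (Prod.map f f) he)) hu hv hl

theorem BadCut.image {A : Finset ℕ} {E : Multiset (ℕ × ℕ)}
    (hE : ∀ e ∈ E, e.1 ∈ A ∧ e.2 ∈ A) {f : ℕ → ℕ} (hf : StrictMonoOn f A) {t : ℕ}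
    (h : BadCut A E t) :
    ∃ s, BadCut (A.image f) (E.map (Prod.map f f)) s ∧ ∀ a ∈ A, f a ≤ s ↔ a ≤ t := by
  obtain ⟨⟨e, he, hc⟩, u, v, huv, hut, htv, hL⟩ := h
  have hu := huv.left_mem
  have hv := huv.right_mem
  have key : ∀ a ∈ A, f a ≤ f u ↔ a ≤ t := by
    intro a ha
    rw [hf.le_iff_le ha hu]
    have := huv.le_or_le a ha
    omega
  refine ⟨f u, ⟨⟨_, Multiset.mem_map_of_mem _ he, ?_⟩, f u, f v,
    ⟨Finset.mem_image_of_mem f hu, Finset.mem_image_of_mem f hv, hf hu hv huv.lt, ?_⟩, le_rfl,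
    hf hu hv huv.lt, fun hl => hL (linked_of_linked_map hE hf.injOn hu hv hl)⟩, key⟩
  · have h1 := key _ (hE e he).1
    have h2 := key _ (hE e he).2
    simp only [Crosses, Prod.map_fst, Prod.map_snd] at hc ⊢
    omega
  · intro x hx
    obtain ⟨a, ha, rfl⟩ := Finset.mem_image.1 hx
    rw [hf.le_iff_le ha hu, hf.le_iff_le hv ha]
    exact huv.le_or_le a ha

theorem LevelLE.image {q : ℕ} {A : Finset ℕ} {E : Multiset (ℕ × ℕ)} (h : LevelLE q A E)
    (hE : ∀ e ∈ E, e.1 ∈ A ∧ e.2 ∈ A) {f : ℕ → ℕ} (hf : StrictMonoOn f A) :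
    LevelLE q (A.image f) (E.map (Prod.map f f)) := by
  intro s hs
  obtain ⟨t, ht, hst⟩ := badCut_of_image hE hf hs
  rw [above_image hf.injOn hst]
  exact h t ht

/-! ### Cuts and contractions of edges -/

theorem linked_contract {A : Finset ℕ} {E : Multiset (ℕ × ℕ)} (hE : ∀ e ∈ E, e.1 ∈ A ∧ e.2 ∈ A)
    {e : ℕ × ℕ} {u v : ℕ} (hu : u ∈ A.erase e.2) (hv : v ∈ A.erase e.2)
    (h : Linked E u v) : Linked ((E.erase e).map (Prod.map (merge e) (merge e))) u v := by
  rw [Finset.mem_erase] at hu hv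
  rw [← merge_of_ne hu.1, ← merge_of_ne hv.1]
  refine linked_map hE (merge e) (fun a ha => ?_) hu.2 hv.2 h
  by_cases hae : a = e
  · rw [hae, merge_snd]
    have : merge e e.1 = e.1 := by unfold merge; split_ifs <;> rfl
    rw [this]
    exact fun _ _ => Iff.rfl
  · exact linked_of_mem
      (Multiset.mem_map_of_mem (Prod.map (merge e) (merge e)) ((Multiset.mem_erase_of_ne hae).2 ha))

theorem linked_of_linked_contract {E : Multiset (ℕ × ℕ)} {e : ℕ × ℕ} (he : e ∈ E)
    (hne : e.1 ≠ e.2) {u v : ℕ} (hu : u ≠ e.2) (hv : v ≠ e.2)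
    (h : Linked ((E.erase e).map (Prod.map (merge e) (merge e))) u v) : Linked E u v := by
  intro C hC
  have := h _ ((closedIn_contract hne (hC e he)).2 hC)
  simpa only [Finset.mem_erase, hu, hv, ne_eq, not_false_iff, true_and] using this

theorem crosses_of_crosses_merge {s : ℕ} {e a : ℕ × ℕ}
    (h : Crosses s (Prod.map (merge e) (merge e) a)) : Crosses s a ∨ Crosses s e := by
  simp only [Crosses, Prod.map_fst, Prod.map_snd, merge] at h ⊢
  split_ifs at h <;> omega

/-- A bad cut of a contraction comes from a bad cut of the graph, which is the same cut if the
removed vertex is not next to it. -/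
theorem badCut_of_contract {A : Finset ℕ} {E : Multiset (ℕ × ℕ)}
    (hE : ∀ e ∈ E, e.1 ∈ A ∧ e.2 ∈ A) (hEl : ∀ e ∈ E, e.1 < e.2) {e : ℕ × ℕ} (he : e ∈ E) {s : ℕ}
    (h : BadCut (A.erase e.2) ((E.erase e).map (Prod.map (merge e) (merge e))) s) :
    ∃ t, BadCut A E t ∧ (t < e.2 → above A t = above (A.erase e.2) s + 1) ∧
      (e.2 ≤ t → above A t = above (A.erase e.2) s) := by
  obtain ⟨⟨a', ha', hc⟩, u, v, huv, hus, hsv, hL⟩ := h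
  obtain ⟨a, ha, rfl⟩ := Multiset.mem_map.1 ha'
  have haE := Multiset.mem_of_mem_erase ha
  obtain ⟨hu1, hu2⟩ := Finset.mem_erase.1 huv.left_mem
  obtain ⟨hv1, hv2⟩ := Finset.mem_erase.1 huv.right_mem
  have hL' : ¬ Linked E u v := fun hl => hL (linked_contract hE huv.left_mem huv.right_mem hl)
  have hlt := hEl e he
  have hm := hE e he
  have hab : ∀ t, (∀ x ∈ A.erase e.2, x ≤ s ↔ x ≤ t) →
      above (A.erase e.2) s = above (A.erase e.2) t := by
    intro t h
    rw [above, above]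
    congr 1
    refine Finset.filter_congr fun x hx => ?_
    have := h x hx
    omega
  by_cases hj : u < e.2 ∧ e.2 < v
  · have h1 : e.1 ≤ u := by
      have := huv.le_or_le e.1 (Finset.mem_erase.2 ⟨hlt.ne, hm.1⟩)
      omega
    have hor : ∀ x ∈ A, x ≤ u ∨ x = e.2 ∨ v ≤ x := by
      intro x hx
      by_cases hxe : x = e.2
      · exact Or.inr (Or.inl hxe)
      · have := huv.le_or_le x (Finset.mem_erase.2 ⟨hxe, hx⟩)
        omega
    by_cases hlu : Linked E u e.2
    · have hlv : ¬ Linked E e.2 v := fun hl => hL' (hlu.trans hl)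
      refine ⟨e.2, ⟨⟨a, haE, ?_⟩, e.2, v, ⟨hm.2, hv2, hj.2, ?_⟩, le_rfl, hj.2, hlv⟩, ?_, ?_⟩
      · have h3 := hor _ (hE a haE).1
        have h4 := hor _ (hE a haE).2
        have h5 := hEl a haE
        simp only [Crosses, Prod.map_fst, Prod.map_snd, merge] at hc ⊢
        split_ifs at hc <;> omega
      · intro x hx
        have := hor x hx
        omega
      · intro h; omega
      · intro _
        rw [← above_erase_of_ge A le_rfl]
        refine (hab e.2 fun x hx => ?_).symm
        have h3 := huv.le_or_le x hx
        omega
    · refine ⟨u, ⟨⟨e, he, Or.inl ⟨h1, hj.1⟩⟩, u, e.2, ⟨hu2, hm.2, hj.1, ?_⟩, le_rfl, hj.1, hlu⟩,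
        ?_, ?_⟩
      · intro x hx
        have := hor x hx
        omega
      · intro _
        rw [← above_erase_of_lt hm.2 hj.1]
        rw [hab u fun x hx => ?_]
        have h3 := huv.le_or_le x hx
        omega
      · intro h; omega
  · refine ⟨s, ⟨?_, u, v, ⟨hu2, hv2, huv.lt, ?_⟩, hus, hsv, hL'⟩, ?_, ?_⟩
    · rcases crosses_of_crosses_merge hc with h | h
      · exact ⟨a, haE, h⟩
      · exact ⟨e, he, h⟩
    · intro x hx
      by_cases hxe : x = e.2
      · omega
      · exact huv.le_or_le x (Finset.mem_erase.2 ⟨hxe, hx⟩)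
    · exact fun h => (above_erase_of_lt hm.2 h).symm
    · exact fun h => (above_erase_of_ge A h).symm

/-- The contraction of an edge does not raise the level. -/
theorem LevelLE.contract {q : ℕ} {A : Finset ℕ} {E : Multiset (ℕ × ℕ)} (h : LevelLE q A E)
    (hE : ∀ e ∈ E, e.1 ∈ A ∧ e.2 ∈ A) (hEl : ∀ e ∈ E, e.1 < e.2) {e : ℕ × ℕ} (he : e ∈ E) :
    LevelLE q (A.erase e.2) ((E.erase e).map (Prod.map (merge e) (merge e))) := by
  intro s hs
  obtain ⟨t, ht, h1, h2⟩ := badCut_of_contract hE hEl he hs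
  have h3 := h t ht
  by_cases h4 : t < e.2
  · have := h1 h4; omega
  · have := h2 (by omega); omega

/-- The removal of one of the upper `q + 1` vertices lowers the level. -/
theorem LevelLE.contract_of_above_le {q : ℕ} {A : Finset ℕ} {E : Multiset (ℕ × ℕ)}
    (h : LevelLE (q + 1) A E) (hE : ∀ e ∈ E, e.1 ∈ A ∧ e.2 ∈ A) (hEl : ∀ e ∈ E, e.1 < e.2)
    {e : ℕ × ℕ} (he : e ∈ E) (hq : above A e.2 ≤ q) :
    LevelLE q (A.erase e.2) ((E.erase e).map (Prod.map (merge e) (merge e))) := by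
  intro s hs
  obtain ⟨t, ht, h1, h2⟩ := badCut_of_contract hE hEl he hs
  have h3 := h t ht
  by_cases h4 : t < e.2
  · have := h1 h4; omega
  · have h5 := h2 (by omega)
    have h6 := above_anti A (not_lt.1 h4)
    omega

/-- The lowest bad cut, which has the largest number of vertices above it, survives the contraction
of an edge below it. -/
theorem BadCut.contract {A : Finset ℕ} {E : Multiset (ℕ × ℕ)} {t : ℕ} (ht : BadCut A E t)
    (hq : LevelLE (above A t) A E) (hE : ∀ e ∈ E, e.1 ∈ A ∧ e.2 ∈ A) (hEl : ∀ e ∈ E, e.1 < e.2)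
    {e : ℕ × ℕ} (he : e ∈ E) (het : e.2 ≤ t) :
    BadCut (A.erase e.2) ((E.erase e).map (Prod.map (merge e) (merge e))) t := by
  obtain ⟨⟨a, ha, hc⟩, u, v, huv, hut, htv, hL⟩ := ht
  have hlt := hEl e he
  have hm := hE e he
  have hae : a ≠ e := by
    rintro rfl
    simp only [Crosses] at hc
    omega
  have hve : v ≠ e.2 := by omega
  refine ⟨⟨_, Multiset.mem_map_of_mem _ ((Multiset.mem_erase_of_ne hae).2 ha), ?_⟩, ?_⟩
  · simp only [Crosses, Prod.map_fst, Prod.map_snd, merge] at hc ⊢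
    split_ifs <;> omega
  · by_cases hue : u = e.2
    · have hne : ((A.erase e.2).filter (· ≤ t)).Nonempty :=
        ⟨e.1, by simp only [Finset.mem_filter, Finset.mem_erase]; exact ⟨⟨hlt.ne, hm.1⟩, by omega⟩⟩
      obtain ⟨u', hu', hu3⟩ : ∃ u' ∈ (A.erase e.2).filter (· ≤ t),
          ∀ x ∈ (A.erase e.2).filter (· ≤ t), x ≤ u' :=
        ⟨_, Finset.max'_mem _ hne, fun x hx => Finset.le_max' _ x hx⟩
      obtain ⟨hu1, hu2⟩ := Finset.mem_filter.1 hu'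
      obtain ⟨hu4, hu5⟩ := Finset.mem_erase.1 hu1
      have h1 : e.1 ≤ u' := hu3 e.1 (by
        simp only [Finset.mem_filter, Finset.mem_erase]; exact ⟨⟨hlt.ne, hm.1⟩, by omega⟩)
      have h2 : u' ≤ u := by
        have := huv.le_or_le u' hu5
        omega
      have h3 : Linked E e.1 u' := linked_of_crosses hq le_rfl he hm.1 hu5 h1 hu2 (by omega)
      have h4 : Linked E u' u := h3.symm.trans (hue ▸ linked_of_mem he)
      refine ⟨u', v, ⟨hu1, Finset.mem_erase.2 ⟨hve, huv.right_mem⟩, by omega, fun x hx => ?_⟩, hu2,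
        htv, fun hl => hL (h4.symm.trans (linked_of_linked_contract he hlt.ne hu4 hve hl))⟩
      by_cases hxt : x ≤ t
      · exact Or.inl (hu3 x (Finset.mem_filter.2 ⟨hx, hxt⟩))
      · have := huv.le_or_le x (Finset.mem_of_mem_erase hx)
        omega
    · exact ⟨u, v, ⟨Finset.mem_erase.2 ⟨hue, huv.left_mem⟩, Finset.mem_erase.2 ⟨hve, huv.right_mem⟩,
        huv.lt, fun x hx => huv.le_or_le x (Finset.mem_of_mem_erase hx)⟩, hut, htv,
        fun hl => hL (linked_of_linked_contract he hlt.ne hue hve hl)⟩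

end Cuts

section Insertion

/-! ### The insertion of a vertex on an edge -/

/-- The vertices after the insertion of a vertex `2 t + 1` behind the cut at `t`; to make space for
it, the labels of the old vertices are doubled. -/
def insVert (t : ℕ) (A : Finset ℕ) : Finset ℕ := insert (2 * t + 1) (A.image (2 * ·))

/-- The edges after the insertion of the vertex `2 t + 1` on the edge `a`. -/
def insEdges (t : ℕ) (E : Multiset (ℕ × ℕ)) (a : ℕ × ℕ) : Multiset (ℕ × ℕ) :=
  (2 * a.1, 2 * t + 1) ::ₘ (2 * t + 1, 2 * a.2) ::ₘ
    (E.erase a).map (Prod.map (2 * ·) (2 * ·))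

theorem mem_insVert {t : ℕ} {A : Finset ℕ} {x : ℕ} :
    x ∈ insVert t A ↔ x = 2 * t + 1 ∨ ∃ a ∈ A, 2 * a = x := by
  simp [insVert]

theorem two_mul_mem_insVert {t : ℕ} {A : Finset ℕ} {x : ℕ} : 2 * x ∈ insVert t A ↔ x ∈ A := by
  rw [mem_insVert]
  constructor
  · rintro (h | ⟨a, ha, h⟩)
    · omega
    · have : a = x := by omega
      exact this ▸ ha
  · exact fun h => Or.inr ⟨x, h, rfl⟩

theorem odd_mem_insVert (t : ℕ) (A : Finset ℕ) : 2 * t + 1 ∈ insVert t A :=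
  mem_insVert.2 (Or.inl rfl)

/-- The new vertex has valence two, so the insertion of a vertex on an edge preserves the condition
on the valences. -/
theorem IsGraphOn.ins {k : ℕ} (hk : k = 0 ∨ k = 2) {A : Finset ℕ} {E : Multiset (ℕ × ℕ)}
    (hE : IsGraphOn k A E) {a : ℕ × ℕ} (ha : a ∈ E) (t : ℕ) :
    IsGraphOn k (insVert t A) (insEdges t E a) where
  mem e he := by
    rw [insEdges, Multiset.mem_cons, Multiset.mem_cons, Multiset.mem_map] at he
    have hm := hE.mem a ha
    rcases he with rfl | rfl | ⟨e, he, rfl⟩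
    · exact ⟨two_mul_mem_insVert.2 hm.1, odd_mem_insVert t A⟩
    · exact ⟨odd_mem_insVert t A, two_mul_mem_insVert.2 hm.2⟩
    · have := hE.mem e (Multiset.mem_of_mem_erase he)
      exact ⟨two_mul_mem_insVert.2 this.1, two_mul_mem_insVert.2 this.2⟩
  le_ends v hv := by
    rcases mem_insVert.1 hv with rfl | ⟨x, hx, rfl⟩
    · have h1 : 2 * a.1 ≠ 2 * t + 1 := by omega
      have h2 : 2 * a.2 ≠ 2 * t + 1 := by omega
      simp only [ends, insEdges, Multiset.map_cons, Multiset.sum_cons, if_neg h1, if_neg h2,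
        if_true]
      omega
    · have h1 := hE.le_ends x hx
      have h2 : 2 * t + 1 ≠ 2 * x := by omega
      have h3 := ends_map (A := Finset.univ.image (fun _ : Unit => x) ∪ A) (f := (2 * ·))
        (E := E.erase a) (fun _ _ _ _ h => by dsimp only at h; omega) (fun e he => ?_) (v := x)
        (by simp)
      · rw [ends_erase ha, ← h3] at h1
        simp only [ends, insEdges, Multiset.map_cons, Multiset.sum_cons, if_neg h2] at h1 ⊢
        have h4 : ∀ y, (if 2 * y = 2 * x then 1 else 0) = if y = x then 1 else 0 := by
          intro y; split_ifs <;> omega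
        rw [h4, h4]
        omega
      · have := hE.mem e (Multiset.mem_of_mem_erase he)
        exact ⟨Finset.mem_union_right _ this.1, Finset.mem_union_right _ this.2⟩

theorem linked_ins {A : Finset ℕ} {E : Multiset (ℕ × ℕ)} (hE : ∀ e ∈ E, e.1 ∈ A ∧ e.2 ∈ A)
    {t : ℕ} {a : ℕ × ℕ} {u v : ℕ} (hu : u ∈ A) (hv : v ∈ A)
    (h : Linked E u v) : Linked (insEdges t E a) (2 * u) (2 * v) := by
  refine linked_map hE (2 * ·) (fun e he => ?_) hu hv h
  by_cases hae : e = a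
  · subst hae
    exact (linked_of_mem (e := (2 * e.1, 2 * t + 1)) (by simp [insEdges])).trans
      (linked_of_mem (e := (2 * t + 1, 2 * e.2)) (by simp [insEdges]))
  · refine linked_of_mem (e := Prod.map (2 * ·) (2 * ·) e) ?_
    rw [insEdges, Multiset.mem_cons, Multiset.mem_cons]
    exact Or.inr (Or.inr (Multiset.mem_map_of_mem _ ((Multiset.mem_erase_of_ne hae).2 he)))

theorem card_filter_insVert_le {A : Finset ℕ} {t s u : ℕ} (hs : 2 * t + 1 ≤ s)
    (h : ∀ x ∈ A, s < 2 * x → u < x) : above (insVert t A) s ≤ above A u := by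
  have : (insVert t A).filter (s < ·) ⊆ (A.filter (u < ·)).image (2 * ·) := by
    intro x hx
    obtain ⟨hx, hsx⟩ := Finset.mem_filter.1 hx
    rcases mem_insVert.1 hx with rfl | ⟨a, ha, rfl⟩
    · omega
    · exact Finset.mem_image_of_mem _ (Finset.mem_filter.2 ⟨ha, h a ha hsx⟩)
  exact (Finset.card_le_card this).trans Finset.card_image_le

/-- The insertion of a vertex at a bad cut with the largest number of vertices above it. The new
vertex is linked to the vertex before it, because the edge `a` crosses no bad cut below. -/
theorem LevelLE.ins {A : Finset ℕ} {E : Multiset (ℕ × ℕ)} {t : ℕ}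
    (hq : LevelLE (above A t) A E) (hE : ∀ e ∈ E, e.1 ∈ A ∧ e.2 ∈ A) {a : ℕ × ℕ} (ha : a ∈ E)
    (h1 : a.1 ≤ t) (h2 : t < a.2) :
    LevelLE (above A t) (insVert t A) (insEdges t E a) := by
  rintro s ⟨⟨e', he', hc⟩, u', v', huv, hus, hsv, hL⟩
  have hm := hE a ha
  rcases mem_insVert.1 huv.left_mem with rfl | ⟨u, hu, rfl⟩
  · refine card_filter_insVert_le hus fun x hx hsx => ?_
    omega
  · rcases mem_insVert.1 huv.right_mem with rfl | ⟨v, hv, rfl⟩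
    · exfalso
      have h3 : a.1 ≤ u := by
        have := huv.le_or_le _ (two_mul_mem_insVert.2 hm.1)
        omega
      have h4 : Linked E a.1 u := linked_of_crosses hq le_rfl ha hm.1 hu h3 (by omega) (by omega)
      exact hL ((linked_ins hE hm.1 hu h4).symm.trans
        (linked_of_mem (e := (2 * a.1, 2 * t + 1)) (by simp [insEdges])))
    · have hlt : u < v := by have := huv.lt; omega
      have hor : ∀ x ∈ A, x ≤ u ∨ v ≤ x := by
        intro x hx
        have := huv.le_or_le _ (two_mul_mem_insVert.2 hx)
        omega
      have hw := huv.le_or_le _ (odd_mem_insVert t A)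
      have hb : BadCut A E u := by
        refine ⟨?_, u, v, ⟨hu, hv, hlt, hor⟩, le_rfl, hlt, fun hl => hL (linked_ins hE hu hv hl)⟩
        rw [insEdges, Multiset.mem_cons, Multiset.mem_cons, Multiset.mem_map] at he'
        rcases he' with rfl | rfl | ⟨e, he, rfl⟩
        · refine ⟨a, ha, ?_⟩
          have h3 := hor _ hm.1
          simp only [Crosses] at hc ⊢
          omega
        · refine ⟨a, ha, ?_⟩
          have h3 := hor _ hm.2
          simp only [Crosses] at hc ⊢
          omega
        · have he := Multiset.mem_of_mem_erase he
          have h3 := hor _ (hE e he).1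
          have h4 := hor _ (hE e he).2
          refine ⟨e, he, ?_⟩
          simp only [Crosses, Prod.map_fst, Prod.map_snd] at hc ⊢
          omega
      have h3 := hq u hb
      have h4 : 2 * t + 1 ≤ s := by
        by_contra! h4
        have := above_lt_above (t := t) hv hlt (by omega)
        omega
      refine (card_filter_insVert_le h4 fun x hx hsx => ?_).trans h3
      omega

end Insertion

section Homotopy

variable (K : Type*) [Field K] (k : ℕ)

/-! ### The contracting homotopy -/

/-- The graph with a vertex inserted on the edge `a`. The sign of `a` makes this compatible with
changes of the orientation of `a`. -/
def insElt (t : ℕ) (A : Finset ℕ) (E : Multiset (ℕ × ℕ)) (a : ℕ × ℕ) : GraphAlg K k :=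
  edgeSign K a • graphElt K k (insVert t A) (insEdges t E a)

/-- The mean value of the insertions of a vertex on the edges that cross the cut at `t`. The sign is
that of the contraction removing the new vertex. -/
def insMean (t : ℕ) (A : Finset ℕ) (E : Multiset (ℕ × ℕ)) : GraphAlg K k :=
  (-1 : K) ^ (SymGraph.rank A t + 1) • ((E.filter (Crosses t)).card : K)⁻¹ •
    ((E.filter (Crosses t)).map (insElt K k t A E)).sum

open Classical in
/-- The mean value of the insertions at the cut with `q` vertices above it, if this cut is bad. -/
def insLevel (q : ℕ) (A : Finset ℕ) (E : Multiset (ℕ × ℕ)) : GraphAlg K k :=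
  if h : ∃ t, BadCut A E t ∧ above A t = q then insMean K k h.choose A E else 0

/-- The homotopy that inserts a vertex at the cut with `q` vertices above it, if this cut is bad. -/
def insHomotopy (q : ℕ) : GraphAlg K k →ₗ[K] GraphAlg K k :=
  (AddMonoidAlgebra.basis (SymGraph.minValence k) K).constr K fun G =>
    insLevel K k q (Finset.Icc 1 G.1.n) G.1.edges

/-- The span of the graphs whose bad cuts have at most `q` vertices above them. -/
def levelSpace (q : ℕ) : Submodule K (GraphAlg K k) :=
  Submodule.span K {x | ∃ A E, IsGraphOn k A E ∧ (∀ e ∈ E, e.1 < e.2) ∧ LevelLE q A E ∧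
    graphElt K k A E = x}

variable {K k}

theorem strictMonoOn_insVert {A : Finset ℕ} {f : ℕ → ℕ} (hf : StrictMonoOn f A) {s t : ℕ}
    (h : ∀ a ∈ A, f a ≤ s ↔ a ≤ t) :
    StrictMonoOn (fun n => if n = 2 * t + 1 then 2 * s + 1 else 2 * f (n / 2)) (insVert t A) := by
  intro x hx y hy hxy
  have e : ∀ a, 2 * a / 2 = a := fun a => by omega
  have e' : ∀ a b, 2 * a ≠ 2 * b + 1 := fun a b => by omega
  dsimp only
  rcases mem_insVert.1 hx with rfl | ⟨a, ha, rfl⟩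
  · rcases mem_insVert.1 hy with rfl | ⟨b, hb, rfl⟩
    · omega
    · have := h b hb
      rw [if_pos rfl, if_neg (e' _ _), e]
      omega
  · rcases mem_insVert.1 hy with rfl | ⟨b, hb, rfl⟩
    · have := h a ha
      rw [if_pos rfl, if_neg (e' _ _), e]
      omega
    · rw [if_neg (e' _ _), if_neg (e' _ _), e, e]
      have := hf ha hb (by omega)
      omega

/-- The insertion of a vertex is compatible with order preserving relabellings. -/
theorem insElt_image (hk : k = 0 ∨ k = 2) {A : Finset ℕ} {E : Multiset (ℕ × ℕ)}
    (hE : IsGraphOn k A E) {f : ℕ → ℕ}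
    (hf : StrictMonoOn f A) {s t : ℕ} (h : ∀ a ∈ A, f a ≤ s ↔ a ≤ t) {a : ℕ × ℕ} (ha : a ∈ E) :
    insElt K k s (A.image f) (E.map (Prod.map f f)) (Prod.map f f a) = insElt K k t A E a := by
  have e : ∀ a, 2 * a / 2 = a := fun a => by omega
  have e' : ∀ a b, 2 * a ≠ 2 * b + 1 := fun a b => by omega
  let g : ℕ → ℕ := fun n => if n = 2 * t + 1 then 2 * s + 1 else 2 * f (n / 2)
  have hg1 : g (2 * t + 1) = 2 * s + 1 := if_pos rfl
  have hg2 : ∀ x, g (2 * x) = 2 * f x := fun x => by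
    simp only [g]
    rw [if_neg (e' _ _), e]
  have hA : (insVert t A).image g = insVert s (A.image f) := by
    rw [insVert, insVert, Finset.image_insert, hg1, Finset.image_image, Finset.image_image]
    congr 1
    exact Finset.image_congr fun x _ => hg2 x
  have hEd : (insEdges t E a).map (Prod.map g g) =
      insEdges s (E.map (Prod.map f f)) (Prod.map f f a) := by
    rw [insEdges, insEdges, Multiset.map_cons, Multiset.map_cons,
      ← Multiset.map_erase_of_mem _ _ ha, Multiset.map_map, Multiset.map_map]
    simp only [Prod.map_apply, hg1, hg2, Prod.map_fst, Prod.map_snd]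
    congr 2
    refine Multiset.map_congr rfl fun x _ => ?_
    exact Prod.ext (hg2 _) (hg2 _)
  rw [insElt, insElt, edgeSign_map hf (hE.mem a ha), ← hA, ← hEd,
    graphElt_image (strictMonoOn_insVert hf h) (hE.ins hk ha t).mem]

theorem insMean_image (hk : k = 0 ∨ k = 2) {A : Finset ℕ} {E : Multiset (ℕ × ℕ)}
    (hE : IsGraphOn k A E) {f : ℕ → ℕ}
    (hf : StrictMonoOn f A) {s t : ℕ} (h : ∀ a ∈ A, f a ≤ s ↔ a ≤ t) :
    insMean K k s (A.image f) (E.map (Prod.map f f)) = insMean K k t A E := by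
  have h1 : (E.map (Prod.map f f)).filter (Crosses s) =
      (E.filter (Crosses t)).map (Prod.map f f) := by
    rw [Multiset.filter_map]
    congr 1
    refine Multiset.filter_congr fun e he => ?_
    have h1 := h _ (hE.mem e he).1
    have h2 := h _ (hE.mem e he).2
    simp only [Crosses, Function.comp_apply, Prod.map_fst, Prod.map_snd]
    omega
  have h2 : SymGraph.rank (A.image f) s = SymGraph.rank A t := by
    have : (A.image f).filter (· ≤ s) = (A.filter (· ≤ t)).image f := by
      ext x
      simp only [Finset.mem_filter, Finset.mem_image]
      constructor
      · rintro ⟨⟨a, ha, rfl⟩, h'⟩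
        exact ⟨a, ⟨ha, (h a ha).1 h'⟩, rfl⟩
      · rintro ⟨a, ⟨ha, h'⟩, rfl⟩
        exact ⟨⟨a, ha, rfl⟩, (h a ha).2 h'⟩
    rw [SymGraph.rank, this, Finset.card_image_of_injOn]
    · rfl
    · exact hf.injOn.mono (by intro x; simp; tauto)
  rw [insMean, insMean, h1, h2, Multiset.card_map, Multiset.map_map]
  congr 3
  refine Multiset.map_congr rfl fun a ha => ?_
  exact insElt_image hk hE hf h (Multiset.mem_of_mem_filter ha)

/-- The insertion of a vertex on an edge that crosses the cut is compatible with the reorientation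
of all edges. -/
theorem insElt_eq_smul (t : ℕ) (A : Finset ℕ) {E : Multiset (ℕ × ℕ)} (hl : ∀ e ∈ E, e.1 ≠ e.2)
    {a : ℕ × ℕ} (ha : a ∈ E) (hc : Crosses t a) : insElt K k t A E a =
      (E.map (edgeSign K)).prod • insElt K k t A (E.map enorm) (enorm a) := by
  have hs : (E.map (edgeSign K)).prod = edgeSign K a * ((E.erase a).map (edgeSign K)).prod := by
    conv_lhs => rw [← Multiset.cons_erase ha]
    rw [Multiset.map_cons, Multiset.prod_cons]
  have h2 : StrictMonoOn (2 * ·) (Set.univ : Set ℕ) := fun a _ b _ h => by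
    dsimp only; omega
  have hins : ∀ e ∈ insEdges t E a, e.1 ≠ e.2 := by
    intro e he
    rw [insEdges, Multiset.mem_cons, Multiset.mem_cons, Multiset.mem_map] at he
    rcases he with rfl | rfl | ⟨e, he, rfl⟩
    · dsimp only; omega
    · dsimp only; omega
    · have := hl e (Multiset.mem_of_mem_erase he)
      simp only [Prod.map_fst, Prod.map_snd]
      omega
  have h3 : ∀ e : ℕ × ℕ, edgeSign K (Prod.map (2 * ·) (2 * ·) e) = edgeSign K e := by
    intro e; simp [edgeSign]
  have h4 : ∀ e : ℕ × ℕ, enorm (Prod.map (2 * ·) (2 * ·) e) =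
      Prod.map (2 * ·) (2 * ·) (enorm e) := by
    intro e; refine Prod.ext ?_ ?_ <;> simp only [enorm, Prod.map_fst, Prod.map_snd] <;> omega
  have h5 : ((insEdges t E a).map (edgeSign K)).prod = ((E.erase a).map (edgeSign K)).prod := by
    rw [insEdges, Multiset.map_cons, Multiset.map_cons, Multiset.prod_cons, Multiset.prod_cons,
      Multiset.map_map, ← mul_assoc]
    have : edgeSign K (2 * a.1, 2 * t + 1) * edgeSign K (2 * t + 1, 2 * a.2) = 1 := by
      rcases hc with ⟨h, h'⟩ | ⟨h, h'⟩
      · rw [edgeSign_of_lt (by dsimp only; omega), edgeSign_of_lt (by dsimp only; omega), mul_one]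
      · rw [edgeSign, edgeSign, if_neg (by dsimp only; omega), if_pos (by dsimp only; omega),
          if_neg (by dsimp only; omega), if_pos (by dsimp only; omega)]
        ring
    rw [this, one_mul]
    congr 1
    exact Multiset.map_congr rfl fun e _ => h3 e
  have h6 : insEdges t (E.map enorm) (enorm a) = (insEdges t E a).map enorm := by
    rw [insEdges, insEdges, Multiset.map_cons, Multiset.map_cons,
      ← Multiset.map_erase_of_mem _ _ ha, Multiset.map_map, Multiset.map_map]
    have h7 : (E.erase a).map (Prod.map (2 * ·) (2 * ·) ∘ enorm) =
        (E.erase a).map (enorm ∘ Prod.map (2 * ·) (2 * ·)) :=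
      Multiset.map_congr rfl fun e _ => (h4 e).symm
    rw [h7]
    rcases hc with ⟨h, h'⟩ | ⟨h, h'⟩
    · rw [enorm_of_lt (e := a) (by omega),
        enorm_of_lt (e := (2 * a.1, 2 * t + 1)) (by dsimp only; omega),
        enorm_of_lt (e := (2 * t + 1, 2 * a.2)) (by dsimp only; omega)]
    · rw [Multiset.cons_swap]
      congr 1
      · refine Prod.ext ?_ ?_ <;> simp only [enorm] <;> omega
      · congr 1
        refine Prod.ext ?_ ?_ <;> simp only [enorm] <;> omega
  rw [insElt, insElt, graphElt_eq_smul _ hins, h5, h6, hs, edgeSign_of_lt (enorm_lt (hl a ha)),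
    one_smul, smul_smul]

theorem insMean_eq_smul (t : ℕ) (A : Finset ℕ) {E : Multiset (ℕ × ℕ)}
    (hl : ∀ e ∈ E, e.1 ≠ e.2) : insMean K k t A E =
      (E.map (edgeSign K)).prod • insMean K k t A (E.map enorm) := by
  have h1 : (E.map enorm).filter (Crosses t) = (E.filter (Crosses t)).map enorm := by
    rw [Multiset.filter_map]
    congr 1
    exact Multiset.filter_congr fun e _ => crosses_enorm
  have h2 : ((E.filter (Crosses t)).map (insElt K k t A E)).sum = (E.map (edgeSign K)).prod •
      (((E.filter (Crosses t)).map enorm).map (insElt K k t A (E.map enorm))).sum := by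
    rw [Multiset.smul_sum, Multiset.map_map, Multiset.map_map]
    congr 1
    refine Multiset.map_congr rfl fun a ha => ?_
    obtain ⟨ha, hc⟩ := Multiset.mem_filter.1 ha
    exact insElt_eq_smul t A hl ha hc
  rw [insMean, insMean, h1, h2, Multiset.card_map]
  simp only [smul_smul]
  congr 1
  ring

theorem insMean_of_loop (t : ℕ) (A : Finset ℕ) {E : Multiset (ℕ × ℕ)} {l : ℕ × ℕ} (hl : l ∈ E)
    (hl' : l.1 = l.2) : insMean K k t A E = 0 := by
  have : ((E.filter (Crosses t)).map (insElt K k t A E)).sum = 0 := by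
    refine Multiset.sum_eq_zero fun x hx => ?_
    obtain ⟨a, ha, rfl⟩ := Multiset.mem_map.1 hx
    have hne : l ≠ a := by
      rintro rfl
      have := (Multiset.mem_filter.1 ha).2
      simp only [Crosses] at this
      omega
    have hm : Prod.map (2 * ·) (2 * ·) l ∈ insEdges t E a := by
      rw [insEdges, Multiset.mem_cons, Multiset.mem_cons]
      exact Or.inr (Or.inr (Multiset.mem_map_of_mem _ ((Multiset.mem_erase_of_ne hne).2 hl)))
    rw [insElt, graphElt_of_loop _ hm (by simp [hl']), smul_zero]
  rw [insMean, this, smul_zero, smul_zero]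

theorem le_iff_le_of_above_eq {A : Finset ℕ} {s t : ℕ} (h : above A s = above A t) :
    ∀ a ∈ A, a ≤ s ↔ a ≤ t := by
  intro a ha
  constructor
  · intro h1
    by_contra! h2
    have := above_lt_above ha h2 h1
    omega
  · intro h1
    by_contra! h2
    have := above_lt_above ha h2 h1
    omega

theorem insHomotopy_single (q : ℕ) (G : SymGraph.minValence k) :
    insHomotopy K k q (AddMonoidAlgebra.single G 1) =
      insLevel K k q (Finset.Icc 1 G.1.n) G.1.edges := by
  have h : (AddMonoidAlgebra.single G 1 : GraphAlg K k) =
    AddMonoidAlgebra.basis (SymGraph.minValence k) K G := by simp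
  rw [h, insHomotopy, Module.Basis.constr_basis]

theorem insHomotopy_graphElt_of_lt (hk : k = 0 ∨ k = 2) {A : Finset ℕ} {E : Multiset (ℕ × ℕ)}
    (hE : IsGraphOn k A E) (hlt : ∀ e ∈ E, e.1 < e.2) {t : ℕ} (ht : BadCut A E t) :
    insHomotopy K k (above A t) (graphElt K k A E) = insMean K k t A E := by
  have hmem := hE.stdGraph_mem hlt
  have hr := rank_strictMonoOn A
  rw [graphElt_of_lt A hlt, graphBasis, dif_pos hmem, insHomotopy_single]
  have hn : (stdGraph A E).n = A.card := rfl
  simp only [stdGraph_edges hE.mem hlt, hn, ← image_rank]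
  have hex : ∃ s, BadCut (A.image (SymGraph.rank A))
      (E.map (Prod.map (SymGraph.rank A) (SymGraph.rank A))) s ∧
        above (A.image (SymGraph.rank A)) s = above A t := by
    obtain ⟨s, hs, h⟩ := ht.image hE.mem hr
    exact ⟨s, hs, above_image hr.injOn h⟩
  rw [insLevel, dif_pos hex]
  obtain ⟨hs, hs'⟩ := hex.choose_spec
  obtain ⟨t', -, h⟩ := badCut_of_image hE.mem hr hs
  rw [above_image hr.injOn h] at hs'
  have h' := le_iff_le_of_above_eq hs'
  exact insMean_image hk hE hr fun a ha => (h a ha).trans (h' a ha)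

/-- The homotopy on a graph with arbitrary vertex labels and orientations. -/
theorem insHomotopy_graphElt_of_bad (hk : k = 0 ∨ k = 2) {A : Finset ℕ} {E : Multiset (ℕ × ℕ)}
    (hE : IsGraphOn k A E) {t : ℕ} (ht : BadCut A E t) :
    insHomotopy K k (above A t) (graphElt K k A E) = insMean K k t A E := by
  by_cases hl : ∀ e ∈ E, e.1 ≠ e.2
  · rw [graphElt_eq_smul A hl, map_smul, insHomotopy_graphElt_of_lt hk hE.map_enorm ?_
      (badCut_map_enorm.2 ht), insMean_eq_smul t A hl]
    intro e he
    obtain ⟨a, ha, rfl⟩ := Multiset.mem_map.1 he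
    exact enorm_lt (hl a ha)
  · push Not at hl
    obtain ⟨l, hl, hl'⟩ := hl
    rw [graphElt_of_loop A hl hl', map_zero, insMean_of_loop t A hl hl']

theorem insHomotopy_graphElt_of_not {q : ℕ} {A : Finset ℕ} {E : Multiset (ℕ × ℕ)}
    (hE : IsGraphOn k A E) (hlt : ∀ e ∈ E, e.1 < e.2) (h : ∀ t, BadCut A E t → above A t ≠ q) :
    insHomotopy K k q (graphElt K k A E) = 0 := by
  have hmem := hE.stdGraph_mem hlt
  have hr := rank_strictMonoOn A
  rw [graphElt_of_lt A hlt, graphBasis, dif_pos hmem, insHomotopy_single]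
  have hn : (stdGraph A E).n = A.card := rfl
  simp only [stdGraph_edges hE.mem hlt, hn, ← image_rank]
  refine dif_neg ?_
  rintro ⟨s, hs, hsq⟩
  obtain ⟨t, ht, hst⟩ := badCut_of_image hE.mem hr hs
  rw [above_image hr.injOn hst] at hsq
  exact h t ht hsq

theorem graphElt_mem_levelSpace {q : ℕ} {A : Finset ℕ} {E : Multiset (ℕ × ℕ)}
    (hE : IsGraphOn k A E) (h : LevelLE q A E) : graphElt K k A E ∈ levelSpace K k q := by
  by_cases hl : ∀ e ∈ E, e.1 ≠ e.2
  · rw [graphElt_eq_smul A hl]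
    refine Submodule.smul_mem _ _ (Submodule.subset_span ⟨A, E.map enorm, hE.map_enorm, ?_,
      levelLE_map_enorm.2 h, rfl⟩)
    intro e he
    obtain ⟨a, ha, rfl⟩ := Multiset.mem_map.1 he
    exact enorm_lt (hl a ha)
  · push Not at hl
    obtain ⟨l, hl, hl'⟩ := hl
    rw [graphElt_of_loop A hl hl']
    exact Submodule.zero_mem _

theorem levelSpace_mono : Monotone (levelSpace K k) := by
  intro q r h
  refine Submodule.span_mono ?_
  rintro _ ⟨A, E, hE, hlt, hq, rfl⟩
  exact ⟨A, E, hE, hlt, hq.mono h, rfl⟩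

theorem exists_mem_levelSpace (x : GraphAlg K k) : ∃ q, x ∈ levelSpace K k q := by
  induction x using graphAlg_induction with
  | zero => exact ⟨0, Submodule.zero_mem _⟩
  | add x y hx hy =>
    obtain ⟨q, hq⟩ := hx
    obtain ⟨r, hr⟩ := hy
    exact ⟨max q r, Submodule.add_mem _ (levelSpace_mono (le_max_left q r) hq)
      (levelSpace_mono (le_max_right q r) hr)⟩
  | smul c x hx =>
    obtain ⟨q, hq⟩ := hx
    exact ⟨q, Submodule.smul_mem _ _ hq⟩
  | elt n E hE _ => exact ⟨_, graphElt_mem_levelSpace hE (levelLE_card _ _)⟩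

theorem insHomotopy_of_mem {q : ℕ} {x : GraphAlg K k} (hx : x ∈ levelSpace K k q) :
    insHomotopy K k (q + 1) x = 0 := by
  induction hx using Submodule.span_induction with
  | zero => exact map_zero _
  | add x y _ _ hx hy => rw [map_add, hx, hy, add_zero]
  | smul c x _ hx => rw [map_smul, hx, smul_zero]
  | mem x hx =>
    obtain ⟨A, E, hE, hlt, hq, rfl⟩ := hx
    refine insHomotopy_graphElt_of_not hE hlt fun t ht => ?_
    have := hq t ht
    omega

theorem dTerm_mem_levelSpace (hk : k = 0 ∨ k = 2) {q : ℕ} {A : Finset ℕ} {E : Multiset (ℕ × ℕ)}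
    (hE : IsGraphOn k A E) (hlt : ∀ e ∈ E, e.1 < e.2) {e : ℕ × ℕ} (he : e ∈ E)
    (h : LevelLE q (A.erase e.2) ((E.erase e).map (Prod.map (merge e) (merge e)))) :
    dTerm K k A E e ∈ levelSpace K k q := by
  have hc := hE.contract hk he (hlt e he).ne
  rw [enorm_of_lt (hlt e he)] at hc
  rw [dTerm_of_lt (hlt e he)]
  exact Submodule.smul_mem _ _ (graphElt_mem_levelSpace hc h)

theorem graphD_mem_levelSpace (hk : k = 0 ∨ k = 2) {q : ℕ} {x : GraphAlg K k}
    (hx : x ∈ levelSpace K k q) : graphD K k x ∈ levelSpace K k q := by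
  induction hx using Submodule.span_induction with
  | zero => rw [map_zero]; exact Submodule.zero_mem _
  | add x y _ _ hx hy => rw [map_add]; exact Submodule.add_mem _ hx hy
  | smul c x _ hx => rw [map_smul]; exact Submodule.smul_mem _ _ hx
  | mem x hx =>
    obtain ⟨A, E, hE, hlt, hq, rfl⟩ := hx
    rw [graphD_graphElt hE]
    refine multiset_sum_mem _ fun y hy => ?_
    obtain ⟨e, he, rfl⟩ := Multiset.mem_map.1 hy
    exact dTerm_mem_levelSpace hk hE hlt he (hq.contract hE.mem hlt he)

theorem rank_insVert_odd (t : ℕ) (A : Finset ℕ) :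
    SymGraph.rank (insVert t A) (2 * t + 1) = SymGraph.rank A t + 1 := by
  have : (insVert t A).filter (· ≤ 2 * t + 1) =
      insert (2 * t + 1) ((A.filter (· ≤ t)).image (2 * ·)) := by
    ext x
    simp only [Finset.mem_filter, mem_insVert, Finset.mem_insert, Finset.mem_image]
    constructor
    · rintro ⟨rfl | ⟨a, ha, rfl⟩, h⟩
      · exact Or.inl rfl
      · exact Or.inr ⟨a, ⟨ha, by omega⟩, rfl⟩
    · rintro (rfl | ⟨a, ⟨ha, h⟩, rfl⟩)
      · exact ⟨Or.inl rfl, le_rfl⟩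
      · exact ⟨Or.inr ⟨a, ha, rfl⟩, by omega⟩
  rw [SymGraph.rank, this, Finset.card_insert_of_notMem, Finset.card_image_of_injective]
  · rfl
  · intro a b h
    dsimp only at h
    omega
  · rw [Finset.mem_image]
    rintro ⟨a, -, h⟩
    omega

theorem rank_insVert_even {t x : ℕ} (A : Finset ℕ) (h : x ≤ t) :
    SymGraph.rank (insVert t A) (2 * x) = SymGraph.rank A x := by
  have : (insVert t A).filter (· ≤ 2 * x) = (A.filter (· ≤ x)).image (2 * ·) := by
    ext y
    simp only [Finset.mem_filter, mem_insVert, Finset.mem_image]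
    constructor
    · rintro ⟨rfl | ⟨a, ha, rfl⟩, h'⟩
      · omega
      · exact ⟨a, ⟨ha, by omega⟩, rfl⟩
    · rintro ⟨a, ⟨ha, h'⟩, rfl⟩
      exact ⟨Or.inr ⟨a, ha, rfl⟩, by omega⟩
  rw [SymGraph.rank, this, Finset.card_image_of_injective]
  · rfl
  · intro a b h
    dsimp only at h
    omega

theorem insEdges_lt {t : ℕ} {E : Multiset (ℕ × ℕ)} (hlt : ∀ e ∈ E, e.1 < e.2) {a : ℕ × ℕ}
    (h1 : a.1 ≤ t) (h2 : t < a.2) : ∀ e ∈ insEdges t E a, e.1 < e.2 := by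
  intro e he
  rw [insEdges, Multiset.mem_cons, Multiset.mem_cons, Multiset.mem_map] at he
  rcases he with rfl | rfl | ⟨e, he, rfl⟩
  · dsimp only; omega
  · dsimp only; omega
  · have := hlt e (Multiset.mem_of_mem_erase he)
    simp only [Prod.map_fst, Prod.map_snd]
    omega

theorem filter_erase_of_not {α : Type*} [DecidableEq α] {p : α → Prop} [DecidablePred p]
    {s : Multiset α} {a : α} (h : ¬ p a) : (s.erase a).filter p = s.filter p := by
  by_cases ha : a ∈ s
  · conv_rhs => rw [← Multiset.cons_erase ha]
    rw [Multiset.filter_cons_of_neg _ h]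
  · rw [Multiset.erase_of_notMem ha]

/-- The contraction of the lower one of the two new edges recovers the graph. -/
theorem dTerm_ins_lower {A : Finset ℕ} {E : Multiset (ℕ × ℕ)} (hE : IsGraphOn k A E)
    {t : ℕ} {a : ℕ × ℕ} (ha : a ∈ E) (h1 : a.1 ≤ t) :
    dTerm K k (insVert t A) (insEdges t E a) (2 * a.1, 2 * t + 1) =
      (-1 : K) ^ (SymGraph.rank A t + 1) • graphElt K k A E := by
  have hm : ∀ x, merge (2 * a.1, 2 * t + 1) (2 * x) = 2 * x := fun x =>
    merge_of_ne (by dsimp only; omega)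
  have h2 : StrictMonoOn (2 * ·) (A : Set ℕ) := fun a _ b _ h => by
    dsimp only; omega
  have hA : (insVert t A).erase (2 * t + 1) = A.image (2 * ·) := by
    rw [insVert, Finset.erase_insert]
    rw [Finset.mem_image]
    rintro ⟨a, -, h⟩
    omega
  rw [dTerm_of_lt (by dsimp only; omega), rank_insVert_odd, hA, insEdges,
    Multiset.erase_cons_head, Multiset.map_cons, Multiset.map_map]
  congr 1
  rw [← graphElt_image h2 hE.mem]
  congr 1
  conv_rhs => rw [← Multiset.cons_erase ha, Multiset.map_cons]
  congr 1
  · exact Prod.ext (merge_snd (2 * a.1, 2 * t + 1)) (hm _)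
  · exact Multiset.map_congr rfl fun e _ => Prod.ext (hm _) (hm _)

/-- The contraction of an edge below the cut commutes with the insertion of a vertex. -/
theorem dTerm_ins_of_le {A : Finset ℕ} {E : Multiset (ℕ × ℕ)} {t : ℕ} {a e : ℕ × ℕ}
    (ha : a ∈ E) (h1 : a.1 ≤ t) (h2 : t < a.2) (he : e ∈ E) (hel : e.1 < e.2) (het : e.2 ≤ t) :
    dTerm K k (insVert t A) (insEdges t E a) (Prod.map (2 * ·) (2 * ·) e) =
      (-1 : K) ^ SymGraph.rank A e.2 • insElt K k t (A.erase e.2)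
        ((E.erase e).map (Prod.map (merge e) (merge e))) (Prod.map (merge e) (merge e) a) := by
  have hae : a ≠ e := by rintro rfl; omega
  have hm : ∀ x, merge (Prod.map (2 * ·) (2 * ·) e) (2 * x) = 2 * merge e x := by
    intro x
    simp only [merge, Prod.map_fst, Prod.map_snd]
    split_ifs <;> omega
  have hw : merge (Prod.map (2 * ·) (2 * ·) e) (2 * t + 1) = 2 * t + 1 :=
    merge_of_ne (by simp only [Prod.map_snd]; omega)
  have ha1 : merge e a.1 ≤ t := by simp only [merge]; split_ifs <;> omega
  have ha2 : merge e a.2 = a.2 := merge_of_ne (by omega)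
  have hA : (insVert t A).erase (2 * e.2) = insVert t (A.erase e.2) := by
    ext x
    simp only [Finset.mem_erase, mem_insVert]
    constructor
    · rintro ⟨h, rfl | ⟨y, hy, rfl⟩⟩
      · exact Or.inl rfl
      · exact Or.inr ⟨y, ⟨by omega, hy⟩, rfl⟩
    · rintro (rfl | ⟨y, ⟨hy', hy⟩, rfl⟩)
      · exact ⟨by omega, Or.inl rfl⟩
      · exact ⟨by omega, Or.inr ⟨y, hy, rfl⟩⟩
  rw [dTerm_of_lt (by simp only [Prod.map_fst, Prod.map_snd]; omega), insElt,
    edgeSign_of_lt (by simp only [Prod.map_fst, Prod.map_snd]; omega), one_smul]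
  change (-1 : K) ^ SymGraph.rank (insVert t A) (2 * e.2) •
    graphElt K k ((insVert t A).erase (2 * e.2)) _ = _
  rw [rank_insVert_even A het, hA]
  congr 2
  rw [insEdges, insEdges, Multiset.erase_cons_tail, Multiset.erase_cons_tail,
    ← Multiset.map_erase_of_mem _ _ ((Multiset.mem_erase_of_ne hae.symm).2 he),
    ← Multiset.map_erase_of_mem _ _ ((Multiset.mem_erase_of_ne hae).2 ha), Multiset.map_cons,
    Multiset.map_cons, Multiset.map_map, Multiset.map_map, Multiset.erase_comm]
  · simp only [Prod.map_apply, hm, hw, Prod.map_fst, Prod.map_snd]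
    congr 2
    exact Multiset.map_congr rfl fun x _ => Prod.ext (hm _) (hm _)
  · intro h
    have := congrArg Prod.fst h
    simp only [Prod.map_fst] at this
    omega
  · intro h
    have := congrArg Prod.snd h
    simp only [Prod.map_snd] at this
    omega

/-- The differential of the insertion of a vertex, up to terms of lower level. -/
theorem graphD_ins_sub_mem (hk : k = 0 ∨ k = 2) {q : ℕ} {A : Finset ℕ} {E : Multiset (ℕ × ℕ)}
    (hE : IsGraphOn k A E) (hlt : ∀ e ∈ E, e.1 < e.2) (hq : LevelLE (q + 1) A E) {t : ℕ}
    (htq : above A t = q + 1) {a : ℕ × ℕ} (ha : a ∈ E) (h1 : a.1 ≤ t) (h2 : t < a.2) :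
    graphD K k (insElt K k t A E a) - (-1 : K) ^ (SymGraph.rank A t + 1) • graphElt K k A E -
      ((E.filter (·.2 ≤ t)).map fun e => dTerm K k (insVert t A) (insEdges t E a)
        (Prod.map (2 * ·) (2 * ·) e)).sum ∈ levelSpace K k q := by
  have hI := hE.ins hk ha t
  have hIl := insEdges_lt hlt h1 h2
  have hIq : LevelLE (q + 1) (insVert t A) (insEdges t E a) :=
    htq ▸ (htq.symm ▸ hq : LevelLE (above A t) A E).ins hE.mem ha h1 h2
  -- the contraction of an edge that ends above the cut lowers the level
  have key : ∀ e ∈ insEdges t E a, ∀ y ∈ A, e.2 = 2 * y → t < y →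
      dTerm K k (insVert t A) (insEdges t E a) e ∈ levelSpace K k q := by
    intro e he y hy hey hty
    refine dTerm_mem_levelSpace hk hI hIl he (hIq.contract_of_above_le hI.mem hIl he ?_)
    rw [hey]
    have h3 : above (insVert t A) (2 * y) ≤ above A y :=
      card_filter_insVert_le (by omega) fun x _ hx => by omega
    have h4 := above_lt_above hy hty le_rfl
    omega
  have hF : (E.filter (·.2 ≤ t)) = (E.erase a).filter (·.2 ≤ t) :=
    (filter_erase_of_not (by omega)).symm
  rw [insElt, edgeSign_of_lt (hlt a ha), one_smul, graphD_graphElt hI]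
  have hsum : ∀ F : ℕ × ℕ → GraphAlg K k, ((insEdges t E a).map F).sum =
      F (2 * a.1, 2 * t + 1) + (F (2 * t + 1, 2 * a.2) +
        (((E.erase a).filter (·.2 ≤ t)).map fun e => F (Prod.map (2 * ·) (2 * ·) e)).sum +
        (((E.erase a).filter (¬ ·.2 ≤ t)).map fun e => F (Prod.map (2 * ·) (2 * ·) e)).sum) := by
    intro F
    rw [add_assoc, ← Multiset.sum_add, ← Multiset.map_add, Multiset.filter_add_not, insEdges,
      Multiset.map_cons, Multiset.map_cons, Multiset.sum_cons, Multiset.sum_cons, Multiset.map_map]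
    rfl
  rw [hsum, dTerm_ins_lower hE ha h1, add_sub_cancel_left, hF, add_right_comm, add_sub_cancel_right]
  refine Submodule.add_mem _ (key _ (by simp [insEdges]) a.2 (hE.mem a ha).2 rfl h2) ?_
  refine multiset_sum_mem _ fun x hx => ?_
  obtain ⟨e, he, rfl⟩ := Multiset.mem_map.1 hx
  obtain ⟨he, het⟩ := Multiset.mem_filter.1 he
  refine key _ ?_ e.2 (hE.mem e (Multiset.mem_of_mem_erase he)).2 rfl (not_le.1 het)
  rw [insEdges, Multiset.mem_cons, Multiset.mem_cons]
  exact Or.inr (Or.inr (Multiset.mem_map_of_mem _ he))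

/-- The homotopy of a contraction of an edge below the cut. -/
theorem insHomotopy_dTerm (hk : k = 0 ∨ k = 2) {q : ℕ} {A : Finset ℕ} {E : Multiset (ℕ × ℕ)}
    (hE : IsGraphOn k A E) (hlt : ∀ e ∈ E, e.1 < e.2) (hq : LevelLE (q + 1) A E) {t : ℕ}
    (ht : BadCut A E t) (htq : above A t = q + 1) {e : ℕ × ℕ} (he : e ∈ E) (het : e.2 ≤ t) :
    insHomotopy K k (q + 1) (dTerm K k A E e) =
      -((-1 : K) ^ (SymGraph.rank A t + 1) • ((E.filter (Crosses t)).card : K)⁻¹ •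
        ((E.filter (Crosses t)).map fun a => dTerm K k (insVert t A) (insEdges t E a)
          (Prod.map (2 * ·) (2 * ·) e)).sum) := by
  have hel := hlt e he
  have hm := hE.mem e he
  have hc := hE.contract hk he hel.ne
  rw [enorm_of_lt hel] at hc
  have hb := ht.contract (htq.symm ▸ hq) hE.mem hlt he het
  have hqe : above (A.erase e.2) t = q + 1 := by rw [above_erase_of_ge A het, htq]
  have hcr : ((E.erase e).map (Prod.map (merge e) (merge e))).filter (Crosses t) =
      (E.filter (Crosses t)).map (Prod.map (merge e) (merge e)) := by
    rw [Multiset.filter_map, ← filter_erase_of_not (p := Crosses t) (s := E) (a := e)]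
    · congr 1
      refine Multiset.filter_congr fun a _ => ?_
      simp only [Crosses, Function.comp_apply, Prod.map_fst, Prod.map_snd, merge]
      split_ifs <;> omega
    · simp only [Crosses]
      omega
  rw [dTerm_of_lt hel, map_smul, ← hqe, insHomotopy_graphElt_of_bad hk hc hb, insMean, hcr,
    Multiset.card_map, Multiset.map_map]
  have hsum : ((E.filter (Crosses t)).map fun a => dTerm K k (insVert t A) (insEdges t E a)
      (Prod.map (2 * ·) (2 * ·) e)).sum = (-1 : K) ^ SymGraph.rank A e.2 •
      ((E.filter (Crosses t)).map (insElt K k t (A.erase e.2)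
        ((E.erase e).map (Prod.map (merge e) (merge e))) ∘ Prod.map (merge e) (merge e))).sum := by
    rw [Multiset.smul_sum, Multiset.map_map]
    congr 1
    refine Multiset.map_congr rfl fun a ha => ?_
    obtain ⟨ha, hca⟩ := Multiset.mem_filter.1 ha
    have hal := hlt a ha
    simp only [Crosses] at hca
    exact dTerm_ins_of_le ha (by omega) (by omega) he hel het
  rw [hsum, ← neg_smul, smul_smul, smul_smul, smul_smul, smul_smul]
  congr 1
  rw [rank_erase_of_le hm.2 het]
  ring

/-- The homotopy contracts each step of the filtration by the level to the step below. -/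
theorem homotopy_sub_mem [CharZero K] (hk : k = 0 ∨ k = 2) {q : ℕ} {x : GraphAlg K k}
    (hx : x ∈ levelSpace K k (q + 1)) :
    graphD K k (insHomotopy K k (q + 1) x) + insHomotopy K k (q + 1) (graphD K k x) - x ∈
      levelSpace K k q := by
  induction hx using Submodule.span_induction with
  | zero => simp
  | add x y _ _ hx hy =>
    have := Submodule.add_mem _ hx hy
    simp only [map_add]
    convert this using 1
    abel
  | smul c x _ hx =>
    have := Submodule.smul_mem _ c hx
    simp only [map_smul]
    convert this using 1
    rw [smul_sub, smul_add]
  | mem x hx =>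
    obtain ⟨A, E, hE, hlt, hq, rfl⟩ := hx
    by_cases hb : ∃ t, BadCut A E t ∧ above A t = q + 1
    · obtain ⟨t, ht, htq⟩ := hb
      have hN : ((E.filter (Crosses t)).card : K) ≠ 0 := by
        obtain ⟨⟨e, he, hc⟩, -⟩ := ht
        rw [Nat.cast_ne_zero, ← Nat.pos_iff_ne_zero, Multiset.card_pos_iff_exists_mem]
        exact ⟨e, Multiset.mem_filter.2 ⟨he, hc⟩⟩
      have e1 : insHomotopy K k (q + 1) (graphElt K k A E) = insMean K k t A E := by
        rw [← htq]
        exact insHomotopy_graphElt_of_bad hk hE ht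
      have e2 : insHomotopy K k (q + 1) (graphD K k (graphElt K k A E)) =
          -((-1 : K) ^ (SymGraph.rank A t + 1) • ((E.filter (Crosses t)).card : K)⁻¹ •
            ((E.filter (Crosses t)).map fun a => ((E.filter (·.2 ≤ t)).map fun e =>
              dTerm K k (insVert t A) (insEdges t E a) (Prod.map (2 * ·) (2 * ·) e)).sum).sum) := by
        rw [graphD_graphElt hE, ← Multiset.filter_add_not (fun e => e.2 ≤ t) E, Multiset.map_add,
          Multiset.sum_add, map_add, map_multiset_sum, map_multiset_sum, Multiset.map_map,
          Multiset.map_map, Multiset.filter_add_not]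
        have z : ((E.filter fun e => ¬ e.2 ≤ t).map
            (insHomotopy K k (q + 1) ∘ dTerm K k A E)).sum = 0 := by
          refine Multiset.sum_eq_zero fun y hy => ?_
          obtain ⟨e, he, rfl⟩ := Multiset.mem_map.1 hy
          obtain ⟨he, het⟩ := Multiset.mem_filter.1 he
          refine insHomotopy_of_mem (dTerm_mem_levelSpace hk hE hlt he
            (hq.contract_of_above_le hE.mem hlt he ?_))
          have := above_lt_above (hE.mem e he).2 (not_le.1 het) le_rfl
          omega
        rw [z, add_zero, Multiset.sum_map_sum_map, Multiset.smul_sum, Multiset.map_map,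
          Multiset.smul_sum, Multiset.map_map, ← Multiset.sum_map_neg', Multiset.map_map]
        congr 1
        refine Multiset.map_congr rfl fun e he => ?_
        obtain ⟨he, het⟩ := Multiset.mem_filter.1 he
        exact insHomotopy_dTerm hk hE hlt hq ht htq he het
      have e3 : ((E.filter (Crosses t)).map fun a => graphD K k (insElt K k t A E a) -
          (-1 : K) ^ (SymGraph.rank A t + 1) • graphElt K k A E -
          ((E.filter (·.2 ≤ t)).map fun e => dTerm K k (insVert t A) (insEdges t E a)
            (Prod.map (2 * ·) (2 * ·) e)).sum).sum ∈ levelSpace K k q := by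
        refine multiset_sum_mem _ fun y hy => ?_
        obtain ⟨a, ha, rfl⟩ := Multiset.mem_map.1 hy
        obtain ⟨ha, hc⟩ := Multiset.mem_filter.1 ha
        have hal := hlt a ha
        simp only [Crosses] at hc
        exact graphD_ins_sub_mem hk hE hlt hq htq ha (by omega) (by omega)
      have e4 := Submodule.smul_mem _ ((-1 : K) ^ (SymGraph.rank A t + 1) *
        ((E.filter (Crosses t)).card : K)⁻¹) e3
      rw [Multiset.sum_map_sub, Multiset.sum_map_sub, Multiset.map_const', Multiset.sum_replicate,
        ← Nat.cast_smul_eq_nsmul K, smul_sub, smul_sub, smul_smul, smul_smul] at e4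
      have e5 : (-1 : K) ^ (SymGraph.rank A t + 1) * ((E.filter (Crosses t)).card : K)⁻¹ *
          (E.filter (Crosses t)).card * (-1 : K) ^ (SymGraph.rank A t + 1) = 1 := by
        rw [mul_assoc, mul_assoc, inv_mul_cancel_left₀ hN, ← mul_pow]
        simp
      rw [e5, one_smul] at e4
      rw [e1, e2, insMean, map_smul, map_smul, map_multiset_sum, Multiset.map_map]
      convert e4 using 1
      simp only [smul_smul, Function.comp_def]
      abel
    · push Not at hb
      have hq' : LevelLE q A E := by
        intro t ht
        have h1 := hq t ht
        have h2 := hb t ht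
        omega
      have hm := graphElt_mem_levelSpace (K := K) hE hq'
      rw [insHomotopy_of_mem hm, insHomotopy_of_mem (graphD_mem_levelSpace hk hm), map_zero,
        zero_add, zero_sub]
      exact Submodule.neg_mem _ hm

/-- A chain whose boundary is a combination of graphs without bad cuts is homologous to such a
combination. -/
theorem exists_sub_graphD_mem_levelSpace [CharZero K] (hk : k = 0 ∨ k = 2) {z : GraphAlg K k}
    (hz : graphD K k z ∈ levelSpace K k 0) : ∃ y, z - graphD K k y ∈ levelSpace K k 0 := by
  obtain ⟨q, hq⟩ := exists_mem_levelSpace z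
  induction q generalizing z with
  | zero => exact ⟨0, by rwa [map_zero, sub_zero]⟩
  | succ q ih =>
    have h := homotopy_sub_mem hk hq
    rw [insHomotopy_of_mem (levelSpace_mono (Nat.zero_le q) hz), add_zero] at h
    obtain ⟨y, hy⟩ := ih (z := z - graphD K k (insHomotopy K k (q + 1) z))
      (by rw [map_sub, graphD_graphD hk, sub_zero]; exact hz)
      (by rw [← neg_sub]; exact Submodule.neg_mem _ h)
    exact ⟨insHomotopy K k (q + 1) z + y, by rwa [map_add, ← sub_sub]⟩

end Homotopy

section NoBadCuts

variable {K : Type*} [Field K] {k : ℕ}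

/-! ### Graphs without bad cuts -/

theorem levelLE_zero_iff {A : Finset ℕ} {E : Multiset (ℕ × ℕ)} :
    LevelLE 0 A E ↔ ∀ t, ¬ BadCut A E t := by
  refine ⟨fun h t ht => ?_, fun h t ht => absurd ht (h t)⟩
  obtain ⟨-, u, v, huv, -, htv, -⟩ := id ht
  have h1 := h t ht
  have h2 : 0 < above A t := Finset.card_pos.2 ⟨v, by simp [huv.right_mem, htv]⟩
  omega

/-- All vertices of a connected graph are linked. -/
theorem IsConn.linked {A : Finset ℕ} {E : Multiset (ℕ × ℕ)} (h : IsConn A E)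
    (hE : ∀ e ∈ E, e.1 ∈ A ∧ e.2 ∈ A) {u v : ℕ} (hu : u ∈ A) (hv : v ∈ A) : Linked E u v := by
  intro C hC
  have hC' : ClosedIn E (C ∩ A) := fun e he => by
    simp only [Finset.mem_inter, hE e he, and_true]
    exact hC e he
  have key : ∀ x ∈ A, x ∈ C → ∀ y ∈ A, y ∈ C := by
    intro x hx hxC y hy
    have := h.eq_of_closed (C ∩ A) Finset.inter_subset_right ⟨x, Finset.mem_inter.2 ⟨hxC, hx⟩⟩ hC'
    rw [← this] at hy
    exact (Finset.mem_inter.1 hy).1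
  exact ⟨fun h => key u hu h v hv, fun h => key v hv h u hu⟩

theorem IsConn.levelLE_zero {A : Finset ℕ} {E : Multiset (ℕ × ℕ)} (h : IsConn A E)
    (hE : ∀ e ∈ E, e.1 ∈ A ∧ e.2 ∈ A) : LevelLE 0 A E := by
  rw [levelLE_zero_iff]
  rintro t ⟨-, u, v, huv, -, -, hL⟩
  exact hL (h.linked hE huv.left_mem huv.right_mem)

/-- A disconnected graph without bad cuts has a cut that no edge crosses. -/
theorem exists_uncrossed_cut {A : Finset ℕ} {E : Multiset (ℕ × ℕ)} (hA : A.Nonempty)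
    (h : LevelLE 0 A E) (hc : ¬ IsConn A E) :
    ∃ u v, Consecutive A u v ∧ ∀ e ∈ E, ¬ Crosses u e := by
  by_contra! hall
  rw [levelLE_zero_iff] at h
  have hlink : ∀ u v, Consecutive A u v → Linked E u v := by
    intro u v huv
    by_contra hL
    exact h u ⟨hall u v huv, u, v, huv, le_rfl, huv.lt, hL⟩
  refine hc ⟨hA, fun C hC hne hcl => ?_⟩
  obtain ⟨c, hcC⟩ := hne
  refine hC.antisymm fun x hx => ?_
  by_contra hxC
  rcases lt_trichotomy c x with hlt | rfl | hlt
  · obtain ⟨u, v, huv, -, -, hn⟩ := exists_consecutive (· ∈ C) (hC hcC) hx hlt (by simp [hcC, hxC])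
    exact hn (hlink u v huv C hcl)
  · exact hxC hcC
  · obtain ⟨u, v, huv, -, -, hn⟩ := exists_consecutive (· ∈ C) hx (hC hcC) hlt (by simp [hcC, hxC])
    exact hn (hlink u v huv C hcl)

theorem badCut_of_edgesIn {A C : Finset ℕ} {E : Multiset (ℕ × ℕ)}
    (hcl : ClosedIn E C) (hA : ∀ u v, Consecutive C u v → Consecutive A u v) {t : ℕ}
    (h : BadCut C (edgesIn E C) t) : BadCut A E t := by
  obtain ⟨⟨e, he, hc⟩, u, v, huv, hut, htv, hL⟩ := h
  refine ⟨⟨e, (mem_edgesIn.1 he).1, hc⟩, u, v, hA u v huv, hut, htv, fun hl => hL ?_⟩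
  intro D hD
  have hD' : ClosedIn E (D ∩ C) := by
    rw [← closedIn_edgesIn hcl Finset.inter_subset_right]
    intro e he
    simp only [Finset.mem_inter, (mem_edgesIn.1 he).2, and_true]
    exact hD e he
  have := hl _ hD'
  simpa only [Finset.mem_inter, huv.left_mem, huv.right_mem, and_true] using this

/-- A graph without bad cuts is an ordered disjoint union of connected graphs: it can be cut where
no edge crosses until it is connected. -/
theorem graphElt_mem_adjoin {A : Finset ℕ} {E : Multiset (ℕ × ℕ)} (hE : IsGraphOn k A E)
    (h : LevelLE 0 A E) : graphElt K k A E ∈ Algebra.adjoin K (connectedGraphs K k : Set _) := by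
  obtain ⟨n, hn⟩ : ∃ n, A.card = n := ⟨_, rfl⟩
  induction n using Nat.strong_induction_on generalizing A E with
  | _ n ih =>
    rcases A.eq_empty_or_nonempty with rfl | hA
    · obtain rfl := hE.edges_empty
      rw [graphElt_empty]
      exact Subalgebra.one_mem _
    · by_cases hc : IsConn A E
      · exact Algebra.subset_adjoin (graphElt_mem_connectedGraphs hE hc)
      · obtain ⟨u, v, huv, hun⟩ := exists_uncrossed_cut hA h hc
        have hlt := huv.lt
        let C := A.filter (· ≤ u)
        have hCA : C ⊆ A := Finset.filter_subset _ _
        have hmem : ∀ x, x ∈ C ↔ x ∈ A ∧ x ≤ u := fun x => Finset.mem_filter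
        have hmem' : ∀ x, x ∈ A \ C ↔ x ∈ A ∧ u < x := fun x => by
          rw [Finset.mem_sdiff, hmem]
          constructor
          · rintro ⟨h1, h2⟩; exact ⟨h1, not_le.1 fun h => h2 ⟨h1, h⟩⟩
          · rintro ⟨h1, h2⟩; exact ⟨h1, fun h => by omega⟩
        have hcl : ClosedIn E C := by
          intro e he
          have h1 := hun e he
          have h2 := hE.mem e he
          simp only [Crosses] at h1
          simp only [hmem, h2, true_and]
          omega
        have hcl' := hcl.sdiff hE
        have hAB : ∀ a ∈ C, ∀ b ∈ A \ C, a < b := by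
          intro a ha b hb
          have h1 := ((hmem a).1 ha).2
          have h2 := ((hmem' b).1 hb).2
          omega
        have h1 : ∀ x y, Consecutive C x y → Consecutive A x y := by
          intro x y hxy
          refine ⟨hCA hxy.left_mem, hCA hxy.right_mem, hxy.lt, fun z hz => ?_⟩
          have := ((hmem y).1 hxy.right_mem).2
          by_cases hzu : z ≤ u
          · exact hxy.le_or_le z ((hmem z).2 ⟨hz, hzu⟩)
          · omega
        have h2 : ∀ x y, Consecutive (A \ C) x y → Consecutive A x y := by
          intro x y hxy
          refine ⟨Finset.sdiff_subset hxy.left_mem, Finset.sdiff_subset hxy.right_mem, hxy.lt,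
            fun z hz => ?_⟩
          have := ((hmem' x).1 hxy.left_mem).2
          by_cases hzu : u < z
          · exact hxy.le_or_le z ((hmem' z).2 ⟨hz, hzu⟩)
          · omega
        rw [levelLE_zero_iff] at h
        have e : graphElt K k A E = graphElt K k C (edgesIn E C) *
            graphElt K k (A \ C) (edgesIn E (A \ C)) := by
          rw [graphElt_mul (hE.edgesIn hCA hcl) (hE.edgesIn Finset.sdiff_subset hcl') hAB,
            edgesIn_add_edgesIn_sdiff hE hcl, Finset.union_sdiff_of_subset hCA]
        have c1 : 0 < C.card := Finset.card_pos.2 ⟨u, (hmem u).2 ⟨huv.left_mem, le_rfl⟩⟩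
        have c2 : 0 < (A \ C).card := Finset.card_pos.2 ⟨v, (hmem' v).2 ⟨huv.right_mem, hlt⟩⟩
        have c3 := Finset.card_sdiff_add_card_eq_card hCA
        rw [e]
        exact Subalgebra.mul_mem _
          (ih C.card (by omega) (hE.edgesIn hCA hcl)
            (levelLE_zero_iff.2 fun t ht => h t (badCut_of_edgesIn hcl h1 ht)) rfl)
          (ih (A \ C).card (by omega) (hE.edgesIn Finset.sdiff_subset hcl')
            (levelLE_zero_iff.2 fun t ht => h t (badCut_of_edgesIn hcl' h2 ht)) rfl)

theorem levelLE_zero_union {A B : Finset ℕ} {E F : Multiset (ℕ × ℕ)} (hE : IsGraphOn k A E)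
    (hF : IsGraphOn k B F) (hAB : ∀ a ∈ A, ∀ b ∈ B, a < b) (h : LevelLE 0 A E)
    (h' : LevelLE 0 B F) : LevelLE 0 (A ∪ B) (E + F) := by
  rw [levelLE_zero_iff] at *
  rintro t ⟨⟨e, he, hc⟩, u, v, huv, hut, htv, hL⟩
  have huv' := huv.le_or_le
  have hlt := huv.lt
  rcases Finset.mem_union.1 huv.left_mem with hu | hu <;>
    rcases Finset.mem_union.1 huv.right_mem with hv | hv
  · refine h t ⟨⟨e, ?_, hc⟩, u, v, ⟨hu, hv, hlt, fun x hx => huv' x (Finset.mem_union_left _ hx)⟩,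
      hut, htv, fun hl => hL fun C hC => hl C fun e he => hC e (Multiset.mem_add.2 (Or.inl he))⟩
    rcases Multiset.mem_add.1 he with he | he
    · exact he
    · have h1 := hAB v hv _ (hF.mem e he).1
      have h2 := hAB v hv _ (hF.mem e he).2
      simp only [Crosses] at hc
      omega
  · simp only [Crosses] at hc
    rcases Multiset.mem_add.1 he with he | he
    · have h1 := hAB _ (hE.mem e he).1 v hv
      have h2 := hAB _ (hE.mem e he).2 v hv
      have h3 := huv' _ (Finset.mem_union_left _ (hE.mem e he).1)
      have h4 := huv' _ (Finset.mem_union_left _ (hE.mem e he).2)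
      omega
    · have h1 := hAB u hu _ (hF.mem e he).1
      have h2 := hAB u hu _ (hF.mem e he).2
      have h3 := huv' _ (Finset.mem_union_right _ (hF.mem e he).1)
      have h4 := huv' _ (Finset.mem_union_right _ (hF.mem e he).2)
      omega
  · have := hAB v hv u hu
    omega
  · refine h' t ⟨⟨e, ?_, hc⟩, u, v, ⟨hu, hv, hlt, fun x hx => huv' x (Finset.mem_union_right _ hx)⟩,
      hut, htv, fun hl => hL fun C hC => hl C fun e he => hC e (Multiset.mem_add.2 (Or.inr he))⟩
    rcases Multiset.mem_add.1 he with he | he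
    · have h1 := hAB _ (hE.mem e he).1 u hu
      have h2 := hAB _ (hE.mem e he).2 u hu
      simp only [Crosses] at hc
      omega
    · exact he

theorem mul_mem_levelSpace_zero {x y : GraphAlg K k} (hx : x ∈ levelSpace K k 0)
    (hy : y ∈ levelSpace K k 0) : x * y ∈ levelSpace K k 0 := by
  induction hx using Submodule.span_induction with
  | zero => rw [zero_mul]; exact Submodule.zero_mem _
  | add x x' _ _ hx hx' => rw [add_mul]; exact Submodule.add_mem _ hx hx'
  | smul c x _ hx => rw [smul_mul_assoc]; exact Submodule.smul_mem _ _ hx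
  | mem x hx =>
    obtain ⟨A, E, hE, -, hq, rfl⟩ := hx
    induction hy using Submodule.span_induction with
    | zero => rw [mul_zero]; exact Submodule.zero_mem _
    | add y y' _ _ hy hy' => rw [mul_add]; exact Submodule.add_mem _ hy hy'
    | smul c y _ hy => rw [mul_smul_comm]; exact Submodule.smul_mem _ _ hy
    | mem y hy =>
      obtain ⟨B, F, hF, -, hq', rfl⟩ := hy
      -- move the second graph behind the first one
      have hmono : StrictMono (A.sup id + 1 + ·) := fun a b h => by dsimp only; omega
      have hAB : ∀ a ∈ A, ∀ b ∈ B.image (A.sup id + 1 + ·), a < b := by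
        intro a ha b hb
        obtain ⟨b', -, rfl⟩ := Finset.mem_image.1 hb
        have : a ≤ A.sup id := Finset.le_sup (f := id) ha
        omega
      have hF' := hF.map hmono.injective.injOn
      rw [← graphElt_image (hmono.strictMonoOn _) hF.mem, graphElt_mul hE hF' hAB]
      exact graphElt_mem_levelSpace (isGraphOn_union hE hF')
        (levelLE_zero_union hE hF' hAB hq (hq'.image hF.mem (hmono.strictMonoOn _)))

/-- The graphs without bad cuts are the ordered disjoint unions of connected graphs. -/
theorem mem_levelSpace_zero_iff {x : GraphAlg K k} : x ∈ levelSpace K k 0 ↔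
    x ∈ Algebra.adjoin K (connectedGraphs K k : Set (GraphAlg K k)) := by
  constructor
  · intro hx
    induction hx using Submodule.span_induction with
    | zero => exact Subalgebra.zero_mem _
    | add x y _ _ hx hy => exact Subalgebra.add_mem _ hx hy
    | smul c x _ hx => exact Subalgebra.smul_mem _ hx c
    | mem x hx =>
      obtain ⟨A, E, hE, -, hq, rfl⟩ := hx
      exact graphElt_mem_adjoin hE hq
  · intro hx
    have h1 : (1 : GraphAlg K k) ∈ levelSpace K k 0 := by
      have h : IsGraphOn k ∅ 0 := ⟨by simp, by simp⟩
      rw [← graphElt_empty]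
      exact graphElt_mem_levelSpace h (levelLE_card ∅ 0)
    induction hx using Algebra.adjoin_induction with
    | mem x hx =>
      refine (Submodule.span_le (p := levelSpace K k 0)).2 ?_ hx
      rintro _ ⟨G, hG, rfl⟩
      have hE := isGraphOn_of_mem G.2
      rw [single_eq_graphElt]
      exact graphElt_mem_levelSpace hE ((isConn_of_connected hG).levelLE_zero hE.mem)
    | algebraMap r =>
      rw [Algebra.algebraMap_eq_smul_one]
      exact Submodule.smul_mem _ _ h1
    | add x y _ _ hx hy => exact Submodule.add_mem _ hx hy
    | mul x y _ _ hx hy => exact mul_mem_levelSpace_zero hx hy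

end NoBadCuts

end ZinbAs

end

theorem mainTheorem9 (K : Type*) [Field K] :
    (∀ (H : Type*) [Ring H] [Algebra K H] (𝒜 : ℤ → Submodule K H) [GradedAlgebra 𝒜]
        (B : ZinbAs.DGZinbAs K 𝒜), B.Connected →
      (∀ x ∈ B.prim, B.d x ∈ B.prim) ∧
      Nonempty (ZinbAs.TensorHomologyIso B B.prim B.prim_isHomogeneous) ∧
      ∀ c : ZinbAs.Homology B.d ⊤,
        (B.homologyCounit c = 0 ∧ B.homologyCoprod c = c ⊗ₜ[K] B.homologyOne) ↔
          c ∈ LinearMap.range (ZinbAs.homologyIncl B.d B.prim)) ∧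
    (CharZero K → ∀ k : ℕ, k = 0 ∨ k = 2 →
      ∃ B : ZinbAs.DGZinbAs K (ZinbAs.graphGrade K k),
        B.d = ZinbAs.graphD K k ∧
        B.coprod = ZinbAs.graphCoprod K k ∧
        B.Connected ∧
        (∀ x ∈ ZinbAs.connectedGraphs K k, B.d x ∈ ZinbAs.connectedGraphs K k) ∧
        Nonempty (ZinbAs.TensorHomologyIso B (ZinbAs.connectedGraphs K k)
          (ZinbAs.connectedGraphs_isHomogeneous K k))) := by
  refine ⟨fun H _ _ 𝒜 _ B hB => ?_, fun _ k hk => ?_⟩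
  · have hP : Nonempty (ZinbAs.TensorHomologyIso B B.prim B.prim_isHomogeneous) :=
      ZinbAs.nonempty_tensorHomologyIso B B.prim_isHomogeneous le_rfl (fun x hx => B.d_prim hx)
        fun z _ => ⟨0, by rw [ZinbAs.adjoin_prim_eq_top B hB]; trivial⟩
    obtain ⟨Φ⟩ := hP
    exact ⟨fun x hx => B.d_prim hx, ⟨Φ⟩, fun c => ZinbAs.homology_primitive_iff B Φ c⟩
  · refine ⟨ZinbAs.graphBialgebra K hk, rfl, rfl, ZinbAs.graphBialgebra_connected hk,
      fun x hx => ZinbAs.graphD_mem_connectedGraphs hk hx, ?_⟩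
    refine ZinbAs.nonempty_tensorHomologyIso _ _ (ZinbAs.connectedGraphs_le_prim hk)
      (fun x hx => ZinbAs.graphD_mem_connectedGraphs hk hx) fun z hz => ?_
    obtain ⟨y, hy⟩ := ZinbAs.exists_sub_graphD_mem_levelSpace hk
      (ZinbAs.mem_levelSpace_zero_iff.2 hz)
    exact ⟨y, ZinbAs.mem_levelSpace_zero_iff.1 hy⟩
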